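/- **Setting.** Let $\Phi:\mathbb{R}^2\to\mathbb{R}^3$ be a homeomorphism onto its image $\Sigma=\Phi(\mathbb{R}^2)$, and let $\mathcal T\subset\Sigma$ be the union of finitely many finite $C^1$ curves (closed, or prolongable beyond their ends as $C^1$ curves) and finitely many points. Assume: (a) $\Sigma$ divides $\mathbb{R}^3$ into two regions: $\mathbb{R}^3\setminus\Sigma=\Omega_{\rm int}\cup\Omega_{\rm ext}$ with $\Omega_{\rm int},\Omega_{\rm ext}$ disjoint, open, connected, nonempty, with common boundary $\Sigma$; $\Omega_{\rm int}$ is convex; and $\Omega_{\rm int},\Omega_{\rm ext}$ are not both half-spaces. (b) At every $s$ with $\Phi(s)\notin\mathcal T$ the map $\Phi$ is $C^2$ near $s$, and its metric tensor $g_{ij}=\partial_i\Phi\cdot\partial_j\Phi$ is uniformly elliptic there: $c_1|v|^2\le\sum_{i,j} g_{ij}(s)v_iv_j\le c_2|v|^2$ for all $v\in\mathbb{R}^2$, with constants $c_1>0$ and $c_2$ independent of $s$. (c) $\Sigma$ is asymptotically planar: the principal curvatures of $\Sigma$ (defined off $\mathcal T$) tend to $0$ as the geodesic distance on $\Sigma$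 from a fixed point of $\Sigma$ tends to infinity. (d) There is $c>0$ with $|\Phi(s)-\Phi(t)|\ge c|s-t|$ for all $s,t\in\mathbb{R}^2$. (e) $V$ equals a constant $V_0>0$ in one of the two regions (either one) and $0$ in the other. Let $\alpha>0$, $g=\det(g_{ij})$, and let $q$ be the quadratic form with domain $H^1(\mathbb{R}^3)\subset L^2(\mathbb{R}^3)$, $$q[\psi]=\|\nabla\psi\|^2+(\psi,V\psi)-\alpha\int_{\mathbb{R}^2}|\psi(\Phi(s))|^2\,g^{1/2}(s)\,ds_1\,ds_2 ,$$ where $\psi\circ\Phi\in L^2(\mathbb{R}^2,g^{1/2}ds)$ denotes the trace of $\psi$ on $\Sigma$ (the limit of $\varphi_n\circ\Phi$ for $\varphi_n\in C_c^\infty(\mathbb{R}^3)$ with $\varphi_n\to\psi$ in $H^1$). **Theorem.** Every $\psi\in H^1(\mathbb{R}^3)$ has a unique trace on $\Sigma$, and there is a unique self-adjoint operator $H=-\Delta+V-\alpha\,\delta(x-\Sigma)$ on $L^2(\mathbb{R}^3)$ associated with $q$: $u\in\mathrm{Dom}(H)$ and $Hu=f$ if and only if $u\in H^1(\mathbb{R}^3)$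 and $q(v,u)=(v,f)$ for all $v\in H^1(\mathbb{R}^3)$. Its essential spectrum (the spectrum without the isolated eigenvalues of finite multiplicity) is $$\sigma_{\rm ess}(H)=[\mu,\infty),\qquad \mu=\begin{cases}-\dfrac{(\alpha^2-V_0)^2}{4\alpha^2}, & V_0<\alpha^2,\\[2mm] 0, & V_0\ge\alpha^2.\end{cases}$$ -/

import Mathlib

open MeasureTheory Filter Topology
open scoped ENNReal ContDiff InnerProductSpace Matrix

noncomputable section

/-- The parameter plane `ℝ²` with its Euclidean norm. -/
abbrev Plane : Type := EuclideanSpace ℝ (Fin 2)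

/-- The space `ℝ³` with its Euclidean norm. -/
abbrev Space : Type := EuclideanSpace ℝ (Fin 3)

/-- The Hilbert space `L²(ℝ³)` of complex-valued functions. -/
abbrev L2Space : Type := Lp ℂ 2 (volume : Measure Space)

/-! ### Surfaces: regions, singular set, metric and curvature -/

/-- The surface `S` divides `ℝ³` into the two regions `U₁` and `U₂`: these are disjoint, open and
connected, they fill the complement of `S`, and `S` is their common boundary. -/
structure DividesInto (S U₁ U₂ : Set Space) : Prop where
  isOpen_left : IsOpen U₁
  isOpen_right : IsOpen U₂
  isConnected_left : IsConnected U₁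
  isConnected_right : IsConnected U₂
  disjoint : Disjoint U₁ U₂
  union_eq : U₁ ∪ U₂ = Sᶜ
  frontier_left : frontier U₁ = S
  frontier_right : frontier U₂ = S

/-- `U` is an open half-space. -/
def IsOpenHalfSpace (U : Set Space) : Prop :=
  ∃ (a : Space) (b : ℝ), a ≠ 0 ∧ U = {x | b < ⟪a, x⟫_ℝ}

/-- `T` is the union of finitely many finite `C¹` curves and finitely many points of the surface `S`.
A `C¹` curve that is closed, or that can be prolonged beyond its ends as a `C¹` curve, is the image
of the interval `[0, 1]` under a `C¹` map defined on the whole line. -/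
def IsSingularSet (S T : Set Space) : Prop :=
  ∃ (m : ℕ) (γ : Fin m → ℝ → Space) (P : Finset Space),
    (∀ j, ContDiff ℝ 1 (γ j)) ∧ (∀ j, γ j '' Set.Icc 0 1 ⊆ S) ∧ (P : Set Space) ⊆ S ∧
      T = (⋃ j, γ j '' Set.Icc 0 1) ∪ (P : Set Space)

/-- The coordinate tangent vector `∂ᵢΦ(s)` of a parametrized surface. -/
def tangentVec (Φ : Plane → Space) (s : Plane) (i : Fin 2) : Space :=
  fderiv ℝ Φ s (EuclideanSpace.single i 1)

/-- The metric tensor (first fundamental form) `g_{ij} = ∂ᵢΦ · ∂ⱼΦ`. -/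
def metricTensor (Φ : Plane → Space) (s : Plane) : Matrix (Fin 2) (Fin 2) ℝ :=
  Matrix.of fun i j => ⟪tangentVec Φ s i, tangentVec Φ s j⟫_ℝ

/-- The vector `∂₁Φ × ∂₂Φ`. -/
def normalVec (Φ : Plane → Space) (s : Plane) : Space :=
  WithLp.toLp 2
    (crossProduct (WithLp.ofLp (tangentVec Φ s 0)) (WithLp.ofLp (tangentVec Φ s 1)))

/-- The unit normal vector of a parametrized surface. -/
def unitNormal (Φ : Plane → Space) (s : Plane) : Space :=
  ‖normalVec Φ s‖⁻¹ • normalVec Φ s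

/-- The second fundamental form `h_{ij} = n · ∂ᵢ∂ⱼΦ`. -/
def secondForm (Φ : Plane → Space) (s : Plane) : Matrix (Fin 2) (Fin 2) ℝ :=
  Matrix.of fun i j =>
    ⟪unitNormal Φ s,
      fderiv ℝ (fun t => tangentVec Φ t j) s (EuclideanSpace.single i 1)⟫_ℝ

/-- `k` is a principal curvature at `Φ(s)`: an eigenvalue of the Weingarten map `g⁻¹ h`, that is,
`h v = k g v` for some nonzero (principal) direction `v`. -/
def IsPrincipalCurvature (Φ : Plane → Space) (s : Plane) (k : ℝ) : Prop :=
  ∃ v : Fin 2 → ℝ, v ≠ 0 ∧ secondForm Φ s *ᵥ v = k • (metricTensor Φ s *ᵥ v)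

/-- The geodesic distance on the surface `S`: the infimum of the lengths of the continuous curves in
`S` from `x` to `y`. -/
def geodesicDist (S : Set Space) (x y : Space) : ℝ≥0∞ :=
  ⨅ γ ∈ {γ : ℝ → Space | ContinuousOn γ (Set.Icc 0 1) ∧ Set.MapsTo γ (Set.Icc 0 1) S ∧
      γ 0 = x ∧ γ 1 = y}, eVariationOn γ (Set.Icc 0 1)

/-- Away from the set `T`, the parametrization `Φ` is `C²` with a uniformly elliptic metric tensor. -/
def IsUniformlyEllipticC2Off (Φ : Plane → Space) (T : Set Space) : Prop :=
  (∀ s, Φ s ∉ T → ContDiffAt ℝ 2 Φ s) ∧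
    ∃ c₁ c₂ : ℝ, 0 < c₁ ∧ ∀ s, Φ s ∉ T → ∀ v : Plane,
      c₁ * ‖v‖ ^ 2 ≤ ∑ i, ∑ j, metricTensor Φ s i j * v i * v j ∧
        ∑ i, ∑ j, metricTensor Φ s i j * v i * v j ≤ c₂ * ‖v‖ ^ 2

/-- The surface parametrized by `Φ`, regular away from `T`, is asymptotically planar: the principal
curvatures vanish as the geodesic distance from a fixed point of the surface tends to infinity. -/
def IsAsymptoticallyPlanar (Φ : Plane → Space) (T : Set Space) : Prop :=
  ∃ s₀ : Plane, ∀ ε : ℝ, 0 < ε → ∃ R : ℝ, ∀ s, Φ s ∉ T →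
    ENNReal.ofReal R < geodesicDist (Set.range Φ) (Φ s₀) (Φ s) →
      ∀ k, IsPrincipalCurvature Φ s k → |k| ≤ ε

/-- `V` equals `V₀` in one of the regions `U₁`, `U₂` and vanishes in the other one. -/
def IsStepBias (V : Space → ℝ) (V₀ : ℝ) (U₁ U₂ : Set Space) : Prop :=
  ((∀ x ∈ U₁, V x = V₀) ∧ ∀ x ∈ U₂, V x = 0) ∨ ((∀ x ∈ U₁, V x = 0) ∧ ∀ x ∈ U₂, V x = V₀)

/-! ### The quadratic form -/

/-- `f` is the weak partial derivative `∂ᵢu` in `L²(ℝ³)`. -/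
def IsWeakPartial (i : Fin 3) (u f : L2Space) : Prop :=
  ∀ φ : Space → ℝ, ContDiff ℝ ∞ φ → HasCompactSupport φ →
    ∫ x, fderiv ℝ φ x (EuclideanSpace.single i 1) • u x = -∫ x, φ x • f x

/-- The Sobolev space `H¹(ℝ³)`, as a subset of `L²(ℝ³)`. -/
def sobolevH1 : Set L2Space :=
  {u | ∀ i, ∃ f, IsWeakPartial i u f}

open Classical in
/-- The weak partial derivative `∂ᵢu` of `u ∈ H¹(ℝ³)` (zero if there is none). -/
def weakPartial (i : Fin 3) (u : L2Space) : L2Space :=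
  if h : ∃ f, IsWeakPartial i u f then h.choose else 0

/-- The surface measure `√g ds₁ ds₂`, on the parameter plane. -/
def surfaceMeasure (Φ : Plane → Space) : Measure Plane :=
  (volume : Measure Plane).withDensity fun s => ENNReal.ofReal √(metricTensor Φ s).det

/-- `τ ∈ L²(ℝ², √g ds)` is the trace `s ↦ u(Φ(s))` of `u ∈ H¹(ℝ³)` on the surface parametrized by
`Φ`: the restriction of test functions, extended by continuity from `C_c^∞(ℝ³)` to `H¹(ℝ³)`. -/
def IsTrace (Φ : Plane → Space) (u : L2Space) (τ : Lp ℂ 2 (surfaceMeasure Φ)) : Prop :=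
  ∃ φ : ℕ → Space → ℂ, (∀ n, ContDiff ℝ ∞ (φ n) ∧ HasCompactSupport (φ n)) ∧
    Tendsto (fun n => eLpNorm (fun x => φ n x - u x) 2 volume) atTop (𝓝 0) ∧
    (∀ i, Tendsto (fun n => eLpNorm (fun x =>
      fderiv ℝ (φ n) x (EuclideanSpace.single i 1) - weakPartial i u x) 2 volume) atTop (𝓝 0)) ∧
    Tendsto (fun n => eLpNorm (fun s => φ n (Φ s) - τ s) 2 (surfaceMeasure Φ)) atTop (𝓝 0)

open Classical in
/-- The trace of `u ∈ H¹(ℝ³)` on the surface parametrized by `Φ` (zero if there is none). -/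
def trace (Φ : Plane → Space) (u : L2Space) : Lp ℂ 2 (surfaceMeasure Φ) :=
  if h : ∃ τ, IsTrace Φ u τ then h.choose else 0

/-- The sesquilinear form (antilinear in the first argument)
`q(v, u) = (∇v, ∇u) + (v, V u) - α ∫ conj (v(Φ(s))) u(Φ(s)) √g ds₁ ds₂`, considered on `H¹(ℝ³)`. -/
def deltaForm (α : ℝ) (V : Space → ℝ) (Φ : Plane → Space) (v u : L2Space) : ℂ :=
  (∑ i, ⟪weakPartial i v, weakPartial i u⟫_ℂ) + (∫ x, (V x : ℂ) * ⟪v x, u x⟫_ℂ)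
    - (α : ℂ) * ⟪trace Φ v, trace Φ u⟫_ℂ

/-! ### Operators and their spectra -/

section Operators

variable {H : Type*} [NormedAddCommGroup H] [InnerProductSpace ℂ H]

/-- `A` is the operator associated with the form `q` with form domain `D`: its domain consists of
those `u ∈ D` for which some `f` satisfies `q(v, u) = (v, f)` for all `v ∈ D`, and `A u = f`. -/
def IsAssociatedOperator (D : Set H) (q : H → H → ℂ) (A : H →ₗ.[ℂ] H) : Prop :=
  ∀ u f : H, (u, f) ∈ A.graph ↔ u ∈ D ∧ ∀ v ∈ D, q v u = ⟪v, f⟫_ℂ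

/-- The resolvent set of a partially defined operator: those `z` for which `A - z` is a bijection
of the domain onto the space with bounded inverse `R`. -/
def opResolventSet (A : H →ₗ.[ℂ] H) : Set ℂ :=
  {z | ∃ R : H →L[ℂ] H,
    (∀ f, ∃ h : R f ∈ A.domain, A ⟨R f, h⟩ - z • R f = f) ∧
      ∀ u : A.domain, R (A u - z • (u : H)) = u}

/-- The spectrum of a partially defined operator. -/
def opSpectrum (A : H →ₗ.[ℂ] H) : Set ℂ :=
  (opResolventSet A)ᶜ

/-- The eigenspace of a partially defined operator. -/
def opEigenspace (A : H →ₗ.[ℂ] H) (z : ℂ) : Submodule ℂ H :=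
  (LinearMap.ker (A.toFun - z • A.domain.subtype)).map A.domain.subtype

/-- The discrete spectrum of a self-adjoint operator: the isolated points of the spectrum that are
eigenvalues of finite multiplicity. -/
def opDiscreteSpectrum (A : H →ₗ.[ℂ] H) : Set ℂ :=
  {z | z ∈ opSpectrum A ∧ (∃ ε > 0, opSpectrum A ∩ Metric.ball z ε = {z}) ∧
    opEigenspace A z ≠ ⊥ ∧ FiniteDimensional ℂ (opEigenspace A z)}

/-- The essential spectrum of a self-adjoint operator: the complement of the discrete spectrum in
the spectrum. -/
def opEssSpectrum (A : H →ₗ.[ℂ] H) : Set ℂ :=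
  opSpectrum A \ opDiscreteSpectrum A

end Operators

/-- The threshold `μ`: the eigenvalue of the transverse problem if `V₀ < α²`, and zero otherwise. -/
def threshold (α V₀ : ℝ) : ℝ :=
  if V₀ < α ^ 2 then -((α ^ 2 - V₀) ^ 2 / (4 * α ^ 2)) else 0

end

/-!
The form `q` is handled through the embedding `sobolevEmb` of a Hilbert space `sobolevSpace` onto
`H¹(ℝ³)` and a bounded operator `formOperator` on it with `q(v, u) = ⟪v, B u⟫`. The chord bound
`c ‖s - t‖ ≤ ‖Φ s - Φ t‖` and the bounded area density make the surface measure of a ball of radius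
`t` at most of order `t²`; averaging test functions over balls of a small radius then bounds the
trace by `η ‖∇φ‖² + K ‖φ‖²` with `η` as small as desired (`exists_trace_le`). So the trace extends to
`H¹(ℝ³)`, and `q` is bounded below and closed, hence it has a unique associated self-adjoint operator
(`FormData.existsUnique_associated`). The essential spectrum is `[μ, ∞)` as soon as, for every
`m < μ`, the form is bounded below by `m` up to finitely many functionals, and every `r ≥ μ` is an
approximate eigenvalue in the sense of the form (`FormData.essSpectrum_eq`). The second property gives
only that `r` lies in the spectrum, but as `[μ, ∞)` has no isolated points this is enough.

The geometric input is that far out the surface is flat (`exists_isFlatPatch`). By the chord bound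
and the ellipticity of the metric the geodesic distance tends to infinity with the parameter, so the
principal curvatures tend to zero, and the unit normal vector varies slowly along the surface; the
singular set is compact, and far out it does not interfere. In a large ball around a far point of the
surface, the surface is therefore a graph over a plane with small slope, having one of the regions
above and the other one below it. There the divergence theorem holds in the direction `e` normal to
the plane (`IsFlatPatch.setIntegral_fderiv`).

For the lower bound, the divergence theorem applied to `‖φ‖² e` on both sides, together with
`κ ‖φ‖² ≤ …` in one direction on either side, gives the energy at least `-m ‖φ‖²` for `φ` supported
in a flat patch provided that `α < √m + √(V₀ + m)`, up to the flatness; this is the condition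
`-m < μ` (`lt_sqrt_add_sqrt`). A continuous partition of unity with balls of a large radius localizes
the form with a small error, patches that do not meet the surface are harmless, and the remaining
bounded part of space is controlled by finitely many functionals through a local Poincaré inequality
(`boundedBelowModFinite_formOperator`). Neither the convexity of the interior region nor which of the
regions carries the potential matters.

For the approximate eigenvalues, if `V₀ ≥ α²` then `μ = 0` and one takes cut off plane waves in large
balls in the region without potential. If `V₀ < α²`, the transverse one-dimensional problem with
potential `V₀` on one side has a bound state `e^{-a₂ t}`, `e^{a₁ t}`, where
`a₁ = (α² - V₀) / (2 α)` and `a₂ = (α² + V₀) / (2 α)` satisfy `a₁ + a₂ = α`, `a₂² - a₁² = V₀` and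
`-a₁² = μ`. The product of a plane wave of wave number `κ` along a flat patch with this bound state,
as a function of the height over the plane of the patch, is an approximate eigenfunction for
`κ² - a₁²`. The surface is not the plane, so the kink of the bound state is smoothed in a layer of
width `η` containing the patch of the surface, and the Gauss theorem is applied on the two sides of
the true surface to the two exponentials (`IsFlatPatch.energyPairing_sub_eq`). The errors live in the
layer, whose volume is small compared with the square of the norm of the wave
(`isApproxFormEigenvalue_of_matched`).
-/

/-! ### Operators associated with quadratic forms -/

noncomputable section FormOperators

variable {H W : Type*} [NormedAddCommGroup H] [InnerProductSpace ℂ H] [CompleteSpace H]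
  [NormedAddCommGroup W] [InnerProductSpace ℂ W] [CompleteSpace W]

/-- A bounded operator on a Hilbert space is invertible if it is bounded below together with its
adjoint. -/
theorem isUnit_of_bddBelow_adjoint (A : H →L[ℂ] H) {c : ℝ} (hc : 0 < c)
    (h₁ : ∀ f, c * ‖f‖ ≤ ‖A f‖) (h₂ : ∀ f, c * ‖f‖ ≤ ‖A.adjoint f‖) : IsUnit A := by
  have hanti : AntilipschitzWith (Real.toNNReal c⁻¹) A := by
    refine AddMonoidHomClass.antilipschitz_of_bound A fun x => ?_
    rw [Real.coe_toNNReal _ (inv_nonneg.2 hc.le), inv_mul_eq_div, le_div_iff₀ hc, mul_comm]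
    exact h₁ x
  rw [ContinuousLinearMap.isUnit_iff_bijective]
  refine ⟨hanti.injective, ?_⟩
  have hclosed : IsClosed (A.range : Set H) := by
    have := hanti.isClosed_range A.uniformContinuous
    rwa [show (A.range : Set H) = Set.range A from rfl]
  have : A.range = ⊤ := by
    have : CompleteSpace A.range := hclosed.completeSpace_coe
    rw [← Submodule.orthogonal_eq_bot_iff, ContinuousLinearMap.orthogonal_range]
    rw [LinearMap.ker_eq_bot']
    intro f hf
    have := h₂ f
    have h0 : A.adjoint f = 0 := hf
    rw [h0, norm_zero] at this
    have : ‖f‖ ≤ 0 := by nlinarith [norm_nonneg f]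
    exact norm_le_zero_iff.1 this
  intro y
  have hy : y ∈ A.range := by rw [this]; trivial
  exact hy

/-- A closed, semibounded form on a Hilbert space `H`, given by its form domain, a Hilbert space `W`
embedded in `H` by `ι`, and by the bounded operator `B` on `W` that represents it: the form is
`(ι v, ι u) ↦ ⟪v, B u⟫`. -/
structure FormData (ι : W →L[ℂ] H) (B : W →L[ℂ] W) (c C : ℝ) : Prop where
  injective : Function.Injective ι
  denseRange : DenseRange ι
  isSymm : ∀ u v, ⟪B u, v⟫_ℂ = ⟪u, B v⟫_ℂ
  pos : 0 < c
  coercive : ∀ u, c * ‖u‖ ^ 2 ≤ (⟪u, B u⟫_ℂ).re + C * ‖ι u‖ ^ 2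

variable {ι : W →L[ℂ] H} {B : W →L[ℂ] W} {c C : ℝ}

/-- The operator `B + C` on the form domain, for the inner product of the form domain. -/
def shiftedForm (ι : W →L[ℂ] H) (B : W →L[ℂ] W) (C : ℝ) : W →L[ℂ] W :=
  B + (C : ℂ) • (ι.adjoint ∘L ι)

theorem inner_shiftedForm (u v : W) :
    ⟪v, shiftedForm ι B C u⟫_ℂ = ⟪v, B u⟫_ℂ + C * ⟪ι v, ι u⟫_ℂ := by
  simp [shiftedForm, ContinuousLinearMap.adjoint_inner_right]

namespace FormData

theorem shifted_symm (h : FormData ι B c C) (u v : W) :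
    ⟪shiftedForm ι B C u, v⟫_ℂ = ⟪u, shiftedForm ι B C v⟫_ℂ := by
  rw [inner_shiftedForm, ← inner_conj_symm, inner_shiftedForm, map_add, map_mul, inner_conj_symm,
    inner_conj_symm, h.isSymm, Complex.conj_ofReal]

theorem isUnit_shifted (h : FormData ι B c C) : IsUnit (shiftedForm ι B C) := by
  have hb : ∀ f, c * ‖f‖ ≤ ‖shiftedForm ι B C f‖ := by
    intro f
    have h1 := h.coercive f
    have h2 : (⟪f, shiftedForm ι B C f⟫_ℂ).re = (⟪f, B f⟫_ℂ).re + C * ‖ι f‖ ^ 2 := by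
      rw [inner_shiftedForm, inner_self_eq_norm_sq_to_K]
      simp [← Complex.ofReal_pow]
    have h3 : (⟪f, shiftedForm ι B C f⟫_ℂ).re ≤ ‖f‖ * ‖shiftedForm ι B C f‖ :=
      (Complex.re_le_norm _).trans (norm_inner_le_norm _ _)
    rcases (norm_nonneg f).eq_or_lt with h0 | h0
    · rw [← h0]; simp
    · have : (c * ‖f‖) * ‖f‖ ≤ ‖shiftedForm ι B C f‖ * ‖f‖ := by nlinarith
      exact le_of_mul_le_mul_right this h0
  refine isUnit_of_bddBelow_adjoint _ h.pos hb ?_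
  have : (shiftedForm ι B C).adjoint = shiftedForm ι B C := by
    symm
    rw [ContinuousLinearMap.eq_adjoint_iff]
    exact h.shifted_symm
  rw [this]; exact hb

/-- The inverse of `B + C` on the form domain. -/
def invShifted (_ : FormData ι B c C) : W →L[ℂ] W := Ring.inverse (shiftedForm ι B C)

theorem shifted_inv (h : FormData ι B c C) (w : W) :
    shiftedForm ι B C (h.invShifted w) = w := by
  have := Ring.mul_inverse_cancel _ h.isUnit_shifted
  exact congrArg (fun A : W →L[ℂ] W => A w) this

theorem inv_shifted (h : FormData ι B c C) (w : W) :
    h.invShifted (shiftedForm ι B C w) = w := by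
  have := Ring.inverse_mul_cancel _ h.isUnit_shifted
  exact congrArg (fun A : W →L[ℂ] W => A w) this

/-- The resolvent at `-C`, with values in the form domain. -/
def preResolvent (h : FormData ι B c C) : H →L[ℂ] W := h.invShifted ∘L ι.adjoint

/-- The resolvent at `-C`. -/
def resolventOp (h : FormData ι B c C) : H →L[ℂ] H := ι ∘L h.preResolvent

theorem preResolvent_iff (h : FormData ι B c C) (w : W) (f : H) :
    w = h.preResolvent f ↔ ∀ v, ⟪v, B w⟫_ℂ + C * ⟪ι v, ι w⟫_ℂ = ⟪ι v, f⟫_ℂ := by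
  constructor
  · rintro rfl v
    rw [← inner_shiftedForm]
    simp [preResolvent, h.shifted_inv, ContinuousLinearMap.adjoint_inner_right]
  · intro hv
    have : shiftedForm ι B C w = ι.adjoint f := by
      refine ext_inner_left ℂ fun v => ?_
      rw [inner_shiftedForm, hv, ContinuousLinearMap.adjoint_inner_right]
    rw [preResolvent, ContinuousLinearMap.comp_apply, ← this, h.inv_shifted]

theorem form_preResolvent (h : FormData ι B c C) (f : H) (v : W) :
    ⟪v, B (h.preResolvent f)⟫_ℂ + C * ⟪ι v, h.resolventOp f⟫_ℂ = ⟪ι v, f⟫_ℂ :=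
  (h.preResolvent_iff _ f).1 rfl v

theorem resolventOp_symm (h : FormData ι B c C) (f g : H) :
    ⟪h.resolventOp f, g⟫_ℂ = ⟪f, h.resolventOp g⟫_ℂ := by
  have h1 := h.form_preResolvent g (h.preResolvent f)
  have h2 := h.form_preResolvent f (h.preResolvent g)
  have h3 := congrArg (starRingEnd ℂ) h2
  rw [map_add, map_mul, inner_conj_symm, Complex.conj_ofReal, inner_conj_symm, inner_conj_symm,
    h.isSymm] at h3
  exact h1.symm.trans h3

theorem adjoint_resolventOp (h : FormData ι B c C) : h.resolventOp.adjoint = h.resolventOp := by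
  symm
  rw [ContinuousLinearMap.eq_adjoint_iff]
  exact h.resolventOp_symm

theorem resolventOp_injective (h : FormData ι B c C) (f : H) (hf : h.resolventOp f = 0) :
    f = 0 := by
  have h0 : h.preResolvent f = 0 := h.injective (by simpa [resolventOp] using hf)
  have h1 : ∀ v, ⟪ι v, f⟫_ℂ = 0 := fun v => by
    rw [← h.form_preResolvent f v, hf, h0]; simp
  exact h.denseRange.eq_zero_of_inner_right (𝕜 := ℂ) h1

/-- The relation between `u` and `f` that defines the operator associated with the form, in terms
of the resolvent. -/
theorem assoc_iff (h : FormData ι B c C) {D : Set H} {q : H → H → ℂ} (hD : D = Set.range ι)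
    (hq : ∀ v u, q (ι v) (ι u) = ⟪v, B u⟫_ℂ) (u f : H) :
    (u ∈ D ∧ ∀ v ∈ D, q v u = ⟪v, f⟫_ℂ) ↔ u = h.resolventOp (f + (C : ℂ) • u) := by
  subst hD
  constructor
  · rintro ⟨⟨w, rfl⟩, hw⟩
    have : w = h.preResolvent (f + (C : ℂ) • ι w) := by
      rw [h.preResolvent_iff]
      intro v
      rw [inner_add_right, inner_smul_right, ← hw (ι v) ⟨v, rfl⟩, hq]
    exact congrArg ι this
  · intro hu
    have hu' : u = ι (h.preResolvent (f + (C : ℂ) • u)) := hu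
    refine ⟨⟨_, hu'.symm⟩, ?_⟩
    rintro _ ⟨v, rfl⟩
    have := h.form_preResolvent (f + (C : ℂ) • u) v
    rw [inner_add_right, inner_smul_right, ← hu] at this
    rw [hu', hq]
    exact add_right_cancel this

end FormData

end FormOperators

noncomputable section FormSpectrum

variable {H W : Type*} [NormedAddCommGroup H] [InnerProductSpace ℂ H] [CompleteSpace H]
  [NormedAddCommGroup W] [InnerProductSpace ℂ W] [CompleteSpace W]
  {ι : W →L[ℂ] H} {B : W →L[ℂ] W} {c C : ℝ}

namespace FormData

/-- The graph of the operator associated with the form. -/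
def opGraph (h : FormData ι B c C) : Submodule ℂ (H × H) :=
  LinearMap.ker (LinearMap.fst ℂ H H - h.resolventOp.toLinearMap ∘ₗ
    (LinearMap.snd ℂ H H + (C : ℂ) • LinearMap.fst ℂ H H))

theorem mem_opGraph (h : FormData ι B c C) (u f : H) :
    (u, f) ∈ h.opGraph ↔ u = h.resolventOp (f + (C : ℂ) • u) := by
  simp [opGraph, sub_eq_zero]

/-- The operator associated with the form. -/
def op (h : FormData ι B c C) : H →ₗ.[ℂ] H := h.opGraph.toLinearPMap

theorem mem_op_graph (h : FormData ι B c C) (u f : H) :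
    (u, f) ∈ h.op.graph ↔ u = h.resolventOp (f + (C : ℂ) • u) := by
  rw [op, Submodule.toLinearPMap_graph_eq, mem_opGraph]
  rintro ⟨u, f⟩ hx (h0 : u = 0)
  rw [mem_opGraph, h0] at hx
  exact h.resolventOp_injective f (by simpa using hx.symm)

variable {A : H →ₗ.[ℂ] H}

theorem apply_of_graph (h : FormData ι B c C)
    (hA : ∀ u f, (u, f) ∈ A.graph ↔ u = h.resolventOp (f + (C : ℂ) • u)) (f : H) :
    ∃ hf : h.resolventOp f ∈ A.domain,
      A ⟨h.resolventOp f, hf⟩ = f - (C : ℂ) • h.resolventOp f := by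
  have : (h.resolventOp f, f - (C : ℂ) • h.resolventOp f) ∈ A.graph := by
    rw [hA]; simp
  rw [LinearPMap.mem_graph_iff] at this
  obtain ⟨y, hy1, hy2⟩ := this
  simp only at hy1 hy2
  have hf : h.resolventOp f ∈ A.domain := hy1 ▸ y.2
  refine ⟨hf, ?_⟩
  rw [← hy2]
  congr 1
  exact Subtype.ext hy1.symm

theorem dense_domain_of_graph (h : FormData ι B c C)
    (hA : ∀ u f, (u, f) ∈ A.graph ↔ u = h.resolventOp (f + (C : ℂ) • u)) :
    Dense (A.domain : Set H) := by
  have hsub : h.resolventOp.range ≤ A.domain := by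
    rintro _ ⟨f, rfl⟩
    exact (h.apply_of_graph hA f).1
  refine Dense.mono (s₁ := (h.resolventOp.range : Set H)) hsub ?_
  rw [Submodule.dense_iff_topologicalClosure_eq_top,
    Submodule.topologicalClosure_eq_top_iff, ContinuousLinearMap.orthogonal_range,
    h.adjoint_resolventOp, LinearMap.ker_eq_bot']
  exact h.resolventOp_injective

theorem isSelfAdjoint_of_graph (h : FormData ι B c C)
    (hA : ∀ u f, (u, f) ∈ A.graph ↔ u = h.resolventOp (f + (C : ℂ) • u)) :
    IsSelfAdjoint A := by
  have hdense := h.dense_domain_of_graph hA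
  have hdom : ∀ u : A.domain, (u : H) = h.resolventOp (A u + (C : ℂ) • (u : H)) := fun u =>
    (hA _ _).1 (A.mem_graph u)
  rw [LinearPMap.isSelfAdjoint_def]
  refine le_antisymm ?_ (LinearPMap.IsFormalAdjoint.le_adjoint hdense ?_)
  · refine LinearPMap.le_of_le_graph ?_
    rintro ⟨y, z⟩ hyz
    rw [LinearPMap.mem_graph_iff] at hyz
    obtain ⟨y', rfl, rfl⟩ := hyz
    rw [hA]
    have hadj := LinearPMap.adjoint_isFormalAdjoint hdense y'
    -- `y` and the resolvent applied to `(A† + C) y` have the same inner product with every vector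
    refine ext_inner_right ℂ fun f => ?_
    obtain ⟨hf, hAf⟩ := h.apply_of_graph hA f
    have h1 := hadj ⟨h.resolventOp f, hf⟩
    rw [hAf, inner_sub_right, inner_smul_right] at h1
    rw [h.resolventOp_symm, inner_add_left, inner_smul_left, Complex.conj_ofReal]
    simp only [] at h1 ⊢
    rw [h1]; ring
  · intro u v
    have hu := hdom u
    have hv := hdom v
    have h1 := h.resolventOp_symm (A u + (C : ℂ) • (u : H)) (A v + (C : ℂ) • (v : H))
    rw [← hu, ← hv, inner_add_right, inner_add_left, inner_smul_left, inner_smul_right,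
      Complex.conj_ofReal] at h1
    exact (add_right_cancel h1).symm

/-- The operator associated with a closed semibounded form exists, is unique and self-adjoint. -/
theorem existsUnique_associated (h : FormData ι B c C) {D : Set H} {q : H → H → ℂ}
    (hD : D = Set.range ι) (hq : ∀ v u, q (ι v) (ι u) = ⟪v, B u⟫_ℂ) :
    ∃! A : H →ₗ.[ℂ] H, IsSelfAdjoint A ∧ IsAssociatedOperator D q A := by
  refine ⟨h.op, ⟨h.isSelfAdjoint_of_graph h.mem_op_graph, fun u f => ?_⟩, ?_⟩
  · rw [h.assoc_iff hD hq, h.mem_op_graph]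
  · rintro A ⟨-, hA⟩
    refine LinearPMap.eq_of_eq_graph ?_
    ext ⟨u, f⟩
    rw [hA, h.assoc_iff hD hq, h.mem_op_graph]

/-! ### The spectrum in terms of the resolvent -/

/-- The operator `1 - (z + C) R`, where `R` is the resolvent at `-C`: it is invertible precisely if
`z` belongs to the resolvent set of the operator associated with the form. -/
def birman (h : FormData ι B c C) (z : ℂ) : H →L[ℂ] H := 1 - (z + C) • h.resolventOp

theorem birman_apply (h : FormData ι B c C) (z : ℂ) (f : H) :
    h.birman z f = f - (z + C) • h.resolventOp f := by simp [birman]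

theorem adjoint_birman (h : FormData ι B c C) (z : ℂ) :
    (h.birman z).adjoint = h.birman (starRingEnd ℂ z) := by
  symm
  rw [ContinuousLinearMap.eq_adjoint_iff]
  intro x y
  simp [birman_apply, inner_sub_left, inner_sub_right, inner_smul_left, inner_smul_right,
    h.resolventOp_symm]

theorem norm_birman_conj (h : FormData ι B c C) (z : ℂ) (f : H) :
    ‖h.birman (starRingEnd ℂ z) f‖ = ‖h.birman z f‖ := by
  have hn : IsStarNormal (h.birman z) := by
    refine ⟨?_⟩
    rw [ContinuousLinearMap.star_eq_adjoint, adjoint_birman, birman, birman]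
    have : Commute h.resolventOp h.resolventOp := Commute.refl _
    exact ((Commute.one_left _).sub_left
      (((Commute.one_right _).sub_right (this.smul_right _)).smul_left _))
  rw [← adjoint_birman]
  exact (ContinuousLinearMap.isStarNormal_iff_norm_eq_adjoint.1 hn f).symm

theorem exists_approx_of_not_mem_resolventSet (h : FormData ι B c C)
    (hA : ∀ u f, (u, f) ∈ A.graph ↔ u = h.resolventOp (f + (C : ℂ) • u)) {z : ℂ}
    (hz : z ∈ opSpectrum A) {ε : ℝ} (hε : 0 < ε) : ∃ f, ‖h.birman z f‖ < ε * ‖f‖ := by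
  by_contra! hcon
  refine hz ?_
  have hu : IsUnit (h.birman z) := by
    refine isUnit_of_bddBelow_adjoint _ hε hcon fun f => ?_
    rw [adjoint_birman, norm_birman_conj]
    exact hcon f
  have hinv1 : ∀ f, h.birman z (Ring.inverse (h.birman z) f) = f := fun f =>
    congrArg (fun T : H →L[ℂ] H => T f) (Ring.mul_inverse_cancel _ hu)
  have hinv2 : ∀ f, Ring.inverse (h.birman z) (h.birman z f) = f := fun f =>
    congrArg (fun T : H →L[ℂ] H => T f) (Ring.inverse_mul_cancel _ hu)
  refine ⟨h.resolventOp ∘L Ring.inverse (h.birman z), fun f => ?_, fun u => ?_⟩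
  · obtain ⟨hf, hAf⟩ := h.apply_of_graph hA (Ring.inverse (h.birman z) f)
    refine ⟨hf, ?_⟩
    simp only [ContinuousLinearMap.comp_apply]
    rw [hAf]
    nth_rewrite 4 [← hinv1 f]
    rw [birman_apply, add_smul]
    abel
  · have hu := (hA _ _).1 (A.mem_graph u)
    set g := A u + (C : ℂ) • (u : H) with hg
    have : A u - z • (u : H) = h.birman z g := by
      rw [birman_apply, ← hu, hg, add_smul]; abel
    rw [this, ContinuousLinearMap.comp_apply, hinv2, ← hu]

/-- Points of the spectrum are real. -/
theorem im_eq_zero_of_mem_spectrum (h : FormData ι B c C)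
    (hA : ∀ u f, (u, f) ∈ A.graph ↔ u = h.resolventOp (f + (C : ℂ) • u)) {z : ℂ}
    (hz : z ∈ opSpectrum A) : z.im = 0 := by
  by_contra hne
  have hpos : 0 < |z.im| := abs_pos.2 hne
  set K := 1 + ‖z + C‖ / |z.im| with hK
  have hKpos : 0 < K := by positivity
  obtain ⟨f, hf⟩ := h.exists_approx_of_not_mem_resolventSet hA hz (inv_pos.2 hKpos)
  have hreal : (⟪h.resolventOp f, f⟫_ℂ).im = 0 := by
    have : starRingEnd ℂ ⟪h.resolventOp f, f⟫_ℂ = ⟪h.resolventOp f, f⟫_ℂ := by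
      rw [inner_conj_symm, h.resolventOp_symm]
    exact Complex.conj_eq_iff_im.1 this
  -- the resolvent operator being symmetric, only the term with `z` contributes to the imaginary part
  have h1 : (⟪h.resolventOp f, h.birman z f⟫_ℂ).im = -(z.im * ‖h.resolventOp f‖ ^ 2) := by
    rw [birman_apply, inner_sub_right, inner_smul_right, inner_self_eq_norm_sq_to_K,
      Complex.sub_im, hreal]
    simp [← Complex.ofReal_pow]
  have h2 : |z.im| * ‖h.resolventOp f‖ ^ 2 ≤ ‖h.resolventOp f‖ * ‖h.birman z f‖ := by
    have := (Complex.abs_im_le_norm ⟪h.resolventOp f, h.birman z f⟫_ℂ).trans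
      (norm_inner_le_norm _ _)
    rwa [h1, abs_neg, abs_mul, abs_of_nonneg (sq_nonneg ‖h.resolventOp f‖)] at this
  have h3 : |z.im| * ‖h.resolventOp f‖ ≤ ‖h.birman z f‖ := by
    rcases (norm_nonneg (h.resolventOp f)).eq_or_lt with h0 | h0
    · rw [← h0]; simp
    · refine le_of_mul_le_mul_right ?_ h0
      nlinarith
  -- so `birman z f` controls `f`, against the choice of `f` as an approximate eigenvector
  have h4 : ‖f‖ ≤ ‖h.birman z f‖ + ‖z + C‖ * ‖h.resolventOp f‖ := by
    have : f = h.birman z f + (z + C) • h.resolventOp f := by rw [birman_apply]; abel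
    calc ‖f‖ = ‖h.birman z f + (z + C) • h.resolventOp f‖ := by rw [← this]
      _ ≤ _ := (norm_add_le _ _).trans (by rw [norm_smul])
  have h5 : ‖f‖ ≤ K * ‖h.birman z f‖ := by
    have : ‖h.resolventOp f‖ ≤ ‖h.birman z f‖ / |z.im| := by
      rw [le_div_iff₀ hpos]; linarith
    have := mul_le_mul_of_nonneg_left this (norm_nonneg (z + C))
    calc ‖f‖ ≤ ‖h.birman z f‖ + ‖z + C‖ * (‖h.birman z f‖ / |z.im|) := by linarith
      _ = K * ‖h.birman z f‖ := by rw [hK]; ring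
  have h6 : K * ‖h.birman z f‖ < K * (K⁻¹ * ‖f‖) := mul_lt_mul_of_pos_left hf hKpos
  rw [mul_inv_cancel_left₀ hKpos.ne'] at h6
  linarith

theorem eigenspace_eq (h : FormData ι B c C)
    (hA : ∀ u f, (u, f) ∈ A.graph ↔ u = h.resolventOp (f + (C : ℂ) • u)) (z : ℂ) :
    opEigenspace A z = (h.birman z).ker := by
  ext u
  have hmem : u ∈ (h.birman z).ker ↔ u = h.resolventOp (z • u + (C : ℂ) • u) := by
    rw [LinearMap.mem_ker, ← add_smul, map_smul]
    change h.birman z u = 0 ↔ _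
    rw [birman_apply, sub_eq_zero]
  rw [hmem, ← hA, opEigenspace, Submodule.mem_map, LinearPMap.mem_graph_iff]
  constructor
  · rintro ⟨y, hy, rfl⟩
    refine ⟨y, rfl, ?_⟩
    rw [LinearMap.mem_ker, LinearMap.sub_apply, sub_eq_zero] at hy
    exact hy
  · rintro ⟨y, hy, hy2⟩
    refine ⟨y, ?_, hy⟩
    rw [LinearMap.mem_ker, LinearMap.sub_apply, sub_eq_zero]
    simp only at hy hy2
    rw [← hy] at hy2
    exact hy2

end FormData
end FormSpectrum

/-! ### The essential spectrum through the quadratic form -/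

noncomputable section EssentialSpectrum

variable {H W : Type*} [NormedAddCommGroup H] [InnerProductSpace ℂ H] [CompleteSpace H]
  [NormedAddCommGroup W] [InnerProductSpace ℂ W] [CompleteSpace W]
  {ι : W →L[ℂ] H} {B : W →L[ℂ] W} {c C : ℝ}

/-- The form is bounded below by `m`, up to a form of finite rank. -/
def BoundedBelowModFinite (ι : W →L[ℂ] H) (B : W →L[ℂ] W) (m : ℝ) : Prop :=
  ∃ (N : ℕ) (g : Fin N → H) (K : ℝ), 0 ≤ K ∧
    ∀ u, m * ‖ι u‖ ^ 2 ≤ (⟪u, B u⟫_ℂ).re + K * ∑ j, ‖⟪g j, ι u⟫_ℂ‖ ^ 2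

/-- `r` is an approximate eigenvalue of the form, in the norm dual to that of the form domain. -/
def IsApproxFormEigenvalue (ι : W →L[ℂ] H) (B : W →L[ℂ] W) (r : ℝ) : Prop :=
  ∀ ε > 0, ∃ ψ, ι ψ ≠ 0 ∧ ∀ v, ‖⟪v, B ψ⟫_ℂ - r * ⟪ι v, ι ψ⟫_ℂ‖ ≤ ε * ‖v‖ * ‖ι ψ‖

namespace FormData

/-- Below a level at which the form is bounded below up to finite rank, bounded sequences of
approximate eigenvectors have convergent subsequences. -/
theorem exists_tendsto_subseq (h : FormData ι B c C) {m r : ℝ} (hm : BoundedBelowModFinite ι B m)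
    (hr : r < m) {M : ℝ} (f : ℕ → H) (hf : ∀ n, ‖f n‖ ≤ M)
    (hlim : Tendsto (fun n => h.birman r (f n)) atTop (𝓝 0)) :
    ∃ f₀, ∃ κ : ℕ → ℕ, StrictMono κ ∧ Tendsto (f ∘ κ) atTop (𝓝 f₀) := by
  obtain ⟨N, g, K, hK, hlow⟩ := hm
  have hM : 0 ≤ M := (norm_nonneg _).trans (hf 0)
  set L := ‖h.resolventOp‖ * M with hL
  have hub : ∀ n, ‖h.resolventOp (f n)‖ ≤ L := fun n =>
    (h.resolventOp.le_opNorm (f n)).trans (mul_le_mul_of_nonneg_left (hf n) (norm_nonneg _))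
  -- the finitely many scalar products that appear in the lower bound converge along a subsequence
  obtain ⟨a, -, κ, hκ, ha⟩ := tendsto_subseq_of_bounded
    (s := Metric.closedBall (0 : Fin N → ℂ) (∑ j, ‖g j‖ * L))
    Metric.isBounded_closedBall (x := fun n j => ⟪g j, h.resolventOp (f n)⟫_ℂ) (by
      intro n
      rw [mem_closedBall_zero_iff, pi_norm_le_iff_of_nonneg (by positivity)]
      intro j
      calc ‖⟪g j, h.resolventOp (f n)⟫_ℂ‖ ≤ ‖g j‖ * ‖h.resolventOp (f n)‖ := norm_inner_le_norm _ _
        _ ≤ ‖g j‖ * L := by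
            gcongr
            exact hub n
        _ ≤ _ := Finset.single_le_sum (f := fun j => ‖g j‖ * L)
            (fun i _ => by positivity) (Finset.mem_univ j))
  set u : ℕ → H := fun n => h.resolventOp (f n) with hu
  set e : ℕ → H := fun n => h.birman r (f n) with he
  have hfe : ∀ n, f n = e n + ((r : ℂ) + C) • u n := fun n => by
    simp only [he, hu, birman_apply]; abel
  have hbound : ∀ p n, (m - r) * ‖u p - u n‖ ^ 2 ≤
      2 * L * (‖e p‖ + ‖e n‖) +
        K * ∑ j, ‖⟪g j, u p⟫_ℂ - ⟪g j, u n⟫_ℂ‖ ^ 2 := by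
    intro p n
    set w := h.preResolvent (f p - f n) with hw
    have hιw : ι w = u p - u n := by
      simp only [hu, ← map_sub]; rfl
    have h1 := hlow w
    have h2 := h.form_preResolvent (f p - f n) w
    rw [← hw] at h2
    have h3 : h.resolventOp (f p - f n) = u p - u n := by simp [hu]
    rw [hιw, h3, hfe p, hfe n, show e p + ((r : ℂ) + C) • u p - (e n + ((r : ℂ) + C) • u n) =
      (e p - e n) + ((r : ℂ) + C) • (u p - u n) by rw [smul_sub]; abel, inner_add_right,
      inner_smul_right, inner_self_eq_norm_sq_to_K] at h2
    have h4 : (⟪w, B w⟫_ℂ).re = (⟪u p - u n, e p - e n⟫_ℂ).re + r * ‖u p - u n‖ ^ 2 := by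
      have : ⟪w, B w⟫_ℂ = ⟪u p - u n, e p - e n⟫_ℂ + (r * ‖u p - u n‖ ^ 2 : ℝ) := by
        push_cast
        linear_combination h2
      rw [this, Complex.add_re, Complex.ofReal_re]
    have h5 : (⟪u p - u n, e p - e n⟫_ℂ).re ≤ 2 * L * (‖e p‖ + ‖e n‖) := by
      refine (Complex.re_le_norm _).trans ((norm_inner_le_norm _ _).trans ?_)
      have h6 : ‖u p - u n‖ ≤ 2 * L := by
        have := hub p
        have := hub n
        have := norm_sub_le (u p) (u n)
        simp only [hu] at *
        linarith
      exact mul_le_mul h6 (norm_sub_le _ _) (norm_nonneg _) (by positivity)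
    rw [hιw, h4] at h1
    have h6 : ∀ j, ⟪g j, u p - u n⟫_ℂ = ⟪g j, u p⟫_ℂ - ⟪g j, u n⟫_ℂ := fun j =>
      inner_sub_right _ _ _
    simp only [h6] at h1
    linarith
  have hcau : CauchySeq (u ∘ κ) := by
    rw [cauchySeq_iff_tendsto_dist_atTop_0]
    have hae : Tendsto (fun n => ‖e (κ n)‖) atTop (𝓝 0) := by
      simpa using (hlim.comp hκ.tendsto_atTop).norm
    have haj : ∀ j, Tendsto (fun n => ⟪g j, u (κ n)⟫_ℂ) atTop (𝓝 (a j)) := fun j =>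
      (tendsto_pi_nhds.1 ha) j
    have hfst := @tendsto_fst ℕ ℕ atTop atTop
    have hsnd := @tendsto_snd ℕ ℕ atTop atTop
    rw [prod_atTop_atTop_eq] at hfst hsnd
    have hR : Tendsto (fun x : ℕ × ℕ => (m - r)⁻¹ * (2 * L *
        (‖e (κ x.1)‖ + ‖e (κ x.2)‖) +
        K * ∑ j, ‖⟪g j, u (κ x.1)⟫_ℂ - ⟪g j, u (κ x.2)⟫_ℂ‖ ^ 2)) atTop (𝓝 0) := by
      have h1 := ((hae.comp hfst).add (hae.comp hsnd)).const_mul (2 * L)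
      have h2 : ∀ j, Tendsto (fun x : ℕ × ℕ =>
          ‖⟪g j, u (κ x.1)⟫_ℂ - ⟪g j, u (κ x.2)⟫_ℂ‖ ^ 2) atTop (𝓝 0) := fun j => by
        have := ((((haj j).comp hfst).sub ((haj j).comp hsnd)).norm.pow 2)
        simpa using this
      have h3 := (tendsto_finsetSum Finset.univ fun j _ => h2 j).const_mul K
      have := (h1.add h3).const_mul (m - r)⁻¹
      simpa using this
    have hsq : Tendsto (fun x : ℕ × ℕ => dist ((u ∘ κ) x.1) ((u ∘ κ) x.2) ^ 2) atTop (𝓝 0) := by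
      refine squeeze_zero (fun _ => sq_nonneg _) (fun x => ?_) hR
      rw [dist_eq_norm, ← div_eq_inv_mul, le_div_iff₀ (sub_pos.2 hr), mul_comm]
      exact hbound _ _
    have := hsq.sqrt
    simpa [Real.sqrt_sq] using this
  obtain ⟨u₀, hu₀⟩ := cauchySeq_tendsto_of_complete hcau
  refine ⟨0 + ((r : ℂ) + C) • u₀, κ, hκ, ?_⟩
  have := (hlim.comp hκ.tendsto_atTop).add (hu₀.const_smul ((r : ℂ) + C))
  refine this.congr fun n => ?_
  simp only [Function.comp_apply]
  exact (hfe (κ n)).symm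

variable {A : H →ₗ.[ℂ] H}

/-- Below a level at which the form is bounded below up to finite rank, points of the spectrum are
eigenvalues. -/
theorem exists_eigenvector (h : FormData ι B c C)
    (hA : ∀ u f, (u, f) ∈ A.graph ↔ u = h.resolventOp (f + (C : ℂ) • u))
    {m r : ℝ} (hm : BoundedBelowModFinite ι B m) (hr : r < m) (hz : (r : ℂ) ∈ opSpectrum A) :
    ∃ f, ‖f‖ = 1 ∧ h.birman r f = 0 := by
  have hex : ∀ n : ℕ, ∃ f, ‖f‖ = 1 ∧ ‖h.birman r f‖ < 1 / ((n : ℝ) + 1) := fun n => by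
    obtain ⟨f, hf⟩ := h.exists_approx_of_not_mem_resolventSet hA hz
      (ε := 1 / ((n : ℝ) + 1)) (by positivity)
    have hpos : 0 < ‖f‖ := by
      rcases (norm_nonneg f).eq_or_lt with h0 | h0
      · rw [← h0, mul_zero] at hf
        exact absurd hf (norm_nonneg _).not_gt
      · exact h0
    refine ⟨((‖f‖⁻¹ : ℝ) : ℂ) • f, ?_, ?_⟩
    · rw [norm_smul, Complex.norm_real, norm_inv, norm_norm, inv_mul_cancel₀ hpos.ne']
    · rw [map_smul, norm_smul, Complex.norm_real, norm_inv, norm_norm, inv_mul_lt_iff₀ hpos]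
      linarith
  choose f hf1 hf2 using hex
  have hlim : Tendsto (fun n => h.birman r (f n)) atTop (𝓝 0) :=
    squeeze_zero_norm (fun n => (hf2 n).le) tendsto_one_div_add_atTop_nhds_zero_nat
  obtain ⟨f₀, κ, hκ, hf₀⟩ := h.exists_tendsto_subseq hm hr f (fun n => (hf1 n).le) hlim
  refine ⟨f₀, tendsto_nhds_unique hf₀.norm (by simp [hf1]), ?_⟩
  exact tendsto_nhds_unique (((h.birman r).continuous.tendsto f₀).comp hf₀)
    (hlim.comp hκ.tendsto_atTop)

theorem finiteDimensional_eigenspace (h : FormData ι B c C)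
    (hA : ∀ u f, (u, f) ∈ A.graph ↔ u = h.resolventOp (f + (C : ℂ) • u))
    {m r : ℝ} (hm : BoundedBelowModFinite ι B m) (hr : r < m) :
    FiniteDimensional ℂ (opEigenspace A (r : ℂ)) := by
  rw [h.eigenspace_eq hA]
  by_contra hinf
  obtain ⟨R, f, -, hf1, hf2⟩ := exists_seq_norm_le_one_le_norm_sub (𝕜 := ℂ) hinf
  have hB : ∀ n, h.birman r (f n) = 0 := fun n => (f n).2
  obtain ⟨f₀, κ, hκ, hf₀⟩ := h.exists_tendsto_subseq hm hr (fun n => (f n : H)) hf1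
    (by simp only [hB]; exact tendsto_const_nhds)
  obtain ⟨n, hn⟩ := Metric.cauchySeq_iff'.1 hf₀.cauchySeq 1 one_pos
  have h1 := hn (n + 1) n.le_succ
  have h2 := hf2 (hκ.injective.ne n.succ_ne_self)
  rw [dist_eq_norm] at h1
  exact absurd h1 (not_lt.2 h2)

theorem inner_eq_zero_of_birman (h : FormData ι B c C) {r s : ℝ} (hrs : r ≠ s) {f g : H}
    (hf : h.birman r f = 0) (hg : h.birman s g = 0) : ⟪f, g⟫_ℂ = 0 := by
  rw [birman_apply, sub_eq_zero] at hf hg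
  have h1 : ((s : ℂ) + C) * ⟪f, g⟫_ℂ = ((r : ℂ) + C) * ⟪f, g⟫_ℂ := by
    calc ((s : ℂ) + C) * ⟪f, g⟫_ℂ
        = ((s : ℂ) + C) * (((r : ℂ) + C) * ⟪h.resolventOp f, g⟫_ℂ) := by
          nth_rewrite 1 [hf]; rw [inner_smul_left]; simp
      _ = ((r : ℂ) + C) * ⟪f, ((s : ℂ) + C) • h.resolventOp g⟫_ℂ := by
          rw [h.resolventOp_symm, inner_smul_right]; ring
      _ = _ := by rw [← hg]
  have h2 : ((s : ℂ) - r) * ⟪f, g⟫_ℂ = 0 := by linear_combination h1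
  rcases mul_eq_zero.1 h2 with h3 | h3
  · exact absurd (by exact_mod_cast (sub_eq_zero.1 h3).symm) hrs
  · exact h3

/-- Below a number `m` to which the form is bounded below up to finite rank, points of the spectrum
do not accumulate: normalized eigenvectors for a sequence of eigenvalues with limit `r` would have an
eigenvector for `r` as a limit point, to which all of them are orthogonal. -/
theorem isolated_of_lt (h : FormData ι B c C)
    (hA : ∀ u f, (u, f) ∈ A.graph ↔ u = h.resolventOp (f + (C : ℂ) • u))
    {m r : ℝ} (hm : BoundedBelowModFinite ι B m) (hr : r < m) :
    ∃ ε > 0, opSpectrum A ∩ Metric.ball (r : ℂ) ε ⊆ {(r : ℂ)} := by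
  by_contra! hcon
  have hex : ∀ n : ℕ, ∃ s : ℝ, ∃ f, ‖f‖ = 1 ∧ h.birman s f = 0 ∧ s ≠ r ∧
      |s - r| < 1 / ((n : ℝ) + 1) := fun n => by
    have hpos : 0 < min (1 / ((n : ℝ) + 1)) (m - r) := lt_min (by positivity) (sub_pos.2 hr)
    obtain ⟨z, ⟨hz1, hz2⟩, hz3⟩ := Set.not_subset.1 (hcon _ hpos)
    have him := h.im_eq_zero_of_mem_spectrum hA hz1
    obtain ⟨s, rfl⟩ : ∃ s : ℝ, z = s := ⟨z.re, Complex.ext rfl (by simpa using him)⟩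
    rw [Metric.mem_ball, Complex.dist_eq, ← Complex.ofReal_sub, Complex.norm_real, lt_min_iff,
      Real.norm_eq_abs] at hz2
    obtain ⟨f, hf1, hf2⟩ := h.exists_eigenvector hA hm
      (by linarith [(abs_lt.1 hz2.2).2]) hz1
    exact ⟨s, f, hf1, hf2, fun h0 => hz3 (by simp [h0]), hz2.1⟩
  choose s f hf1 hf2 hs hsr using hex
  have hlim : Tendsto (fun n => h.birman r (f n)) atTop (𝓝 0) := by
    have h0 : Tendsto (fun n : ℕ => 1 / ((n : ℝ) + 1) * ‖h.resolventOp‖) atTop (𝓝 0) := by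
      simpa using tendsto_one_div_add_atTop_nhds_zero_nat.mul_const ‖h.resolventOp‖
    refine squeeze_zero_norm (fun n => ?_) h0
    have h1 : h.birman r (f n) = ((s n - r : ℝ) : ℂ) • h.resolventOp (f n) := by
      have := hf2 n
      rw [birman_apply, sub_eq_zero] at this
      rw [birman_apply]
      nth_rewrite 1 [this]
      rw [← sub_smul]; push_cast; ring_nf
    rw [h1, norm_smul, Complex.norm_real]
    refine mul_le_mul (hsr n).le ?_ (norm_nonneg _) (by positivity)
    simpa [hf1 n] using h.resolventOp.le_opNorm (f n)
  obtain ⟨f₀, κ, hκ, hf₀⟩ := h.exists_tendsto_subseq hm hr f (fun n => (hf1 n).le) hlim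
  have hB : h.birman r f₀ = 0 := tendsto_nhds_unique
    (((h.birman r).continuous.tendsto f₀).comp hf₀) (hlim.comp hκ.tendsto_atTop)
  have h1 : ‖f₀‖ = 1 := tendsto_nhds_unique hf₀.norm (by simp [hf1])
  -- eigenvectors for the eigenvalues `s n ≠ r` are orthogonal to their limit
  have h2 : ⟪f₀, f₀⟫_ℂ = 0 := by
    refine tendsto_nhds_unique (hf₀.inner tendsto_const_nhds) ?_
    simp [h.inner_eq_zero_of_birman (hs _) (hf2 _) hB]
  rw [inner_self_eq_zero] at h2
  simp [h2] at h1

/-- Weyl's criterion: an approximate eigenvalue of the form belongs to the spectrum. -/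
theorem mem_spectrum_of_approx (h : FormData ι B c C)
    (hA : ∀ u f, (u, f) ∈ A.graph ↔ u = h.resolventOp (f + (C : ℂ) • u))
    {r : ℝ} (hr : IsApproxFormEigenvalue ι B r) : (r : ℂ) ∈ opSpectrum A := by
  rintro ⟨S, hS, -⟩
  set M := ‖h.preResolvent‖ * (1 + ‖(r : ℂ) + C‖ * ‖S‖) with hM
  have hMpos : 0 ≤ M := by positivity
  obtain ⟨ψ, hψ0, hψ⟩ := hr (1 / (M + 1)) (by positivity)
  obtain ⟨hd, hSf⟩ := hS (ι ψ)
  set x : A.domain := ⟨S (ι ψ), hd⟩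
  have hAx : A x = ι ψ + (r : ℂ) • S (ι ψ) := by exact (sub_eq_iff_eq_add.1 hSf)
  have hx : S (ι ψ) = h.resolventOp (A x + (C : ℂ) • S (ι ψ)) := (hA _ _).1 (A.mem_graph x)
  set v := h.preResolvent (A x + (C : ℂ) • S (ι ψ)) with hv
  have hιv : ι v = S (ι ψ) := hx.symm
  have hvn : ‖v‖ ≤ M * ‖ι ψ‖ := by
    refine (h.preResolvent.le_opNorm _).trans ?_
    rw [hM, mul_assoc]
    gcongr
    rw [hAx, add_assoc, ← add_smul, add_mul, one_mul]
    refine (norm_add_le _ _).trans ?_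
    gcongr
    rw [norm_smul, mul_assoc]
    gcongr
    exact S.le_opNorm _
  -- the vector `v = (A - r)⁻¹ ψ`, tested against the approximate eigenvector `ψ`, gives `‖ψ‖²`
  have h1 : ⟪ψ, B v⟫_ℂ = ⟪ι ψ, A x⟫_ℂ := by
    have := h.form_preResolvent (A x + (C : ℂ) • S (ι ψ)) ψ
    rw [← hx, ← hv, inner_add_right, inner_smul_right] at this
    exact add_right_cancel this
  have h2 : ⟪v, B ψ⟫_ℂ - r * ⟪ι v, ι ψ⟫_ℂ = ((‖ι ψ‖ ^ 2 : ℝ) : ℂ) := by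
    rw [← h.isSymm, ← inner_conj_symm, h1, hAx, inner_conj_symm, hιv, inner_add_left,
      inner_smul_left, Complex.conj_ofReal, inner_self_eq_norm_sq_to_K]
    push_cast
    simp
  have h3 := hψ v
  rw [h2, Complex.norm_real, Real.norm_of_nonneg (sq_nonneg _)] at h3
  have hpos : 0 < ‖ι ψ‖ := norm_pos_iff.2 hψ0
  have h4 : 1 / (M + 1) * ‖v‖ * ‖ι ψ‖ ≤ 1 / (M + 1) * (M * ‖ι ψ‖) * ‖ι ψ‖ := by gcongr
  have h5 : 1 / (M + 1) * (M * ‖ι ψ‖) * ‖ι ψ‖ = M / (M + 1) * ‖ι ψ‖ ^ 2 := by ring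
  have h6 : M / (M + 1) < 1 := by rw [div_lt_one (by positivity)]; linarith
  have h7 : 0 < ‖ι ψ‖ ^ 2 := by positivity
  nlinarith

/-- The essential spectrum of the operator associated with a form that, up to finite rank, is
bounded below by every number below `μ`, and that has all numbers above `μ` as approximate
eigenvalues. -/
theorem essSpectrum_eq (h : FormData ι B c C) {D : Set H} {q : H → H → ℂ}
    (hD : D = Set.range ι) (hq : ∀ v u, q (ι v) (ι u) = ⟪v, B u⟫_ℂ)
    (hA : IsAssociatedOperator D q A) {μ : ℝ}
    (hlow : ∀ m < μ, BoundedBelowModFinite ι B m)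
    (hup : ∀ r, μ ≤ r → IsApproxFormEigenvalue ι B r) :
    opEssSpectrum A = (fun r : ℝ => (r : ℂ)) '' Set.Ici μ := by
  have hg : ∀ u f, (u, f) ∈ A.graph ↔ u = h.resolventOp (f + (C : ℂ) • u) := fun u f => by
    rw [hA, h.assoc_iff hD hq]
  ext z
  constructor
  · rintro ⟨hz, hnd⟩
    have him := h.im_eq_zero_of_mem_spectrum hg hz
    obtain ⟨r, rfl⟩ : ∃ r : ℝ, z = r := ⟨z.re, Complex.ext rfl (by simpa using him)⟩
    refine ⟨r, ?_, rfl⟩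
    by_contra hr
    rw [Set.mem_Ici, not_le] at hr
    obtain ⟨m, hrm, hmμ⟩ := exists_between hr
    have hm := hlow m hmμ
    obtain ⟨ε, hε, hsub⟩ := h.isolated_of_lt hg hm hrm
    refine hnd ⟨hz, ⟨ε, hε, hsub.antisymm ?_⟩, ?_, h.finiteDimensional_eigenspace hg hm hrm⟩
    · rintro _ rfl
      exact ⟨hz, Metric.mem_ball_self hε⟩
    · obtain ⟨f, hf1, hf2⟩ := h.exists_eigenvector hg hm hrm hz
      rw [h.eigenspace_eq hg]
      intro h0
      have : f ∈ (h.birman r).ker := hf2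
      rw [h0, Submodule.mem_bot] at this
      simp [this] at hf1
  · rintro ⟨r, hr, rfl⟩
    refine ⟨h.mem_spectrum_of_approx hg (hup r hr), ?_⟩
    rintro ⟨-, ⟨ε, hε, hball⟩, -⟩
    -- no point of the half-line is isolated, as all larger numbers belong to the spectrum, too
    have h1 : ((r + ε / 2 : ℝ) : ℂ) ∈ opSpectrum A ∩ Metric.ball (r : ℂ) ε := by
      refine ⟨h.mem_spectrum_of_approx hg (hup _ ?_), ?_⟩
      · rw [Set.mem_Ici] at hr; linarith
      · rw [Metric.mem_ball, Complex.dist_eq, ← Complex.ofReal_sub, Complex.norm_real,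
          Real.norm_eq_abs, add_sub_cancel_left, abs_of_pos (by positivity)]
        linarith
    simp only [] at hball
    rw [hball, Set.mem_singleton_iff, Complex.ofReal_inj] at h1
    linarith

end FormData
end EssentialSpectrum

/-! ### Test functions and their density in the Sobolev space -/

noncomputable section SobolevDensity

/-- A complex-valued test function on `ℝ³`. -/
def IsTestFunction (φ : Space → ℂ) : Prop := ContDiff ℝ ∞ φ ∧ HasCompactSupport φ

/-- The partial derivative of a function on `ℝ³`. -/
def pderiv (i : Fin 3) (φ : Space → ℂ) (x : Space) : ℂ :=
  fderiv ℝ φ x (EuclideanSpace.single i 1)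

theorem eLpNorm_two_sq {X F : Type*} [MeasurableSpace X] [NormedAddCommGroup F] (f : X → F)
    (ν : Measure X) : eLpNorm f 2 ν ^ 2 = ∫⁻ x, ‖f x‖ₑ ^ 2 ∂ν := by
  have := eLpNorm_nnreal_pow_eq_lintegral (f := f) (μ := ν) (p := 2) (by norm_num)
  simpa using this

/-- The Cauchy–Schwarz inequality against the constant `1`. -/
theorem sq_lintegral_le {X : Type*} [MeasurableSpace X] (ν : Measure X) {f : X → ℝ≥0∞}
    (hf : AEMeasurable f ν) : (∫⁻ x, f x ∂ν) ^ 2 ≤ ν Set.univ * ∫⁻ x, f x ^ 2 ∂ν := by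
  have h := ENNReal.lintegral_mul_le_Lp_mul_Lq ν (p := 2) (q := 2)
    (by norm_num [Real.holderConjugate_iff]) hf (aemeasurable_const (b := 1))
  simp only [Pi.mul_apply, mul_one, ENNReal.one_rpow, lintegral_const, one_mul] at h
  calc (∫⁻ x, f x ∂ν) ^ 2 ≤ ((∫⁻ x, f x ^ (2 : ℝ) ∂ν) ^ (1 / 2 : ℝ) *
        ν Set.univ ^ (1 / 2 : ℝ)) ^ 2 := by gcongr
    _ = _ := by
      rw [mul_pow, ← ENNReal.rpow_natCast, ← ENNReal.rpow_natCast, ← ENNReal.rpow_mul,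
        ← ENNReal.rpow_mul]
      norm_num
      rw [mul_comm]

/-- Translations act continuously on `L²`. -/
theorem tendsto_lintegral_translate (u : L2Space) :
    Tendsto (fun y : Space => ∫⁻ x, ‖u (x - y) - u x‖ₑ ^ 2) (𝓝 0) (𝓝 0) := by
  let g : C(Space, C(Space, Space)) :=
    ContinuousMap.curry ⟨fun p : Space × Space => p.2 - p.1, by fun_prop⟩
  have hg : ∀ y, MeasurePreserving (g y) (volume : Measure Space) volume := fun y =>
    measurePreserving_sub_right volume y
  have h1 : Tendsto (fun y : Space => Lp.compMeasurePreserving (g y) (hg y) u) (𝓝 0)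
      (𝓝 (Lp.compMeasurePreserving (g 0) (hg 0) u)) :=
    (tendsto_const_nhds (x := u)).compMeasurePreservingLp (g.continuous.tendsto 0) hg (hg 0)
      (by norm_num)
  have h0 : Lp.compMeasurePreserving (g 0) (hg 0) u = u := by
    refine Lp.ext ((Lp.coeFn_compMeasurePreserving u (hg 0)).trans ?_)
    refine Eventually.of_forall fun x => ?_
    simp [g]
  rw [h0, EMetric.tendsto_nhds] at h1
  have h2 : Tendsto (fun y : Space => edist (Lp.compMeasurePreserving (g y) (hg y) u) u ^ 2)
      (𝓝 0) (𝓝 0) := by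
    have : Tendsto (fun y : Space => edist (Lp.compMeasurePreserving (g y) (hg y) u) u)
        (𝓝 0) (𝓝 0) := by
      rw [ENNReal.tendsto_nhds_zero]
      exact fun ε hε => (h1 ε hε).mono fun y hy => hy.le
    simpa using ENNReal.Tendsto.pow (n := 2) this
  refine h2.congr fun y => ?_
  rw [Lp.edist_def, eLpNorm_two_sq]
  refine lintegral_congr_ae ?_
  filter_upwards [Lp.coeFn_compMeasurePreserving u (hg y)] with x hx
  rw [Pi.sub_apply, hx]
  rfl

/-- Mollification of `u` by a smooth bump function. -/
def mollify (ρ : ContDiffBump (0 : Space)) (u : Space → ℂ) : Space → ℂ :=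
  fun x => ∫ y, ρ.normed volume y • u (x - y)

/-- The mollification differs from `u` by no more than the translates of `u` do: the
Cauchy–Schwarz inequality for the probability measure with the density of the mollifier, and
Tonelli's theorem. -/
theorem memLp_mollify_sub (ρ : ContDiffBump (0 : Space)) (u : L2Space) {δ : ℝ≥0∞}
    (hδ : ∀ y : Space, ‖y‖ < ρ.rOut → ∫⁻ x, ‖u (x - y) - u x‖ₑ ^ 2 ≤ δ) :
    ∫⁻ x, ‖mollify ρ u x - u x‖ₑ ^ 2 ≤ δ := by
  set κ : Space → ℝ := ρ.normed volume with hκ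
  have hκ0 : ∀ y, 0 ≤ κ y := fun y => ρ.nonneg_normed y
  have hκc : Continuous κ := ρ.continuous_normed
  have hκi : Integrable κ := ρ.integrable_normed
  have hκ1 : ∫⁻ y, ENNReal.ofReal (κ y) = 1 := by
    rw [← ofReal_integral_eq_lintegral_ofReal hκi (Eventually.of_forall hκ0), hκ,
      ρ.integral_normed]; simp
  have hum : StronglyMeasurable u := Lp.stronglyMeasurable u
  have hloc : LocallyIntegrable u volume := (Lp.memLp u).locallyIntegrable (by norm_num)
  have hm : Measurable fun p : Space × Space => ‖u (p.1 - p.2) - u p.1‖ₑ ^ 2 := by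
    have h1 : Measurable fun p : Space × Space => u (p.1 - p.2) :=
      hum.measurable.comp (measurable_fst.sub measurable_snd)
    have h2 : Measurable fun p : Space × Space => u p.1 := hum.measurable.comp measurable_fst
    exact (h1.sub h2).enorm.pow_const 2
  set ν : Measure Space := volume.withDensity fun y => ENNReal.ofReal (κ y) with hν
  have hν1 : ν Set.univ = 1 := by rw [hν, withDensity_apply _ MeasurableSet.univ]; simpa using hκ1
  have hκm : Measurable fun y => ENNReal.ofReal (κ y) := hκc.measurable.ennreal_ofReal
  have hpt : ∀ x, ‖mollify ρ u x - u x‖ₑ ^ 2 ≤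
      ∫⁻ y, ENNReal.ofReal (κ y) * ‖u (x - y) - u x‖ₑ ^ 2 := by
    intro x
    have hint : Integrable fun y => κ y • u (x - y) := by
      have := (ρ.hasCompactSupport_normed (μ := volume)).convolutionExists_left
        (ContinuousLinearMap.lsmul ℝ ℝ) hκc hloc x
      simpa [ConvolutionExistsAt] using this
    have h1 : mollify ρ u x - u x = ∫ y, κ y • (u (x - y) - u x) := by
      simp_rw [smul_sub]
      rw [integral_sub hint (hκi.smul_const _), integral_smul_const, hκ, ρ.integral_normed, one_smul]
      rfl
    have hmx : Measurable fun y => ‖u (x - y) - u x‖ₑ := by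
      have : Measurable fun y => u (x - y) := hum.measurable.comp (measurable_const.sub measurable_id)
      exact (this.sub measurable_const).enorm
    calc ‖mollify ρ u x - u x‖ₑ ^ 2 ≤ (∫⁻ y, ‖κ y • (u (x - y) - u x)‖ₑ) ^ 2 := by
          rw [h1]; gcongr; exact enorm_integral_le_lintegral_enorm _
      _ = (∫⁻ y, ‖u (x - y) - u x‖ₑ ∂ν) ^ 2 := by
          rw [hν, lintegral_withDensity_eq_lintegral_mul _ hκm hmx]
          congr 1
          refine lintegral_congr fun y => ?_
          rw [Pi.mul_apply, enorm_smul, Real.enorm_of_nonneg (hκ0 y)]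
      _ ≤ ν Set.univ * ∫⁻ y, ‖u (x - y) - u x‖ₑ ^ 2 ∂ν := sq_lintegral_le _ hmx.aemeasurable
      _ = _ := by
          rw [hν1, one_mul, hν, lintegral_withDensity_eq_lintegral_mul _ hκm (hmx.pow_const 2)]
          rfl
  calc ∫⁻ x, ‖mollify ρ u x - u x‖ₑ ^ 2
      ≤ ∫⁻ x, ∫⁻ y, ENNReal.ofReal (κ y) * ‖u (x - y) - u x‖ₑ ^ 2 := lintegral_mono hpt
    _ = ∫⁻ y, ∫⁻ x, ENNReal.ofReal (κ y) * ‖u (x - y) - u x‖ₑ ^ 2 := by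
        refine lintegral_lintegral_swap ?_
        exact ((hκm.comp measurable_snd).mul hm).aemeasurable
    _ ≤ ∫⁻ y, ENNReal.ofReal (κ y) * δ := by
        refine lintegral_mono fun y => ?_
        rw [lintegral_const_mul' _ _ ENNReal.ofReal_ne_top]
        by_cases hy : ‖y‖ < ρ.rOut
        · gcongr; exact hδ y hy
        · have : κ y = 0 := by
            have : y ∉ Function.support κ := by
              rw [hκ, ρ.support_normed_eq]; simpa using hy
            simpa using this
          simp [this]
    _ = δ := by rw [lintegral_mul_const _ hκm, hκ1, one_mul]

theorem mollify_eq_convolution (ρ : ContDiffBump (0 : Space)) (u : Space → ℂ) :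
    mollify ρ u = convolution (ρ.normed volume) u (ContinuousLinearMap.lsmul ℝ ℝ) volume := by
  ext x; rfl

theorem contDiff_mollify (ρ : ContDiffBump (0 : Space)) (u : L2Space) :
    ContDiff ℝ ∞ (mollify ρ u) := by
  rw [mollify_eq_convolution]
  exact (ρ.hasCompactSupport_normed (μ := volume)).contDiff_convolution_left _
    ρ.contDiff_normed ((Lp.memLp u).locallyIntegrable (by norm_num))

/-- Mollification commutes with weak derivatives. -/
theorem pderiv_mollify (ρ : ContDiffBump (0 : Space)) {i : Fin 3} {u f : L2Space}
    (hf : IsWeakPartial i u f) (x : Space) :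
    pderiv i (mollify ρ u) x = mollify ρ f x := by
  have hloc : LocallyIntegrable u volume := (Lp.memLp u).locallyIntegrable (by norm_num)
  set κ : Space → ℝ := ρ.normed volume with hκ
  have hκs : ContDiff ℝ ∞ κ := ρ.contDiff_normed
  have hκc : HasCompactSupport κ := ρ.hasCompactSupport_normed
  have h1 := hκc.hasFDerivAt_convolution_left (ContinuousLinearMap.lsmul ℝ ℝ)
    (hκs.of_le (by exact_mod_cast le_top)) (μ := volume) hloc x
  rw [pderiv, mollify_eq_convolution, h1.fderiv, convolution_def, ContinuousLinearMap.integral_apply]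
  · simp only [ContinuousLinearMap.precompL_apply, ContinuousLinearMap.lsmul_apply]
    have h2 := hf (fun y => κ (x - y)) (hκs.comp (contDiff_const.sub contDiff_id))
      (hκc.comp_homeomorph (Homeomorph.subLeft x))
    have h3 : ∀ y, fderiv ℝ (fun y => κ (x - y)) y (EuclideanSpace.single i 1) =
        -fderiv ℝ κ (x - y) (EuclideanSpace.single i 1) := by
      intro y
      have : HasFDerivAt (fun y => κ (x - y)) (-(fderiv ℝ κ (x - y))) y := by
        have h4 : HasFDerivAt κ (fderiv ℝ κ (x - y)) (x - y) :=
          (hκs.differentiable (by simp) _).hasFDerivAt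
        exact (h4.comp y ((hasFDerivAt_id y).const_sub x)).congr_fderiv (by ext; simp)
      rw [this.fderiv]; rfl
    simp_rw [h3, neg_smul] at h2
    rw [integral_neg, neg_inj] at h2
    rw [mollify, ← integral_sub_left_eq_self (fun y => κ y • f (x - y)) volume x,
      ← integral_sub_left_eq_self
        (fun t => (fderiv ℝ κ t) (EuclideanSpace.single i 1) • u (x - t)) volume x]
    simpa using h2
  · have := (hκc.fderiv (𝕜 := ℝ)).convolutionExists_left
      ((ContinuousLinearMap.lsmul ℝ ℝ).precompL Space) (hκs.continuous_fderiv (by simp)) hloc x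
      (μ := volume)
    exact this

/-- Cutting off an `L²` function at a large radius. -/
theorem tendsto_cutoff {χ : Space → ℝ} (hχ : Continuous χ) (hχ0 : χ 0 = 1)
    (hχ1 : ∀ x, χ x ∈ Set.Icc (0 : ℝ) 1) {h : Space → ℂ} (hh : MemLp h 2 volume) :
    Tendsto (fun n : ℕ => ∫⁻ x, ‖(χ (((n : ℝ) + 1)⁻¹ • x) - 1) • h x‖ₑ ^ 2) atTop (𝓝 0) := by
  have hfin : ∫⁻ x, ‖h x‖ₑ ^ 2 ≠ ⊤ := by
    rw [← eLpNorm_two_sq]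
    exact ENNReal.pow_ne_top hh.eLpNorm_ne_top
  have hlim : Tendsto (fun n : ℕ => ((n : ℝ) + 1)⁻¹) atTop (𝓝 0) := by
    simpa [one_div] using tendsto_one_div_add_atTop_nhds_zero_nat (𝕜 := ℝ)
  have := tendsto_lintegral_of_dominated_convergence' (μ := (volume : Measure Space))
    (F := fun n : ℕ => fun x => ‖(χ (((n : ℝ) + 1)⁻¹ • x) - 1) • h x‖ₑ ^ 2) (f := fun _ => 0)
    (fun x => ‖h x‖ₑ ^ 2) (fun n => ?_) (fun n => ?_) hfin ?_
  · simpa using this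
  · refine AEMeasurable.pow_const (AEStronglyMeasurable.enorm ?_) 2
    refine AEStronglyMeasurable.smul (f := fun x => χ (((n : ℝ) + 1)⁻¹ • x) - 1) ?_ hh.1
    exact (Continuous.aestronglyMeasurable (by fun_prop))
  · refine Eventually.of_forall fun x => ?_
    simp only
    gcongr
    rw [enorm_smul]
    calc ‖χ (((n : ℝ) + 1)⁻¹ • x) - 1‖ₑ * ‖h x‖ₑ ≤ 1 * ‖h x‖ₑ := by
          gcongr
          rw [← enorm_one (G := ℝ), enorm_le_iff_norm_le, Real.norm_eq_abs, norm_one, abs_le]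
          constructor <;> linarith [(hχ1 (((n : ℝ) + 1)⁻¹ • x)).1, (hχ1 (((n : ℝ) + 1)⁻¹ • x)).2]
      _ = _ := one_mul _
  · refine Eventually.of_forall fun x => ?_
    have h1 : Tendsto (fun n : ℕ => (χ (((n : ℝ) + 1)⁻¹ • x) - 1) • h x) atTop (𝓝 0) := by
      have h2 : Tendsto (fun n : ℕ => ((n : ℝ) + 1)⁻¹ • x) atTop (𝓝 ((0 : ℝ) • x)) :=
        hlim.smul_const x
      rw [zero_smul] at h2
      have h3 := ((hχ.tendsto 0).comp h2).sub_const 1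
      rw [hχ0, sub_self] at h3
      simpa using h3.smul_const (h x)
    have h4 := (ENNReal.Tendsto.pow (n := 2) h1.enorm)
    simpa using h4

theorem IsTestFunction.continuous {φ : Space → ℂ} (hφ : IsTestFunction φ) : Continuous φ :=
  hφ.1.continuous

theorem contDiff_pderiv {φ : Space → ℂ} (hφ : ContDiff ℝ ∞ φ) (i : Fin 3) :
    ContDiff ℝ ∞ (pderiv i φ) :=
  (hφ.fderiv_right (m := ∞) (by simp)).clm_apply contDiff_const

theorem IsTestFunction.pderiv {φ : Space → ℂ} (hφ : IsTestFunction φ) (i : Fin 3) :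
    IsTestFunction (pderiv i φ) :=
  ⟨contDiff_pderiv hφ.1 i, hφ.2.fderiv_apply (𝕜 := ℝ) _⟩

theorem IsTestFunction.memLp {φ : Space → ℂ} (hφ : IsTestFunction φ) (p : ℝ≥0∞) :
    MemLp φ p volume :=
  hφ.continuous.memLp_of_hasCompactSupport hφ.2

theorem pderiv_smul {χ : Space → ℝ} {φ : Space → ℂ} {x : Space} (hχ : DifferentiableAt ℝ χ x)
    (hφ : DifferentiableAt ℝ φ x) (i : Fin 3) :
    pderiv i (fun x => χ x • φ x) x =
      χ x • pderiv i φ x + fderiv ℝ χ x (EuclideanSpace.single i 1) • φ x := by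
  have h : HasFDerivAt (fun x => χ x • φ x) _ x := hχ.hasFDerivAt.smul hφ.hasFDerivAt
  rw [pderiv, h.fderiv]
  simp [pderiv]

/-- Test functions are dense in `H¹(ℝ³)`. -/
theorem exists_testFunction_near {u : L2Space} {f : Fin 3 → L2Space}
    (hf : ∀ i, IsWeakPartial i u (f i)) {ε : ℝ≥0∞} (hε : ε ≠ 0) (hε' : ε ≠ ⊤) :
    ∃ φ, IsTestFunction φ ∧ eLpNorm (fun x => φ x - u x) 2 volume ≤ ε ∧
      ∀ i, eLpNorm (fun x => pderiv i φ x - f i x) 2 volume ≤ ε := by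
  have hε3 : ε / 3 ≠ 0 := by simpa using hε
  have hsq : (0 : ℝ≥0∞) < (ε / 3) ^ 2 := by positivity
  -- mollification
  have hev : ∀ᶠ y : Space in 𝓝 0, (∫⁻ x, ‖u (x - y) - u x‖ₑ ^ 2 ≤ (ε / 3) ^ 2) ∧
      ∀ i, ∫⁻ x, ‖f i (x - y) - f i x‖ₑ ^ 2 ≤ (ε / 3) ^ 2 :=
    ((ENNReal.tendsto_nhds_zero.1 (tendsto_lintegral_translate u)) _ hsq).and
      (eventually_all.2 fun i =>
        (ENNReal.tendsto_nhds_zero.1 (tendsto_lintegral_translate (f i))) _ hsq)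
  obtain ⟨r, hr, hball⟩ := Metric.eventually_nhds_iff.1 hev
  let ρ : ContDiffBump (0 : Space) := ⟨r / 2, r, by positivity, by linarith⟩
  have hpow : ∀ {g h : Space → ℂ}, ∫⁻ x, ‖g x - h x‖ₑ ^ 2 ≤ (ε / 3) ^ 2 →
      eLpNorm (fun x => g x - h x) 2 volume ≤ ε / 3 := by
    intro g h hgh
    rw [← eLpNorm_two_sq (fun x => g x - h x)] at hgh
    exact (ENNReal.pow_le_pow_left_iff two_ne_zero).1 hgh
  set c := mollify ρ u with hc
  have hcs : ContDiff ℝ ∞ c := contDiff_mollify ρ u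
  have hcu : eLpNorm (fun x => c x - u x) 2 volume ≤ ε / 3 :=
    hpow (memLp_mollify_sub ρ u fun y hy => (hball (by simpa using hy)).1)
  have hcf : ∀ i, eLpNorm (fun x => pderiv i c x - f i x) 2 volume ≤ ε / 3 := fun i => by
    simp_rw [hc, pderiv_mollify ρ (hf i)]
    exact hpow (memLp_mollify_sub ρ (f i) fun y hy => (hball (by simpa using hy)).2 i)
  have hε3' : ε / 3 ≠ ⊤ := ENNReal.div_ne_top hε' (by norm_num)
  have hmem : ∀ {g : Space → ℂ} {h : L2Space}, Continuous g →
      eLpNorm (fun x => g x - h x) 2 volume ≤ ε / 3 → MemLp g 2 volume := by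
    intro g h hg hgh
    have h1 : MemLp (fun x => g x - h x) 2 volume :=
      ⟨hg.aestronglyMeasurable.sub (Lp.aestronglyMeasurable h), hgh.trans_lt hε3'.lt_top⟩
    have h2 := h1.add (Lp.memLp h)
    refine h2.ae_eq (Eventually.of_forall fun x => ?_)
    simp
  have hc2 : MemLp c 2 volume := hmem hcs.continuous hcu
  have hpc2 : ∀ i, MemLp (pderiv i c) 2 volume := fun i =>
    hmem (contDiff_pderiv hcs i).continuous (hcf i)
  -- truncation
  let χ : ContDiffBump (0 : Space) := ⟨1, 2, one_pos, one_lt_two⟩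
  have hχc : ContDiff ℝ ∞ χ := χ.contDiff
  have hχ1 : ∀ x, χ x ∈ Set.Icc (0 : ℝ) 1 := fun x => ⟨χ.nonneg, χ.le_one⟩
  have hχ0 : χ 0 = 1 := χ.one_of_mem_closedBall (by simp [χ])
  obtain ⟨M, hM⟩ := (χ.hasCompactSupport.fderiv (𝕜 := ℝ)).exists_bound_of_continuous
    (hχc.continuous_fderiv (by simp))
  have hM0 : 0 ≤ M := (norm_nonneg _).trans (hM 0)
  have hsmall : ∀ {h : Space → ℂ}, MemLp h 2 volume → ∀ᶠ n : ℕ in atTop,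
      eLpNorm (fun x => (χ (((n : ℝ) + 1)⁻¹ • x) - 1) • h x) 2 volume ≤ ε / 3 := by
    intro h hh
    filter_upwards [(ENNReal.tendsto_nhds_zero.1 (tendsto_cutoff hχc.continuous hχ0 hχ1 hh)) _ hsq]
      with n hn
    rw [← eLpNorm_two_sq (fun x => (χ (((n : ℝ) + 1)⁻¹ • x) - 1) • h x)] at hn
    exact (ENNReal.pow_le_pow_left_iff two_ne_zero).1 hn
  have hgrad : Tendsto (fun n : ℕ => ENNReal.ofReal (((n : ℝ) + 1)⁻¹ * M) *
      eLpNorm c 2 volume) atTop (𝓝 0) := by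
    have h1 : Tendsto (fun n : ℕ => ((n : ℝ) + 1)⁻¹ * M) atTop (𝓝 0) := by
      simpa [one_div] using (tendsto_one_div_add_atTop_nhds_zero_nat (𝕜 := ℝ)).mul_const M
    have h2 := ENNReal.Tendsto.mul_const (b := eLpNorm c 2 volume)
      (ENNReal.tendsto_ofReal h1) (Or.inr hc2.eLpNorm_ne_top)
    simpa using h2
  obtain ⟨n, hn1, hn2, hn3⟩ := ((hsmall hc2).and ((eventually_all.2 fun i =>
    hsmall (hpc2 i)).and (ENNReal.tendsto_nhds_zero.1 hgrad (ε / 3) (by positivity)))).exists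
  set a : ℝ := ((n : ℝ) + 1)⁻¹ with ha
  have ha0 : 0 < a := by positivity
  have hχa : ContDiff ℝ ∞ fun x : Space => χ (a • x) := hχc.comp (contDiff_const_smul a)
  have hthird : ε / 3 + ε / 3 ≤ ε := by
    calc ε / 3 + ε / 3 ≤ ε / 3 + ε / 3 + ε / 3 := le_self_add
      _ = ε := ENNReal.add_thirds ε
  refine ⟨fun x => χ (a • x) • c x, ⟨hχa.smul hcs, ?_⟩, ?_, fun i => ?_⟩
  · exact (χ.hasCompactSupport.comp_smul ha0.ne').smul_right
  · have : (fun x => χ (a • x) • c x - u x) =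
        (fun x => (χ (a • x) - 1) • c x) + fun x => c x - u x := by
      ext1 x; simp only [Pi.add_apply, sub_smul, one_smul]; ring
    rw [this]
    refine (eLpNorm_add_le ?_ ?_ one_le_two).trans ((add_le_add hn1 hcu).trans hthird)
    · exact ((hχa.continuous.sub continuous_const).smul hcs.continuous).aestronglyMeasurable
    · exact hcs.continuous.aestronglyMeasurable.sub (Lp.aestronglyMeasurable u)
  · have hder : ∀ x, fderiv ℝ (fun x : Space => χ (a • x)) x (EuclideanSpace.single i 1) =
        a * fderiv ℝ χ (a • x) (EuclideanSpace.single i 1) := by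
      intro x
      have h1 : HasFDerivAt χ (fderiv ℝ χ (a • x)) (a • x) :=
        (hχc.differentiable (by simp) _).hasFDerivAt
      have h2 : HasFDerivAt (fun x : Space => χ (a • x)) _ x :=
        h1.comp x ((hasFDerivAt_id x).const_smul a)
      rw [h2.fderiv]
      simp
    have : (fun x => pderiv i (fun x => χ (a • x) • c x) x - f i x) =
        (fun x => (χ (a • x) - 1) • pderiv i c x) +
        ((fun x => (a * fderiv ℝ χ (a • x) (EuclideanSpace.single i 1)) • c x) +
        fun x => pderiv i c x - f i x) := by
      ext1 x
      rw [pderiv_smul (hχa.differentiable (by simp) x) (hcs.differentiable (by simp) x), hder]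
      simp only [Pi.add_apply, sub_smul, one_smul]; ring
    have hcontd : Continuous fun x : Space =>
        a * fderiv ℝ χ (a • x) (EuclideanSpace.single i 1) :=
      continuous_const.mul (((hχc.continuous_fderiv (by simp)).comp
        (continuous_const_smul a)).clm_apply continuous_const)
    have hm2 : AEStronglyMeasurable (fun x => (a * fderiv ℝ χ (a • x)
        (EuclideanSpace.single i 1)) • c x) volume :=
      (hcontd.smul hcs.continuous).aestronglyMeasurable
    have hm3 : AEStronglyMeasurable (fun x => pderiv i c x - f i x) volume :=
      (contDiff_pderiv hcs i).continuous.aestronglyMeasurable.sub (Lp.aestronglyMeasurable (f i))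
    rw [this]
    refine (eLpNorm_add_le ?_ (hm2.add hm3) one_le_two).trans ?_
    · exact ((hχa.continuous.sub continuous_const).smul
        (contDiff_pderiv hcs i).continuous).aestronglyMeasurable
    refine (add_le_add (hn2 i) ((eLpNorm_add_le hm2 hm3 one_le_two).trans
      (add_le_add (b := ε / 3) ?_ (hcf i)))).trans ?_
    · refine le_trans ?_ hn3
      refine eLpNorm_le_mul_eLpNorm_of_ae_le_mul (Eventually.of_forall fun x => ?_) 2
      rw [norm_smul, norm_mul, Real.norm_of_nonneg ha0.le]
      gcongr
      calc ‖fderiv ℝ χ (a • x) (EuclideanSpace.single i 1)‖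
          ≤ ‖fderiv ℝ χ (a • x)‖ * ‖EuclideanSpace.single i (1 : ℝ)‖ :=
            ContinuousLinearMap.le_opNorm _ _
        _ ≤ M := by simpa using hM (a • x)
    · rw [← add_assoc, ENNReal.add_thirds]

/-- The weak partial derivative is unique. -/
theorem IsWeakPartial.unique {i : Fin 3} {u f g : L2Space} (hf : IsWeakPartial i u f)
    (hg : IsWeakPartial i u g) : f = g := by
  have hlf : LocallyIntegrable f volume := (Lp.memLp f).locallyIntegrable (by norm_num)
  have hlg : LocallyIntegrable g volume := (Lp.memLp g).locallyIntegrable (by norm_num)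
  refine Lp.ext (ae_eq_of_integral_contDiff_smul_eq hlf hlg fun φ hφ hφc => ?_)
  have := (hf φ hφ hφc).symm.trans (hg φ hφ hφc)
  exact neg_inj.1 this

theorem IsWeakPartial.weakPartial_eq {i : Fin 3} {u f : L2Space} (hf : IsWeakPartial i u f) :
    weakPartial i u = f := by
  have h : ∃ f, IsWeakPartial i u f := ⟨f, hf⟩
  rw [weakPartial, dif_pos h]
  exact h.choose_spec.unique hf

/-- The element of `L²(ℝ³)` given by a test function. -/
def IsTestFunction.toL2 {φ : Space → ℂ} (hφ : IsTestFunction φ) : L2Space := (hφ.memLp 2).toLp φ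

theorem IsTestFunction.coeFn_toL2 {φ : Space → ℂ} (hφ : IsTestFunction φ) :
    hφ.toL2 =ᵐ[volume] φ := MemLp.coeFn_toLp _

/-- Integration by parts against a test function. -/
theorem integral_fderiv_smul_eq {χ : Space → ℝ} {φ : Space → ℂ} (hχ : ContDiff ℝ ∞ χ)
    (hχc : HasCompactSupport χ) (hφ : ContDiff ℝ ∞ φ) (v : Space) :
    ∫ x, fderiv ℝ χ x v • φ x = -∫ x, χ x • fderiv ℝ φ x v := by
  have h1 : Continuous fun x => fderiv ℝ χ x v :=
    (hχ.continuous_fderiv (by simp)).clm_apply continuous_const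
  have h2 : Continuous fun x => fderiv ℝ φ x v :=
    (hφ.continuous_fderiv (by simp)).clm_apply continuous_const
  have := integral_smul_fderiv_eq_neg_fderiv_smul_of_integrable (μ := (volume : Measure Space))
    (𝕜 := ℝ) (f := χ) (g := φ) (v := v) ?_ ?_ ?_ 
    (fun x _ => hχ.differentiable (by simp) x) (fun x _ => hφ.differentiable (by simp) x)
  · rw [this, neg_neg]
  · exact (h1.smul hφ.continuous).integrable_of_hasCompactSupport
      (hχc.fderiv_apply (𝕜 := ℝ) v).smul_right
  · exact (hχ.continuous.smul h2).integrable_of_hasCompactSupport hχc.smul_right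
  · exact (hχ.continuous.smul hφ.continuous).integrable_of_hasCompactSupport hχc.smul_right

theorem IsTestFunction.isWeakPartial {φ : Space → ℂ} (hφ : IsTestFunction φ) (i : Fin 3) :
    IsWeakPartial i hφ.toL2 (hφ.pderiv i).toL2 := by
  intro χ hχ hχc
  have h1 : ∫ x, fderiv ℝ χ x (EuclideanSpace.single i 1) • hφ.toL2 x =
      ∫ x, fderiv ℝ χ x (EuclideanSpace.single i 1) • φ x := by
    refine integral_congr_ae ?_
    filter_upwards [hφ.coeFn_toL2] with x hx
    rw [hx]
  have h2 : ∫ x, χ x • (hφ.pderiv i).toL2 x = ∫ x, χ x • _root_.pderiv i φ x := by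
    refine integral_congr_ae ?_
    filter_upwards [(hφ.pderiv i).coeFn_toL2] with x hx
    rw [hx]
  rw [h1, h2]
  exact integral_fderiv_smul_eq hχ hχc hφ.1 _

end SobolevDensity

/-! ### The surface measure -/

noncomputable section SurfaceMeasure

theorem volume_eq_zero_of_dimH_lt {d : ℕ} {s : Set (EuclideanSpace ℝ (Fin d))}
    (hs : dimH s < d) : volume s = 0 := by
  have hac : (volume : Measure (EuclideanSpace ℝ (Fin d))) ≪ Measure.hausdorffMeasure d :=
    Measure.absolutelyContinuous_isAddHaarMeasure _ _
  exact measure_zero_of_dimH_lt (d := d) (by simpa using hac) (by simpa using hs)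

theorem IsSingularSet.dimH_le {S T : Set Space} (hT : IsSingularSet S T) : dimH T ≤ 1 := by
  obtain ⟨m, γ, P, hγ, -, -, rfl⟩ := hT
  rw [dimH_union, dimH_iUnion, P.dimH_zero]
  refine max_le (iSup_le fun j => ?_) zero_le_one
  refine (dimH_mono (Set.image_subset_range _ _)).trans ?_
  simpa using (hγ j).dimH_range_le

theorem IsSingularSet.isCompact {S T : Set Space} (hT : IsSingularSet S T) : IsCompact T := by
  obtain ⟨m, γ, P, hγ, -, -, rfl⟩ := hT
  exact (isCompact_iUnion fun j => isCompact_Icc.image (hγ j).continuous).union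
    P.finite_toSet.isCompact

/-- The parametrization expands distances at least by the factor `c`. -/
def IsChordBound (Φ : Plane → Space) (c : ℝ) : Prop :=
  0 < c ∧ ∀ s t, c * ‖s - t‖ ≤ ‖Φ s - Φ t‖

variable {Φ : Plane → Space} {c : ℝ} {T : Set Space}

theorem IsChordBound.antilipschitz (h : IsChordBound Φ c) :
    AntilipschitzWith (Real.toNNReal c⁻¹) Φ := by
  refine AntilipschitzWith.of_le_mul_dist fun s t => ?_
  rw [Real.coe_toNNReal _ (inv_nonneg.2 h.1.le), inv_mul_eq_div, le_div_iff₀ h.1, mul_comm,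
    dist_eq_norm, dist_eq_norm]
  exact h.2 s t

theorem IsChordBound.injective (h : IsChordBound Φ c) : Function.Injective Φ :=
  h.antilipschitz.injective

theorem volume_preimage_singularSet (h : IsChordBound Φ c)
    (hT : IsSingularSet (Set.range Φ) T) : volume (Φ ⁻¹' T) = 0 := by
  refine volume_eq_zero_of_dimH_lt ?_
  calc dimH (Φ ⁻¹' T) ≤ dimH T := h.antilipschitz.dimH_preimage_le T
    _ ≤ 1 := hT.dimH_le
    _ < _ := by norm_num

theorem volume_range_eq_zero (hT : IsSingularSet (Set.range Φ) T)
    (hreg : IsUniformlyEllipticC2Off Φ T) : volume (Set.range Φ) = 0 := by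
  refine volume_eq_zero_of_dimH_lt ?_
  have hsub : Set.range Φ ⊆ Φ '' (Φ ⁻¹' Tᶜ) ∪ T := by
    rintro _ ⟨s, rfl⟩
    by_cases hs : Φ s ∈ T
    · exact Or.inr hs
    · exact Or.inl ⟨s, hs, rfl⟩
  refine (dimH_mono hsub).trans_lt ?_
  rw [dimH_union]
  refine max_lt ?_ (hT.dimH_le.trans_lt (by norm_num))
  have h1 : dimH (Φ '' (Φ ⁻¹' Tᶜ)) ≤ dimH (Φ ⁻¹' Tᶜ) := by
    refine dimH_image_le_of_locally_lipschitzOn fun s hs => ?_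
    obtain ⟨K, t, ht, hK⟩ := ((hreg.1 s hs).of_le one_le_two).exists_lipschitzOnWith
    exact ⟨K, t, mem_nhdsWithin_of_mem_nhds ht, hK⟩
  refine (h1.trans (dimH_mono (Set.subset_univ _))).trans_lt ?_
  rw [Real.dimH_univ_eq_finrank]
  norm_num

theorem sum_metricTensor_eq (Φ : Plane → Space) (s v : Plane) :
    ∑ i, ∑ j, metricTensor Φ s i j * v i * v j = ‖fderiv ℝ Φ s v‖ ^ 2 := by
  have hv : v = ∑ i, v i • EuclideanSpace.single i (1 : ℝ) := by
    ext k; fin_cases k <;> simp [Fin.sum_univ_two]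
  have h1 : fderiv ℝ Φ s v = ∑ i, v i • tangentVec Φ s i := by
    conv_lhs => rw [hv]
    simp [tangentVec]
  rw [h1, ← real_inner_self_eq_norm_sq, sum_inner]
  refine Finset.sum_congr rfl fun i _ => ?_
  rw [inner_sum]
  refine Finset.sum_congr rfl fun j _ => ?_
  rw [real_inner_smul_left, real_inner_smul_right, metricTensor, Matrix.of_apply]
  ring

theorem det_metricTensor_eq (Φ : Plane → Space) (s : Plane) :
    (metricTensor Φ s).det = ‖tangentVec Φ s 0‖ ^ 2 * ‖tangentVec Φ s 1‖ ^ 2 -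
      ⟪tangentVec Φ s 0, tangentVec Φ s 1⟫_ℝ ^ 2 := by
  rw [Matrix.det_fin_two]
  simp only [metricTensor, Matrix.of_apply, real_inner_self_eq_norm_sq,
    real_inner_comm (tangentVec Φ s 0) (tangentVec Φ s 1)]
  ring

theorem measurable_metricTensor_det (Φ : Plane → Space) :
    Measurable fun s => (metricTensor Φ s).det := by
  have h : ∀ i, Measurable fun s => tangentVec Φ s i := fun i =>
    measurable_fderiv_apply_const ℝ Φ _
  simp_rw [det_metricTensor_eq]
  exact (((h 0).norm.pow_const 2).mul ((h 1).norm.pow_const 2)).sub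
    (((h 0).inner (h 1)).pow_const 2)

theorem measurable_surfaceDensity (Φ : Plane → Space) :
    Measurable fun s => ENNReal.ofReal √(metricTensor Φ s).det :=
  (measurable_metricTensor_det Φ).sqrt.ennreal_ofReal

theorem sqrt_det_metricTensor_le {c₂ : ℝ} {s : Plane}
    (h : ∀ v : Plane, ∑ i, ∑ j, metricTensor Φ s i j * v i * v j ≤ c₂ * ‖v‖ ^ 2) :
    √(metricTensor Φ s).det ≤ c₂ := by
  have hi : ∀ i, ‖tangentVec Φ s i‖ ^ 2 ≤ c₂ := fun i => by
    have := h (EuclideanSpace.single i 1)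
    rw [sum_metricTensor_eq] at this
    simpa [tangentVec] using this
  have h0 : 0 ≤ c₂ := (sq_nonneg _).trans (hi 0)
  rw [Real.sqrt_le_left h0, det_metricTensor_eq]
  have := mul_le_mul (hi 0) (hi 1) (sq_nonneg _) h0
  nlinarith [sq_nonneg ⟪tangentVec Φ s 0, tangentVec Φ s 1⟫_ℝ]

/-- The surface measure is dominated by a multiple of the Lebesgue measure on the parameter
plane. -/
theorem exists_surfaceMeasure_le (h : IsChordBound Φ c) (hT : IsSingularSet (Set.range Φ) T)
    (hreg : IsUniformlyEllipticC2Off Φ T) :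
    ∃ K : ℝ, 0 ≤ K ∧ surfaceMeasure Φ ≤ ENNReal.ofReal K • volume := by
  obtain ⟨-, c₁, c₂, -, hc⟩ := hreg
  refine ⟨max c₂ 0, le_max_right _ _, ?_⟩
  rw [surfaceMeasure, ← withDensity_const]
  refine withDensity_mono ?_
  have : ∀ᵐ s : Plane, Φ s ∉ T := measure_eq_zero_iff_ae_notMem.1 (volume_preimage_singularSet h hT)
  filter_upwards [this] with s hs
  exact ENNReal.ofReal_le_ofReal
    ((sqrt_det_metricTensor_le fun v => (hc s hs v).2).trans (le_max_left _ _))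

/-! ### The trace inequality -/

theorem ENNReal_add_sq_le (a b : ℝ≥0∞) : (a + b) ^ 2 ≤ 2 * a ^ 2 + 2 * b ^ 2 := by
  induction a with
  | top => simp
  | coe a =>
    induction b with
    | top => simp
    | coe b =>
      have h : (a + b) ^ 2 ≤ 2 * a ^ 2 + 2 * b ^ 2 := by
        rw [← NNReal.coe_le_coe]
        push_cast
        nlinarith [sq_nonneg ((a : ℝ) - b)]
      exact_mod_cast h

/-- The parameters of the points of the surface in a ball of radius `t` form a set of area at most
of order `t²`. -/
theorem volume_preimage_ball_le (h : IsChordBound Φ c) (z : Space) {t : ℝ} (ht : 0 < t) :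
    volume {s : Plane | ‖z - Φ s‖ < t} ≤
      ENNReal.ofReal ((2 * t / c) ^ 2) * volume (Metric.ball (0 : Plane) 1) := by
  rcases Set.eq_empty_or_nonempty {s : Plane | ‖z - Φ s‖ < t} with h0 | ⟨s, hs⟩
  · rw [h0]; simp
  · have hsub : {s : Plane | ‖z - Φ s‖ < t} ⊆ Metric.closedBall s (2 * t / c) := by
      intro r hr
      rw [Metric.mem_closedBall, dist_eq_norm, le_div_iff₀ h.1, mul_comm]
      refine (h.2 r s).trans ?_
      have : Φ r - Φ s = (z - Φ s) - (z - Φ r) := by abel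
      rw [this]
      refine (norm_sub_le _ _).trans ?_
      simp only [Set.mem_ofPred_eq] at hs hr
      linarith
    refine (measure_mono hsub).trans ?_
    rw [Measure.addHaar_closedBall _ _ (div_nonneg (by positivity) h.1.le)]
    simp

theorem lintegral_comp_add_smul (G : Space → ℝ≥0∞) (hG : Measurable G) (x : Space) {t : ℝ}
    (ht : 0 < t) :
    ∫⁻ y, G (x + t • y) = ENNReal.ofReal ((t ^ 3)⁻¹) * ∫⁻ z, G z := by
  have h1 : ∫⁻ y, G (x + t • y) = ∫⁻ y, G (x + y) ∂(Measure.map (fun y : Space => t • y) volume) := by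
    rw [lintegral_map (f := fun y => G (x + y)) (hG.comp (measurable_const_add x))
      (measurable_const_smul t)]
  rw [h1, Measure.map_addHaar_smul _ ht.ne', lintegral_smul_measure, lintegral_add_left_eq_self]
  simp [abs_of_pos ht]

/-- Averaging over balls of radius `t` centred on the surface. -/
theorem lintegral_average_le (h : IsChordBound Φ c) (hΦ : Continuous Φ) {G : Space → ℝ≥0∞}
    (hG : Measurable G) {t : ℝ} (ht : 0 < t) :
    ∫⁻ s : Plane, ∫⁻ y in Metric.ball (0 : Space) 1, G (Φ s + t • y) ≤
      ENNReal.ofReal (4 / c ^ 2 / t) * volume (Metric.ball (0 : Plane) 1) * ∫⁻ z, G z := by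
  have h1 : ∀ s, ∫⁻ y in Metric.ball (0 : Space) 1, G (Φ s + t • y) =
      ENNReal.ofReal ((t ^ 3)⁻¹) * ∫⁻ z, {p : Plane × Space | ‖p.2 - Φ p.1‖ < t}.indicator
        (fun p => G p.2) (s, z) := by
    intro s
    rw [← lintegral_indicator Metric.isOpen_ball.measurableSet, ← lintegral_comp_add_smul
      (fun z => {p : Plane × Space | ‖p.2 - Φ p.1‖ < t}.indicator (fun p => G p.2) (s, z)) ?_
      (Φ s) ht]
    · refine lintegral_congr fun y => ?_
      have hiff : ‖(Φ s + t • y) - Φ s‖ < t ↔ ‖y‖ < 1 := by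
        rw [add_sub_cancel_left, norm_smul, Real.norm_of_nonneg ht.le]
        exact ⟨fun h => by nlinarith, fun h => by nlinarith⟩
      by_cases hy : ‖y‖ < 1
      · rw [Set.indicator_of_mem (by simpa using hy), Set.indicator_of_mem]
        exact hiff.2 hy
      · rw [Set.indicator_of_notMem (by simpa using hy), Set.indicator_of_notMem]
        exact fun h0 => hy (hiff.1 h0)
    · have : (fun z => {p : Plane × Space | ‖p.2 - Φ p.1‖ < t}.indicator
          (fun p => G p.2) (s, z)) = {z | ‖z - Φ s‖ < t}.indicator G := by
        ext z; simp [Set.indicator]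
      rw [this]
      exact hG.indicator (isOpen_lt (by fun_prop) continuous_const).measurableSet
  have hS : MeasurableSet {p : Plane × Space | ‖p.2 - Φ p.1‖ < t} :=
    (isOpen_lt (by fun_prop) continuous_const).measurableSet
  simp_rw [h1]
  -- by the chord bound the parameters of points at distance less than `t` from `z` have an area of
  -- order `t²`, against the volume `t³` of the ball
  rw [lintegral_const_mul' _ _ ENNReal.ofReal_ne_top, lintegral_lintegral_swap]
  · have h2 : ∀ z, ∫⁻ s : Plane, {p : Plane × Space | ‖p.2 - Φ p.1‖ < t}.indicator
        (fun p => G p.2) (s, z) ≤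
        ENNReal.ofReal ((2 * t / c) ^ 2) * volume (Metric.ball (0 : Plane) 1) * G z := by
      intro z
      have : (fun s : Plane => {p : Plane × Space | ‖p.2 - Φ p.1‖ < t}.indicator
          (fun p => G p.2) (s, z)) = {s : Plane | ‖z - Φ s‖ < t}.indicator fun _ => G z := by
        ext s; simp [Set.indicator]
      rw [this, lintegral_indicator_const (isOpen_lt (by fun_prop) continuous_const).measurableSet,
        mul_comm]
      gcongr
      exact volume_preimage_ball_le h z ht
    calc ENNReal.ofReal ((t ^ 3)⁻¹) * ∫⁻ z, ∫⁻ s : Plane,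
          {p : Plane × Space | ‖p.2 - Φ p.1‖ < t}.indicator (fun p => G p.2) (s, z)
        ≤ ENNReal.ofReal ((t ^ 3)⁻¹) * ∫⁻ z, ENNReal.ofReal ((2 * t / c) ^ 2) *
            volume (Metric.ball (0 : Plane) 1) * G z := by
          gcongr with z; exact h2 z
      _ = ENNReal.ofReal ((t ^ 3)⁻¹) * ENNReal.ofReal ((2 * t / c) ^ 2) *
            volume (Metric.ball (0 : Plane) 1) * ∫⁻ z, G z := by
          rw [lintegral_const_mul _ hG]; ring
      _ = _ := by
          rw [← ENNReal.ofReal_mul (by positivity)]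
          congr 3
          have := h.1
          field_simp
          norm_num
  · exact ((hG.comp measurable_snd).indicator hS).aemeasurable

end SurfaceMeasure

noncomputable section TraceInequality

variable {Φ : Plane → Space} {c : ℝ} {T : Set Space}

theorem norm_fderiv_sq_le (φ : Space → ℂ) (x : Space) :
    ‖fderiv ℝ φ x‖ ^ 2 ≤ ∑ i, ‖pderiv i φ x‖ ^ 2 := by
  have h : ‖fderiv ℝ φ x‖ ≤ √(∑ i, ‖pderiv i φ x‖ ^ 2) := by
    refine ContinuousLinearMap.opNorm_le_bound _ (Real.sqrt_nonneg _) fun v => ?_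
    have hv : v = ∑ i, v i • EuclideanSpace.single i (1 : ℝ) := by
      ext k; fin_cases k <;> simp [Fin.sum_univ_three]
    calc ‖fderiv ℝ φ x v‖ = ‖∑ i, v i • pderiv i φ x‖ := by
          conv_lhs => rw [hv]
          simp [pderiv]
      _ ≤ ∑ i, ‖pderiv i φ x‖ * ‖v i‖ := by
          refine (norm_sum_le _ _).trans (Finset.sum_le_sum fun i _ => ?_)
          rw [norm_smul, mul_comm]
      _ ≤ √(∑ i, ‖pderiv i φ x‖ ^ 2) * √(∑ i, ‖v i‖ ^ 2) := Real.sum_mul_le_sqrt_mul_sqrt _ _ _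
      _ = _ := by rw [EuclideanSpace.norm_eq]
  calc ‖fderiv ℝ φ x‖ ^ 2 ≤ √(∑ i, ‖pderiv i φ x‖ ^ 2) ^ 2 := by gcongr
    _ = _ := Real.sq_sqrt (Finset.sum_nonneg fun i _ => sq_nonneg _)

theorem enorm_fderiv_sq_le (φ : Space → ℂ) (x : Space) :
    ‖fderiv ℝ φ x‖ₑ ^ 2 ≤ ∑ i, ‖pderiv i φ x‖ₑ ^ 2 := by
  have h := ENNReal.ofReal_le_ofReal (norm_fderiv_sq_le φ x)
  rw [ENNReal.ofReal_sum_of_nonneg (fun i _ => sq_nonneg _)] at h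
  simpa [ENNReal.ofReal_pow, ofReal_norm] using h

/-- The values of a function at two points, compared along the quadratically parametrized segment
that joins them: the speed vanishes at the starting point, which compensates the singularity of the
averages in `lintegral_average_le`. -/
theorem enorm_sq_le_of_segment {φ : Space → ℂ} (hφ : ContDiff ℝ 1 φ) (x : Space) {y : Space}
    (hy : ‖y‖ < 1) {r : ℝ} (hr : 0 < r) :
    ‖φ x‖ₑ ^ 2 ≤ 2 * ‖φ (x + r • y)‖ₑ ^ 2 + 2 * ∫⁻ τ in Set.Ioc (0 : ℝ) 1,
      ENNReal.ofReal ((2 * r * τ) ^ 2) * ‖fderiv ℝ φ (x + (r * τ ^ 2) • y)‖ₑ ^ 2 := by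
  have hder : ∀ τ : ℝ, HasDerivAt (fun τ : ℝ => φ (x + (r * τ ^ 2) • y))
      (fderiv ℝ φ (x + (r * τ ^ 2) • y) ((r * (2 * τ)) • y)) τ := by
    intro τ
    have h1 : HasFDerivAt φ (fderiv ℝ φ (x + (r * τ ^ 2) • y)) (x + (r * τ ^ 2) • y) :=
      (hφ.differentiable one_ne_zero _).hasFDerivAt
    have h2 : HasDerivAt (fun τ : ℝ => x + (r * τ ^ 2) • y) ((r * (2 * τ)) • y) τ := by
      have := (((hasDerivAt_pow 2 τ).const_mul r).smul_const y).const_add x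
      simpa using this
    exact h1.comp_hasDerivAt τ h2
  have hcont : Continuous fun τ : ℝ => fderiv ℝ φ (x + (r * τ ^ 2) • y) :=
    (hφ.continuous_fderiv one_ne_zero).comp (by fun_prop)
  have hcont' : Continuous fun τ : ℝ => fderiv ℝ φ (x + (r * τ ^ 2) • y) ((r * (2 * τ)) • y) :=
    hcont.clm_apply (by fun_prop)
  have hftc := intervalIntegral.integral_eq_sub_of_hasDerivAt (a := 0) (b := 1)
    (fun τ _ => hder τ) (hcont'.intervalIntegrable _ _)
  have h1 : ‖φ x‖ₑ ≤ ‖φ (x + r • y)‖ₑ + ∫⁻ τ in Set.Ioc (0 : ℝ) 1,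
      ENNReal.ofReal (2 * r * τ) * ‖fderiv ℝ φ (x + (r * τ ^ 2) • y)‖ₑ := by
    have h2 : φ x = φ (x + r • y) -
        ∫ τ in (0 : ℝ)..1, fderiv ℝ φ (x + (r * τ ^ 2) • y) ((r * (2 * τ)) • y) := by
      rw [hftc]; simp
    rw [h2]
    refine (enorm_sub_le).trans ?_
    gcongr
    rw [intervalIntegral.integral_of_le zero_le_one]
    refine (enorm_integral_le_lintegral_enorm _).trans ?_
    refine setLIntegral_mono' measurableSet_Ioc fun τ hτ => ?_
    refine (ContinuousLinearMap.le_opENorm _ _).trans ?_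
    rw [mul_comm]
    gcongr
    rw [← ofReal_norm]
    refine ENNReal.ofReal_le_ofReal ?_
    rw [norm_smul, Real.norm_of_nonneg (by have := hτ.1; positivity)]
    nlinarith [hτ.1, mul_pos hr hτ.1]
  have hmeas : Measurable fun τ : ℝ =>
      ENNReal.ofReal (2 * r * τ) * ‖fderiv ℝ φ (x + (r * τ ^ 2) • y)‖ₑ :=
    (by fun_prop : Measurable fun τ : ℝ => ENNReal.ofReal (2 * r * τ)).mul
      hcont.measurable.enorm
  calc ‖φ x‖ₑ ^ 2 ≤ (‖φ (x + r • y)‖ₑ + ∫⁻ τ in Set.Ioc (0 : ℝ) 1,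
      ENNReal.ofReal (2 * r * τ) * ‖fderiv ℝ φ (x + (r * τ ^ 2) • y)‖ₑ) ^ 2 := by gcongr
    _ ≤ _ := ENNReal_add_sq_le _ _
    _ ≤ _ := by
      gcongr
      refine (sq_lintegral_le _ hmeas.aemeasurable).trans ?_
      rw [Measure.restrict_apply_univ, Real.volume_Ioc]
      norm_num
      refine lintegral_mono_ae (ae_restrict_of_forall_mem measurableSet_Ioc fun τ hτ => ?_)
      rw [mul_pow, ENNReal.ofReal_pow (by have := hτ.1; positivity)]

/-- The trace inequality with respect to the Lebesgue measure of the parameter plane. The segments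
of `enorm_sq_le_of_segment` are averaged over the directions `y` in the unit ball; on balls of radius
`t = r τ²` the constant of `lintegral_average_le` is of order `1 / (r τ²)`, and the square of the
speed `2 r τ` makes up for it. -/
theorem lintegral_comp_le (h : IsChordBound Φ c) (hΦ : Continuous Φ) {φ : Space → ℂ}
    (hφ : ContDiff ℝ 1 φ) {r : ℝ} (hr : 0 < r) :
    volume (Metric.ball (0 : Space) 1) * ∫⁻ s : Plane, ‖φ (Φ s)‖ₑ ^ 2 ≤
      volume (Metric.ball (0 : Plane) 1) *
        (ENNReal.ofReal (32 / c ^ 2 * r) * (∫⁻ x, ‖fderiv ℝ φ x‖ₑ ^ 2) +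
          ENNReal.ofReal (8 / c ^ 2 / r) * ∫⁻ x, ‖φ x‖ₑ ^ 2) := by
  set b := volume (Metric.ball (0 : Plane) 1)
  have hφc := hφ.continuous
  have hDc := hφ.continuous_fderiv one_ne_zero
  have hm1 : Measurable fun x => ‖φ x‖ₑ ^ 2 := hφc.measurable.enorm.pow_const 2
  have hm2 : Measurable fun x => ‖fderiv ℝ φ x‖ₑ ^ 2 := hDc.measurable.enorm.pow_const 2
  set ν := (volume : Measure Space).restrict (Metric.ball 0 1) with hν
  have hstep : ∀ s : Plane, volume (Metric.ball (0 : Space) 1) * ‖φ (Φ s)‖ₑ ^ 2 ≤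
      2 * (∫⁻ y, ‖φ (Φ s + r • y)‖ₑ ^ 2 ∂ν) + 2 * ∫⁻ τ in Set.Ioc (0 : ℝ) 1,
        ENNReal.ofReal ((2 * r * τ) ^ 2) *
          ∫⁻ y, ‖fderiv ℝ φ (Φ s + (r * τ ^ 2) • y)‖ₑ ^ 2 ∂ν := by
    intro s
    have h1 : volume (Metric.ball (0 : Space) 1) * ‖φ (Φ s)‖ₑ ^ 2 = ∫⁻ _y, ‖φ (Φ s)‖ₑ ^ 2 ∂ν := by
      rw [lintegral_const, hν, Measure.restrict_apply_univ, mul_comm]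
    rw [h1]
    calc ∫⁻ _y, ‖φ (Φ s)‖ₑ ^ 2 ∂ν ≤ ∫⁻ y, (2 * ‖φ (Φ s + r • y)‖ₑ ^ 2 +
          2 * ∫⁻ τ in Set.Ioc (0 : ℝ) 1, ENNReal.ofReal ((2 * r * τ) ^ 2) *
            ‖fderiv ℝ φ (Φ s + (r * τ ^ 2) • y)‖ₑ ^ 2) ∂ν :=
          setLIntegral_mono' Metric.isOpen_ball.measurableSet fun y hy =>
            enorm_sq_le_of_segment hφ (Φ s) (by simpa using hy) hr
      _ = _ := by
          have hmF : Measurable fun p : Space × ℝ => ENNReal.ofReal ((2 * r * p.2) ^ 2) *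
              ‖fderiv ℝ φ (Φ s + (r * p.2 ^ 2) • p.1)‖ₑ ^ 2 :=
            (by fun_prop : Measurable fun p : Space × ℝ => ENNReal.ofReal ((2 * r * p.2) ^ 2)).mul
              (hm2.comp (by fun_prop : Measurable fun p : Space × ℝ => Φ s + (r * p.2 ^ 2) • p.1))
          rw [lintegral_add_left, lintegral_const_mul, lintegral_const_mul]
          · congr 2
            rw [lintegral_lintegral_swap hmF.aemeasurable]
            refine lintegral_congr fun τ => ?_
            rw [lintegral_const_mul' _ _ ENNReal.ofReal_ne_top]
          · exact hmF.lintegral_prod_right'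
          · exact hm1.comp (by fun_prop : Measurable fun y : Space => Φ s + r • y)
          · exact (hm1.comp (by fun_prop : Measurable fun y : Space => Φ s + r • y)).const_mul 2
  have hΦm := hΦ.measurable
  have hmG : Measurable fun p : (Plane × ℝ) × Space => 
      ‖fderiv ℝ φ (Φ p.1.1 + (r * p.1.2 ^ 2) • p.2)‖ₑ ^ 2 :=
    hm2.comp (by fun_prop : Measurable fun p : (Plane × ℝ) × Space =>
      Φ p.1.1 + (r * p.1.2 ^ 2) • p.2)
  have hmH : Measurable fun p : Plane × ℝ => ENNReal.ofReal ((2 * r * p.2) ^ 2) *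
      ∫⁻ y, ‖fderiv ℝ φ (Φ p.1 + (r * p.2 ^ 2) • y)‖ₑ ^ 2 ∂ν :=
    (by fun_prop : Measurable fun p : Plane × ℝ => ENNReal.ofReal ((2 * r * p.2) ^ 2)).mul
      hmG.lintegral_prod_right'
  have hmK : Measurable fun s : Plane => ∫⁻ y, ‖φ (Φ s + r • y)‖ₑ ^ 2 ∂ν := by
    have : Measurable fun p : Plane × Space => ‖φ (Φ p.1 + r • p.2)‖ₑ ^ 2 :=
      hm1.comp (by fun_prop : Measurable fun p : Plane × Space => Φ p.1 + r • p.2)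
    exact this.lintegral_prod_right'
  calc volume (Metric.ball (0 : Space) 1) * ∫⁻ s : Plane, ‖φ (Φ s)‖ₑ ^ 2
      = ∫⁻ s : Plane, volume (Metric.ball (0 : Space) 1) * ‖φ (Φ s)‖ₑ ^ 2 := by
        rw [lintegral_const_mul (f := fun s => ‖φ (Φ s)‖ₑ ^ 2) _ (hm1.comp hΦm)]
    _ ≤ ∫⁻ s : Plane, (2 * (∫⁻ y, ‖φ (Φ s + r • y)‖ₑ ^ 2 ∂ν) + 2 * ∫⁻ τ in Set.Ioc (0 : ℝ) 1,
        ENNReal.ofReal ((2 * r * τ) ^ 2) *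
          ∫⁻ y, ‖fderiv ℝ φ (Φ s + (r * τ ^ 2) • y)‖ₑ ^ 2 ∂ν) := lintegral_mono hstep
    _ = 2 * (∫⁻ s : Plane, ∫⁻ y, ‖φ (Φ s + r • y)‖ₑ ^ 2 ∂ν) + 2 * ∫⁻ τ in Set.Ioc (0 : ℝ) 1,
        ENNReal.ofReal ((2 * r * τ) ^ 2) *
          ∫⁻ s : Plane, ∫⁻ y, ‖fderiv ℝ φ (Φ s + (r * τ ^ 2) • y)‖ₑ ^ 2 ∂ν := by
        rw [lintegral_add_left (hmK.const_mul 2), lintegral_const_mul _ hmK,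
          lintegral_const_mul _ hmH.lintegral_prod_right', lintegral_lintegral_swap
            (f := fun s τ => ENNReal.ofReal ((2 * r * τ) ^ 2) *
              ∫⁻ y, ‖fderiv ℝ φ (Φ s + (r * τ ^ 2) • y)‖ₑ ^ 2 ∂ν) hmH.aemeasurable]
        congr 2
        refine lintegral_congr fun τ => ?_
        rw [lintegral_const_mul' _ _ ENNReal.ofReal_ne_top]
    _ ≤ 2 * (ENNReal.ofReal (4 / c ^ 2 / r) * b * ∫⁻ z, ‖φ z‖ₑ ^ 2) +
        2 * ∫⁻ _τ in Set.Ioc (0 : ℝ) 1,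
          ENNReal.ofReal (16 / c ^ 2 * r) * b * ∫⁻ z, ‖fderiv ℝ φ z‖ₑ ^ 2 := by
        refine add_le_add (mul_le_mul' le_rfl ?_) (mul_le_mul' le_rfl ?_)
        · exact lintegral_average_le h hΦ hm1 hr
        · refine setLIntegral_mono' measurableSet_Ioc fun τ hτ => ?_
          have hτ0 : 0 < τ := hτ.1
          refine (mul_le_mul' le_rfl (lintegral_average_le h hΦ hm2
            (t := r * τ ^ 2) (by positivity))).trans ?_
          rw [← mul_assoc, ← mul_assoc, ← ENNReal.ofReal_mul (by positivity)]
          refine mul_le_mul' (mul_le_mul' (le_of_eq (congrArg _ ?_)) le_rfl) le_rfl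
          have := h.1
          field_simp
          norm_num
    _ = _ := by
        rw [setLIntegral_const, Real.volume_Ioc]
        have h1 : ENNReal.ofReal (32 / c ^ 2 * r) = 2 * ENNReal.ofReal (16 / c ^ 2 * r) := by
          rw [show (32 / c ^ 2 * r) = 2 * (16 / c ^ 2 * r) by ring, ENNReal.ofReal_mul (by norm_num)]
          norm_num
        have h2 : ENNReal.ofReal (8 / c ^ 2 / r) = 2 * ENNReal.ofReal (4 / c ^ 2 / r) := by
          rw [show (8 / c ^ 2 / r) = 2 * (4 / c ^ 2 / r) by ring, ENNReal.ofReal_mul (by norm_num)]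
          norm_num
        rw [h1, h2]
        norm_num
        ring

/-- The trace inequality: the trace is bounded on `H¹`, with an arbitrarily small constant in front
of the gradient. -/
theorem exists_trace_le (h : IsChordBound Φ c) (hΦ : Continuous Φ)
    (hT : IsSingularSet (Set.range Φ) T) (hreg : IsUniformlyEllipticC2Off Φ T) {η : ℝ}
    (hη : 0 < η) : ∃ K : ℝ, 0 ≤ K ∧ ∀ φ : Space → ℂ, ContDiff ℝ ∞ φ →
      ∫⁻ s, ‖φ (Φ s)‖ₑ ^ 2 ∂surfaceMeasure Φ ≤
        ENNReal.ofReal η * (∑ i, ∫⁻ x, ‖pderiv i φ x‖ₑ ^ 2) + ENNReal.ofReal K * ∫⁻ x, ‖φ x‖ₑ ^ 2 := by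
  obtain ⟨M, hM, hle⟩ := exists_surfaceMeasure_le h hT hreg
  set a := (volume (Metric.ball (0 : Space) 1)).toReal with ha
  set b := (volume (Metric.ball (0 : Plane) 1)).toReal with hb
  have ha0 : 0 < a := ENNReal.toReal_pos (Metric.measure_ball_pos _ _ one_pos).ne'
    measure_ball_lt_top.ne
  have hb0 : 0 < b := ENNReal.toReal_pos (Metric.measure_ball_pos _ _ one_pos).ne'
    measure_ball_lt_top.ne
  have haE : volume (Metric.ball (0 : Space) 1) = ENNReal.ofReal a :=
    (ENNReal.ofReal_toReal measure_ball_lt_top.ne).symm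
  have hbE : volume (Metric.ball (0 : Plane) 1) = ENNReal.ofReal b :=
    (ENNReal.ofReal_toReal measure_ball_lt_top.ne).symm
  have hc := h.1
  -- with this radius the constant in front of the gradient is at most `η`
  set r := η * a * c ^ 2 / (32 * b * (M + 1)) with hr
  have hr0 : 0 < r := by positivity
  refine ⟨M * b / a * (8 / c ^ 2 / r), by positivity, fun φ hφ => ?_⟩
  have hφ1 : ContDiff ℝ 1 φ := hφ.of_le (by exact_mod_cast le_top)
  have h1 := lintegral_comp_le h hΦ hφ1 hr0
  set I := ∫⁻ s : Plane, ‖φ (Φ s)‖ₑ ^ 2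
  have hgrad : ∫⁻ x, ‖fderiv ℝ φ x‖ₑ ^ 2 ≤ ∑ i, ∫⁻ x, ‖pderiv i φ x‖ₑ ^ 2 := by
    rw [← lintegral_finsetSum]
    · exact lintegral_mono (enorm_fderiv_sq_le φ)
    · exact fun i _ => (contDiff_pderiv hφ i).continuous.measurable.enorm.pow_const 2
  calc ∫⁻ s, ‖φ (Φ s)‖ₑ ^ 2 ∂surfaceMeasure Φ ≤ ∫⁻ s, ‖φ (Φ s)‖ₑ ^ 2 ∂(ENNReal.ofReal M • volume) :=
        lintegral_mono' hle le_rfl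
    _ = ENNReal.ofReal (M / a) * (volume (Metric.ball (0 : Space) 1) * I) := by
        rw [lintegral_smul_measure, haE, ← mul_assoc, ← ENNReal.ofReal_mul (by positivity),
          div_mul_cancel₀ _ ha0.ne', smul_eq_mul]
    _ ≤ ENNReal.ofReal (M / a) * (volume (Metric.ball (0 : Plane) 1) *
        (ENNReal.ofReal (32 / c ^ 2 * r) * (∑ i, ∫⁻ x, ‖pderiv i φ x‖ₑ ^ 2) +
          ENNReal.ofReal (8 / c ^ 2 / r) * ∫⁻ x, ‖φ x‖ₑ ^ 2)) := by
        refine mul_le_mul' le_rfl (h1.trans ?_)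
        gcongr
    _ = ENNReal.ofReal (M / a * b * (32 / c ^ 2 * r)) * (∑ i, ∫⁻ x, ‖pderiv i φ x‖ₑ ^ 2) +
        ENNReal.ofReal (M * b / a * (8 / c ^ 2 / r)) * ∫⁻ x, ‖φ x‖ₑ ^ 2 := by
        rw [hbE, ENNReal.ofReal_mul (p := M / a * b) (by positivity),
          ENNReal.ofReal_mul (p := M / a) (q := b) (by positivity),
          show M * b / a * (8 / c ^ 2 / r) = M / a * (b * (8 / c ^ 2 / r)) by ring,
          ENNReal.ofReal_mul (p := M / a) (by positivity),
          ENNReal.ofReal_mul (p := b) (by positivity)]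
        ring
    _ ≤ _ := by
        gcongr
        rw [hr]
        calc M / a * b * (32 / c ^ 2 * (η * a * c ^ 2 / (32 * b * (M + 1))))
            = η * (M / (M + 1)) := by field_simp
          _ ≤ η * 1 := by
              gcongr
              rw [div_le_one (by positivity)]; linarith
          _ = η := mul_one η

end TraceInequality

/-! ### The Sobolev space as a Hilbert space -/

noncomputable section SobolevSpace

theorem ofReal_norm_sq_eq_lintegral {X : Type*} [MeasurableSpace X] {ν : Measure X}
    (f : Lp ℂ 2 ν) : ENNReal.ofReal (‖f‖ ^ 2) = ∫⁻ x, ‖f x‖ₑ ^ 2 ∂ν := by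
  rw [← eLpNorm_two_sq, Lp.norm_def, ← ENNReal.toReal_pow,
    ENNReal.ofReal_toReal (ENNReal.pow_ne_top (Lp.eLpNorm_ne_top f))]

theorem ofReal_norm_toLp_sq {X : Type*} [MeasurableSpace X] {ν : Measure X} {φ : X → ℂ}
    (hφ : MemLp φ 2 ν) : ENNReal.ofReal (‖hφ.toLp φ‖ ^ 2) = ∫⁻ x, ‖φ x‖ₑ ^ 2 ∂ν := by
  rw [ofReal_norm_sq_eq_lintegral]
  refine lintegral_congr_ae ?_
  filter_upwards [hφ.coeFn_toLp] with x hx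
  rw [hx]

/-- The submodule of test functions. -/
def testFunctions : Submodule ℂ (Space → ℂ) where
  carrier := {φ | IsTestFunction φ}
  add_mem' hφ hψ := ⟨hφ.1.add hψ.1, hφ.2.add hψ.2⟩
  zero_mem' := ⟨contDiff_const, HasCompactSupport.zero⟩
  smul_mem' _ _ hφ := ⟨contDiff_const.smul hφ.1, hφ.2.smul_left⟩

theorem IsTestFunction.ofReal {χ : Space → ℝ} (hχ : ContDiff ℝ ∞ χ) (hχc : HasCompactSupport χ) :
    IsTestFunction fun x => (χ x : ℂ) :=
  ⟨Complex.ofRealCLM.contDiff.comp hχ, hχc.comp_left (g := fun r : ℝ => (r : ℂ)) (by simp)⟩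

theorem pderiv_ofReal {χ : Space → ℝ} (hχ : ContDiff ℝ ∞ χ) (i : Fin 3) (x : Space) :
    pderiv i (fun x => (χ x : ℂ)) x = (fderiv ℝ χ x (EuclideanSpace.single i 1) : ℝ) := by
  have h1 : HasFDerivAt χ (fderiv ℝ χ x) x := (hχ.differentiable (by simp) x).hasFDerivAt
  have h2 : HasFDerivAt (fun x => (χ x : ℂ)) _ x := Complex.ofRealCLM.hasFDerivAt.comp x h1
  rw [pderiv, h2.fderiv]; rfl

theorem integral_smul_eq_inner {χ : Space → ℝ} (hχ : ContDiff ℝ ∞ χ) (hχc : HasCompactSupport χ)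
    (u : L2Space) : ∫ x, χ x • u x = ⟪(IsTestFunction.ofReal hχ hχc).toL2, u⟫_ℂ := by
  rw [L2.inner_def]
  refine integral_congr_ae ?_
  filter_upwards [(IsTestFunction.ofReal hχ hχc).coeFn_toL2] with x hx
  rw [hx]
  simp [mul_comm]

/-- Weak derivatives in terms of inner products. -/
theorem isWeakPartial_iff {i : Fin 3} {u f : L2Space} :
    IsWeakPartial i u f ↔ ∀ χ : Space → ℝ, ∀ (hχ : ContDiff ℝ ∞ χ) (hχc : HasCompactSupport χ),
      ⟪((IsTestFunction.ofReal hχ hχc).pderiv i).toL2, u⟫_ℂ +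
        ⟪(IsTestFunction.ofReal hχ hχc).toL2, f⟫_ℂ = 0 := by
  refine forall_congr' fun χ => forall_congr' fun hχ => forall_congr' fun hχc => ?_
  have h1 : ∫ x, fderiv ℝ χ x (EuclideanSpace.single i 1) • u x =
      ⟪((IsTestFunction.ofReal hχ hχc).pderiv i).toL2, u⟫_ℂ := by
    rw [L2.inner_def]
    refine integral_congr_ae ?_
    filter_upwards [((IsTestFunction.ofReal hχ hχc).pderiv i).coeFn_toL2] with x hx
    rw [hx, pderiv_ofReal hχ]
    simp [mul_comm]
  rw [h1, integral_smul_eq_inner hχ hχc, eq_neg_iff_add_eq_zero]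

/-- The Sobolev space `H¹(ℝ³)` as a space of tuples `(u, ∂₁u, ∂₂u, ∂₃u)`, in which it is closed;
the component with index `none` is `u` itself. -/
def sobolevSpace : Submodule ℂ (PiLp 2 fun _ : Option (Fin 3) => L2Space) where
  carrier := {F | ∀ i : Fin 3, IsWeakPartial i (F none) (F (some i))}
  add_mem' {F G} hF hG i := by
    have hF := isWeakPartial_iff.1 (hF i)
    have hG := isWeakPartial_iff.1 (hG i)
    refine isWeakPartial_iff.2 fun χ hχ hχc => ?_
    rw [PiLp.add_apply, PiLp.add_apply, inner_add_right, inner_add_right]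
    linear_combination hF χ hχ hχc + hG χ hχ hχc
  zero_mem' i := isWeakPartial_iff.2 fun χ hχ hχc => by simp
  smul_mem' a F hF i := by
    have hF := isWeakPartial_iff.1 (hF i)
    refine isWeakPartial_iff.2 fun χ hχ hχc => ?_
    rw [PiLp.smul_apply, PiLp.smul_apply, inner_smul_right, inner_smul_right]
    linear_combination a * hF χ hχ hχc

theorem isClosed_sobolevSpace : IsClosed (sobolevSpace : Set (PiLp 2 fun _ : Option (Fin 3) =>
    L2Space)) := by
  have : (sobolevSpace : Set (PiLp 2 fun _ : Option (Fin 3) => L2Space)) =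
      ⋂ i : Fin 3, ⋂ χ : Space → ℝ, ⋂ hχ : ContDiff ℝ ∞ χ, ⋂ hχc : HasCompactSupport χ,
      {F | ⟪((IsTestFunction.ofReal hχ hχc).pderiv i).toL2, F none⟫_ℂ +
        ⟪(IsTestFunction.ofReal hχ hχc).toL2, F (some i)⟫_ℂ = 0} := by
    ext F
    simp only [Set.mem_iInter]
    exact forall_congr' fun i => isWeakPartial_iff
  rw [this]
  refine isClosed_iInter fun i => isClosed_iInter fun χ => isClosed_iInter fun hχ =>
    isClosed_iInter fun hχc => isClosed_eq ?_ continuous_const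
  fun_prop

instance : CompleteSpace sobolevSpace := isClosed_sobolevSpace.completeSpace_coe

/-- The embedding of `H¹(ℝ³)` into `L²(ℝ³)`. -/
def sobolevEmb : sobolevSpace →L[ℂ] L2Space :=
  (PiLp.proj 2 (fun _ : Option (Fin 3) => L2Space) none : _ →L[ℂ] L2Space) ∘L sobolevSpace.subtypeL

/-- The weak partial derivatives, as bounded operators on `H¹(ℝ³)`. -/
def sobolevDeriv (i : Fin 3) : sobolevSpace →L[ℂ] L2Space :=
  (PiLp.proj 2 (fun _ : Option (Fin 3) => L2Space) (some i) : _ →L[ℂ] L2Space) ∘L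
    sobolevSpace.subtypeL

theorem isWeakPartial_sobolevDeriv (w : sobolevSpace) (i : Fin 3) :
    IsWeakPartial i (sobolevEmb w) (sobolevDeriv i w) := w.2 i

theorem weakPartial_sobolevEmb (w : sobolevSpace) (i : Fin 3) :
    weakPartial i (sobolevEmb w) = sobolevDeriv i w := (isWeakPartial_sobolevDeriv w i).weakPartial_eq

theorem sobolev_norm_sq (w : sobolevSpace) :
    ‖w‖ ^ 2 = ‖sobolevEmb w‖ ^ 2 + ∑ i, ‖sobolevDeriv i w‖ ^ 2 := by
  rw [Submodule.coe_norm, PiLp.norm_sq_eq_of_L2, Fintype.sum_option]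
  rfl

theorem sobolevEmb_injective : Function.Injective sobolevEmb := by
  rw [injective_iff_map_eq_zero]
  intro w hw
  have h1 : ∀ i, sobolevDeriv i w = 0 := fun i => by
    refine (isWeakPartial_sobolevDeriv w i).unique ?_
    rw [hw]
    exact isWeakPartial_iff.2 fun χ hχ hχc => by simp
  have := sobolev_norm_sq w
  rw [hw] at this
  simpa [h1] using this

theorem range_sobolevEmb : sobolevH1 = Set.range sobolevEmb := by
  ext u
  constructor
  · intro hu
    choose f hf using hu
    exact ⟨⟨WithLp.toLp 2 fun k : Option (Fin 3) => k.elim u f, fun i => hf i⟩, rfl⟩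
  · rintro ⟨w, rfl⟩ i
    exact ⟨_, isWeakPartial_sobolevDeriv w i⟩

/-- The element of `H¹(ℝ³)` given by a test function. -/
def IsTestFunction.toSobolev {φ : Space → ℂ} (hφ : IsTestFunction φ) : sobolevSpace :=
  ⟨WithLp.toLp 2 fun k : Option (Fin 3) => k.elim hφ.toL2 fun i => (hφ.pderiv i).toL2,
    fun i => hφ.isWeakPartial i⟩

theorem IsTestFunction.sobolevEmb_toSobolev {φ : Space → ℂ} (hφ : IsTestFunction φ) :
    sobolevEmb hφ.toSobolev = hφ.toL2 := rfl

theorem IsTestFunction.sobolevDeriv_toSobolev {φ : Space → ℂ} (hφ : IsTestFunction φ) (i : Fin 3) :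
    sobolevDeriv i hφ.toSobolev = (hφ.pderiv i).toL2 := rfl

/-- The inclusion of the test functions into `H¹(ℝ³)`. -/
def testToSobolev : testFunctions →ₗ[ℂ] sobolevSpace where
  toFun φ := IsTestFunction.toSobolev φ.2
  map_add' φ ψ := by
    refine sobolevEmb_injective ?_
    rw [map_add]
    exact MemLp.toLp_add (IsTestFunction.memLp φ.2 2) (IsTestFunction.memLp ψ.2 2)
  map_smul' a φ := by
    refine sobolevEmb_injective ?_
    rw [map_smul]
    exact MemLp.toLp_const_smul a (IsTestFunction.memLp φ.2 2)

theorem denseRange_testToSobolev : DenseRange testToSobolev := by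
  intro w
  rw [Metric.mem_closure_iff]
  intro ε hε
  obtain ⟨φ, hφ, h0, hi⟩ := exists_testFunction_near (fun i => isWeakPartial_sobolevDeriv w i)
    (ε := ENNReal.ofReal (ε / 4)) (by simpa using hε) ENNReal.ofReal_ne_top
  refine ⟨_, ⟨⟨φ, hφ⟩, rfl⟩, ?_⟩
  have hkey : ∀ {g : Space → ℂ} (hg : IsTestFunction g) (f : L2Space),
      eLpNorm (fun x => g x - f x) 2 volume ≤ ENNReal.ofReal (ε / 4) → ‖f - hg.toL2‖ ≤ ε / 4 := by
    intro g hg f h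
    rw [norm_sub_rev, Lp.norm_def]
    refine ENNReal.toReal_le_of_le_ofReal (by positivity) (le_trans (le_of_eq ?_) h)
    refine eLpNorm_congr_ae ?_
    filter_upwards [Lp.coeFn_sub hg.toL2 f, hg.coeFn_toL2] with x hx hx'
    rw [hx, Pi.sub_apply, hx']
  have h1 := hkey hφ _ h0
  have h2 : ∀ i, ‖sobolevDeriv i w - (hφ.pderiv i).toL2‖ ≤ ε / 4 := fun i =>
    hkey (hφ.pderiv i) _ (hi i)
  rw [dist_eq_norm]
  have h3 := sobolev_norm_sq (w - testToSobolev ⟨φ, hφ⟩)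
  rw [map_sub] at h3
  simp only [map_sub] at h3
  have h4 : ‖sobolevEmb w - sobolevEmb (testToSobolev ⟨φ, hφ⟩)‖ ^ 2 ≤ (ε / 4) ^ 2 :=
    pow_le_pow_left₀ (norm_nonneg _) h1 2
  have h5 : ∑ i, ‖sobolevDeriv i w - sobolevDeriv i (testToSobolev ⟨φ, hφ⟩)‖ ^ 2 ≤
      ∑ _i : Fin 3, (ε / 4) ^ 2 :=
    Finset.sum_le_sum fun i _ => pow_le_pow_left₀ (norm_nonneg _) (h2 i) 2
  simp only [Finset.sum_const, Finset.card_univ, Fintype.card_fin, nsmul_eq_mul] at h5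
  refine lt_of_pow_lt_pow_left₀ 2 hε.le ?_
  rw [h3]
  have : 0 < ε ^ 2 := by positivity
  push_cast at h5
  nlinarith

theorem denseRange_sobolevEmb : DenseRange sobolevEmb := by
  have : Dense (sobolevEmb.range : Set L2Space) := by
    rw [Submodule.dense_iff_topologicalClosure_eq_top, Submodule.topologicalClosure_eq_top_iff,
      Submodule.eq_bot_iff]
    intro f hf
    have h1 : ∀ᵐ x, f x = 0 := by
      refine ae_eq_zero_of_integral_contDiff_smul_eq_zero
        ((Lp.memLp f).locallyIntegrable (by norm_num)) fun χ hχ hχc => ?_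
      rw [integral_smul_eq_inner hχ hχc]
      exact (Submodule.mem_orthogonal _ _).1 hf _ ⟨(IsTestFunction.ofReal hχ hχc).toSobolev, rfl⟩
    exact (Lp.eq_zero_iff_ae_eq_zero).2 h1
  exact this

/-! ### The trace operator -/

/-- The trace on the surface is bounded by the `H¹` norm, with an arbitrarily small constant in
front of the gradient. -/
def HasTraceBound (Φ : Plane → Space) : Prop :=
  Continuous Φ ∧ ∀ η : ℝ, 0 < η → ∃ K : ℝ, 0 ≤ K ∧ ∀ φ : Space → ℂ, ContDiff ℝ ∞ φ →
    ∫⁻ s, ‖φ (Φ s)‖ₑ ^ 2 ∂surfaceMeasure Φ ≤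
      ENNReal.ofReal η * (∑ i, ∫⁻ x, ‖pderiv i φ x‖ₑ ^ 2) + ENNReal.ofReal K * ∫⁻ x, ‖φ x‖ₑ ^ 2

variable {Φ : Plane → Space}

namespace HasTraceBound

theorem lintegral_le (h : HasTraceBound Φ) {η : ℝ} (hη : 0 < η) : ∃ K : ℝ, 0 ≤ K ∧
    ∀ φ : testFunctions, ∫⁻ s, ‖(φ : Space → ℂ) (Φ s)‖ₑ ^ 2 ∂surfaceMeasure Φ ≤
      ENNReal.ofReal (η * ∑ i, ‖sobolevDeriv i (testToSobolev φ)‖ ^ 2 +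
        K * ‖sobolevEmb (testToSobolev φ)‖ ^ 2) := by
  obtain ⟨K, hK, hle⟩ := h.2 η hη
  refine ⟨K, hK, fun φ => (hle φ φ.2.1).trans (le_of_eq ?_)⟩
  have h1 : ∀ i, ∫⁻ x, ‖pderiv i φ x‖ₑ ^ 2 =
      ENNReal.ofReal (‖sobolevDeriv i (testToSobolev φ)‖ ^ 2) := fun i =>
    (ofReal_norm_toLp_sq ((IsTestFunction.pderiv φ.2 i).memLp 2)).symm
  have h2 : ∫⁻ x, ‖(φ : Space → ℂ) x‖ₑ ^ 2 =
      ENNReal.ofReal (‖sobolevEmb (testToSobolev φ)‖ ^ 2) :=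
    (ofReal_norm_toLp_sq (IsTestFunction.memLp φ.2 2)).symm
  simp_rw [h1]
  rw [h2, ← ENNReal.ofReal_sum_of_nonneg (fun i _ => sq_nonneg _), ← ENNReal.ofReal_mul hη.le,
    ← ENNReal.ofReal_mul hK, ← ENNReal.ofReal_add (by positivity) (by positivity)]

theorem memLp (h : HasTraceBound Φ) (φ : testFunctions) :
    MemLp (fun s => (φ : Space → ℂ) (Φ s)) 2 (surfaceMeasure Φ) := by
  refine ⟨((IsTestFunction.continuous φ.2).comp h.1).aestronglyMeasurable, ?_⟩
  obtain ⟨K, -, hK⟩ := h.lintegral_le one_pos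
  have := (hK φ).trans_lt ENNReal.ofReal_lt_top
  rw [← eLpNorm_two_sq (fun s => (φ : Space → ℂ) (Φ s))] at this
  by_contra h0
  rw [not_lt, top_le_iff] at h0
  simp [h0] at this

/-- The restriction of test functions to the surface. -/
def restrictTest (h : HasTraceBound Φ) : testFunctions →ₗ[ℂ] Lp ℂ 2 (surfaceMeasure Φ) where
  toFun φ := (h.memLp φ).toLp _
  map_add' _ _ := MemLp.toLp_add _ _
  map_smul' _ _ := MemLp.toLp_const_smul _ _

theorem restrictTest_norm_sq_le (h : HasTraceBound Φ) {η : ℝ} (hη : 0 < η) : ∃ K : ℝ, 0 ≤ K ∧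
    ∀ φ : testFunctions, ‖h.restrictTest φ‖ ^ 2 ≤
      η * ∑ i, ‖sobolevDeriv i (testToSobolev φ)‖ ^ 2 +
        K * ‖sobolevEmb (testToSobolev φ)‖ ^ 2 := by
  obtain ⟨K, hK, hle⟩ := h.lintegral_le hη
  refine ⟨K, hK, fun φ => ?_⟩
  have h1 := hle φ
  rw [← ofReal_norm_toLp_sq (h.memLp φ)] at h1
  exact (ENNReal.ofReal_le_ofReal_iff (by positivity)).1 h1

theorem restrictTest_bounded (h : HasTraceBound Φ) :
    ∃ C : ℝ, ∀ φ : testFunctions, ‖h.restrictTest φ‖ ≤ C * ‖testToSobolev φ‖ := by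
  obtain ⟨K, hK, hle⟩ := h.restrictTest_norm_sq_le one_pos
  refine ⟨√(K + 1), fun φ => ?_⟩
  refine le_of_sq_le_sq ?_ (by positivity)
  rw [mul_pow, Real.sq_sqrt (by positivity), sobolev_norm_sq]
  have := hle φ
  have h2 : 0 ≤ ∑ i, ‖sobolevDeriv i (testToSobolev φ)‖ ^ 2 := by positivity
  nlinarith [sq_nonneg ‖sobolevEmb (testToSobolev φ)‖]

/-- The trace operator from `H¹(ℝ³)` to `L²` of the surface. -/
def traceOp (h : HasTraceBound Φ) : sobolevSpace →L[ℂ] Lp ℂ 2 (surfaceMeasure Φ) :=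
  h.restrictTest.extendOfNorm testToSobolev

theorem traceOp_test (h : HasTraceBound Φ) (φ : testFunctions) :
    h.traceOp (testToSobolev φ) = h.restrictTest φ :=
  LinearMap.extendOfNorm_eq denseRange_testToSobolev h.restrictTest_bounded φ

theorem traceOp_norm_sq_le (h : HasTraceBound Φ) {η : ℝ} (hη : 0 < η) : ∃ K : ℝ, 0 ≤ K ∧
    ∀ w, ‖h.traceOp w‖ ^ 2 ≤ η * ∑ i, ‖sobolevDeriv i w‖ ^ 2 + K * ‖sobolevEmb w‖ ^ 2 := by
  obtain ⟨K, hK, hle⟩ := h.restrictTest_norm_sq_le hη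
  refine ⟨K, hK, fun w => ?_⟩
  refine denseRange_testToSobolev.induction_on w ?_ fun φ => ?_
  · exact isClosed_le (by fun_prop) (by fun_prop)
  · rw [traceOp_test]; exact hle φ

theorem edist_toLp {X : Type*} [MeasurableSpace X] {ν : Measure X} {g : X → ℂ}
    (hg : MemLp g 2 ν) (f : Lp ℂ 2 ν) :
    eLpNorm (fun x => g x - f x) 2 ν = edist (hg.toLp g) f := by
  rw [Lp.edist_def]
  refine eLpNorm_congr_ae ?_
  filter_upwards [hg.coeFn_toLp] with x hx
  rw [Pi.sub_apply, hx]

/-- Convergence in `H¹` is convergence in `L²` of the functions and of their derivatives. -/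
theorem tendsto_sobolev_iff {w : ℕ → sobolevSpace} {w₀ : sobolevSpace} :
    Tendsto w atTop (𝓝 w₀) ↔ Tendsto (fun n => sobolevEmb (w n)) atTop (𝓝 (sobolevEmb w₀)) ∧
      ∀ i, Tendsto (fun n => sobolevDeriv i (w n)) atTop (𝓝 (sobolevDeriv i w₀)) := by
  refine ⟨fun h => ⟨(sobolevEmb.continuous.tendsto _).comp h,
    fun i => ((sobolevDeriv i).continuous.tendsto _).comp h⟩, fun ⟨h0, hi⟩ => ?_⟩
  rw [tendsto_iff_norm_sub_tendsto_zero]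
  have h1 : Tendsto (fun n => ‖sobolevEmb (w n) - sobolevEmb w₀‖ ^ 2 +
      ∑ i, ‖sobolevDeriv i (w n) - sobolevDeriv i w₀‖ ^ 2) atTop (𝓝 (0 ^ 2 + ∑ _i : Fin 3, 0 ^ 2)) :=
    ((tendsto_iff_norm_sub_tendsto_zero.1 h0).pow 2).add
      (tendsto_finsetSum _ fun i _ => (tendsto_iff_norm_sub_tendsto_zero.1 (hi i)).pow 2)
  have h2 := (Real.continuous_sqrt.tendsto _).comp h1
  simp only [ne_eq, OfNat.ofNat_ne_zero, not_false_eq_true, zero_pow, Finset.sum_const_zero,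
    add_zero, Real.sqrt_zero] at h2
  refine h2.congr fun n => ?_
  simp only [Function.comp_apply, ← map_sub, ← sobolev_norm_sq, Real.sqrt_sq (norm_nonneg _)]

/-- `τ` is the trace of `w ∈ H¹` precisely if the trace operator maps `w` to `τ`. -/
theorem isTrace_iff (h : HasTraceBound Φ) (w : sobolevSpace) (τ : Lp ℂ 2 (surfaceMeasure Φ)) :
    IsTrace Φ (sobolevEmb w) τ ↔ h.traceOp w = τ := by
  have key : ∀ φ : ℕ → testFunctions,
      ((Tendsto (fun n => eLpNorm (fun x => (φ n : Space → ℂ) x - sobolevEmb w x) 2 volume)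
          atTop (𝓝 0)) ∧
        (∀ i, Tendsto (fun n => eLpNorm (fun x =>
          fderiv ℝ (φ n : Space → ℂ) x (EuclideanSpace.single i 1) -
            weakPartial i (sobolevEmb w) x) 2 volume) atTop (𝓝 0)) ↔
        Tendsto (fun n => testToSobolev (φ n)) atTop (𝓝 w)) ∧
      (Tendsto (fun n => eLpNorm (fun s => (φ n : Space → ℂ) (Φ s) - τ s) 2 (surfaceMeasure Φ))
        atTop (𝓝 0) ↔ Tendsto (fun n => h.restrictTest (φ n)) atTop (𝓝 τ)) := by
    refine fun φ => ⟨?_, ?_⟩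
    · rw [tendsto_sobolev_iff]
      refine and_congr ?_ (forall_congr' fun i => ?_)
      · rw [tendsto_iff_edist_tendsto_0]
        simp_rw [fun n => edist_toLp (IsTestFunction.memLp (φ n).2 2) (sobolevEmb w)]
        rfl
      · rw [tendsto_iff_edist_tendsto_0, weakPartial_sobolevEmb]
        have : ∀ n, eLpNorm (fun x => fderiv ℝ (φ n : Space → ℂ) x (EuclideanSpace.single i 1) -
            sobolevDeriv i w x) 2 volume =
            edist (sobolevDeriv i (testToSobolev (φ n))) (sobolevDeriv i w) := fun n =>
          edist_toLp ((IsTestFunction.pderiv (φ n).2 i).memLp 2) (sobolevDeriv i w)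
        simp_rw [this]
    · rw [tendsto_iff_edist_tendsto_0]
      have : ∀ n, eLpNorm (fun s => (φ n : Space → ℂ) (Φ s) - τ s) 2 (surfaceMeasure Φ) =
          edist (h.restrictTest (φ n)) τ := fun n => edist_toLp (h.memLp (φ n)) τ
      simp_rw [this]
  have hlim : ∀ φ : ℕ → testFunctions, Tendsto (fun n => testToSobolev (φ n)) atTop (𝓝 w) →
      Tendsto (fun n => h.restrictTest (φ n)) atTop (𝓝 (h.traceOp w)) := by
    intro φ hφ
    have := (h.traceOp.continuous.tendsto w).comp hφ
    exact this.congr fun n => h.traceOp_test _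
  constructor
  · rintro ⟨φ, hφ, h0, hi, hτ⟩
    obtain ⟨k1, k2⟩ := key fun n => ⟨φ n, hφ n⟩
    exact tendsto_nhds_unique (hlim _ (k1.1 ⟨h0, hi⟩)) (k2.1 hτ)
  · intro hw
    obtain ⟨x, hx, hxw⟩ := mem_closure_iff_seq_limit.1 (denseRange_testToSobolev w)
    choose φ hφ using hx
    obtain ⟨k1, k2⟩ := key φ
    have hφw : Tendsto (fun n => testToSobolev (φ n)) atTop (𝓝 w) := by simpa only [hφ] using hxw
    obtain ⟨h0, hi⟩ := k1.2 hφw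
    exact ⟨fun n => φ n, fun n => (φ n).2, h0, hi, k2.2 (hw ▸ hlim φ hφw)⟩

theorem existsUnique_isTrace (h : HasTraceBound Φ) {u : L2Space} (hu : u ∈ sobolevH1) :
    ∃! τ, IsTrace Φ u τ := by
  rw [range_sobolevEmb] at hu
  obtain ⟨w, rfl⟩ := hu
  exact ⟨_, (h.isTrace_iff w _).2 rfl, fun τ hτ => ((h.isTrace_iff w τ).1 hτ).symm⟩

theorem trace_sobolevEmb (h : HasTraceBound Φ) (w : sobolevSpace) :
    trace Φ (sobolevEmb w) = h.traceOp w := by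
  have hex : ∃ τ, IsTrace Φ (sobolevEmb w) τ := ⟨_, (h.isTrace_iff w _).2 rfl⟩
  rw [trace, dif_pos hex]
  exact ((h.isTrace_iff w _).1 hex.choose_spec).symm

end HasTraceBound
end SobolevSpace

/-! ### The form as a bounded operator -/

noncomputable section DeltaForm

variable {Φ : Plane → Space}

/-- Restriction of an `H¹` function to a subset of space. -/
def sobolevRestrict (U : Set Space) : sobolevSpace →L[ℂ] Lp ℂ 2 (volume.restrict U) :=
  LpToLpRestrictCLM Space ℂ ℂ volume 2 U ∘L sobolevEmb

theorem coeFn_sobolevRestrict (U : Set Space) (w : sobolevSpace) :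
    sobolevRestrict U w =ᵐ[volume.restrict U] sobolevEmb w :=
  LpToLpRestrictCLM_coeFn ℂ U (sobolevEmb w)

theorem continuous_re_inner_self {W : Type*} [NormedAddCommGroup W]
    [InnerProductSpace ℂ W] (B : W →L[ℂ] W) : Continuous fun u => (⟪u, B u⟫_ℂ).re := by
  fun_prop

theorem continuous_norm_form_sub {W H₁ : Type*} [NormedAddCommGroup W]
    [InnerProductSpace ℂ W] [NormedAddCommGroup H₁] [InnerProductSpace ℂ H₁] (B : W →L[ℂ] W)
    (ι : W →L[ℂ] H₁) (r : ℂ) (ψ : W) :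
    Continuous fun v => ‖⟪v, B ψ⟫_ℂ - r * ⟪ι v, ι ψ⟫_ℂ‖ := by
  fun_prop

section Abstract

variable {W H₁ H₂ H₃ : Type*} [NormedAddCommGroup W] [InnerProductSpace ℂ W] [CompleteSpace W]
  [NormedAddCommGroup H₁] [InnerProductSpace ℂ H₁] [CompleteSpace H₁]
  [NormedAddCommGroup H₂] [InnerProductSpace ℂ H₂] [CompleteSpace H₂]
  [NormedAddCommGroup H₃] [InnerProductSpace ℂ H₃] [CompleteSpace H₃]
  {κ : Type*} [Fintype κ]

/-- The operator `∑ᵢ Dᵢ* Dᵢ + b R* R - a T* T`. -/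
def gramOperator (D : κ → W →L[ℂ] H₁) (R : W →L[ℂ] H₂) (T : W →L[ℂ] H₃) (a b : ℝ) : W →L[ℂ] W :=
  (∑ i, (D i).adjoint ∘L D i) + (b : ℂ) • (R.adjoint ∘L R) - (a : ℂ) • (T.adjoint ∘L T)

variable (D : κ → W →L[ℂ] H₁) (R : W →L[ℂ] H₂) (T : W →L[ℂ] H₃) (a b : ℝ) (v u : W)

theorem inner_gramOperator : ⟪v, gramOperator D R T a b u⟫_ℂ =
    (∑ i, ⟪D i v, D i u⟫_ℂ) + b * ⟪R v, R u⟫_ℂ - a * ⟪T v, T u⟫_ℂ := by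
  simp only [gramOperator, sub_apply, add_apply, sum_apply, smul_apply,
    ContinuousLinearMap.comp_apply, inner_sub_right, inner_add_right, inner_sum, inner_smul_right,
    ContinuousLinearMap.adjoint_inner_right]

theorem inner_gramOperator_left :
    ⟪gramOperator D R T a b v, u⟫_ℂ = ⟪v, gramOperator D R T a b u⟫_ℂ := by
  rw [← inner_conj_symm, inner_gramOperator, inner_gramOperator]
  simp [inner_conj_symm]

theorem re_inner_gramOperator : (⟪u, gramOperator D R T a b u⟫_ℂ).re =
    (∑ i, ‖D i u‖ ^ 2) + b * ‖R u‖ ^ 2 - a * ‖T u‖ ^ 2 := by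
  rw [inner_gramOperator]
  simp only [inner_self_eq_norm_sq_to_K]
  rw [← Complex.ofReal_re (_ - _)]
  push_cast
  rfl

end Abstract

/-- The bounded operator on `H¹(ℝ³)` that represents the form
`∑ᵢ (∂ᵢv, ∂ᵢu) + V₀ (v, u)_U - α (tr v, tr u)`. -/
def formOperator (h : HasTraceBound Φ) (α V₀ : ℝ) (U : Set Space) :
    sobolevSpace →L[ℂ] sobolevSpace :=
  gramOperator sobolevDeriv (sobolevRestrict U) h.traceOp α V₀

theorem inner_formOperator (h : HasTraceBound Φ) (α V₀ : ℝ) (U : Set Space) (v u : sobolevSpace) :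
    ⟪v, formOperator h α V₀ U u⟫_ℂ = (∑ i, ⟪sobolevDeriv i v, sobolevDeriv i u⟫_ℂ) +
      V₀ * ⟪sobolevRestrict U v, sobolevRestrict U u⟫_ℂ - α * ⟪h.traceOp v, h.traceOp u⟫_ℂ :=
  inner_gramOperator _ _ _ _ _ _ _

theorem re_inner_formOperator (h : HasTraceBound Φ) (α V₀ : ℝ) (U : Set Space)
    (u : sobolevSpace) :
    (⟪u, formOperator h α V₀ U u⟫_ℂ).re = (∑ i, ‖sobolevDeriv i u‖ ^ 2) +
      V₀ * ‖sobolevRestrict U u‖ ^ 2 - α * ‖h.traceOp u‖ ^ 2 :=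
  re_inner_gramOperator _ _ _ _ _ _

theorem exists_half_gradient_le (h : HasTraceBound Φ) {α V₀ : ℝ} (hα : 0 < α) (hV₀ : 0 ≤ V₀)
    (U : Set Space) : ∃ C : ℝ, 0 ≤ C ∧ ∀ u : sobolevSpace, 1 / 2 * ∑ i, ‖sobolevDeriv i u‖ ^ 2 ≤
      (⟪u, formOperator h α V₀ U u⟫_ℂ).re + C * ‖sobolevEmb u‖ ^ 2 := by
  obtain ⟨K, hK, hle⟩ := h.traceOp_norm_sq_le (η := 1 / (2 * α)) (by positivity)
  refine ⟨α * K, by positivity, fun u => ?_⟩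
  rw [re_inner_formOperator]
  have h1 := mul_le_mul_of_nonneg_left (hle u) hα.le
  have h2 : α * (1 / (2 * α) * ∑ i, ‖sobolevDeriv i u‖ ^ 2 + K * ‖sobolevEmb u‖ ^ 2) =
      1 / 2 * (∑ i, ‖sobolevDeriv i u‖ ^ 2) + α * K * ‖sobolevEmb u‖ ^ 2 := by
    field_simp
  have h3 : 0 ≤ V₀ * ‖sobolevRestrict U u‖ ^ 2 := by positivity
  linarith

theorem exists_formData (h : HasTraceBound Φ) {α V₀ : ℝ} (hα : 0 < α) (hV₀ : 0 ≤ V₀)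
    (U : Set Space) : ∃ C, FormData sobolevEmb (formOperator h α V₀ U) (1 / 2) C := by
  obtain ⟨C, hC, hle⟩ := exists_half_gradient_le h hα hV₀ U
  refine ⟨C + 1 / 2, sobolevEmb_injective, denseRange_sobolevEmb,
    fun _ _ => inner_gramOperator_left _ _ _ _ _ _ _, by norm_num, fun u => ?_⟩
  have := hle u
  rw [sobolev_norm_sq]
  linarith

theorem deltaForm_sobolevEmb (h : HasTraceBound Φ) (α : ℝ) {V₀ : ℝ} {V : Space → ℝ} {U U' : Set Space}
    (hU : MeasurableSet U) (hae : ∀ᵐ x : Space, x ∈ U ∪ U') (hV : ∀ x ∈ U, V x = V₀)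
    (hV' : ∀ x ∈ U', V x = 0) (hd : Disjoint U U') (v u : sobolevSpace) :
    deltaForm α V Φ (sobolevEmb v) (sobolevEmb u) = ⟪v, formOperator h α V₀ U u⟫_ℂ := by
  rw [inner_formOperator, deltaForm, h.trace_sobolevEmb, h.trace_sobolevEmb]
  simp only [weakPartial_sobolevEmb]
  congr 2
  rw [L2.inner_def, ← integral_const_mul]
  have h1 : ∀ᵐ x ∂(volume.restrict U),
      (V₀ : ℂ) * ⟪sobolevRestrict U v x, sobolevRestrict U u x⟫_ℂ =
        (V₀ : ℂ) * ⟪sobolevEmb v x, sobolevEmb u x⟫_ℂ := by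
    filter_upwards [coeFn_sobolevRestrict U v, coeFn_sobolevRestrict U u] with x h1 h2
    rw [h1, h2]
  rw [integral_congr_ae h1, ← integral_indicator hU]
  refine integral_congr_ae ?_
  filter_upwards [hae] with x hx
  rcases hx with hx | hx
  · rw [Set.indicator_of_mem hx, hV x hx]
  · rw [Set.indicator_of_notMem (Set.disjoint_right.1 hd hx), hV' x hx]; simp

/-! ### The form on test functions -/

/-- The energy `‖∇φ‖² + V₀ ‖φ‖²_U - α ‖φ ∘ Φ‖²` of a test function. -/
def energy (Φ : Plane → Space) (α V₀ : ℝ) (U : Set Space) (φ : Space → ℂ) : ℝ :=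
  (∑ i, ∫ x, ‖pderiv i φ x‖ ^ 2) + V₀ * (∫ x in U, ‖φ x‖ ^ 2) -
    α * ∫ s, ‖φ (Φ s)‖ ^ 2 ∂surfaceMeasure Φ

/-- The polarized energy
`∑ᵢ (∂ᵢv, ∂ᵢφ) + V₀ (v, φ)_U - α (v ∘ Φ, φ ∘ Φ)` of two test functions. -/
def energyPairing (Φ : Plane → Space) (α V₀ : ℝ) (U : Set Space) (v φ : Space → ℂ) : ℂ :=
  (∑ i, ∫ x, starRingEnd ℂ (pderiv i v x) * pderiv i φ x) +
    V₀ * (∫ x in U, starRingEnd ℂ (v x) * φ x) -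
    α * ∫ s, starRingEnd ℂ (v (Φ s)) * φ (Φ s) ∂surfaceMeasure Φ

theorem inner_toLp {X : Type*} [MeasurableSpace X] {ν : Measure X} {f g : X → ℂ}
    (hf : MemLp f 2 ν) (hg : MemLp g 2 ν) :
    ⟪hf.toLp f, hg.toLp g⟫_ℂ = ∫ x, starRingEnd ℂ (f x) * g x ∂ν := by
  rw [L2.inner_def]
  refine integral_congr_ae ?_
  filter_upwards [hf.coeFn_toLp, hg.coeFn_toLp] with x h1 h2
  rw [h1, h2]
  simp [mul_comm]

theorem norm_toLp_sq {X : Type*} [MeasurableSpace X] {ν : Measure X} {f : X → ℂ}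
    (hf : MemLp f 2 ν) : ‖hf.toLp f‖ ^ 2 = ∫ x, ‖f x‖ ^ 2 ∂ν := by
  have h1 := inner_self_eq_norm_sq_to_K (𝕜 := ℂ) (hf.toLp f)
  rw [inner_toLp] at h1
  have h2 : ∀ x, starRingEnd ℂ (f x) * f x = ((‖f x‖ ^ 2 : ℝ) : ℂ) := fun x => by
    rw [← Complex.normSq_eq_conj_mul_self, Complex.normSq_eq_norm_sq]
  simp_rw [h2] at h1
  have h3 : ∫ x, ((‖f x‖ ^ 2 : ℝ) : ℂ) ∂ν = ((∫ x, ‖f x‖ ^ 2 ∂ν : ℝ) : ℂ) := integral_ofReal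
  rw [h3] at h1
  refine (Complex.ofReal_injective ?_).symm
  rw [h1]
  simp

theorem sobolevRestrict_test (U : Set Space) (φ : testFunctions) :
    sobolevRestrict U (testToSobolev φ) = ((IsTestFunction.memLp φ.2 2).restrict U).toLp _ := by
  refine Lp.ext ?_
  filter_upwards [coeFn_sobolevRestrict U (testToSobolev φ),
    ((IsTestFunction.memLp φ.2 2).restrict U).coeFn_toLp,
    ae_restrict_of_ae (s := U) (IsTestFunction.coeFn_toL2 φ.2)] with x h1 h2 h3
  rw [h1, h2, ← h3]
  rfl

theorem inner_formOperator_test (h : HasTraceBound Φ) (α V₀ : ℝ) (U : Set Space)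
    (v φ : testFunctions) :
    ⟪testToSobolev v, formOperator h α V₀ U (testToSobolev φ)⟫_ℂ = energyPairing Φ α V₀ U v φ := by
  rw [inner_formOperator, h.traceOp_test, h.traceOp_test, sobolevRestrict_test,
    sobolevRestrict_test, inner_toLp, energyPairing]
  congr 2
  · refine Finset.sum_congr rfl fun i _ => ?_
    exact inner_toLp ((IsTestFunction.pderiv v.2 i).memLp 2) ((IsTestFunction.pderiv φ.2 i).memLp 2)
  · exact inner_toLp (h.memLp v) (h.memLp φ)

theorem re_inner_formOperator_test (h : HasTraceBound Φ) (α V₀ : ℝ) (U : Set Space)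
    (φ : testFunctions) :
    (⟪testToSobolev φ, formOperator h α V₀ U (testToSobolev φ)⟫_ℂ).re = energy Φ α V₀ U φ := by
  rw [re_inner_formOperator, h.traceOp_test, sobolevRestrict_test, norm_toLp_sq, energy]
  congr 2
  · refine Finset.sum_congr rfl fun i _ => ?_
    exact norm_toLp_sq ((IsTestFunction.pderiv φ.2 i).memLp 2)
  · exact norm_toLp_sq (h.memLp φ)

theorem sobolevEmb_test_norm_sq (φ : testFunctions) :
    ‖sobolevEmb (testToSobolev φ)‖ ^ 2 = ∫ x, ‖(φ : Space → ℂ) x‖ ^ 2 :=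
  norm_toLp_sq (IsTestFunction.memLp φ.2 2)

/-- Lower bounds modulo finitely many functionals need only be verified for test functions. -/
theorem boundedBelowModFinite_of_test (h : HasTraceBound Φ) {α V₀ : ℝ} {U : Set Space} {m : ℝ}
    {N : ℕ} (g : Fin N → L2Space) {K : ℝ} (hK : 0 ≤ K)
    (hle : ∀ φ (hφ : IsTestFunction φ), m * ∫ x, ‖φ x‖ ^ 2 ≤
      energy Φ α V₀ U φ + K * ∑ j, ‖⟪g j, hφ.toL2⟫_ℂ‖ ^ 2) :
    BoundedBelowModFinite sobolevEmb (formOperator h α V₀ U) m := by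
  refine ⟨N, g, K, hK, fun u => ?_⟩
  refine denseRange_testToSobolev.induction_on u ?_ fun φ => ?_
  · refine isClosed_le (by fun_prop) ?_
    exact (continuous_re_inner_self _).add (by fun_prop)
  · rw [re_inner_formOperator_test, sobolevEmb_test_norm_sq]
    exact hle φ φ.2

/-- Approximate eigenfunctions of the form need only be tested against test functions. -/
theorem isApproxFormEigenvalue_of_test (h : HasTraceBound Φ) {α V₀ : ℝ} {U : Set Space} {r : ℝ}
    (hr : ∀ ε > 0, ∃ ψ, ∃ _ : IsTestFunction ψ, 0 < ∫ x, ‖ψ x‖ ^ 2 ∧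
      ∀ v (hv : IsTestFunction v),
        ‖energyPairing Φ α V₀ U v ψ - r * ∫ x, starRingEnd ℂ (v x) * ψ x‖ ≤
          ε * ‖hv.toSobolev‖ * √(∫ x, ‖ψ x‖ ^ 2)) :
    IsApproxFormEigenvalue sobolevEmb (formOperator h α V₀ U) r := by
  intro ε hε
  obtain ⟨ψ, hψ, hpos, hle⟩ := hr ε hε
  have hnorm := sobolevEmb_test_norm_sq ⟨ψ, hψ⟩
  refine ⟨testToSobolev ⟨ψ, hψ⟩, fun h0 => ?_, fun v => ?_⟩
  · rw [h0] at hnorm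
    simp at hnorm
    exact hpos.ne hnorm
  · refine denseRange_testToSobolev.induction_on v ?_ fun v => ?_
    · exact isClosed_le (continuous_norm_form_sub _ _ _ _) (by fun_prop)
    · rw [inner_formOperator_test]
      have h1 : ⟪sobolevEmb (testToSobolev v), sobolevEmb (testToSobolev ⟨ψ, hψ⟩)⟫_ℂ =
          ∫ x, starRingEnd ℂ ((v : Space → ℂ) x) * ψ x :=
        inner_toLp (IsTestFunction.memLp v.2 2) (IsTestFunction.memLp hψ 2)
      rw [h1, ← Real.sqrt_sq (norm_nonneg (sobolevEmb (testToSobolev ⟨ψ, hψ⟩))), hnorm]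
      exact hle v v.2

end DeltaForm

/-! ### Geometry of surfaces with small curvature -/

noncomputable section SurfaceGeometry

theorem Space.inner_eq (x y : Space) : ⟪x, y⟫_ℝ = x 0 * y 0 + x 1 * y 1 + x 2 * y 2 := by
  simp [PiLp.inner_apply, Fin.sum_univ_three]
  ring

theorem Space.norm_sq_eq (x : Space) : ‖x‖ ^ 2 = x 0 ^ 2 + x 1 ^ 2 + x 2 ^ 2 := by
  rw [← real_inner_self_eq_norm_sq, Space.inner_eq]; ring

variable {Φ : Plane → Space} {s : Plane}

theorem normalVec_apply_zero : normalVec Φ s 0 =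
    tangentVec Φ s 0 1 * tangentVec Φ s 1 2 - tangentVec Φ s 0 2 * tangentVec Φ s 1 1 := by
  simp [normalVec, cross_apply]

theorem normalVec_apply_one : normalVec Φ s 1 =
    tangentVec Φ s 0 2 * tangentVec Φ s 1 0 - tangentVec Φ s 0 0 * tangentVec Φ s 1 2 := by
  simp [normalVec, cross_apply]

theorem normalVec_apply_two : normalVec Φ s 2 =
    tangentVec Φ s 0 0 * tangentVec Φ s 1 1 - tangentVec Φ s 0 1 * tangentVec Φ s 1 0 := by
  simp [normalVec, cross_apply]

theorem norm_normalVec_sq (Φ : Plane → Space) (s : Plane) :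
    ‖normalVec Φ s‖ ^ 2 = (metricTensor Φ s).det := by
  rw [det_metricTensor_eq, Space.norm_sq_eq, Space.norm_sq_eq, Space.norm_sq_eq, Space.inner_eq,
    normalVec_apply_zero, normalVec_apply_one, normalVec_apply_two]
  ring

theorem norm_normalVec (Φ : Plane → Space) (s : Plane) :
    ‖normalVec Φ s‖ = √(metricTensor Φ s).det := by
  rw [← norm_normalVec_sq, Real.sqrt_sq (norm_nonneg _)]

theorem inner_normalVec_tangentVec (Φ : Plane → Space) (s : Plane) (i : Fin 2) :
    ⟪normalVec Φ s, tangentVec Φ s i⟫_ℝ = 0 := by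
  rw [Space.inner_eq, normalVec_apply_zero, normalVec_apply_one, normalVec_apply_two]
  fin_cases i <;> simp <;> ring

/-- The size of a vector in terms of its inner products with the normal and the tangent vectors. -/
theorem norm_sq_mul_norm_normalVec_sq (x : Space) : ‖x‖ ^ 2 * ‖normalVec Φ s‖ ^ 2 =
    ⟪normalVec Φ s, x⟫_ℝ ^ 2 + ‖⟪x, tangentVec Φ s 1⟫_ℝ • tangentVec Φ s 0 -
      ⟪x, tangentVec Φ s 0⟫_ℝ • tangentVec Φ s 1‖ ^ 2 := by
  simp only [Space.norm_sq_eq, Space.inner_eq, normalVec_apply_zero, normalVec_apply_one,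
    normalVec_apply_two, PiLp.sub_apply, PiLp.smul_apply, smul_eq_mul]
  ring

theorem fderiv_eq_sum_tangentVec (Φ : Plane → Space) (s v : Plane) :
    fderiv ℝ Φ s v = v 0 • tangentVec Φ s 0 + v 1 • tangentVec Φ s 1 := by
  have hv : v = ∑ i, v i • EuclideanSpace.single i (1 : ℝ) := by
    ext k; fin_cases k <;> simp [Fin.sum_univ_two]
  conv_lhs => rw [hv]
  simp [tangentVec, Fin.sum_univ_two]

/-- A symmetric form with at most the eigenvalue `ε` relative to `g` is bounded by `ε g`. -/
theorem form_le_of_eigenvalue_le {g₀ g₁ g₂ h₀ h₁ h₂ ε : ℝ} (hg : 0 < g₀)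
    (hd : 0 < g₀ * g₂ - g₁ ^ 2)
    (hk : ∀ k, (h₀ - k * g₀) * (h₂ - k * g₂) - (h₁ - k * g₁) ^ 2 = 0 → k ≤ ε) (x y : ℝ) :
    h₀ * x ^ 2 + 2 * h₁ * x * y + h₂ * y ^ 2 ≤
      ε * (g₀ * x ^ 2 + 2 * g₁ * x * y + g₂ * y ^ 2) := by
  set p : ℝ → ℝ := fun k => (h₀ - k * g₀) * (h₂ - k * g₂) - (h₁ - k * g₁) ^ 2 with hp
  have hcont : Continuous p := by fun_prop
  -- the determinant is positive for large `k`, hence for all `k > ε`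
  have hroot : ∀ k, p k ≤ 0 → k ≤ ε := by
    intro k hpk
    have hlim : Tendsto p atTop atTop := by
      have : p = fun k => k * (k * (g₀ * g₂ - g₁ ^ 2) - (h₀ * g₂ + h₂ * g₀ - 2 * h₁ * g₁)) +
          (h₀ * h₂ - h₁ ^ 2) := by
        funext k; simp only [hp]; ring
      rw [this]
      refine tendsto_atTop_add_const_right _ _ (tendsto_id.atTop_mul_atTop₀ ?_)
      exact tendsto_atTop_add_const_right _ _ (tendsto_id.atTop_mul_const hd)
    obtain ⟨l, hl, hkl⟩ := ((hlim.eventually_ge_atTop 0).and (eventually_ge_atTop k)).exists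
    obtain ⟨z, hz, hz0⟩ := intermediate_value_Icc hkl hcont.continuousOn ⟨hpk, hl⟩
    exact hz.1.trans (hk z hz0)
  have hmain : ∀ k, ε < k → 0 ≤ (k * g₀ - h₀) * x ^ 2 + 2 * (k * g₁ - h₁) * x * y +
      (k * g₂ - h₂) * y ^ 2 := by
    intro k hεk
    have hpos : 0 < p k := by
      by_contra h
      exact (hroot k (not_lt.1 h)).not_gt hεk
    have h0 : 0 < k * g₀ - h₀ := by
      by_contra h
      have h1 : k ≤ h₀ / g₀ := by rw [le_div_iff₀ hg]; linarith
      have h2 : p (h₀ / g₀) ≤ 0 := by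
        have : h₀ - h₀ / g₀ * g₀ = 0 := by field_simp; ring
        simp only [hp, this]
        nlinarith [sq_nonneg (h₁ - h₀ / g₀ * g₁)]
      exact (hroot _ h2).not_gt (hεk.trans_le h1)
    have h3 : 0 ≤ (k * g₀ - h₀) * ((k * g₀ - h₀) * x ^ 2 + 2 * (k * g₁ - h₁) * x * y +
        (k * g₂ - h₂) * y ^ 2) := by
      have : (k * g₀ - h₀) * ((k * g₀ - h₀) * x ^ 2 + 2 * (k * g₁ - h₁) * x * y +
        (k * g₂ - h₂) * y ^ 2) = ((k * g₀ - h₀) * x + (k * g₁ - h₁) * y) ^ 2 + p k * y ^ 2 := by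
        simp only [hp]; ring
      rw [this]; positivity
    exact nonneg_of_mul_nonneg_right h3 h0
  have hlim : Tendsto (fun k => (k * g₀ - h₀) * x ^ 2 + 2 * (k * g₁ - h₁) * x * y +
      (k * g₂ - h₂) * y ^ 2) (𝓝[>] ε) (𝓝 ((ε * g₀ - h₀) * x ^ 2 + 2 * (ε * g₁ - h₁) * x * y +
      (ε * g₂ - h₂) * y ^ 2)) :=
    (Continuous.tendsto (by fun_prop) ε).mono_left nhdsWithin_le_nhds
  have := ge_of_tendsto hlim (eventually_nhdsWithin_of_forall hmain)
  linarith

/-- A point at which the surface is `C²`, with ellipticity constants `c₁`, `c₂` of the metric and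
with principal curvatures bounded by `ε`. -/
structure IsNearlyFlatAt (Φ : Plane → Space) (c₁ c₂ ε : ℝ) (s : Plane) : Prop where
  pos : 0 < c₁
  nonneg : 0 ≤ ε
  contDiffAt : ContDiffAt ℝ 2 Φ s
  le_metric : ∀ v : Plane, c₁ * ‖v‖ ^ 2 ≤ ∑ i, ∑ j, metricTensor Φ s i j * v i * v j
  metric_le : ∀ v : Plane, ∑ i, ∑ j, metricTensor Φ s i j * v i * v j ≤ c₂ * ‖v‖ ^ 2
  curvature_le : ∀ k, IsPrincipalCurvature Φ s k → |k| ≤ ε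

namespace IsNearlyFlatAt

variable {c₁ c₂ ε : ℝ}

theorem norm_fderiv_sq_le (h : IsNearlyFlatAt Φ c₁ c₂ ε s) (v : Plane) :
    ‖fderiv ℝ Φ s v‖ ^ 2 ≤ c₂ * ‖v‖ ^ 2 := by
  have := h.metric_le v
  rwa [sum_metricTensor_eq] at this

theorem le_norm_fderiv_sq (h : IsNearlyFlatAt Φ c₁ c₂ ε s) (v : Plane) :
    c₁ * ‖v‖ ^ 2 ≤ ‖fderiv ℝ Φ s v‖ ^ 2 := by
  have := h.le_metric v
  rwa [sum_metricTensor_eq] at this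

theorem norm_tangentVec_sq_le (h : IsNearlyFlatAt Φ c₁ c₂ ε s) (i : Fin 2) :
    ‖tangentVec Φ s i‖ ^ 2 ≤ c₂ := by
  simpa [tangentVec] using h.norm_fderiv_sq_le (EuclideanSpace.single i 1)

theorem le_norm_tangentVec_sq (h : IsNearlyFlatAt Φ c₁ c₂ ε s) (i : Fin 2) :
    c₁ ≤ ‖tangentVec Φ s i‖ ^ 2 := by
  simpa [tangentVec] using h.le_norm_fderiv_sq (EuclideanSpace.single i 1)

theorem c₂_pos (h : IsNearlyFlatAt Φ c₁ c₂ ε s) : 0 < c₂ :=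
  h.pos.trans_le ((h.le_norm_tangentVec_sq 0).trans (h.norm_tangentVec_sq_le 0))

theorem sq_le_det (h : IsNearlyFlatAt Φ c₁ c₂ ε s) : c₁ ^ 2 ≤ (metricTensor Φ s).det := by
  set a := ‖tangentVec Φ s 0‖ ^ 2 with ha
  set b := ⟪tangentVec Φ s 0, tangentVec Φ s 1⟫_ℝ with hb
  have h0 : c₁ ≤ a := h.le_norm_tangentVec_sq 0
  have ha0 : 0 < a := h.pos.trans_le h0
  have h1 := h.le_norm_fderiv_sq !₂[-b / a, 1]
  rw [fderiv_eq_sum_tangentVec, EuclideanSpace.norm_sq_eq, Fin.sum_univ_two] at h1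
  simp only [PiLp.toLp_apply, Matrix.cons_val_zero, Matrix.cons_val_one, one_smul,
    norm_add_sq_real, norm_smul, Real.norm_eq_abs, inner_smul_left, mul_pow, sq_abs, ← ha,
    ← hb, abs_one, one_pow] at h1
  rw [det_metricTensor_eq, ← ha, ← hb]
  simp only [RCLike.conj_to_real] at h1
  have h2 : (-b / a) ^ 2 * a + 2 * (-b / a * b) + ‖tangentVec Φ s 1‖ ^ 2 =
      (a * ‖tangentVec Φ s 1‖ ^ 2 - b ^ 2) / a := by field_simp; ring
  rw [h2, le_div_iff₀ ha0] at h1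
  have h3 : 0 ≤ (-b / a) ^ 2 := sq_nonneg _
  have h4 := h.pos
  calc c₁ ^ 2 = c₁ * 1 * c₁ := by ring
    _ ≤ c₁ * ((-b / a) ^ 2 + 1) * a := by gcongr; linarith
    _ ≤ _ := h1

theorem le_norm_normalVec (h : IsNearlyFlatAt Φ c₁ c₂ ε s) : c₁ ≤ ‖normalVec Φ s‖ := by
  refine le_of_sq_le_sq ?_ (norm_nonneg _)
  rw [norm_normalVec_sq]
  exact h.sq_le_det

theorem normalVec_ne_zero (h : IsNearlyFlatAt Φ c₁ c₂ ε s) : normalVec Φ s ≠ 0 :=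
  norm_pos_iff.1 (h.pos.trans_le h.le_norm_normalVec)

theorem norm_unitNormal (h : IsNearlyFlatAt Φ c₁ c₂ ε s) : ‖unitNormal Φ s‖ = 1 := by
  rw [unitNormal, norm_smul, norm_inv, norm_norm,
    inv_mul_cancel₀ (norm_ne_zero_iff.2 h.normalVec_ne_zero)]

theorem contDiffAt_tangentVec (h : IsNearlyFlatAt Φ c₁ c₂ ε s) (j : Fin 2) :
    ContDiffAt ℝ 1 (fun t => tangentVec Φ t j) s :=
  (h.contDiffAt.fderiv_right (m := 1) (by norm_num)).clm_apply contDiffAt_const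

theorem secondForm_comm (h : IsNearlyFlatAt Φ c₁ c₂ ε s) :
    secondForm Φ s 0 1 = secondForm Φ s 1 0 := by
  have hd : DifferentiableAt ℝ (fderiv ℝ Φ) s :=
    (h.contDiffAt.fderiv_right (m := 1) (by norm_num)).differentiableAt (by norm_num)
  have h1 : ∀ i j : Fin 2, fderiv ℝ (fun t => tangentVec Φ t j) s (EuclideanSpace.single i 1) =
      fderiv ℝ (fderiv ℝ Φ) s (EuclideanSpace.single i 1) (EuclideanSpace.single j 1) := by
    intro i j
    have h2 : HasFDerivAt (fun t => tangentVec Φ t j) _ s :=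
      hd.hasFDerivAt.clm_apply (hasFDerivAt_const (EuclideanSpace.single j (1 : ℝ)) s)
    rw [h2.fderiv]
    simp
  have hsymm : IsSymmSndFDerivAt ℝ Φ s := h.contDiffAt.isSymmSndFDerivAt (by simp)
  simp only [secondForm, Matrix.of_apply, h1]
  rw [hsymm.eq]

/-- The second fundamental form is small as a quadratic form: its eigenvalues relative to the metric
are the principal curvatures, and the metric is bounded by `c₂`. -/
theorem abs_form_le (h : IsNearlyFlatAt Φ c₁ c₂ ε s) (x y : ℝ) :
    |secondForm Φ s 0 0 * x ^ 2 + 2 * secondForm Φ s 0 1 * x * y + secondForm Φ s 1 1 * y ^ 2| ≤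
      ε * c₂ * (x ^ 2 + y ^ 2) := by
  set g := metricTensor Φ s with hgdef
  set b := secondForm Φ s with hbdef
  have hg10 : g 1 0 = g 0 1 := by
    simp only [hgdef, metricTensor, Matrix.of_apply]; exact real_inner_comm _ _
  have hb10 : b 1 0 = b 0 1 := h.secondForm_comm.symm
  have hg0 : 0 < g 0 0 := by
    have := h.le_norm_tangentVec_sq 0
    simp only [hgdef, metricTensor, Matrix.of_apply, real_inner_self_eq_norm_sq]
    linarith [h.pos]
  have hd : 0 < g 0 0 * g 1 1 - g 0 1 ^ 2 := by
    have h1 := h.sq_le_det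
    rw [Matrix.det_fin_two, ← hgdef, hg10] at h1
    nlinarith [pow_pos h.pos 2]
  have hpc : ∀ k, (b 0 0 - k * g 0 0) * (b 1 1 - k * g 1 1) - (b 0 1 - k * g 0 1) ^ 2 = 0 →
      |k| ≤ ε := by
    intro k hk
    refine h.curvature_le k ?_
    have hdet : (b - k • g).det = 0 := by
      rw [Matrix.det_fin_two]
      simp only [Matrix.sub_apply, Matrix.smul_apply, smul_eq_mul, hb10, hg10]
      linear_combination hk
    obtain ⟨v, hv, hv0⟩ := Matrix.exists_mulVec_eq_zero_iff.2 hdet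
    refine ⟨v, hv, ?_⟩
    rw [Matrix.sub_mulVec, Matrix.smul_mulVec, sub_eq_zero] at hv0
    exact hv0
  have hgle : g 0 0 * x ^ 2 + 2 * g 0 1 * x * y + g 1 1 * y ^ 2 ≤ c₂ * (x ^ 2 + y ^ 2) := by
    have h1 := h.metric_le !₂[x, y]
    rw [EuclideanSpace.norm_sq_eq] at h1
    simp only [Fin.sum_univ_two, PiLp.toLp_apply, Matrix.cons_val_zero, Matrix.cons_val_one,
      Real.norm_eq_abs, sq_abs, ← hgdef, hg10] at h1
    linarith
  have hle := mul_le_mul_of_nonneg_left hgle h.nonneg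
  have hup := form_le_of_eigenvalue_le hg0 hd (fun k hk => (le_abs_self k).trans (hpc k hk)) x y
  have hlow := form_le_of_eigenvalue_le (h₀ := -b 0 0) (h₁ := -b 0 1) (h₂ := -b 1 1) (ε := ε) hg0 hd
    (fun k hk => by
      have := hpc (-k) (by linear_combination hk)
      rw [abs_neg] at this
      exact (le_abs_self k).trans this) x y
  rw [abs_le]
  constructor <;> linarith

theorem abs_secondForm_le (h : IsNearlyFlatAt Φ c₁ c₂ ε s) (i j : Fin 2) :
    |secondForm Φ s i j| ≤ ε * c₂ := by
  have h1 := abs_le.1 (h.abs_form_le 1 0)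
  have h2 := abs_le.1 (h.abs_form_le 0 1)
  have h3 := abs_le.1 (h.abs_form_le 1 1)
  have h4 := abs_le.1 (h.abs_form_le 1 (-1))
  have h5 := h.secondForm_comm
  rw [abs_le]
  fin_cases i <;> fin_cases j <;> simp <;> constructor <;> linarith

theorem differentiableAt_unitNormal (h : IsNearlyFlatAt Φ c₁ c₂ ε s) :
    DifferentiableAt ℝ (unitNormal Φ) s := by
  have ht : ∀ (j : Fin 2) (k : Fin 3), DifferentiableAt ℝ (fun t => tangentVec Φ t j k) s :=
    fun j k => (EuclideanSpace.proj (𝕜 := ℝ) k : Space →L[ℝ] ℝ).differentiableAt.comp s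
      ((h.contDiffAt_tangentVec j).differentiableAt (by norm_num))
  have hN : DifferentiableAt ℝ (normalVec Φ) s := by
    rw [differentiableAt_euclidean]
    intro k
    fin_cases k
    · exact (((ht 0 1).mul (ht 1 2)).sub ((ht 0 2).mul (ht 1 1))).congr_of_eventuallyEq
        (Eventually.of_forall fun t => normalVec_apply_zero)
    · exact (((ht 0 2).mul (ht 1 0)).sub ((ht 0 0).mul (ht 1 2))).congr_of_eventuallyEq
        (Eventually.of_forall fun t => normalVec_apply_one)
    · exact (((ht 0 0).mul (ht 1 1)).sub ((ht 0 1).mul (ht 1 0))).congr_of_eventuallyEq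
        (Eventually.of_forall fun t => normalVec_apply_two)
  exact ((hN.norm ℝ h.normalVec_ne_zero).inv (norm_ne_zero_iff.2 h.normalVec_ne_zero)).smul hN

theorem inner_unitNormal_tangentVec (Φ : Plane → Space) (s : Plane) (j : Fin 2) :
    ⟪unitNormal Φ s, tangentVec Φ s j⟫_ℝ = 0 := by
  rw [unitNormal, inner_smul_left, inner_normalVec_tangentVec, mul_zero]

theorem inner_unitNormal_fderiv (Φ : Plane → Space) (s v : Plane) :
    ⟪unitNormal Φ s, fderiv ℝ Φ s v⟫_ℝ = 0 := by
  rw [fderiv_eq_sum_tangentVec, inner_add_right, inner_smul_right, inner_smul_right,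
    inner_unitNormal_tangentVec, inner_unitNormal_tangentVec]
  simp

/-- The derivative of the normal is given by the second fundamental form. -/
theorem inner_fderiv_unitNormal_tangentVec (h : IsNearlyFlatAt Φ c₁ c₂ ε s) (i j : Fin 2) :
    ⟪fderiv ℝ (unitNormal Φ) s (EuclideanSpace.single i 1), tangentVec Φ s j⟫_ℝ =
      -secondForm Φ s i j := by
  have h1 := h.differentiableAt_unitNormal.hasFDerivAt.inner ℝ
    ((h.contDiffAt_tangentVec j).differentiableAt (by norm_num)).hasFDerivAt
  have h2 : (fun t => ⟪unitNormal Φ t, tangentVec Φ t j⟫_ℝ) = fun _ => (0 : ℝ) :=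
    funext fun t => inner_unitNormal_tangentVec Φ t j
  rw [h2] at h1
  have h3 := congrArg (fun L => L (EuclideanSpace.single i 1)) (h1.unique (hasFDerivAt_const 0 s))
  simp at h3
  rw [secondForm, Matrix.of_apply]
  linarith

theorem inner_unitNormal_fderiv_unitNormal (h : IsNearlyFlatAt Φ c₁ c₂ ε s)
    (hn : ∀ᶠ t in 𝓝 s, ‖unitNormal Φ t‖ = 1) (v : Plane) :
    ⟪unitNormal Φ s, fderiv ℝ (unitNormal Φ) s v⟫_ℝ = 0 := by
  have h1 := h.differentiableAt_unitNormal.hasFDerivAt.inner ℝ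
    h.differentiableAt_unitNormal.hasFDerivAt
  have h2 : (fun t => ⟪unitNormal Φ t, unitNormal Φ t⟫_ℝ) =ᶠ[𝓝 s] fun _ => (1 : ℝ) := by
    filter_upwards [hn] with t ht
    rw [real_inner_self_eq_norm_sq, ht, one_pow]
  have h3 := congrArg (fun L => L v)
    ((h1.congr_of_eventuallyEq h2.symm).unique (hasFDerivAt_const 1 s))
  simp at h3
  rw [real_inner_comm (unitNormal Φ s)] at h3
  linarith

/-- The derivative of the unit normal is tangential, and its tangential components are given by the
second fundamental form (Weingarten's equations), so that small principal curvatures make it small.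
-/
theorem norm_fderiv_unitNormal_le (h : IsNearlyFlatAt Φ c₁ c₂ ε s)
    (hn : ∀ᶠ t in 𝓝 s, ‖unitNormal Φ t‖ = 1) :
    ‖fderiv ℝ (unitNormal Φ) s‖ ≤ 4 * (√c₂ * c₂ / c₁) * ε := by
  have hc₁ := h.pos
  have hc₂ := h.c₂_pos
  have hε := h.nonneg
  have ht : ∀ j, ‖tangentVec Φ s j‖ ≤ √c₂ := fun j =>
    Real.le_sqrt_of_sq_le (h.norm_tangentVec_sq_le j)
  have hi : ∀ i, ‖fderiv ℝ (unitNormal Φ) s (EuclideanSpace.single i 1)‖ ≤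
      2 * (√c₂ * c₂ / c₁) * ε := by
    intro i
    set x := fderiv ℝ (unitNormal Φ) s (EuclideanSpace.single i 1) with hx
    have h0 : ⟪normalVec Φ s, x⟫_ℝ = 0 := by
      have := h.inner_unitNormal_fderiv_unitNormal hn (EuclideanSpace.single i 1)
      rw [unitNormal, inner_smul_left, mul_eq_zero] at this
      refine this.resolve_left ?_
      simpa using h.normalVec_ne_zero
    have h1 := norm_sq_mul_norm_normalVec_sq (Φ := Φ) (s := s) x
    rw [h0, h.inner_fderiv_unitNormal_tangentVec, h.inner_fderiv_unitNormal_tangentVec,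
      zero_pow two_ne_zero, zero_add, ← mul_pow] at h1
    have h2 := (pow_left_inj₀ (by positivity) (norm_nonneg _) two_ne_zero).1 h1
    have h3 : ‖-secondForm Φ s i 1 • tangentVec Φ s 0 - -secondForm Φ s i 0 • tangentVec Φ s 1‖ ≤
        ε * c₂ * √c₂ + ε * c₂ * √c₂ := by
      refine (norm_sub_le _ _).trans ?_
      rw [norm_smul, norm_smul, norm_neg, norm_neg]
      gcongr
      · exact h.abs_secondForm_le i 1
      · exact ht 0
      · exact h.abs_secondForm_le i 0
      · exact ht 1
    have h4 : ‖x‖ * c₁ ≤ ε * c₂ * √c₂ + ε * c₂ * √c₂ :=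
      (mul_le_mul_of_nonneg_left h.le_norm_normalVec (norm_nonneg _)).trans (h2.trans_le h3)
    rw [← le_div_iff₀ hc₁] at h4
    refine h4.trans (le_of_eq ?_)
    ring
  refine ContinuousLinearMap.opNorm_le_bound _ (by positivity) fun v => ?_
  have hv : v = ∑ i, v i • EuclideanSpace.single i (1 : ℝ) := by
    ext k; fin_cases k <;> simp [Fin.sum_univ_two]
  have hvi : ∀ i, ‖v i‖ ≤ ‖v‖ := fun i => PiLp.norm_apply_le v i
  calc ‖fderiv ℝ (unitNormal Φ) s v‖
      = ‖∑ i, v i • fderiv ℝ (unitNormal Φ) s (EuclideanSpace.single i 1)‖ := by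
        conv_lhs => rw [hv]
        simp
    _ ≤ ∑ i : Fin 2, ‖v‖ * (2 * (√c₂ * c₂ / c₁) * ε) := by
        refine (norm_sum_le _ _).trans (Finset.sum_le_sum fun i _ => ?_)
        rw [norm_smul]
        exact mul_le_mul (hvi i) (hi i) (norm_nonneg _) (norm_nonneg _)
    _ = _ := by simp; ring

end IsNearlyFlatAt

end SurfaceGeometry

/-! ### Flat patches of the surface -/

noncomputable section FlatPatches

variable {Φ : Plane → Space} {c : ℝ} {T U U' : Set Space}

theorem edist_le_geodesicDist (S : Set Space) (x y : Space) : edist x y ≤ geodesicDist S x y := by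
  refine le_iInf₂ fun γ hγ => ?_
  obtain ⟨-, -, h0, h1⟩ := hγ
  rw [← h0, ← h1]
  exact eVariationOn.edist_le γ (by simp) (by simp)

/-- The surface is nearly flat outside a bounded set of parameters. By the chord bound such points
leave the singular set, which is compact, and their Euclidean distance from the reference point,
which bounds the geodesic distance from below, is large. -/
theorem exists_isNearlyFlatAt (h : IsChordBound Φ c) (hT : IsSingularSet (Set.range Φ) T)
    (hreg : IsUniformlyEllipticC2Off Φ T) (hpl : IsAsymptoticallyPlanar Φ T) :
    ∃ c₁ c₂ : ℝ, 0 < c₁ ∧ ∀ ε > 0, ∃ R, ∀ s : Plane, R < ‖s‖ → IsNearlyFlatAt Φ c₁ c₂ ε s := by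
  obtain ⟨hC, c₁, c₂, hc₁, hc⟩ := hreg
  obtain ⟨s₀, hs₀⟩ := hpl
  refine ⟨c₁, c₂, hc₁, fun ε hε => ?_⟩
  obtain ⟨R, hR⟩ := hs₀ ε hε
  obtain ⟨M, hM⟩ := hT.isCompact.isBounded.exists_norm_le
  refine ⟨max ((M + ‖Φ 0‖) / c) (‖s₀‖ + max R 0 / c), fun s hs => ?_⟩
  have h1 := (le_max_left _ _).trans_lt hs
  have h2 := (le_max_right _ _).trans_lt hs
  have hsT : Φ s ∉ T := by
    intro hsT
    have h3 := hM _ hsT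
    have h4 := h.2 s 0
    rw [sub_zero] at h4
    have h5 := norm_sub_le (Φ s) (Φ 0)
    rw [div_lt_iff₀ h.1] at h1
    linarith
  have hdist : ENNReal.ofReal R < geodesicDist (Set.range Φ) (Φ s₀) (Φ s) := by
    refine lt_of_lt_of_le ?_ (edist_le_geodesicDist _ _ _)
    rw [edist_dist]
    have h3 : R < dist (Φ s₀) (Φ s) := by
      have h4 := h.2 s s₀
      have h5 := norm_sub_norm_le s s₀
      have h6 : max R 0 / c < ‖s - s₀‖ := by linarith
      rw [div_lt_iff₀ h.1] at h6
      rw [dist_comm, dist_eq_norm]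
      linarith [le_max_left R 0]
    have h3' : 0 < dist (Φ s₀) (Φ s) := by
      have h4 := h.2 s s₀
      have h6 : 0 ≤ max R 0 / c := div_nonneg (le_max_right _ _) h.1.le
      have h7 : 0 < c * ‖s - s₀‖ := mul_pos h.1 (by linarith [norm_sub_norm_le s s₀])
      rw [dist_comm, dist_eq_norm]
      linarith
    exact ENNReal.ofReal_lt_ofReal_iff'.2 ⟨h3, h3'⟩
  exact ⟨hc₁, hε.le, hC s hsT, fun v => (hc s hsT v).1, fun v => (hc s hsT v).2,
    hR s hsT hdist⟩

/-- Far out, the surface is nearly orthogonal to a fixed direction in balls of a given size: its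
normal vector is almost constant there. -/
theorem exists_almost_constant_normal (h : IsChordBound Φ c) (hT : IsSingularSet (Set.range Φ) T)
    (hreg : IsUniformlyEllipticC2Off Φ T) (hpl : IsAsymptoticallyPlanar Φ T) {r δ : ℝ} (hr : 0 < r)
    (hδ : 0 < δ) : ∃ R, ∀ s₁ : Plane, R < ‖s₁‖ → ∃ e : Space, ‖e‖ = 1 ∧
      (∀ s, Φ s ∈ Metric.ball (Φ s₁) r → ContDiffAt ℝ 2 Φ s) ∧
      (∀ s, Φ s ∈ Metric.ball (Φ s₁) r →
        (1 - δ) * √(metricTensor Φ s).det ≤ |⟪normalVec Φ s, e⟫_ℝ|) ∧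
      ∀ s t, Φ s ∈ Metric.ball (Φ s₁) r → Φ t ∈ Metric.ball (Φ s₁) r →
        |⟪Φ s - Φ t, e⟫_ℝ| ≤ δ * ‖Φ s - Φ t‖ := by
  obtain ⟨c₁, c₂, hc₁, hflat⟩ := exists_isNearlyFlatAt h hT hreg hpl
  have hc := h.1
  obtain ⟨R', hR'⟩ := hflat 1 one_pos
  have hc₂ : 0 < c₂ := by
    obtain ⟨s, hs⟩ := NormedSpace.exists_lt_norm ℝ Plane R'
    exact (hR' s hs).c₂_pos
  -- the variation allowed for the unit normal, and the curvature that guarantees it on parameter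
  -- balls of radius `r / c`, which cover the preimages of balls of radius `r`
  set η : ℝ := min (δ * c / √c₂) δ with hη
  have hη0 : 0 < η := by positivity
  set ε : ℝ := η / (4 * (√c₂ * c₂ / c₁) * (r / c)) with hε
  have hε0 : 0 < ε := by positivity
  obtain ⟨R, hR⟩ := hflat ε hε0
  refine ⟨R + r / c, fun s₁ hs₁ => ⟨unitNormal Φ s₁, ?_⟩⟩
  have hgood : ∀ s ∈ Metric.ball s₁ (r / c), IsNearlyFlatAt Φ c₁ c₂ ε s := by
    intro s hs
    refine hR s ?_
    rw [Metric.mem_ball, dist_comm, dist_eq_norm] at hs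
    linarith [norm_sub_norm_le s₁ s]
  have hmem : ∀ s, Φ s ∈ Metric.ball (Φ s₁) r → s ∈ Metric.ball s₁ (r / c) := by
    intro s hs
    rw [Metric.mem_ball, dist_eq_norm] at hs ⊢
    rw [lt_div_iff₀ hc, mul_comm]
    exact (h.2 s s₁).trans_lt hs
  have hs₁mem : s₁ ∈ Metric.ball s₁ (r / c) := Metric.mem_ball_self (by positivity)
  have hnormal : ∀ s ∈ Metric.ball s₁ (r / c), ‖unitNormal Φ s - unitNormal Φ s₁‖ ≤ η := by
    intro s hs
    have h1 := (convex_ball s₁ (r / c)).norm_image_sub_le_of_norm_fderiv_le (𝕜 := ℝ)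
      (f := unitNormal Φ) (C := 4 * (√c₂ * c₂ / c₁) * ε)
      (fun t ht => (hgood t ht).differentiableAt_unitNormal) (fun t ht =>
        (hgood t ht).norm_fderiv_unitNormal_le (by
          filter_upwards [Metric.isOpen_ball.mem_nhds ht] with z hz
          exact (hgood z hz).norm_unitNormal)) hs₁mem hs
    refine h1.trans ?_
    rw [Metric.mem_ball, dist_eq_norm] at hs
    calc 4 * (√c₂ * c₂ / c₁) * ε * ‖s - s₁‖ ≤ 4 * (√c₂ * c₂ / c₁) * ε * (r / c) := by gcongr
      _ = η := by rw [hε]; field_simp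
  refine ⟨(hgood s₁ hs₁mem).norm_unitNormal, fun s hs => (hgood s (hmem s hs)).contDiffAt,
    fun s hs => ?_, fun s t hs ht => ?_⟩
  · have hgs := hgood s (hmem s hs)
    have h1 : ⟪unitNormal Φ s, unitNormal Φ s₁⟫_ℝ =
        1 - ⟪unitNormal Φ s, unitNormal Φ s - unitNormal Φ s₁⟫_ℝ := by
      rw [inner_sub_right, real_inner_self_eq_norm_sq, hgs.norm_unitNormal]; ring
    have h2 := real_inner_le_norm (unitNormal Φ s) (unitNormal Φ s - unitNormal Φ s₁)
    rw [hgs.norm_unitNormal, one_mul] at h2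
    have h3 := h2.trans ((hnormal s (hmem s hs)).trans (min_le_right _ _))
    have h4 : normalVec Φ s = ‖normalVec Φ s‖ • unitNormal Φ s := by
      rw [unitNormal, smul_smul, mul_inv_cancel₀ (norm_ne_zero_iff.2 hgs.normalVec_ne_zero),
        one_smul]
    rw [← norm_normalVec, h4, inner_smul_left, norm_smul, norm_norm, hgs.norm_unitNormal, mul_one,
      mul_comm]
    refine le_trans ?_ (le_abs_self _)
    simp only [RCLike.conj_to_real]
    exact mul_le_mul_of_nonneg_left (by linarith) (norm_nonneg _)
  · have h1 := (convex_ball s₁ (r / c)).norm_image_sub_le_of_norm_fderiv_le (𝕜 := ℝ)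
      (f := fun z => ⟪Φ z, unitNormal Φ s₁⟫_ℝ) (C := √c₂ * η)
      (fun z hz => ((hgood z hz).contDiffAt.differentiableAt (by norm_num)).inner ℝ
        (differentiableAt_const _)) (fun z hz => ?_) (hmem t ht) (hmem s hs)
    · rw [← inner_sub_left, Real.norm_eq_abs] at h1
      refine h1.trans ?_
      have h2 : √c₂ * η ≤ δ * c := by
        have := min_le_left (δ * c / √c₂) δ
        rwa [← hη, le_div_iff₀ (by positivity), mul_comm] at this
      calc √c₂ * η * ‖s - t‖ ≤ δ * c * ‖s - t‖ := by gcongr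
        _ = δ * (c * ‖s - t‖) := by ring
        _ ≤ _ := by gcongr; exact h.2 s t
    · have hgz := hgood z hz
      have h2 : HasFDerivAt (fun z => ⟪Φ z, unitNormal Φ s₁⟫_ℝ) _ z :=
        (hgz.contDiffAt.differentiableAt (by norm_num)).hasFDerivAt.inner ℝ
          (hasFDerivAt_const (unitNormal Φ s₁) z)
      rw [h2.fderiv]
      refine ContinuousLinearMap.opNorm_le_bound _ (by positivity) fun v => ?_
      have h3 : ⟪fderiv ℝ Φ z v, unitNormal Φ s₁⟫_ℝ =
          ⟪fderiv ℝ Φ z v, unitNormal Φ s₁ - unitNormal Φ z⟫_ℝ := by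
        rw [inner_sub_right, real_inner_comm _ (fderiv ℝ Φ z v), real_inner_comm _ (fderiv ℝ Φ z v),
          IsNearlyFlatAt.inner_unitNormal_fderiv, sub_zero]
      have h4 : ‖fderiv ℝ Φ z v‖ ≤ √c₂ * ‖v‖ := by
        refine le_of_sq_le_sq ?_ (by positivity)
        rw [mul_pow, Real.sq_sqrt hc₂.le]
        exact hgz.norm_fderiv_sq_le v
      have h5 := (abs_real_inner_le_norm (fderiv ℝ Φ z v) (unitNormal Φ s₁ - unitNormal Φ z))
      rw [norm_sub_rev] at h5
      simp only [ContinuousLinearMap.comp_apply, ContinuousLinearMap.prod_apply,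
        fderivInnerCLM_apply, zero_apply, inner_zero_right, zero_add, h3, Real.norm_eq_abs]
      refine h5.trans ?_
      calc _ ≤ √c₂ * ‖v‖ * η := mul_le_mul h4 (hnormal z hz) (norm_nonneg _) (by positivity)
        _ = _ := by ring

theorem DividesInto.symm {S : Set Space} (h : DividesInto S U U') : DividesInto S U' U :=
  ⟨h.isOpen_right, h.isOpen_left, h.isConnected_right, h.isConnected_left, h.disjoint.symm,
    by rw [Set.union_comm, h.union_eq], h.frontier_right, h.frontier_left⟩

/-- A preconnected set off the surface lies in one of the regions. -/
theorem DividesInto.subset_of_mem {S A : Set Space} (h : DividesInto S U U')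
    (hA : IsPreconnected A) (hAS : Disjoint A S) {x : Space} (hx : x ∈ A) (hxU : x ∈ U) :
    A ⊆ U :=
  hA.subset_left_of_subset_union h.isOpen_left h.isOpen_right h.disjoint
    (by rw [h.union_eq]; exact hAS.subset_compl_right) ⟨x, hx, hxU⟩

theorem DividesInto.exists_mem_segment {S : Set Space} (h : DividesInto S U U') {p v : Space}
    {t₁ t₂ : ℝ} (h12 : t₁ ≤ t₂) (h1 : p + t₁ • v ∈ U) (h2 : p + t₂ • v ∈ U') :
    ∃ t ∈ Set.Icc t₁ t₂, p + t • v ∈ S := by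
  by_contra! hcon
  have hsub := h.subset_of_mem (A := (fun t : ℝ => p + t • v) '' Set.Icc t₁ t₂)
    (isPreconnected_Icc.image _ (by fun_prop)) (by
      rw [Set.disjoint_left]
      rintro _ ⟨t, ht, rfl⟩
      exact hcon t ht) ⟨t₁, Set.left_mem_Icc.2 h12, rfl⟩ h1
  exact Set.disjoint_left.1 h.disjoint (hsub ⟨t₂, Set.right_mem_Icc.2 h12, rfl⟩) h2

/-- Within the ball of radius `ρ` about `x₁`, the surface is regular, nearly orthogonal to the unit
vector `e`, it separates the region `U` (in the direction of `e`) from `U'`, and the lines in the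
direction of `e` through a smaller ball meet it. -/
structure IsFlatPatch (Φ : Plane → Space) (U U' : Set Space) (ρ δ : ℝ) (x₁ e : Space) : Prop where
  norm_eq : ‖e‖ = 1
  contDiffAt : ∀ s, Φ s ∈ Metric.ball x₁ ρ → ContDiffAt ℝ 2 Φ s
  density_le : ∀ s, Φ s ∈ Metric.ball x₁ ρ →
    (1 - δ) * √(metricTensor Φ s).det ≤ |⟪normalVec Φ s, e⟫_ℝ|
  flat : ∀ s t, Φ s ∈ Metric.ball x₁ ρ → Φ t ∈ Metric.ball x₁ ρ →
    |⟪Φ s - Φ t, e⟫_ℝ| ≤ δ * ‖Φ s - Φ t‖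
  upper : ∀ s (t : ℝ), Φ s ∈ Metric.ball x₁ ρ → 0 < t → Φ s + t • e ∈ Metric.ball x₁ ρ →
    Φ s + t • e ∈ U
  lower : ∀ s (t : ℝ), Φ s ∈ Metric.ball x₁ ρ → t < 0 → Φ s + t • e ∈ Metric.ball x₁ ρ →
    Φ s + t • e ∈ U'
  exists_foot : ∀ x ∈ Metric.ball x₁ (ρ / 3), ∃ s, ∃ t : ℝ, Φ s ∈ Metric.ball x₁ ρ ∧ x = Φ s + t • e

/-- A patch of surface with small slope against the plane orthogonal to `e` separates the two
regions in the direction of `e`: the surface meets each line in this direction at most once, so the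
parts of the ball above and below it lie in different regions. The direction of the patch is `e`
or `-e`, depending on which region lies above. -/
theorem exists_isFlatPatch_of_flat (hd : DividesInto (Set.range Φ) U U') {ρ δ : ℝ} (hρ : 0 < ρ)
    (hδ : 0 < δ) (hδ' : δ ≤ 1 / 32) {s₁ : Plane} {e : Space} (he : ‖e‖ = 1)
    (hC : ∀ s, Φ s ∈ Metric.ball (Φ s₁) (4 * ρ) → ContDiffAt ℝ 2 Φ s)
    (hden : ∀ s, Φ s ∈ Metric.ball (Φ s₁) (4 * ρ) →
      (1 - δ) * √(metricTensor Φ s).det ≤ |⟪normalVec Φ s, e⟫_ℝ|)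
    (hflat : ∀ s t, Φ s ∈ Metric.ball (Φ s₁) (4 * ρ) → Φ t ∈ Metric.ball (Φ s₁) (4 * ρ) →
      |⟪Φ s - Φ t, e⟫_ℝ| ≤ δ * ‖Φ s - Φ t‖) :
    ∃ e', IsFlatPatch Φ U U' ρ δ (Φ s₁) e' := by
  set x₁ := Φ s₁ with hx₁
  -- two points of the surface on one line in the direction of `e` coincide
  have huniq : ∀ (p : Space) (a b : ℝ), p + a • e ∈ Metric.ball x₁ (4 * ρ) →
      p + b • e ∈ Metric.ball x₁ (4 * ρ) → p + a • e ∈ Set.range Φ → p + b • e ∈ Set.range Φ →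
      a = b := by
    rintro p a b ha hb ⟨s, hs⟩ ⟨t, ht⟩
    have h1 := hflat s t (hs ▸ ha) (ht ▸ hb)
    have h2 : Φ s - Φ t = (a - b) • e := by rw [hs, ht, sub_smul]; abel
    rw [h2, inner_smul_left, norm_smul, he, real_inner_self_eq_norm_sq, he] at h1
    simp only [RCLike.conj_to_real, one_pow, mul_one, Real.norm_eq_abs] at h1
    have h3 : |a - b| ≤ 0 := by nlinarith [abs_nonneg (a - b)]
    exact sub_eq_zero.1 (abs_nonpos_iff.1 h3)
  -- the parts of the ball above and below a thin layer are off the surface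
  set A : ℝ → Set Space := fun σ => Metric.ball x₁ (4 * ρ) ∩ {x | 4 * ρ * δ < ⟪x - x₁, σ • e⟫_ℝ}
    with hA
  have hAconv : ∀ σ, IsPreconnected (A σ) := by
    intro σ
    refine ((convex_ball x₁ (4 * ρ)).inter ?_).isPreconnected
    have : {x | 4 * ρ * δ < ⟪x - x₁, σ • e⟫_ℝ} =
        {x | 4 * ρ * δ + ⟪x₁, σ • e⟫_ℝ < ⟪x, σ • e⟫_ℝ} := by
      ext x
      simp only [Set.mem_ofPred_eq, inner_sub_left]
      constructor <;> intro h <;> linarith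
    rw [this]
    exact convex_halfSpace_gt (f := fun x : Space => ⟪x, σ • e⟫_ℝ)
      ⟨fun x y => inner_add_left _ _ _, fun a x => by simp [inner_smul_left]⟩ _
  have hAoff : ∀ σ : ℝ, |σ| = 1 → Disjoint (A σ) (Set.range Φ) := by
    intro σ hσ
    rw [Set.disjoint_left]
    rintro _ ⟨hs, hs'⟩ ⟨s, rfl⟩
    have h1 := hflat s s₁ hs (Metric.mem_ball_self (by positivity))
    rw [Set.mem_ofPred_eq, inner_smul_right] at hs'
    have h2 : σ * ⟪Φ s - x₁, e⟫_ℝ ≤ |⟪Φ s - x₁, e⟫_ℝ| := by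
      calc _ ≤ |σ * ⟪Φ s - x₁, e⟫_ℝ| := le_abs_self _
        _ = _ := by rw [abs_mul, hσ, one_mul]
    rw [Metric.mem_ball, dist_eq_norm] at hs
    nlinarith
  have hAmem : ∀ (σ : ℝ) (y : Space) (t : ℝ), |σ| = 1 → ‖y - x₁‖ < ρ → |t| ≤ 2 * ρ →
      4 * ρ * δ + ‖y - x₁‖ < t * σ → y + t • e ∈ A σ := by
    intro σ y t hσ hy ht hlt
    refine ⟨?_, ?_⟩
    · rw [Metric.mem_ball, dist_eq_norm, show y + t • e - x₁ = (y - x₁) + t • e by abel]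
      refine (norm_add_le _ _).trans_lt ?_
      rw [norm_smul, he, Real.norm_eq_abs]; linarith
    · rw [Set.mem_ofPred_eq, show y + t • e - x₁ = (y - x₁) + t • e by abel, inner_add_left,
        inner_smul_left, inner_smul_right, inner_smul_right, real_inner_self_eq_norm_sq, he]
      simp only [RCLike.conj_to_real]
      have h1 : |σ * ⟪y - x₁, e⟫_ℝ| ≤ ‖y - x₁‖ := by
        rw [abs_mul, hσ, one_mul]
        simpa [he] using abs_real_inner_le_norm (y - x₁) e
      have := (abs_le.1 h1).1
      linarith
  have hcov : ∀ σ : ℝ, |σ| = 1 → A σ ⊆ U ∨ A σ ⊆ U' := by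
    intro σ hσ
    have hmem : x₁ + (σ * ρ) • e ∈ A σ := by
      refine hAmem σ x₁ (σ * ρ) hσ (by simpa using hρ) ?_ ?_
      · rw [abs_mul, hσ, abs_of_pos hρ]; linarith
      · have : σ * σ = 1 := by rw [← abs_mul_abs_self, hσ, one_mul]
        rw [sub_self, norm_zero]; nlinarith
    have h1 : x₁ + (σ * ρ) • e ∈ U ∪ U' := by
      rw [hd.union_eq]
      exact Set.disjoint_left.1 (hAoff σ hσ) hmem
    exact h1.imp (hd.subset_of_mem (hAconv σ) (hAoff σ hσ) hmem)
      (hd.symm.subset_of_mem (hAconv σ) (hAoff σ hσ) hmem)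
  -- not both of them lie in the same region
  have hnot : ∀ {W W' : Set Space}, DividesInto (Set.range Φ) W W' → A 1 ⊆ W → ¬ A (-1) ⊆ W := by
    intro W W' hW h1 h2
    have hx : x₁ ∈ closure W' := by
      have : x₁ ∈ frontier W' := by rw [hW.frontier_right]; exact ⟨s₁, rfl⟩
      exact frontier_subset_closure this
    obtain ⟨z, hz, hzx⟩ := Metric.mem_closure_iff.1 hx (ρ / 4) (by positivity)
    rw [dist_comm, dist_eq_norm] at hzx
    have hp : z + ρ • e ∈ W := h1 (hAmem 1 z ρ (by simp) (by linarith)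
      (by rw [abs_of_pos hρ]; linarith) (by nlinarith))
    have hm : z + (-ρ) • e ∈ W := h2 (hAmem (-1) z (-ρ) (by simp) (by linarith)
      (by rw [abs_neg, abs_of_pos hρ]; linarith) (by nlinarith))
    have hz0 : z + (0 : ℝ) • e ∈ W' := by simpa using hz
    obtain ⟨a, ha, haS⟩ := hW.symm.exists_mem_segment hρ.le hz0 hp
    obtain ⟨b, hb, hbS⟩ := hW.exists_mem_segment (neg_nonpos.2 hρ.le) hm hz0
    have hball : ∀ t : ℝ, |t| ≤ ρ → z + t • e ∈ Metric.ball x₁ (4 * ρ) := by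
      intro t ht
      rw [Metric.mem_ball, dist_eq_norm, show z + t • e - x₁ = (z - x₁) + t • e by abel]
      refine (norm_add_le _ _).trans_lt ?_
      rw [norm_smul, he, Real.norm_eq_abs]; linarith
    have hab := huniq z a b (hball a (abs_le.2 ⟨by linarith [ha.1], ha.2⟩))
      (hball b (abs_le.2 ⟨hb.1, by linarith [hb.2]⟩)) haS hbS
    have ha0 : a = 0 := le_antisymm (hab ▸ hb.2) ha.1
    rw [ha0] at haS
    have : z + (0 : ℝ) • e ∈ (Set.range Φ)ᶜ := by rw [← hW.union_eq]; exact Or.inr hz0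
    exact this haS
  have hkey : ∀ σ : ℝ, |σ| = 1 → A σ ⊆ U → A (-σ) ⊆ U' →
      IsFlatPatch Φ U U' ρ δ x₁ (σ • e) := by
    intro σ hσ hU hU'
    have hσσ : σ * σ = 1 := by rw [← abs_mul_abs_self, hσ, one_mul]
    have hsub : Metric.ball x₁ ρ ⊆ Metric.ball x₁ (4 * ρ) := Metric.ball_subset_ball (by linarith)
    have hside : ∀ {W W' : Set Space} (κ : ℝ), |κ| = 1 → DividesInto (Set.range Φ) W W' →
        A κ ⊆ W → ∀ s (t : ℝ), Φ s ∈ Metric.ball x₁ ρ → 0 < t * κ →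
        Φ s + t • e ∈ Metric.ball x₁ ρ → Φ s + t • e ∈ W := by
      intro W W' κ hκ hW hAW s t hs ht hst
      have hκκ : κ * κ = 1 := by rw [← abs_mul_abs_self, hκ, one_mul]
      have hs' := hs
      rw [Metric.mem_ball, dist_eq_norm] at hs hst
      have ht2 : t * κ < 2 * ρ := by
        have h1 : ‖t • e‖ ≤ ‖Φ s + t • e - x₁‖ + ‖Φ s - x₁‖ := by
          have := norm_sub_le (Φ s + t • e - x₁) (Φ s - x₁)
          rwa [show Φ s + t • e - x₁ - (Φ s - x₁) = t • e by abel] at this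
        rw [norm_smul, he, mul_one, Real.norm_eq_abs] at h1
        have h2 : t * κ ≤ |t| := by
          calc t * κ ≤ |t * κ| := le_abs_self _
            _ = |t| := by rw [abs_mul, hκ, mul_one]
        linarith
      have hball : ∀ τ ∈ Set.Ioc 0 (2 * ρ), Φ s + (τ * κ) • e ∈ Metric.ball x₁ (4 * ρ) := by
        intro τ hτ
        rw [Metric.mem_ball, dist_eq_norm,
          show Φ s + (τ * κ) • e - x₁ = (Φ s - x₁) + (τ * κ) • e by abel]
        refine (norm_add_le _ _).trans_lt ?_
        rw [norm_smul, he, Real.norm_eq_abs, abs_mul, hκ, abs_of_pos hτ.1]; linarith [hτ.2]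
      have htop : Φ s + (2 * ρ * κ) • e ∈ W := by
        refine hAW (hAmem κ (Φ s) (2 * ρ * κ) hκ hs ?_ ?_)
        · rw [abs_mul, hκ, mul_one, abs_of_pos (by linarith)]
        · rw [show 2 * ρ * κ * κ = 2 * ρ * (κ * κ) by ring, hκκ]; nlinarith
      have hray := hW.subset_of_mem (A := (fun τ : ℝ => Φ s + (τ * κ) • e) '' Set.Ioc 0 (2 * ρ))
        (isPreconnected_Ioc.image _ (by fun_prop)) (by
          rw [Set.disjoint_left]
          rintro _ ⟨τ, hτ, rfl⟩ hS
          have h0 := huniq (Φ s) (τ * κ) 0 (hball τ hτ) (by simpa using hsub hs') hS (by simp)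
          have hκ0 : κ ≠ 0 := by rintro rfl; simp at hκ
          exact hτ.1.ne' ((mul_eq_zero.1 h0).resolve_right hκ0))
        ⟨2 * ρ, ⟨by linarith, le_rfl⟩, rfl⟩ htop
      refine hray ⟨t * κ, ⟨ht, ht2.le⟩, ?_⟩
      simp only [mul_assoc, hκκ, mul_one]
    refine ⟨?_, fun s hs => hC s (hsub hs), fun s hs => ?_, fun s t hs ht => ?_, ?_, ?_, ?_⟩
    · rw [norm_smul, he, Real.norm_eq_abs, hσ, one_mul]
    · rw [inner_smul_right, abs_mul, hσ, one_mul]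
      exact hden s (hsub hs)
    · rw [inner_smul_right, abs_mul, hσ, one_mul]
      exact hflat s t (hsub hs) (hsub ht)
    · intro s t hs ht hst
      rw [smul_smul] at hst ⊢
      exact hside σ hσ hd hU s (t * σ) hs (by rw [mul_assoc, hσσ]; linarith) hst
    · intro s t hs ht hst
      rw [smul_smul] at hst ⊢
      exact hside (-σ) (by rwa [abs_neg]) hd.symm hU' s (t * σ) hs (by nlinarith) hst
    · intro x hx
      rw [Metric.mem_ball, dist_eq_norm] at hx
      have hp : x + (ρ / 2) • (σ • e) ∈ U := by
        rw [smul_smul]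
        refine hU (hAmem σ x _ hσ (by linarith) ?_ ?_)
        · rw [abs_mul, hσ, abs_of_pos (by positivity)]; linarith
        · rw [show ρ / 2 * σ * σ = ρ / 2 * (σ * σ) by ring, hσσ]; nlinarith
      have hm : x + (-(ρ / 2)) • (σ • e) ∈ U' := by
        rw [smul_smul]
        refine hU' (hAmem (-σ) x _ (by rwa [abs_neg]) (by linarith) ?_ ?_)
        · rw [abs_mul, hσ, abs_neg, abs_of_pos (by positivity)]; linarith
        · rw [show -(ρ / 2) * σ * -σ = ρ / 2 * (σ * σ) by ring, hσσ]; nlinarith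
      obtain ⟨t, ht, s, hs⟩ := hd.symm.exists_mem_segment (by linarith) hm hp
      refine ⟨s, -t, ?_, ?_⟩
      · rw [hs, Metric.mem_ball, dist_eq_norm,
          show x + t • σ • e - x₁ = (x - x₁) + t • σ • e by abel]
        refine (norm_add_le _ _).trans_lt ?_
        rw [norm_smul, norm_smul, he, Real.norm_eq_abs, Real.norm_eq_abs, hσ]
        have := abs_le.2 ht
        linarith
      · rw [hs, neg_smul]; abel
  rcases hcov 1 (by simp) with h1 | h1
  · rcases hcov (-1) (by simp) with h2 | h2
    · exact absurd h2 (hnot hd h1)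
    · exact ⟨_, hkey 1 (by simp) h1 h2⟩
  · rcases hcov (-1) (by simp) with h2 | h2
    · exact ⟨_, hkey (-1) (by simp) h2 (by rwa [neg_neg])⟩
    · exact absurd h2 (hnot hd.symm h1)

/-- Far out, the surface consists of flat patches of any given size and precision. -/
theorem exists_isFlatPatch (h : IsChordBound Φ c) (hT : IsSingularSet (Set.range Φ) T)
    (hreg : IsUniformlyEllipticC2Off Φ T) (hpl : IsAsymptoticallyPlanar Φ T)
    (hd : DividesInto (Set.range Φ) U U') {ρ δ : ℝ} (hρ : 0 < ρ) (hδ : 0 < δ) (hδ' : δ ≤ 1 / 32) :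
    ∃ R, ∀ s₁ : Plane, R < ‖s₁‖ → ∃ e, IsFlatPatch Φ U U' ρ δ (Φ s₁) e := by
  obtain ⟨R, hR⟩ := exists_almost_constant_normal h hT hreg hpl (r := 4 * ρ) (by positivity) hδ
  refine ⟨R, fun s₁ hs₁ => ?_⟩
  obtain ⟨e, he, hC, hden, hflat⟩ := hR s₁ hs₁
  exact exists_isFlatPatch_of_flat hd hρ hδ hδ' he hC hden hflat

end FlatPatches

/-! ### The divergence theorem in a flat patch -/

noncomputable section PatchGauss

theorem integral_fderiv_eq_zero {𝕜 : Type*} [RCLike 𝕜] {F : Space → 𝕜} (hF : ContDiff ℝ 1 F) (hFc : HasCompactSupport F)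
    (v : Space) : ∫ x, fderiv ℝ F x v = 0 := by
  have hint : Integrable fun x => fderiv ℝ F x v :=
    ((hF.continuous_fderiv (by norm_num)).clm_apply continuous_const).integrable_of_hasCompactSupport
      (hFc.fderiv_apply ℝ v)
  have h1 := integral_mul_fderiv_eq_neg_fderiv_mul_of_integrable (μ := (volume : Measure Space))
    (f := fun _ => (1 : 𝕜)) (g := F) (v := v) (by simp) (by simpa using hint)
    (by simpa using hF.continuous.integrable_of_hasCompactSupport hFc)
    (fun x _ => differentiableAt_const _) (fun x _ => hF.differentiable (by norm_num) x)
  simpa using h1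

/-- Space as the product of the parameter plane and a line. -/
def splitSpace : Space ≃ᵐ Plane × ℝ :=
  ((MeasurableEquiv.toLp 2 (Fin 3 → ℝ)).symm.trans
    (MeasurableEquiv.piFinSuccAbove (fun _ => ℝ) 2)).trans
    (MeasurableEquiv.prodComm.trans
      (MeasurableEquiv.prodCongr (MeasurableEquiv.toLp 2 (Fin 2 → ℝ)) (MeasurableEquiv.refl ℝ)))

theorem splitSpace_apply (x : Space) : splitSpace x = (!₂[x 0, x 1], x 2) := by
  refine Prod.ext ?_ rfl
  ext k
  fin_cases k <;> rfl

theorem measurePreserving_splitSpace : MeasurePreserving splitSpace := by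
  have h1 : MeasurePreserving (MeasurableEquiv.toLp 2 (Fin 3 → ℝ)).symm :=
    PiLp.volume_preserving_ofLp (Fin 3)
  have h2 : MeasurePreserving (MeasurableEquiv.toLp 2 (Fin 2 → ℝ)) :=
    PiLp.volume_preserving_toLp (Fin 2)
  exact ((h2.prod (MeasurePreserving.id volume)).comp Measure.measurePreserving_swap).comp
    ((volume_preserving_piFinSuccAbove (fun _ : Fin 3 => ℝ) 2).comp h1)

/-- The linear projection of space to the parameter plane. -/
def planeProj : Space →L[ℝ] Plane :=
  (EuclideanSpace.equiv (Fin 2) ℝ).symm.toContinuousLinearMap ∘L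
    ContinuousLinearMap.pi ![EuclideanSpace.proj 0, EuclideanSpace.proj 1]

theorem planeProj_apply (x : Space) : planeProj x = !₂[x 0, x 1] := by
  ext k
  fin_cases k <;> rfl

theorem splitSpace_fst (x : Space) : (splitSpace x).1 = planeProj x := by
  rw [splitSpace_apply, planeProj_apply]

theorem splitSpace_snd (x : Space) : (splitSpace x).2 = x 2 := by
  rw [splitSpace_apply]

variable {Φ : Plane → Space} {U U' : Set Space} {ρ δ : ℝ} {x₁ e : Space}

/-- The derivative of `x ↦ Φ(x₀, x₁) + x₂ e`. -/
def shearDeriv (Φ : Plane → Space) (e x : Space) : Space →L[ℝ] Space :=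
  fderiv ℝ Φ (planeProj x) ∘L planeProj +
    (EuclideanSpace.proj (2 : Fin 3) : Space →L[ℝ] ℝ).smulRight e

theorem det_shearDeriv (Φ : Plane → Space) (e x : Space) :
    (shearDeriv Φ e x).det = ⟪normalVec Φ (planeProj x), e⟫_ℝ := by
  have hp : ∀ j : Fin 3, planeProj (EuclideanSpace.single j 1) =
      ![EuclideanSpace.single 0 1, EuclideanSpace.single 1 1, 0] j := by
    intro j
    rw [planeProj_apply]
    ext k
    fin_cases j <;> fin_cases k <;> simp
  have hcol : ∀ j : Fin 3, shearDeriv Φ e x (EuclideanSpace.single j 1) =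
      ![tangentVec Φ (planeProj x) 0, tangentVec Φ (planeProj x) 1, e] j := by
    intro j
    rw [shearDeriv, add_apply, ContinuousLinearMap.comp_apply, hp]
    fin_cases j <;> simp [tangentVec]
  rw [ContinuousLinearMap.det, ← LinearMap.det_toMatrix (EuclideanSpace.basisFun (Fin 3) ℝ).toBasis,
    Matrix.det_fin_three]
  simp only [LinearMap.toMatrix_apply, OrthonormalBasis.coe_toBasis, EuclideanSpace.basisFun_apply,
    ContinuousLinearMap.coe_coe, hcol, OrthonormalBasis.coe_toBasis_repr_apply,
    EuclideanSpace.basisFun_repr]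
  rw [Space.inner_eq, normalVec_apply_zero, normalVec_apply_one, normalVec_apply_two]
  simp
  ring

namespace IsFlatPatch

theorem injOn (h : IsFlatPatch Φ U U' ρ δ x₁ e) (hΦ : Function.Injective Φ) (hδ : δ < 1)
    {s t : Plane} {a b : ℝ} (hs : Φ s ∈ Metric.ball x₁ ρ) (ht : Φ t ∈ Metric.ball x₁ ρ)
    (hst : Φ s + a • e = Φ t + b • e) : s = t ∧ a = b := by
  have h1 := h.flat s t hs ht
  have h2 : Φ s - Φ t = (b - a) • e := by
    rw [sub_smul, sub_eq_sub_iff_add_eq_add, add_comm (b • e), ← hst]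
  rw [h2, inner_smul_left, norm_smul, real_inner_self_eq_norm_sq, h.norm_eq] at h1
  simp only [RCLike.conj_to_real, one_pow, mul_one, Real.norm_eq_abs] at h1
  have h3 : |b - a| ≤ 0 := by nlinarith [abs_nonneg (b - a)]
  have h4 : b = a := sub_eq_zero.1 (abs_nonpos_iff.1 h3)
  refine ⟨hΦ (sub_eq_zero.1 ?_), h4.symm⟩
  rw [h2, h4, sub_self, zero_smul]

/-- Integration along the lines in the direction of `e`. -/
theorem integral_eq (h : IsFlatPatch Φ U U' ρ δ x₁ e) (hΦ : Continuous Φ)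
    (hinj : Function.Injective Φ) (hδ : δ < 1) {g : Space → ℂ} (hg : Integrable g)
    (hsupp : ∀ x, x ∉ Metric.ball x₁ (ρ / 3) → g x = 0) :
    ∫ x, g x = ∫ s in Φ ⁻¹' Metric.ball x₁ ρ,
      |⟪normalVec Φ s, e⟫_ℝ| • ∫ t : ℝ, g (Φ s + t • e) := by
  -- the change of variables from parameters and heights to the points of space
  set f : Space → Space := fun x => Φ (planeProj x) + x 2 • e with hf
  set D := Φ ⁻¹' Metric.ball x₁ ρ with hD
  have hDo : IsOpen D := Metric.isOpen_ball.preimage hΦ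
  set S : Set Space := splitSpace ⁻¹' (D ×ˢ Set.univ) with hS
  have hSmem : ∀ x, x ∈ S ↔ planeProj x ∈ D := by
    intro x
    rw [hS, Set.mem_preimage, Set.mem_prod, splitSpace_fst]
    simp
  have hSm : MeasurableSet S := splitSpace.measurable (hDo.measurableSet.prod MeasurableSet.univ)
  have hderiv : ∀ x ∈ S, HasFDerivWithinAt f (shearDeriv Φ e x) S x := by
    intro x hx
    have h1 := ((h.contDiffAt _ ((hSmem x).1 hx)).differentiableAt (by norm_num)).hasFDerivAt
    exact ((h1.comp x planeProj.hasFDerivAt).add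
      ((EuclideanSpace.proj (𝕜 := ℝ) (2 : Fin 3) : Space →L[ℝ] ℝ).hasFDerivAt.smul_const
        e)).hasFDerivWithinAt
  have hinjS : Set.InjOn f S := by
    intro x hx y hy hxy
    obtain ⟨h1, h2⟩ := h.injOn hinj hδ ((hSmem x).1 hx) ((hSmem y).1 hy) hxy
    refine splitSpace.injective (Prod.ext ?_ ?_)
    · rw [splitSpace_fst, splitSpace_fst, h1]
    · rw [splitSpace_snd, splitSpace_snd, h2]
  have hcover : ∀ x, x ∉ f '' S → g x = 0 := by
    intro x hx
    refine hsupp x fun hxb => hx ?_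
    obtain ⟨s, t, hs, hst⟩ := h.exists_foot x hxb
    have h1 := splitSpace.apply_symm_apply (s, t)
    have h2 : planeProj (splitSpace.symm (s, t)) = s := by rw [← splitSpace_fst, h1]
    have h3 : (splitSpace.symm (s, t)) 2 = t := by rw [← splitSpace_snd, h1]
    refine ⟨splitSpace.symm (s, t), (hSmem _).2 (by rw [h2]; exact hs), ?_⟩
    simp only [hf, h2, h3, hst]
  set G : Plane × ℝ → ℂ := fun p => |⟪normalVec Φ p.1, e⟫_ℝ| • g (Φ p.1 + p.2 • e) with hG
  have hGf : ∀ x, |(shearDeriv Φ e x).det| • g (f x) = G (splitSpace x) := by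
    intro x
    simp only [hG, hf, det_shearDeriv, splitSpace_fst, splitSpace_snd]
  have hint : IntegrableOn G (D ×ˢ Set.univ) (volume.prod volume) := by
    have h1 := (integrableOn_image_iff_integrableOn_abs_det_fderiv_smul volume hSm hderiv hinjS
      g).1 hg.integrableOn
    simp_rw [hGf] at h1
    exact (measurePreserving_splitSpace.integrableOn_comp_preimage
      splitSpace.measurableEmbedding).1 h1
  rw [← setIntegral_eq_integral_of_forall_compl_eq_zero hcover,
    integral_image_eq_integral_abs_det_fderiv_smul volume hSm hderiv hinjS g]
  simp_rw [hGf]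
  rw [hS, measurePreserving_splitSpace.setIntegral_preimage_emb splitSpace.measurableEmbedding]
  rw [Measure.volume_eq_prod, setIntegral_prod _ hint]
  refine setIntegral_congr_fun hDo.measurableSet fun s _ => ?_
  simp only [hG, Measure.restrict_univ]
  exact integral_smul _ _

/-- The divergence theorem for the vector field `F e` on the part of `U` in a flat patch. -/
theorem setIntegral_fderiv (h : IsFlatPatch Φ U U' ρ δ x₁ e) (hΦ : Continuous Φ)
    (hinj : Function.Injective Φ) (hδ : δ < 1) (hρ : 0 < ρ) (hd : DividesInto (Set.range Φ) U U')
    {F : Space → ℂ} (hF : ContDiff ℝ 1 F) (hFc : HasCompactSupport F)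
    (hsupp : tsupport F ⊆ Metric.ball x₁ (ρ / 3)) :
    ∫ x in U, fderiv ℝ F x e =
      -∫ s in Φ ⁻¹' Metric.ball x₁ ρ, |⟪normalVec Φ s, e⟫_ℝ| • F (Φ s) := by
  have hUm := hd.isOpen_left.measurableSet
  have hcont : Continuous fun x => fderiv ℝ F x e :=
    (hF.continuous_fderiv (by norm_num)).clm_apply continuous_const
  have hder0 : ∀ x, x ∉ tsupport F → fderiv ℝ F x e = 0 := by
    intro x hx
    have : fderiv ℝ F x = 0 := image_eq_zero_of_notMem_tsupport fun hx' =>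
      hx (tsupport_fderiv_subset ℝ hx')
    rw [this, zero_apply]
  have hcs : HasCompactSupport fun x => fderiv ℝ F x e := hFc.mono' fun x hx => by
    by_contra hx'
    exact hx (hder0 x hx')
  rw [← integral_indicator hUm, h.integral_eq hΦ hinj hδ
    ((hcont.integrable_of_hasCompactSupport hcs).indicator hUm), ← integral_neg]
  · refine setIntegral_congr_fun (Metric.isOpen_ball.preimage hΦ).measurableSet fun s hs => ?_
    simp only [← smul_neg]
    congr 1
    -- along the line, the indicator of `U` is that of the half-line `t > 0`
    have hline : ContDiff ℝ 1 fun t : ℝ => F (Φ s + t • e) := by fun_prop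
    have hlinec : HasCompactSupport fun t : ℝ => F (Φ s + t • e) := by
      refine HasCompactSupport.of_support_subset_isCompact
        (K := Metric.closedBall 0 (2 * ρ)) (isCompact_closedBall _ _) fun t ht => ?_
      have h1 := hsupp (subset_tsupport F ht)
      rw [Metric.mem_ball, dist_eq_norm] at h1
      rw [Set.mem_preimage, Metric.mem_ball, dist_eq_norm] at hs
      rw [mem_closedBall_zero_iff]
      have h2 := norm_sub_le (Φ s + t • e - x₁) (Φ s - x₁)
      rw [show Φ s + t • e - x₁ - (Φ s - x₁) = t • e by abel, norm_smul, h.norm_eq] at h2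
      linarith
    have hd1 : ∀ t : ℝ, deriv (fun t : ℝ => F (Φ s + t • e)) t = fderiv ℝ F (Φ s + t • e) e := by
      intro t
      have h1 : HasDerivAt (fun t : ℝ => Φ s + t • e) e t := by
        simpa using ((hasDerivAt_id t).smul_const e).const_add (Φ s)
      exact ((hF.differentiable (by norm_num) _).hasFDerivAt.comp_hasDerivAt t h1).deriv
    have h2 := hlinec.integral_Ioi_deriv_eq hline 0
    rw [zero_smul, add_zero] at h2
    rw [← h2, ← integral_indicator measurableSet_Ioi]
    refine integral_congr_ae (Eventually.of_forall fun t => ?_)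
    simp only [Set.indicator_apply, Set.mem_Ioi, hd1]
    by_cases hts : Φ s + t • e ∈ tsupport F
    · have hball : Φ s + t • e ∈ Metric.ball x₁ ρ :=
        Metric.ball_subset_ball (by linarith) (hsupp hts)
      rcases lt_trichotomy t 0 with ht | ht | ht
      · rw [if_neg ht.not_gt, Set.indicator_of_notMem]
        exact Set.disjoint_right.1 hd.disjoint (h.lower s t hs ht hball)
      · rw [if_neg (by simp [ht]), Set.indicator_of_notMem]
        intro hU
        have : Φ s + t • e ∈ (Set.range Φ)ᶜ := by rw [← hd.union_eq]; exact Or.inl hU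
        exact this ⟨s, by simp [ht]⟩
      · rw [if_pos ht, Set.indicator_of_mem (h.upper s t hs ht hball)]
    · simp [hder0 _ hts]
  · intro x hx
    rw [Set.indicator_apply_eq_zero]
    exact fun _ => hder0 x fun hx' => hx (hsupp hx')

/-- The divergence theorem on the other side of the surface. -/
theorem setIntegral_compl_fderiv (h : IsFlatPatch Φ U U' ρ δ x₁ e) (hΦ : Continuous Φ)
    (hinj : Function.Injective Φ) (hδ : δ < 1) (hρ : 0 < ρ) (hd : DividesInto (Set.range Φ) U U')
    {F : Space → ℂ} (hF : ContDiff ℝ 1 F) (hFc : HasCompactSupport F)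
    (hsupp : tsupport F ⊆ Metric.ball x₁ (ρ / 3)) :
    ∫ x in Uᶜ, fderiv ℝ F x e =
      ∫ s in Φ ⁻¹' Metric.ball x₁ ρ, |⟪normalVec Φ s, e⟫_ℝ| • F (Φ s) := by
  have hint : Integrable fun x => fderiv ℝ F x e := by
    refine Continuous.integrable_of_hasCompactSupport
      ((hF.continuous_fderiv (by norm_num)).clm_apply continuous_const) ?_
    exact hFc.fderiv_apply ℝ e
  have h0 : ∫ x, fderiv ℝ F x e = 0 :=
    integral_fderiv_eq_zero hF hFc e
  have h1 := integral_add_compl hd.isOpen_left.measurableSet hint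
  rw [h0, h.setIntegral_fderiv hΦ hinj hδ hρ hd hF hFc hsupp] at h1
  linear_combination h1

end IsFlatPatch

end PatchGauss

/-! ### The form on functions supported in a flat patch -/

noncomputable section PatchBound

variable {Φ : Plane → Space} {U U' : Set Space} {ρ δ : ℝ} {x₁ e : Space}

theorem integral_surfaceMeasure {E : Type*} [NormedAddCommGroup E] [NormedSpace ℝ E]
    (Φ : Plane → Space) (f : Plane → E) :
    ∫ s, f s ∂surfaceMeasure Φ = ∫ s, √(metricTensor Φ s).det • f s := by
  rw [surfaceMeasure, integral_withDensity_eq_integral_toReal_smul (measurable_surfaceDensity Φ)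
    (Eventually.of_forall fun _ => ENNReal.ofReal_lt_top)]
  simp [ENNReal.toReal_ofReal (Real.sqrt_nonneg _)]

theorem integrable_surfaceMeasure_iff {E : Type*} [NormedAddCommGroup E] [NormedSpace ℝ E]
    {f : Plane → E} : Integrable f (surfaceMeasure Φ) ↔
      Integrable fun s => √(metricTensor Φ s).det • f s := by
  rw [surfaceMeasure, integrable_withDensity_iff_integrable_smul' (measurable_surfaceDensity Φ)
    (Eventually.of_forall fun _ => ENNReal.ofReal_lt_top)]
  simp [ENNReal.toReal_ofReal (Real.sqrt_nonneg _)]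

theorem measurable_inner_normalVec (Φ : Plane → Space) (e : Space) :
    Measurable fun s => ⟪normalVec Φ s, e⟫_ℝ := by
  have h : ∀ i (k : Fin 3), Measurable fun s => tangentVec Φ s i k := fun i k =>
    (EuclideanSpace.proj (𝕜 := ℝ) k : Space →L[ℝ] ℝ).continuous.measurable.comp
      (measurable_fderiv_apply_const ℝ Φ _)
  simp_rw [Space.inner_eq, normalVec_apply_zero, normalVec_apply_one, normalVec_apply_two]
  exact (((((h 0 1).mul (h 1 2)).sub ((h 0 2).mul (h 1 1))).mul_const _).add
    ((((h 0 2).mul (h 1 0)).sub ((h 0 0).mul (h 1 2))).mul_const _)).add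
    ((((h 0 0).mul (h 1 1)).sub ((h 0 1).mul (h 1 0))).mul_const _)

theorem abs_inner_normalVec_le (Φ : Plane → Space) (s : Plane) (he : ‖e‖ = 1) :
    |⟪normalVec Φ s, e⟫_ℝ| ≤ √(metricTensor Φ s).det := by
  simpa [he, norm_normalVec] using abs_real_inner_le_norm (normalVec Φ s) e

theorem integrable_inner_normalVec_smul {E : Type*} [NormedAddCommGroup E] [NormedSpace ℝ E]
    (he : ‖e‖ = 1) {f : Plane → E} (hf : Integrable f (surfaceMeasure Φ))
    (hfm : AEStronglyMeasurable f volume) :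
    Integrable fun s => |⟪normalVec Φ s, e⟫_ℝ| • f s := by
  refine (integrable_surfaceMeasure_iff.1 hf).mono
    ((measurable_inner_normalVec Φ e).norm.aestronglyMeasurable.smul hfm)
    (Eventually.of_forall fun s => ?_)
  rw [norm_smul, norm_smul, Real.norm_eq_abs, abs_abs, Real.norm_eq_abs,
    abs_of_nonneg (Real.sqrt_nonneg _)]
  exact mul_le_mul_of_nonneg_right (abs_inner_normalVec_le Φ s he) (norm_nonneg _)

theorem IsTestFunction.integrable_sq {φ : Space → ℂ} (hφ : IsTestFunction φ) :
    Integrable fun x => ‖φ x‖ ^ 2 :=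
  (hφ.memLp 2).integrable_norm_pow (by norm_num)

theorem HasTraceBound.integrable_sq (h : HasTraceBound Φ) {φ : Space → ℂ}
    (hφ : IsTestFunction φ) : Integrable (fun s => ‖φ (Φ s)‖ ^ 2) (surfaceMeasure Φ) :=
  (h.memLp ⟨φ, hφ⟩).integrable_norm_pow (by norm_num)

theorem IsTestFunction.contDiff_norm_sq {φ : Space → ℂ} (hφ : IsTestFunction φ) :
    ContDiff ℝ 1 fun x => ((‖φ x‖ ^ 2 : ℝ) : ℂ) :=
  Complex.ofRealCLM.contDiff.comp ((hφ.1.of_le (by simp)).norm_sq ℝ)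

theorem IsTestFunction.fderiv_norm_sq {φ : Space → ℂ} (hφ : IsTestFunction φ) (x v : Space) :
    fderiv ℝ (fun x => ((‖φ x‖ ^ 2 : ℝ) : ℂ)) x v =
      ((2 * ⟪φ x, fderiv ℝ φ x v⟫_ℝ : ℝ) : ℂ) := by
  have h1 : HasFDerivAt φ (fderiv ℝ φ x) x := (hφ.1.differentiable (by simp) x).hasFDerivAt
  have h2 : HasFDerivAt (fun x => ((‖φ x‖ ^ 2 : ℝ) : ℂ)) _ x :=
    Complex.ofRealCLM.hasFDerivAt.comp x h1.norm_sq
  rw [h2.fderiv]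
  simp
  ring

theorem IsTestFunction.fderiv_apply {φ : Space → ℂ} (hφ : IsTestFunction φ) (v : Space) :
    IsTestFunction fun x => fderiv ℝ φ x v :=
  ⟨(hφ.1.fderiv_right (m := ∞) (by simp)).clm_apply contDiff_const, hφ.2.fderiv_apply ℝ v⟩

theorem IsTestFunction.integrable_inner {φ ψ : Space → ℂ} (hφ : IsTestFunction φ)
    (hψ : IsTestFunction ψ) : Integrable fun x => ⟪φ x, ψ x⟫_ℝ :=
  (hφ.continuous.inner hψ.continuous).integrable_of_hasCompactSupport
    (hφ.2.mono' fun x hx => subset_tsupport φ fun h => hx (by simp [h]))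

theorem integral_linear_combination {X : Type*} [MeasurableSpace X] {ν : Measure X} {f g h : X → ℝ}
    (hf : Integrable f ν) (hg : Integrable g ν) (hh : Integrable h ν) {a b : ℝ} :
    ∫ x, a * f x + b * g x + h x ∂ν = a * ∫ x, f x ∂ν + b * ∫ x, g x ∂ν + ∫ x, h x ∂ν := by
  have h1 : Integrable (fun x => a * f x + b * g x) ν := (hf.const_mul a).add (hg.const_mul b)
  rw [integral_add h1 hh, integral_add (hf.const_mul a) (hg.const_mul b), integral_const_mul,
    integral_const_mul]

namespace IsFlatPatch

/-- The contribution of one side of the surface to the lower bound: it comes from expanding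
`0 ≤ ∫ |∂ₑφ + κ φ|²` over that side. -/
theorem side_bound {A : Set Space} {φ : Space → ℂ} (hφ : IsTestFunction φ) {S κ : ℝ}
    (hS : ∫ x in A, fderiv ℝ (fun x => ((‖φ x‖ ^ 2 : ℝ) : ℂ)) x e = ((-S : ℝ) : ℂ)) :
    κ * S ≤ (∫ x in A, ‖fderiv ℝ φ x e‖ ^ 2) + κ ^ 2 * ∫ x in A, ‖φ x‖ ^ 2 := by
  have hd := hφ.fderiv_apply e
  have hi1 := hd.integrable_sq
  have hi2 := hφ.integrable_sq
  have hi3 := (hφ.integrable_inner hd).const_mul 2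
  have h1 : ∫ x in A, 2 * ⟪φ x, fderiv ℝ φ x e⟫_ℝ = -S := by
    simp_rw [hφ.fderiv_norm_sq] at hS
    have : ∫ x in A, ((2 * ⟪φ x, fderiv ℝ φ x e⟫_ℝ : ℝ) : ℂ) =
      ((∫ x in A, 2 * ⟪φ x, fderiv ℝ φ x e⟫_ℝ : ℝ) : ℂ) := integral_complex_ofReal
    rw [this] at hS
    exact Complex.ofReal_injective hS
  have h2 : 0 ≤ ∫ x in A, ‖κ • φ x + fderiv ℝ φ x e‖ ^ 2 :=
    integral_nonneg fun x => sq_nonneg _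
  have h3 : ∀ x, ‖κ • φ x + fderiv ℝ φ x e‖ ^ 2 =
      κ ^ 2 * ‖φ x‖ ^ 2 + κ * (2 * ⟪φ x, fderiv ℝ φ x e⟫_ℝ) + ‖fderiv ℝ φ x e‖ ^ 2 := by
    intro x
    rw [norm_add_sq_real, norm_smul, inner_smul_left, mul_pow, Real.norm_eq_abs, sq_abs]
    simp only [RCLike.conj_to_real]
    ring
  simp_rw [h3] at h2
  rw [integral_linear_combination hi2.restrict hi3.restrict hi1.restrict, h1] at h2
  linarith

/-- The surface measure compared with the measure induced by the direction `e`. -/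
theorem integral_surfaceMeasure_le (h : IsFlatPatch Φ U U' ρ δ x₁ e) (hΦ : Continuous Φ)
    {f : Plane → ℝ} (hf : Integrable f (surfaceMeasure Φ)) (hfm : AEStronglyMeasurable f volume)
    (hf0 : ∀ s, 0 ≤ f s) (hfD : ∀ s, Φ s ∉ Metric.ball x₁ ρ → f s = 0) :
    (1 - δ) * ∫ s, f s ∂surfaceMeasure Φ ≤
      ∫ s in Φ ⁻¹' Metric.ball x₁ ρ, |⟪normalVec Φ s, e⟫_ℝ| • f s := by
  have h0 : ∀ s, s ∉ Φ ⁻¹' Metric.ball x₁ ρ → √(metricTensor Φ s).det • f s = 0 := by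
    intro s hs
    rw [hfD s hs, smul_zero]
  have h1 := setIntegral_eq_integral_of_forall_compl_eq_zero (μ := (volume : Measure Plane)) h0
  rw [integral_surfaceMeasure, ← h1, ← integral_const_mul]
  refine setIntegral_mono_on
    ((integrable_surfaceMeasure_iff.1 hf).const_mul _).integrableOn
    (integrable_inner_normalVec_smul h.norm_eq hf hfm).integrableOn
    (Metric.isOpen_ball.preimage hΦ).measurableSet fun s hs => ?_
  rw [smul_eq_mul, smul_eq_mul, ← mul_assoc]
  exact mul_le_mul_of_nonneg_right (h.density_le s hs) (hf0 s)

theorem sum_setIntegral_fderiv_sq_le {φ : Space → ℂ} (hφ : IsTestFunction φ) (he : ‖e‖ = 1)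
    {A : Set Space} (hA : MeasurableSet A) :
    (∫ x in A, ‖fderiv ℝ φ x e‖ ^ 2) + ∫ x in Aᶜ, ‖fderiv ℝ φ x e‖ ^ 2 ≤
      ∑ i, ∫ x, ‖pderiv i φ x‖ ^ 2 := by
  have hi1 := (hφ.fderiv_apply e).integrable_sq
  rw [integral_add_compl hA hi1, ← integral_finsetSum _ fun i _ => (hφ.pderiv i).integrable_sq]
  refine integral_mono hi1 (integrable_finsetSum _ fun i _ => (hφ.pderiv i).integrable_sq)
    fun x => ?_
  refine le_trans ?_ (norm_fderiv_sq_le φ x)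
  have := (fderiv ℝ φ x).le_opNorm e
  rw [he, mul_one] at this
  exact pow_le_pow_left₀ (norm_nonneg _) this 2

/-- The energy of a test function that is supported in a flat patch: its lower bound is that of the
one-dimensional problem in the direction transverse to the surface. -/
theorem neg_le_energy (h : IsFlatPatch Φ U U' ρ δ x₁ e) (hb : HasTraceBound Φ)
    (hinj : Function.Injective Φ) (hδ : δ < 1) (hρ : 0 < ρ) (hd : DividesInto (Set.range Φ) U U')
    {α V₀ m : ℝ} (hm : 0 ≤ m) (hV₀ : 0 ≤ V₀) (hα : α ≤ (1 - δ) * (√m + √(V₀ + m)))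
    {φ : Space → ℂ} (hφ : IsTestFunction φ) (hsupp : tsupport φ ⊆ Metric.ball x₁ (ρ / 3)) :
    -m * ∫ x, ‖φ x‖ ^ 2 ≤ energy Φ α V₀ U φ := by
  set F : Space → ℂ := fun x => ((‖φ x‖ ^ 2 : ℝ) : ℂ) with hF
  have hFc : HasCompactSupport F := hφ.2.comp_left (g := fun z : ℂ => ((‖z‖ ^ 2 : ℝ) : ℂ)) (by simp)
  have hFs : tsupport F ⊆ Metric.ball x₁ (ρ / 3) :=
    (closure_mono (Function.support_comp_subset (g := fun z : ℂ => ((‖z‖ ^ 2 : ℝ) : ℂ))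
      (by simp) φ)).trans hsupp
  set D := Φ ⁻¹' Metric.ball x₁ ρ with hD
  have hDm : MeasurableSet D := (Metric.isOpen_ball.preimage hb.1).measurableSet
  set S : ℝ := ∫ s in D, |⟪normalVec Φ s, e⟫_ℝ| • ‖φ (Φ s)‖ ^ 2 with hS
  have hSc : ∫ s in D, |⟪normalVec Φ s, e⟫_ℝ| • F (Φ s) = (S : ℂ) := by
    rw [hS]
    refine Eq.trans ?_ integral_complex_ofReal
    refine integral_congr_ae (Eventually.of_forall fun s => ?_)
    simp [hF]
  have hcd := hφ.contDiff_norm_sq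
  have hU := h.setIntegral_fderiv hb.1 hinj hδ hρ hd hcd hFc hFs
  have hUc := h.setIntegral_compl_fderiv hb.1 hinj hδ hρ hd hcd hFc hFs
  rw [← hD, hSc] at hU hUc
  have h1 := side_bound (κ := √(V₀ + m)) hφ (S := S) (by rw [hU]; push_cast; rfl)
  have h2 := side_bound (κ := -√m) hφ (S := -S) (by rw [hUc]; push_cast; ring)
  rw [Real.sq_sqrt (by linarith)] at h1
  rw [neg_sq, Real.sq_sqrt hm] at h2
  -- compare the two densities on the surface
  have hsm := hb.integrable_sq hφ
  have hmeas : AEStronglyMeasurable (fun s => ‖φ (Φ s)‖ ^ 2) volume :=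
    ((hφ.continuous.comp hb.1).norm.pow 2).aestronglyMeasurable
  have h3 : (1 - δ) * ∫ s, ‖φ (Φ s)‖ ^ 2 ∂surfaceMeasure Φ ≤ S := by
    refine h.integral_surfaceMeasure_le hb.1 hsm hmeas (fun s => sq_nonneg _) fun s hs => ?_
    have : φ (Φ s) = 0 := image_eq_zero_of_notMem_tsupport fun hx =>
      hs (Metric.ball_subset_ball (by linarith) (hsupp hx))
    rw [this, norm_zero, zero_pow two_ne_zero]
  have h4 := sum_setIntegral_fderiv_sq_le hφ h.norm_eq hd.isOpen_left.measurableSet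
  have h5 := integral_add_compl hd.isOpen_left.measurableSet hφ.integrable_sq
  have h6 : 0 ≤ ∫ s, ‖φ (Φ s)‖ ^ 2 ∂surfaceMeasure Φ := integral_nonneg fun s => sq_nonneg _
  have h7 : α * ∫ s, ‖φ (Φ s)‖ ^ 2 ∂surfaceMeasure Φ ≤ (√m + √(V₀ + m)) * S := by
    calc _ ≤ (1 - δ) * (√m + √(V₀ + m)) * ∫ s, ‖φ (Φ s)‖ ^ 2 ∂surfaceMeasure Φ := by gcongr
      _ = (√m + √(V₀ + m)) * ((1 - δ) * ∫ s, ‖φ (Φ s)‖ ^ 2 ∂surfaceMeasure Φ) := by ring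
      _ ≤ _ := by gcongr
  rw [energy]
  have h8 : m * ∫ x, ‖φ x‖ ^ 2 = m * (∫ x in U, ‖φ x‖ ^ 2) + m * ∫ x in Uᶜ, ‖φ x‖ ^ 2 := by
    rw [← h5]; ring
  linarith

end IsFlatPatch

end PatchBound

/-! ### Localization -/

noncomputable section Localization

variable {Φ : Plane → Space} {U : Set Space} {α V₀ : ℝ}

/-- The average of an integral against the translates of a kernel. -/
theorem kernel_average {X : Type*} [MeasurableSpace X] {ν : Measure X} [SFinite ν] {k : Space → ℝ}
    (hk : Continuous k) (hkc : HasCompactSupport k) {p : X → Space} (hp : Measurable p) {f : X → ℝ}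
    (hf : Integrable f ν) :
    Integrable (fun y => ∫ x, k (p x - y) * f x ∂ν) ∧
      ∫ y, ∫ x, k (p x - y) * f x ∂ν = (∫ z, k z) * ∫ x, f x ∂ν := by
  have hki : Integrable k := hk.integrable_of_hasCompactSupport hkc
  have hmeas : AEStronglyMeasurable (fun q : Space × X => k (p q.2 - q.1) * f q.2)
      ((volume : Measure Space).prod ν) := by
    refine AEStronglyMeasurable.mul ?_ hf.1.comp_snd
    exact (hk.measurable.comp ((hp.comp measurable_snd).sub measurable_fst)).aestronglyMeasurable
  have hint : Integrable (fun q : Space × X => k (p q.2 - q.1) * f q.2)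
      ((volume : Measure Space).prod ν) := by
    rw [integrable_prod_iff' hmeas]
    refine ⟨Eventually.of_forall fun x => (hki.comp_sub_left (p x)).mul_const (f x), ?_⟩
    have : ∀ x, ∫ y, ‖k (p x - y) * f x‖ = (∫ z, ‖k z‖) * ‖f x‖ := by
      intro x
      simp_rw [norm_mul]
      rw [integral_mul_const, integral_sub_left_eq_self (fun z => ‖k z‖) volume (p x)]
    simp_rw [this]
    exact hf.norm.const_mul _
  refine ⟨hint.integral_prod_left, ?_⟩
  rw [integral_integral_swap hint]
  simp_rw [integral_mul_const]
  have : ∀ x, ∫ y, k (p x - y) = ∫ z, k z := fun x => integral_sub_left_eq_self k volume (p x)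
  simp_rw [this]
  rw [integral_const_mul]

instance : SFinite (surfaceMeasure Φ) :=
  inferInstanceAs (SFinite ((volume : Measure Plane).withDensity _))

/-- A function localized near `y`. -/
def localize (χ : Space → ℝ) (φ : Space → ℂ) (y : Space) : Space → ℂ := fun x => χ (x - y) • φ x

theorem isTestFunction_localize {χ : Space → ℝ} (hχ : ContDiff ℝ ∞ χ) {φ : Space → ℂ}
    (hφ : IsTestFunction φ) (y : Space) : IsTestFunction (localize χ φ y) :=
  have h1 : ContDiff ℝ ∞ fun x => χ (x - y) := hχ.comp (contDiff_id.sub contDiff_const)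
  ⟨h1.smul hφ.1, hφ.2.mono' fun x hx => subset_tsupport φ fun h0 => hx (by simp [localize, h0])⟩

theorem norm_localize_sq (χ : Space → ℝ) (φ : Space → ℂ) (x y : Space) :
    ‖localize χ φ y x‖ ^ 2 = χ (x - y) ^ 2 * ‖φ x‖ ^ 2 := by
  rw [localize, norm_smul, mul_pow, Real.norm_eq_abs, sq_abs]

theorem norm_pderiv_localize_sq {χ : Space → ℝ} (hχ : ContDiff ℝ ∞ χ) {φ : Space → ℂ}
    (hφ : IsTestFunction φ) (x y : Space) (i : Fin 3) :
    ‖pderiv i (localize χ φ y) x‖ ^ 2 = χ (x - y) ^ 2 * ‖pderiv i φ x‖ ^ 2 +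
      fderiv ℝ (fun z => χ z ^ 2) (x - y) (EuclideanSpace.single i 1) * ⟪pderiv i φ x, φ x⟫_ℝ +
      fderiv ℝ χ (x - y) (EuclideanSpace.single i 1) ^ 2 * ‖φ x‖ ^ 2 := by
  have h1 : HasFDerivAt χ (fderiv ℝ χ (x - y)) (x - y) :=
    (hχ.differentiable (by simp) _).hasFDerivAt
  have h2 : HasFDerivAt (fun x => χ (x - y)) (fderiv ℝ χ (x - y)) x := by
    have h3 : HasFDerivAt (fun x : Space => x - y) (ContinuousLinearMap.id ℝ Space) x :=
      (hasFDerivAt_id x).sub_const y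
    exact h1.comp x h3
  have h4 : HasFDerivAt φ (fderiv ℝ φ x) x := (hφ.1.differentiable (by simp) x).hasFDerivAt
  have h5 : HasFDerivAt (localize χ φ y) _ x := h2.smul h4
  have h6 : HasFDerivAt (fun z => χ z ^ 2) _ (x - y) := h1.pow 2
  rw [pderiv, h5.fderiv, h6.fderiv]
  simp only [add_apply, smul_apply, ContinuousLinearMap.smulRight_apply]
  rw [norm_add_sq_real, norm_smul, norm_smul, inner_smul_left, inner_smul_right, mul_pow, mul_pow,
    Real.norm_eq_abs, Real.norm_eq_abs, sq_abs, sq_abs]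
  simp only [RCLike.conj_to_real, pderiv, smul_eq_mul]
  norm_num
  ring

/-- Localization of the energy (IMS formula): averaging the energy of the localized functions
gives the energy up to a term of order zero, because the mixed terms cancel. -/
theorem integral_energy_localize (h : HasTraceBound Φ) {χ : Space → ℝ} (hχ : ContDiff ℝ ∞ χ)
    (hχc : HasCompactSupport χ) (hχ1 : ∫ z, χ z ^ 2 = 1) {φ : Space → ℂ} (hφ : IsTestFunction φ) :
    Integrable (fun y => energy Φ α V₀ U (localize χ φ y)) ∧
      ∫ y, energy Φ α V₀ U (localize χ φ y) = energy Φ α V₀ U φ +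
        (∑ i, ∫ z, fderiv ℝ χ z (EuclideanSpace.single i 1) ^ 2) * ∫ x, ‖φ x‖ ^ 2 := by
  have hk0 : Continuous fun z => χ z ^ 2 := hχ.continuous.pow 2
  have hk0c : HasCompactSupport fun z => χ z ^ 2 := hχc.comp_left (g := fun r => r ^ 2) (by simp)
  have hχ2 : ContDiff ℝ 1 fun z => χ z ^ 2 := (hχ.of_le (by simp)).pow 2
  have hk1 : ∀ i : Fin 3, Continuous fun z =>
      fderiv ℝ (fun z => χ z ^ 2) z (EuclideanSpace.single i 1) := fun i =>
    (hχ2.continuous_fderiv (by norm_num)).clm_apply continuous_const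
  have hk1c : ∀ i : Fin 3, HasCompactSupport fun z =>
      fderiv ℝ (fun z => χ z ^ 2) z (EuclideanSpace.single i 1) := fun i =>
    hk0c.fderiv_apply ℝ _
  have hk2 : ∀ i : Fin 3, Continuous fun z => fderiv ℝ χ z (EuclideanSpace.single i 1) ^ 2 :=
    fun i => ((hχ.continuous_fderiv (by simp)).clm_apply continuous_const).pow 2
  have hk2c : ∀ i : Fin 3, HasCompactSupport fun z =>
      fderiv ℝ χ z (EuclideanSpace.single i 1) ^ 2 := fun i =>
    (hχc.fderiv_apply ℝ _).comp_left (g := fun r : ℝ => r ^ 2) (by simp)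
  have hf0 := hφ.integrable_sq
  have hf1 : ∀ i, Integrable fun x => ‖pderiv i φ x‖ ^ 2 := fun i => (hφ.pderiv i).integrable_sq
  have hf2 : ∀ i, Integrable fun x => ⟪pderiv i φ x, φ x⟫_ℝ := fun i =>
    (hφ.pderiv i).integrable_inner hφ
  have hA : ∀ i, _ := fun i => kernel_average hk0 hk0c measurable_id (hf1 i)
  have hB : ∀ i, _ := fun i => kernel_average (hk1 i) (hk1c i) measurable_id (hf2 i)
  have hC : ∀ i, _ := fun i => kernel_average (hk2 i) (hk2c i) measurable_id hf0
  have hD := kernel_average hk0 hk0c measurable_id (hf0.restrict (s := U))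
  have hE := kernel_average hk0 hk0c h.1.measurable (h.integrable_sq hφ)
  simp only [id] at hA hB hC hD
  have hloc : ∀ (k : Space → ℝ) (y : Space), Continuous k → HasCompactSupport k →
      ∀ f : Space → ℝ, Continuous f → Integrable fun x => k (x - y) * f x := by
    intro k y hk hkc f hf
    refine Continuous.integrable_of_hasCompactSupport (by fun_prop) ?_
    exact (hkc.comp_homeomorph (Homeomorph.subRight y)).mul_right
  have henergy : ∀ y, energy Φ α V₀ U (localize χ φ y) =
      (∑ i, ((∫ x, χ (x - y) ^ 2 * ‖pderiv i φ x‖ ^ 2) +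
        (∫ x, fderiv ℝ (fun z => χ z ^ 2) (x - y) (EuclideanSpace.single i 1) *
          ⟪pderiv i φ x, φ x⟫_ℝ) +
        ∫ x, fderiv ℝ χ (x - y) (EuclideanSpace.single i 1) ^ 2 * ‖φ x‖ ^ 2)) +
      V₀ * (∫ x in U, χ (x - y) ^ 2 * ‖φ x‖ ^ 2) -
      α * ∫ s, χ (Φ s - y) ^ 2 * ‖φ (Φ s)‖ ^ 2 ∂surfaceMeasure Φ := by
    intro y
    rw [energy]
    simp only [norm_localize_sq, norm_pderiv_localize_sq hχ hφ]
    congr 3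
    funext i
    have h1 := hloc _ y hk0 hk0c (fun x => ‖pderiv i φ x‖ ^ 2)
      ((hφ.pderiv i).continuous.norm.pow 2)
    have h2 := hloc _ y (hk1 i) (hk1c i) _ ((hφ.pderiv i).continuous.inner hφ.continuous)
    have h3 := hloc _ y (hk2 i) (hk2c i) (fun x => ‖φ x‖ ^ 2) (hφ.continuous.norm.pow 2)
    have h12 : Integrable fun x => χ (x - y) ^ 2 * ‖pderiv i φ x‖ ^ 2 +
        fderiv ℝ (fun z => χ z ^ 2) (x - y) (EuclideanSpace.single i 1) *
          ⟪pderiv i φ x, φ x⟫_ℝ := h1.add h2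
    rw [integral_add h12 h3, integral_add h1 h2]
  simp_rw [henergy]
  have hsum : ∀ i : Fin 3, Integrable fun y => (∫ x, χ (x - y) ^ 2 * ‖pderiv i φ x‖ ^ 2) +
        (∫ x, fderiv ℝ (fun z => χ z ^ 2) (x - y) (EuclideanSpace.single i 1) *
          ⟪pderiv i φ x, φ x⟫_ℝ) +
        ∫ x, fderiv ℝ χ (x - y) (EuclideanSpace.single i 1) ^ 2 * ‖φ x‖ ^ 2 := fun i =>
    ((hA i).1.add (hB i).1).add (hC i).1
  have hsum' := integrable_finsetSum Finset.univ fun i _ => hsum i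
  have hsumD := hsum'.add (hD.1.const_mul V₀)
  refine ⟨hsumD.sub (hE.1.const_mul α), ?_⟩
  refine (integral_sub hsumD (hE.1.const_mul α)).trans ?_
  refine (congrArg (· - _) (integral_add hsum' (hD.1.const_mul V₀))).trans ?_
  rw [integral_finsetSum _ fun i _ => hsum i, integral_const_mul, integral_const_mul, hD.2, hE.2,
    hχ1, one_mul, one_mul]
  have hi : ∀ i : Fin 3, ∫ y, ((∫ x, χ (x - y) ^ 2 * ‖pderiv i φ x‖ ^ 2) +
        (∫ x, fderiv ℝ (fun z => χ z ^ 2) (x - y) (EuclideanSpace.single i 1) *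
          ⟪pderiv i φ x, φ x⟫_ℝ) +
        ∫ x, fderiv ℝ χ (x - y) (EuclideanSpace.single i 1) ^ 2 * ‖φ x‖ ^ 2) =
      (∫ x, ‖pderiv i φ x‖ ^ 2) +
        (∫ z, fderiv ℝ χ z (EuclideanSpace.single i 1) ^ 2) * ∫ x, ‖φ x‖ ^ 2 := by
    intro i
    refine (integral_add ((hA i).1.add (hB i).1) (hC i).1).trans ?_
    refine (congrArg (· + _) (integral_add (hA i).1 (hB i).1)).trans ?_
    -- the mixed term is the integral of a derivative of `χ²`
    rw [(hA i).2, (hB i).2, (hC i).2, hχ1, integral_fderiv_eq_zero hχ2 hk0c]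
    ring
  simp_rw [hi]
  rw [Finset.sum_add_distrib, ← Finset.sum_mul, energy]
  ring

/-- A local lower bound far out and a global one give a lower bound up to the mass in a ball. -/
theorem le_energy_of_local (h : HasTraceBound Φ) {χ : Space → ℝ} (hχ : ContDiff ℝ ∞ χ)
    (hχ1 : ∫ z, χ z ^ 2 = 1) {r R₁ m C₀ : ℝ} (hr : tsupport χ ⊆ Metric.closedBall 0 r)
    (hm : 0 ≤ m) (hC₀ : 0 ≤ C₀)
    (hloc : ∀ y : Space, R₁ < ‖y‖ → ∀ ψ, IsTestFunction ψ → tsupport ψ ⊆ Metric.closedBall y r →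
      -m * ∫ x, ‖ψ x‖ ^ 2 ≤ energy Φ α V₀ U ψ)
    (hglob : ∀ ψ, IsTestFunction ψ → -C₀ * ∫ x, ‖ψ x‖ ^ 2 ≤ energy Φ α V₀ U ψ)
    {φ : Space → ℂ} (hφ : IsTestFunction φ) :
    -m * (∫ x, ‖φ x‖ ^ 2) - C₀ * ∫ x in Metric.closedBall 0 (R₁ + r), ‖φ x‖ ^ 2 ≤
      energy Φ α V₀ U φ +
        (∑ i, ∫ z, fderiv ℝ χ z (EuclideanSpace.single i 1) ^ 2) * ∫ x, ‖φ x‖ ^ 2 := by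
  have hχc : HasCompactSupport χ :=
    HasCompactSupport.of_support_subset_isCompact (isCompact_closedBall 0 r)
      ((subset_tsupport χ).trans hr)
  have hk0 : Continuous fun z => χ z ^ 2 := hχ.continuous.pow 2
  have hk0c : HasCompactSupport fun z => χ z ^ 2 := hχc.comp_left (g := fun r => r ^ 2) (by simp)
  set B := Metric.closedBall (0 : Space) (R₁ + r) with hB
  have hBm : MeasurableSet B := Metric.isClosed_closedBall.measurableSet
  have hA := kernel_average hk0 hk0c measurable_id hφ.integrable_sq
  have hA' := kernel_average hk0 hk0c measurable_id (hφ.integrable_sq.restrict (s := B))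
  obtain ⟨hI, hE⟩ := integral_energy_localize (α := α) (V₀ := V₀) (U := U) h hχ hχc hχ1 hφ
  rw [← hE]
  simp only [id, hχ1, one_mul] at hA hA'
  rw [← hA.2, ← hA'.2, ← integral_const_mul, ← integral_const_mul]
  refine (integral_sub (hA.1.const_mul _) (hA'.1.const_mul _)).symm.trans_le ?_
  refine integral_mono ((hA.1.const_mul _).sub (hA'.1.const_mul _)) hI fun y => ?_
  have hψ := isTestFunction_localize hχ hφ y
  have hnn : ∀ S : Set Space, 0 ≤ ∫ x in S, χ (x - y) ^ 2 * ‖φ x‖ ^ 2 := fun S =>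
    integral_nonneg fun x => by positivity
  have hsq : ∫ x, ‖localize χ φ y x‖ ^ 2 = ∫ x, χ (x - y) ^ 2 * ‖φ x‖ ^ 2 := by
    simp only [norm_localize_sq]
  have hzero : ∀ x, x ∉ Metric.closedBall y r → χ (x - y) = 0 := by
    intro x hx
    refine image_eq_zero_of_notMem_tsupport fun hx' => hx ?_
    have := hr hx'
    rwa [mem_closedBall_zero_iff, ← dist_eq_norm] at this
  -- localization functions that are not centred far out live in the ball of radius `R₁ + r`
  by_cases hy : R₁ < ‖y‖
  · have h1 := hloc y hy _ hψ (by
      refine closure_minimal (fun x hx => ?_) Metric.isClosed_closedBall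
      by_contra hx'
      exact hx (by rw [localize, hzero x hx', zero_smul]))
    rw [hsq] at h1
    refine le_trans ?_ h1
    have := mul_nonneg hC₀ (hnn B)
    simp only []
    linarith
  · have h1 := hglob _ hψ
    rw [hsq] at h1
    have h2 : ∫ x in B, χ (x - y) ^ 2 * ‖φ x‖ ^ 2 = ∫ x, χ (x - y) ^ 2 * ‖φ x‖ ^ 2 := by
      refine setIntegral_eq_integral_of_forall_compl_eq_zero fun x hx => ?_
      rw [hzero x, zero_pow two_ne_zero, zero_mul]
      intro hx'
      refine hx ?_
      rw [hB, mem_closedBall_zero_iff]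
      rw [Metric.mem_closedBall, dist_eq_norm] at hx'
      have := norm_sub_norm_le x y
      linarith
    have h3 := mul_nonneg hm (hnn Set.univ)
    rw [Measure.restrict_univ] at h3
    simp only [h2]
    linarith

/-- There are localization functions with arbitrarily small gradient. -/
theorem exists_localization {ε : ℝ} (hε : 0 < ε) : ∃ χ : Space → ℝ, ∃ r : ℝ, 0 < r ∧
    ContDiff ℝ ∞ χ ∧ tsupport χ ⊆ Metric.closedBall 0 r ∧ ∫ z, χ z ^ 2 = 1 ∧
      ∑ i, ∫ z, fderiv ℝ χ z (EuclideanSpace.single i 1) ^ 2 ≤ ε := by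
  let g : ContDiffBump (0 : Space) := ⟨1, 2, one_pos, one_lt_two⟩
  have hg : ContDiff ℝ ∞ g := g.contDiff
  have hgc : HasCompactSupport g := g.hasCompactSupport
  set N := ∫ z, g z ^ 2 with hN
  set G := ∑ i : Fin 3, ∫ z, fderiv ℝ g z (EuclideanSpace.single i 1) ^ 2 with hG
  have hG0 : 0 ≤ G := Finset.sum_nonneg fun i _ => integral_nonneg fun z => sq_nonneg _
  have hN0 : 0 < N := by
    have hc : Continuous fun z => g z ^ 2 := g.continuous.pow 2
    refine hc.integral_pos_of_hasCompactSupport_nonneg_nonzero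
      (hgc.comp_left (g := fun r : ℝ => r ^ 2) (by simp)) (fun z => sq_nonneg _) (x := 0) ?_
    have : g 0 = 1 := g.one_of_mem_closedBall (Metric.mem_closedBall_self zero_le_one)
    simp [this]
  -- stretching by `R` divides the gradient term by `R²`, once the `L²` norm is normalized by `A`
  set R : ℝ := √(G / (N * ε)) + 1 with hR
  have hR0 : 0 < R := by positivity
  set A : ℝ := (√(N * R ^ 3))⁻¹ with hA
  have hA2 : A ^ 2 = (N * R ^ 3)⁻¹ := by rw [hA, inv_pow, Real.sq_sqrt (by positivity)]
  have hscale : ∀ f : Space → ℝ, ∫ z, f (R⁻¹ • z) = R ^ 3 * ∫ z, f z := by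
    intro f
    rw [Measure.integral_comp_inv_smul_of_nonneg volume f hR0.le]
    simp
  refine ⟨fun z => A * g (R⁻¹ • z), 2 * R, by positivity, ?_, ?_, ?_, ?_⟩
  · exact contDiff_const.mul (hg.comp (contDiff_id.const_smul R⁻¹))
  · refine closure_minimal (fun z hz => ?_) Metric.isClosed_closedBall
    have h1 : R⁻¹ • z ∈ Function.support g := fun h0 => hz (by simp [h0])
    rw [g.support_eq, mem_ball_zero_iff, norm_smul, norm_inv, Real.norm_eq_abs, abs_of_pos hR0,
      inv_mul_lt_iff₀ hR0] at h1
    rw [mem_closedBall_zero_iff]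
    linarith [h1, show g.rOut = 2 from rfl, mul_comm R 2, show R * g.rOut = R * 2 from rfl]
  · simp_rw [mul_pow]
    rw [integral_const_mul, hscale fun z => g z ^ 2, hA2, ← hN]
    field_simp
  · have hder : ∀ (i : Fin 3) (z : Space),
        fderiv ℝ (fun z => A * g (R⁻¹ • z)) z (EuclideanSpace.single i 1) ^ 2 =
          A ^ 2 * (R⁻¹) ^ 2 * fderiv ℝ g (R⁻¹ • z) (EuclideanSpace.single i 1) ^ 2 := by
      intro i z
      have h1 : HasFDerivAt g (fderiv ℝ g (R⁻¹ • z)) (R⁻¹ • z) :=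
        (hg.differentiable (by simp) _).hasFDerivAt
      have h2 : HasFDerivAt (fun z : Space => R⁻¹ • z) (R⁻¹ • ContinuousLinearMap.id ℝ Space) z :=
        (hasFDerivAt_id z).const_smul R⁻¹
      have h3 : HasFDerivAt (fun z => A * g (R⁻¹ • z)) _ z := (h1.comp z h2).const_mul A
      rw [h3.fderiv]
      simp
      ring_nf
    simp_rw [hder]
    have h4 : ∀ i : Fin 3, ∫ z, A ^ 2 * (R⁻¹) ^ 2 *
        fderiv ℝ g (R⁻¹ • z) (EuclideanSpace.single i 1) ^ 2 =
        A ^ 2 * (R⁻¹) ^ 2 * (R ^ 3 * ∫ z, fderiv ℝ g z (EuclideanSpace.single i 1) ^ 2) := by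
      intro i
      rw [integral_const_mul, hscale fun z => fderiv ℝ g z (EuclideanSpace.single i 1) ^ 2]
    simp_rw [h4]
    rw [← Finset.mul_sum, ← Finset.mul_sum, ← hG, hA2]
    have h5 : (N * R ^ 3)⁻¹ * R⁻¹ ^ 2 * (R ^ 3 * G) = G / (N * R ^ 2) := by field_simp
    rw [h5, div_le_iff₀ (by positivity)]
    have h6 : G / (N * ε) ≤ R ^ 2 := by
      have h7 : √(G / (N * ε)) ^ 2 = G / (N * ε) := Real.sq_sqrt (by positivity)
      rw [hR]
      nlinarith [Real.sqrt_nonneg (G / (N * ε))]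
    rw [div_le_iff₀ (by positivity)] at h6
    linarith

end Localization

/-! ### A local Poincaré inequality -/

noncomputable section LocalPoincare

theorem lintegral_enorm_sq_eq {X : Type*} [MeasurableSpace X] {ν : Measure X} {f : X → ℂ}
    (hf : Integrable (fun x => ‖f x‖ ^ 2) ν) :
    ∫⁻ x, ‖f x‖ₑ ^ 2 ∂ν = ENNReal.ofReal (∫ x, ‖f x‖ ^ 2 ∂ν) := by
  rw [ofReal_integral_eq_lintegral_ofReal hf (Eventually.of_forall fun x => sq_nonneg _)]
  refine lintegral_congr fun x => ?_
  rw [ENNReal.ofReal_pow (norm_nonneg _), ofReal_norm]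

/-- Translations by `h` change a test function in `L²` by at most `‖h‖` times its gradient. -/
theorem lintegral_translate_sub_le {φ : Space → ℂ} (hφ : IsTestFunction φ) (h : Space) :
    ∫⁻ x, ‖φ (x + h) - φ x‖ₑ ^ 2 ≤ ‖h‖ₑ ^ 2 * ∑ i, ∫⁻ x, ‖pderiv i φ x‖ₑ ^ 2 := by
  have hDc : Continuous (fderiv ℝ φ) := hφ.1.continuous_fderiv (by simp)
  have hpt : ∀ x, ‖φ (x + h) - φ x‖ₑ ^ 2 ≤
      ‖h‖ₑ ^ 2 * ∫⁻ t in Set.Ioc (0 : ℝ) 1, ‖fderiv ℝ φ (x + t • h)‖ₑ ^ 2 := by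
    intro x
    have hder : ∀ t : ℝ, HasDerivAt (fun t : ℝ => φ (x + t • h)) (fderiv ℝ φ (x + t • h) h) t := by
      intro t
      have h1 : HasFDerivAt φ (fderiv ℝ φ (x + t • h)) (x + t • h) :=
        (hφ.1.differentiable (by simp) _).hasFDerivAt
      have h2 : HasDerivAt (fun t : ℝ => x + t • h) h t := by
        simpa using ((hasDerivAt_id t).smul_const h).const_add x
      exact h1.comp_hasDerivAt t h2
    have hcont : Continuous fun t : ℝ => fderiv ℝ φ (x + t • h) := hDc.comp (by fun_prop)
    have hftc := intervalIntegral.integral_eq_sub_of_hasDerivAt (a := 0) (b := 1)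
      (fun t _ => hder t) ((hcont.clm_apply continuous_const).intervalIntegrable _ _)
    rw [one_smul, zero_smul, add_zero, intervalIntegral.integral_of_le zero_le_one] at hftc
    rw [← hftc]
    calc ‖∫ t in Set.Ioc (0 : ℝ) 1, fderiv ℝ φ (x + t • h) h‖ₑ ^ 2
        ≤ (∫⁻ t in Set.Ioc (0 : ℝ) 1, ‖h‖ₑ * ‖fderiv ℝ φ (x + t • h)‖ₑ) ^ 2 := by
          refine pow_le_pow_left' ?_ 2
          refine (enorm_integral_le_lintegral_enorm _).trans (lintegral_mono fun t => ?_)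
          rw [mul_comm]
          exact ContinuousLinearMap.le_opENorm _ _
      _ ≤ ∫⁻ t in Set.Ioc (0 : ℝ) 1, (‖h‖ₑ * ‖fderiv ℝ φ (x + t • h)‖ₑ) ^ 2 := by
          refine (sq_lintegral_le _ (hcont.measurable.enorm.const_mul _).aemeasurable).trans ?_
          rw [Measure.restrict_apply_univ, Real.volume_Ioc]
          norm_num
      _ = _ := by
          simp_rw [mul_pow]
          rw [lintegral_const_mul _ (hcont.measurable.enorm.pow_const 2)]
  have hmeas : Measurable fun p : Space × ℝ => ‖fderiv ℝ φ (p.1 + p.2 • h)‖ₑ ^ 2 := by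
    have : Continuous fun p : Space × ℝ => fderiv ℝ φ (p.1 + p.2 • h) := hDc.comp (by fun_prop)
    exact this.measurable.enorm.pow_const 2
  have hmeas' : Measurable fun x => ∫⁻ t in Set.Ioc (0 : ℝ) 1, ‖fderiv ℝ φ (x + t • h)‖ₑ ^ 2 :=
    hmeas.lintegral_prod_right'
  calc ∫⁻ x, ‖φ (x + h) - φ x‖ₑ ^ 2
      ≤ ∫⁻ x, ‖h‖ₑ ^ 2 * ∫⁻ t in Set.Ioc (0 : ℝ) 1, ‖fderiv ℝ φ (x + t • h)‖ₑ ^ 2 :=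
        lintegral_mono hpt
    _ = ‖h‖ₑ ^ 2 * ∫⁻ t in Set.Ioc (0 : ℝ) 1, ∫⁻ x, ‖fderiv ℝ φ (x + t • h)‖ₑ ^ 2 := by
        rw [lintegral_const_mul _ hmeas', lintegral_lintegral_swap hmeas.aemeasurable]
    _ = ‖h‖ₑ ^ 2 * ∫⁻ x, ‖fderiv ℝ φ x‖ₑ ^ 2 := by
        congr 1
        have : ∀ t : ℝ, ∫⁻ x, ‖fderiv ℝ φ (x + t • h)‖ₑ ^ 2 = ∫⁻ x, ‖fderiv ℝ φ x‖ₑ ^ 2 :=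
          fun t => lintegral_add_right_eq_self (fun x => ‖fderiv ℝ φ x‖ₑ ^ 2) (t • h)
        simp_rw [this]
        simp
    _ ≤ _ := by
        refine mul_le_mul_right ?_ _
        rw [← lintegral_finsetSum _ fun i _ =>
          ((hφ.pderiv i).continuous.measurable.enorm.pow_const 2)]
        exact lintegral_mono fun x => enorm_fderiv_sq_le φ x

/-- A Poincaré inequality on a set of finite measure, with the averages of the squared differences
in place of the gradient. -/
theorem volume_mul_lintegral_le {φ : Space → ℂ} (hφ : IsTestFunction φ) {Q : Set Space}
    (hQ0 : volume Q ≠ 0) (hQt : volume Q ≠ ⊤) :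
    volume Q * ∫⁻ x in Q, ‖φ x‖ₑ ^ 2 ≤
      2 * (∫⁻ x in Q, ∫⁻ y in Q, ‖φ y - φ x‖ₑ ^ 2) + 2 * ‖∫ y in Q, φ y‖ₑ ^ 2 := by
  have hm2 : Measurable fun p : Space × Space => ‖φ p.2 - φ p.1‖ₑ ^ 2 :=
    (((hφ.continuous.comp continuous_snd).sub
      (hφ.continuous.comp continuous_fst)).measurable.enorm.pow_const 2)
  have hpt : ∀ x, volume Q ^ 2 * ‖φ x‖ₑ ^ 2 ≤
      2 * (volume Q * ∫⁻ y in Q, ‖φ y - φ x‖ₑ ^ 2) + 2 * ‖∫ y in Q, φ y‖ₑ ^ 2 := by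
    intro x
    have hi : IntegrableOn φ Q :=
      (hφ.continuous.integrable_of_hasCompactSupport hφ.2).integrableOn
    -- the value at `x` differs from the mean by the mean of the differences
    have h1 : (volume.real Q : ℂ) * φ x = (∫ y in Q, φ y) - ∫ y in Q, (φ y - φ x) := by
      rw [integral_sub hi (integrableOn_const hQt), setIntegral_const]
      simp
    have h2 : volume Q * ‖φ x‖ₑ ≤ ‖∫ y in Q, (φ y - φ x)‖ₑ + ‖∫ y in Q, φ y‖ₑ := by
      have h3 : ‖(volume.real Q : ℂ) * φ x‖ₑ = volume Q * ‖φ x‖ₑ := by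
        rw [enorm_mul, ← ofReal_norm, Complex.norm_real, Real.norm_of_nonneg measureReal_nonneg,
          ofReal_measureReal hQt]
      rw [← h3, h1, add_comm]
      exact enorm_sub_le
    rw [← mul_pow]
    refine (pow_le_pow_left' h2 2).trans ((ENNReal_add_sq_le _ _).trans ?_)
    refine add_le_add_left (mul_le_mul_right ?_ 2) _
    refine (pow_le_pow_left' (enorm_integral_le_lintegral_enorm _) 2).trans ?_
    refine (sq_lintegral_le _ ?_).trans (by rw [Measure.restrict_apply_univ])
    exact (hφ.continuous.sub continuous_const).measurable.enorm.aemeasurable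
  have h1 : volume Q ^ 2 * ∫⁻ x in Q, ‖φ x‖ₑ ^ 2 ≤
      volume Q * (2 * (∫⁻ x in Q, ∫⁻ y in Q, ‖φ y - φ x‖ₑ ^ 2) + 2 * ‖∫ y in Q, φ y‖ₑ ^ 2) := by
    have hm3 : Measurable fun x => ∫⁻ y in Q, ‖φ y - φ x‖ₑ ^ 2 := hm2.lintegral_prod_right'
    calc volume Q ^ 2 * ∫⁻ x in Q, ‖φ x‖ₑ ^ 2
        = ∫⁻ x in Q, volume Q ^ 2 * ‖φ x‖ₑ ^ 2 :=
          (lintegral_const_mul _ (hφ.continuous.measurable.enorm.pow_const 2)).symm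
      _ ≤ ∫⁻ x in Q, (2 * (volume Q * ∫⁻ y in Q, ‖φ y - φ x‖ₑ ^ 2) +
            2 * ‖∫ y in Q, φ y‖ₑ ^ 2) := lintegral_mono fun x => hpt x
      _ = _ := by
          rw [lintegral_add_right _ measurable_const, lintegral_const_mul _ (hm3.const_mul _),
            lintegral_const_mul _ hm3, lintegral_const, Measure.restrict_apply_univ]
          ring
  rw [pow_two, mul_assoc] at h1
  exact (ENNReal.mul_le_mul_iff_right hQ0 hQt).1 h1

/-- The half-open cubes of side `ℓ` with corners in the lattice `ℓ ℤ³`. -/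
def latticeCube (ℓ : ℝ) (k : Fin 3 → ℤ) : Set Space := {x | ∀ i, ⌊x i / ℓ⌋ = k i}

theorem latticeCube_eq {ℓ : ℝ} (hℓ : 0 < ℓ) (k : Fin 3 → ℤ) :
    latticeCube ℓ k = WithLp.ofLp ⁻¹'
      (Set.univ.pi fun i => Set.Ico (k i * ℓ) ((k i + 1) * ℓ) : Set (Fin 3 → ℝ)) := by
  ext x
  simp only [latticeCube, Set.mem_ofPred_eq, Int.floor_eq_iff, le_div_iff₀ hℓ, div_lt_iff₀ hℓ,
    Set.mem_preimage, Set.mem_pi, Set.mem_univ, true_implies, Set.mem_Ico]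

theorem measurableSet_latticeCube {ℓ : ℝ} (hℓ : 0 < ℓ) (k : Fin 3 → ℤ) :
    MeasurableSet (latticeCube ℓ k) := by
  rw [latticeCube_eq hℓ]
  exact (PiLp.volume_preserving_ofLp (Fin 3)).measurable
    (MeasurableSet.univ_pi fun i => measurableSet_Ico)

theorem volume_latticeCube {ℓ : ℝ} (hℓ : 0 < ℓ) (k : Fin 3 → ℤ) :
    volume (latticeCube ℓ k) = ENNReal.ofReal (ℓ ^ 3) := by
  rw [latticeCube_eq hℓ, (PiLp.volume_preserving_ofLp (Fin 3)).measure_preimage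
    (MeasurableSet.univ_pi fun i => measurableSet_Ico).nullMeasurableSet, Real.volume_pi_Ico]
  have : ∀ i, ((k i : ℝ) + 1) * ℓ - k i * ℓ = ℓ := fun i => by ring
  simp [this, ENNReal.ofReal_pow hℓ.le]

theorem dist_lt_of_mem_latticeCube {ℓ : ℝ} (hℓ : 0 < ℓ) {k : Fin 3 → ℤ} {x y : Space}
    (hx : x ∈ latticeCube ℓ k) (hy : y ∈ latticeCube ℓ k) : ‖y - x‖ < 2 * ℓ := by
  have h1 : ∀ i, |y i - x i| ≤ ℓ := by
    intro i
    have h2 := Int.abs_sub_lt_one_of_floor_eq_floor ((hy i).trans (hx i).symm)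
    rw [← sub_div, abs_div, abs_of_pos hℓ, div_lt_one hℓ] at h2
    exact h2.le
  refine lt_of_pow_lt_pow_left₀ 2 (by positivity) ?_
  rw [Space.norm_sq_eq]
  have h3 : ∀ i, (y - x) i ^ 2 ≤ ℓ ^ 2 := fun i => by
    rw [PiLp.sub_apply, ← sq_abs]
    exact pow_le_pow_left₀ (abs_nonneg _) (h1 i) 2
  nlinarith [h3 0, h3 1, h3 2, pow_pos hℓ 2]

/-- The mean squared differences over the cubes are controlled by the gradient: two points of a
cube differ by a vector of length less than `2 ℓ`, and translation by `z` changes a function by at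
most `‖z‖` times its gradient in the `L²` norm. -/
theorem sum_latticeCube_le {φ : Space → ℂ} (hφ : IsTestFunction φ) {ℓ : ℝ} (hℓ : 0 < ℓ)
    (K : Finset (Fin 3 → ℤ)) :
    ∑ k ∈ K, ∫⁻ x in latticeCube ℓ k, ∫⁻ y in latticeCube ℓ k, ‖φ y - φ x‖ₑ ^ 2 ≤
      ENNReal.ofReal (32 * ℓ ^ 5) * volume (Metric.ball (0 : Space) 1) *
        ∑ i, ∫⁻ x, ‖pderiv i φ x‖ₑ ^ 2 := by
  have hm2 : Measurable fun p : Space × Space => ‖φ (p.1 + p.2) - φ p.1‖ₑ ^ 2 :=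
    (((hφ.continuous.comp (continuous_fst.add continuous_snd)).sub
      (hφ.continuous.comp continuous_fst)).measurable.enorm.pow_const 2)
  set B := Metric.ball (0 : Space) (2 * ℓ) with hB
  have hBm : MeasurableSet B := Metric.isOpen_ball.measurableSet
  have h1 : ∀ k, ∀ x ∈ latticeCube ℓ k, ∫⁻ y in latticeCube ℓ k, ‖φ y - φ x‖ₑ ^ 2 ≤
      ∫⁻ z in B, ‖φ (x + z) - φ x‖ₑ ^ 2 := by
    intro k x hx
    rw [← lintegral_indicator hBm, ← lintegral_indicator (measurableSet_latticeCube hℓ k),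
      ← lintegral_add_left_eq_self _ x]
    refine lintegral_mono fun z => ?_
    by_cases hz : x + z ∈ latticeCube ℓ k
    · have hzB : z ∈ B := by
        rw [hB, mem_ball_zero_iff]
        simpa using dist_lt_of_mem_latticeCube hℓ hx hz
      rw [Set.indicator_of_mem hzB, Set.indicator_of_mem hz]
    · rw [Set.indicator_of_notMem hz]
      exact zero_le
  have hdisj : (K : Set (Fin 3 → ℤ)).PairwiseDisjoint (latticeCube ℓ) := by
    intro k _ l _ hkl
    refine Set.disjoint_left.2 fun x hx hx' => hkl ?_
    funext i
    exact (hx i).symm.trans (hx' i)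
  calc ∑ k ∈ K, ∫⁻ x in latticeCube ℓ k, ∫⁻ y in latticeCube ℓ k, ‖φ y - φ x‖ₑ ^ 2
      ≤ ∑ k ∈ K, ∫⁻ x in latticeCube ℓ k, ∫⁻ z in B, ‖φ (x + z) - φ x‖ₑ ^ 2 :=
        Finset.sum_le_sum fun k _ => setLIntegral_mono' (measurableSet_latticeCube hℓ k) (h1 k)
    _ = ∫⁻ x in ⋃ k ∈ K, latticeCube ℓ k, ∫⁻ z in B, ‖φ (x + z) - φ x‖ₑ ^ 2 :=
        (lintegral_biUnion_finset hdisj (fun k _ => measurableSet_latticeCube hℓ k) _).symm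
    _ ≤ ∫⁻ x, ∫⁻ z in B, ‖φ (x + z) - φ x‖ₑ ^ 2 := setLIntegral_le_lintegral _ _
    _ = ∫⁻ z in B, ∫⁻ x, ‖φ (x + z) - φ x‖ₑ ^ 2 := lintegral_lintegral_swap hm2.aemeasurable
    _ ≤ ∫⁻ _z in B, ENNReal.ofReal ((2 * ℓ) ^ 2) * ∑ i, ∫⁻ x, ‖pderiv i φ x‖ₑ ^ 2 := by
        refine setLIntegral_mono' hBm fun z hz => ?_
        refine (lintegral_translate_sub_le hφ z).trans (mul_le_mul_left ?_ _)
        rw [← ofReal_norm, ← ENNReal.ofReal_pow (norm_nonneg _)]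
        refine ENNReal.ofReal_le_ofReal ?_
        rw [hB, mem_ball_zero_iff] at hz
        exact pow_le_pow_left₀ (norm_nonneg _) hz.le 2
    _ = _ := by
        rw [setLIntegral_const, hB, ← mul_one (2 * ℓ),
          Measure.addHaar_ball_mul volume _ (by positivity)]
        rw [finrank_euclideanSpace_fin, mul_one]
        have : ENNReal.ofReal (32 * ℓ ^ 5) = ENNReal.ofReal ((2 * ℓ) ^ 2) *
            ENNReal.ofReal ((2 * ℓ) ^ 3) := by
          rw [← ENNReal.ofReal_mul (by positivity)]; congr 1; ring
        rw [this]
        ring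

/-- On a bounded set, the `L²` norm is controlled by a small multiple of the gradient and finitely
many functionals. -/
theorem exists_local_poincare (R : ℝ) {κ : ℝ} (hκ : 0 < κ) :
    ∃ (N : ℕ) (g : Fin N → L2Space) (C : ℝ), 0 ≤ C ∧ ∀ φ (hφ : IsTestFunction φ),
      ∫ x in Metric.closedBall 0 R, ‖φ x‖ ^ 2 ≤
        κ * (∑ i, ∫ x, ‖pderiv i φ x‖ ^ 2) + C * ∑ j, ‖⟪g j, hφ.toL2⟫_ℂ‖ ^ 2 := by
  set v := volume.real (Metric.ball (0 : Space) 1) with hv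
  have hv0 : 0 ≤ v := measureReal_nonneg
  set ℓ := √(κ / (64 * (v + 1))) with hℓdef
  have hℓ : 0 < ℓ := by positivity
  have hℓ2 : 64 * v * ℓ ^ 2 ≤ κ := by
    rw [hℓdef, Real.sq_sqrt (by positivity)]
    have : 64 * v * (κ / (64 * (v + 1))) = κ * (v / (v + 1)) := by field_simp
    rw [this]
    exact mul_le_of_le_one_right hκ.le ((div_le_one (by positivity)).2 (by linarith))
  set M : ℤ := ⌈R / ℓ⌉ with hM
  set K : Finset (Fin 3 → ℤ) := Fintype.piFinset fun _ => Finset.Icc (-M) M with hK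
  have hQt : ∀ k, volume (latticeCube ℓ k) ≠ ⊤ := fun k => by
    rw [volume_latticeCube hℓ]; exact ENNReal.ofReal_ne_top
  have hcover : Metric.closedBall (0 : Space) R ⊆ ⋃ k ∈ K, latticeCube ℓ k := by
    intro x hx
    rw [mem_closedBall_zero_iff] at hx
    refine Set.mem_biUnion (x := fun i => ⌊x i / ℓ⌋) ?_ fun i => rfl
    simp only [hK, Finset.mem_coe, Fintype.mem_piFinset, Finset.mem_Icc]
    intro i
    have h1 : |x i| ≤ R := (PiLp.norm_apply_le x i).trans hx
    have h2 := Int.le_ceil (R / ℓ)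
    have h3 : |x i / ℓ| ≤ M := by
      rw [abs_div, abs_of_pos hℓ]
      exact (div_le_div_of_nonneg_right h1 hℓ.le).trans h2
    obtain ⟨h4, h5⟩ := abs_le.1 h3
    refine ⟨Int.le_floor.2 (by push_cast; exact h4), ?_⟩
    exact Int.cast_le.1 ((Int.floor_le _).trans h5)
  set g : (Fin 3 → ℤ) → L2Space := fun k =>
    indicatorConstLp 2 (measurableSet_latticeCube hℓ k) (hQt k) 1 with hg
  have hgφ : ∀ k φ (hφ : IsTestFunction φ), ⟪g k, hφ.toL2⟫_ℂ = ∫ y in latticeCube ℓ k, φ y := by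
    intro k φ hφ
    rw [hg, L2.inner_indicatorConstLp_one]
    exact integral_congr_ae (ae_restrict_of_ae hφ.coeFn_toL2)
  refine ⟨K.card, fun j => g (K.equivFin.symm j), 2 / ℓ ^ 3, by positivity, fun φ hφ => ?_⟩
  have hsum : ∑ j, ‖⟪g (K.equivFin.symm j), hφ.toL2⟫_ℂ‖ ^ 2 =
      ∑ k ∈ K, ‖∫ y in latticeCube ℓ k, φ y‖ ^ 2 := by
    rw [Equiv.sum_comp K.equivFin.symm fun k : K => ‖⟪g k, hφ.toL2⟫_ℂ‖ ^ 2]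
    rw [Finset.sum_coe_sort K fun k => ‖⟪g k, hφ.toL2⟫_ℂ‖ ^ 2]
    simp_rw [hgφ]
  rw [hsum]
  have hdisj : (K : Set (Fin 3 → ℤ)).PairwiseDisjoint (latticeCube ℓ) := by
    intro k _ l _ hkl
    refine Set.disjoint_left.2 fun x hx hx' => hkl ?_
    funext i
    exact (hx i).symm.trans (hx' i)
  have h1 : ENNReal.ofReal (ℓ ^ 3) * ∫⁻ x in Metric.closedBall 0 R, ‖φ x‖ₑ ^ 2 ≤
      2 * (ENNReal.ofReal (32 * ℓ ^ 5) * volume (Metric.ball (0 : Space) 1) *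
        ∑ i, ∫⁻ x, ‖pderiv i φ x‖ₑ ^ 2) + 2 * ∑ k ∈ K, ‖∫ y in latticeCube ℓ k, φ y‖ₑ ^ 2 := by
    calc ENNReal.ofReal (ℓ ^ 3) * ∫⁻ x in Metric.closedBall 0 R, ‖φ x‖ₑ ^ 2
        ≤ ENNReal.ofReal (ℓ ^ 3) * ∫⁻ x in ⋃ k ∈ K, latticeCube ℓ k, ‖φ x‖ₑ ^ 2 :=
          mul_le_mul_right (lintegral_mono_set hcover) _
      _ = ∑ k ∈ K, volume (latticeCube ℓ k) * ∫⁻ x in latticeCube ℓ k, ‖φ x‖ₑ ^ 2 := by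
          rw [lintegral_biUnion_finset hdisj (fun k _ => measurableSet_latticeCube hℓ k),
            Finset.mul_sum]
          simp_rw [volume_latticeCube hℓ]
      _ ≤ ∑ k ∈ K, (2 * (∫⁻ x in latticeCube ℓ k, ∫⁻ y in latticeCube ℓ k, ‖φ y - φ x‖ₑ ^ 2) +
            2 * ‖∫ y in latticeCube ℓ k, φ y‖ₑ ^ 2) := by
          refine Finset.sum_le_sum fun k _ =>
            volume_mul_lintegral_le hφ ?_ (hQt k)
          rw [volume_latticeCube hℓ]
          simpa using pow_pos hℓ 3
      _ ≤ _ := by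
          rw [Finset.sum_add_distrib, ← Finset.mul_sum, ← Finset.mul_sum]
          exact add_le_add_left (mul_le_mul_right (sum_latticeCube_le hφ hℓ K) _) _
  -- pass to real numbers
  set E := ∑ i, ∫ x, ‖pderiv i φ x‖ ^ 2 with hE
  have hE0 : 0 ≤ E := Finset.sum_nonneg fun i _ => integral_nonneg fun x => sq_nonneg _
  have h2 : ∑ i, ∫⁻ x, ‖pderiv i φ x‖ₑ ^ 2 = ENNReal.ofReal E := by
    rw [hE, ENNReal.ofReal_sum_of_nonneg fun i _ => integral_nonneg fun x => sq_nonneg _]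
    exact Finset.sum_congr rfl fun i _ => lintegral_enorm_sq_eq (hφ.pderiv i).integrable_sq
  have h3 : ∑ k ∈ K, ‖∫ y in latticeCube ℓ k, φ y‖ₑ ^ 2 =
      ENNReal.ofReal (∑ k ∈ K, ‖∫ y in latticeCube ℓ k, φ y‖ ^ 2) := by
    rw [ENNReal.ofReal_sum_of_nonneg fun k _ => sq_nonneg _]
    refine Finset.sum_congr rfl fun k _ => ?_
    rw [ENNReal.ofReal_pow (norm_nonneg _), ofReal_norm]
  set A := ∑ k ∈ K, ‖∫ y in latticeCube ℓ k, φ y‖ ^ 2 with hA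
  have hA0 : 0 ≤ A := Finset.sum_nonneg fun k _ => sq_nonneg _
  have htwo : ∀ r : ℝ, (2 : ℝ≥0∞) * ENNReal.ofReal r = ENNReal.ofReal (2 * r) := fun r => by
    rw [ENNReal.ofReal_mul zero_le_two, ENNReal.ofReal_ofNat]
  rw [h2, h3, lintegral_enorm_sq_eq hφ.integrable_sq.restrict,
    ← ofReal_measureReal measure_ball_lt_top.ne, ← hv,
    ← ENNReal.ofReal_mul (by positivity), ← ENNReal.ofReal_mul (by positivity),
    ← ENNReal.ofReal_mul (by positivity), htwo, htwo,
    ← ENNReal.ofReal_add (by positivity) (by positivity),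
    ENNReal.ofReal_le_ofReal_iff (by positivity)] at h1
  have hℓ3 : 0 < ℓ ^ 3 := by positivity
  rw [← le_div_iff₀' hℓ3] at h1
  refine h1.trans ?_
  have h4 : (2 * (32 * ℓ ^ 5 * v * E) + 2 * A) / ℓ ^ 3 = 64 * v * ℓ ^ 2 * E + 2 / ℓ ^ 3 * A := by
    field_simp
    ring
  rw [h4]
  exact add_le_add_left (mul_le_mul_of_nonneg_right hℓ2 hE0) _

end LocalPoincare

/-! ### The form below the threshold -/

noncomputable section LowerBound

variable {Φ : Plane → Space} {c α V₀ : ℝ} {T U U' : Set Space}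

/-- For `-m` below the threshold, the one-dimensional transverse problem binds strictly above `-m`. -/
theorem lt_sqrt_add_sqrt (hα : 0 < α) {m : ℝ} (hm : 0 < m)
    (h : -m < threshold α V₀) : α < √m + √(V₀ + m) := by
  rw [threshold] at h
  split_ifs at h with hlt
  · have h1 : ((α ^ 2 - V₀) / (2 * α)) ^ 2 < m := by
      have : ((α ^ 2 - V₀) / (2 * α)) ^ 2 = (α ^ 2 - V₀) ^ 2 / (4 * α ^ 2) := by
        rw [div_pow]; ring
      rw [this]; linarith
    have h2 : ((α ^ 2 + V₀) / (2 * α)) ^ 2 < V₀ + m := by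
      have : ((α ^ 2 + V₀) / (2 * α)) ^ 2 = V₀ + ((α ^ 2 - V₀) / (2 * α)) ^ 2 := by
        field_simp; ring
      rw [this]; linarith
    have h3 := Real.lt_sqrt_of_sq_lt h1
    have h4 := Real.lt_sqrt_of_sq_lt h2
    have h5 : (α ^ 2 - V₀) / (2 * α) + (α ^ 2 + V₀) / (2 * α) = α := by field_simp; ring
    linarith
  · have h1 : α ≤ √(V₀ + m) := Real.le_sqrt_of_sq_le (by linarith)
    have h2 := Real.sqrt_pos.2 hm
    linarith

theorem threshold_nonpos (α V₀ : ℝ) : threshold α V₀ ≤ 0 := by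
  rw [threshold]
  split_ifs
  · have : 0 ≤ (α ^ 2 - V₀) ^ 2 / (4 * α ^ 2) := by positivity
    linarith
  · exact le_rfl

/-- Far out, the energy of functions supported in balls of a given size is bounded below as in the
transverse problem. -/
theorem exists_local_energy_bound (h : IsChordBound Φ c) (hb : HasTraceBound Φ)
    (hT : IsSingularSet (Set.range Φ) T) (hreg : IsUniformlyEllipticC2Off Φ T)
    (hpl : IsAsymptoticallyPlanar Φ T) (hd : DividesInto (Set.range Φ) U U') (hα : 0 < α)
    (hV₀ : 0 < V₀) {m : ℝ} (hm : 0 < m) (hmt : -m < threshold α V₀) {r : ℝ} (hr : 0 < r) :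
    ∃ R₁ : ℝ, ∀ y : Space, R₁ < ‖y‖ → ∀ ψ, IsTestFunction ψ →
      tsupport ψ ⊆ Metric.closedBall y r → -m * ∫ x, ‖ψ x‖ ^ 2 ≤ energy Φ α V₀ U ψ := by
  have hS := lt_sqrt_add_sqrt hα hm hmt
  set S := √m + √(V₀ + m) with hSdef
  have hS0 : 0 < S := hα.trans hS
  set δ := min (1 / 32) (1 - α / S) with hδdef
  have hδ0 : 0 < δ := lt_min (by norm_num) (by rw [sub_pos, div_lt_one hS0]; exact hS)
  have hδ32 : δ ≤ 1 / 32 := min_le_left _ _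
  have hδS : α ≤ (1 - δ) * S := by
    have h1 : δ ≤ 1 - α / S := min_le_right _ _
    calc α = α / S * S := by field_simp
      _ ≤ (1 - δ) * S := by gcongr; linarith
  obtain ⟨R, hR⟩ := exists_isFlatPatch h hT hreg hpl hd (ρ := 7 * r) (by positivity) hδ0 hδ32
  obtain ⟨M, hM⟩ := ((isCompact_closedBall (0 : Plane) R).image hb.1).isBounded.exists_norm_le
  refine ⟨M + r, fun y hy ψ hψ hsupp => ?_⟩
  -- a ball that misses the surface carries no negative part of the energy
  by_cases hs : ∃ s₁, Φ s₁ ∈ Metric.closedBall y r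
  · obtain ⟨s₁, hs₁⟩ := hs
    have hRs : R < ‖s₁‖ := by
      by_contra hcon
      have h1 := hM (Φ s₁) ⟨s₁, by rw [mem_closedBall_zero_iff]; exact not_lt.1 hcon, rfl⟩
      rw [Metric.mem_closedBall, dist_comm, dist_eq_norm] at hs₁
      have := norm_sub_norm_le y (Φ s₁)
      linarith
    obtain ⟨e, he⟩ := hR s₁ hRs
    refine he.neg_le_energy hb h.injective (by linarith) (by positivity) hd hm.le hV₀.le hδS hψ
      (hsupp.trans fun x hx => ?_)
    rw [Metric.mem_closedBall] at hx hs₁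
    rw [Metric.mem_ball]
    have := dist_triangle_right x (Φ s₁) y
    linarith
  · have h0 : ∀ s, ψ (Φ s) = 0 := fun s =>
      image_eq_zero_of_notMem_tsupport fun hs' => hs ⟨s, hsupp hs'⟩
    have h1 : 0 ≤ ∫ x, ‖ψ x‖ ^ 2 := integral_nonneg fun x => sq_nonneg _
    have h2 : 0 ≤ ∑ i, ∫ x, ‖pderiv i ψ x‖ ^ 2 :=
      Finset.sum_nonneg fun i _ => integral_nonneg fun x => sq_nonneg _
    have h3 : 0 ≤ ∫ x in U, ‖ψ x‖ ^ 2 := integral_nonneg fun x => sq_nonneg _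
    have h4 : ∫ s, ‖ψ (Φ s)‖ ^ 2 ∂surfaceMeasure Φ = 0 := by simp [h0]
    rw [energy, h4]
    nlinarith [mul_nonneg hm.le h1, mul_nonneg hV₀.le h3]

/-- Below the threshold, the form is bounded below modulo finitely many functionals. -/
theorem boundedBelowModFinite_formOperator (h : IsChordBound Φ c) (hb : HasTraceBound Φ)
    (hT : IsSingularSet (Set.range Φ) T) (hreg : IsUniformlyEllipticC2Off Φ T)
    (hpl : IsAsymptoticallyPlanar Φ T) (hd : DividesInto (Set.range Φ) U U') (hα : 0 < α)
    (hV₀ : 0 < V₀) {m : ℝ} (hm : m < threshold α V₀) :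
    BoundedBelowModFinite sobolevEmb (formOperator hb α V₀ U) m := by
  set μ := threshold α V₀ with hμ
  have hμ0 : μ ≤ 0 := threshold_nonpos α V₀
  set s := μ - m with hs
  have hs0 : 0 < s := sub_pos.2 hm
  obtain ⟨χ, r, hr, hχ, hχr, hχ1, hχε⟩ := exists_localization (ε := s / 8) (by positivity)
  obtain ⟨R₁, hR₁⟩ := exists_local_energy_bound h hb hT hreg hpl hd hα hV₀ (m := -μ + s / 2)
    (by linarith) (by rw [← hμ]; linarith) hr
  obtain ⟨C, hC, hhalf⟩ := exists_half_gradient_le hb hα hV₀.le U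
  have hgrad : ∀ φ, IsTestFunction φ → 1 / 2 * ∑ i, ∫ x, ‖pderiv i φ x‖ ^ 2 ≤
      energy Φ α V₀ U φ + C * ∫ x, ‖φ x‖ ^ 2 := by
    intro φ hφ
    have h1 := hhalf (testToSobolev ⟨φ, hφ⟩)
    rw [re_inner_formOperator_test, sobolevEmb_test_norm_sq] at h1
    refine le_trans (le_of_eq ?_) h1
    congr 1
    exact Finset.sum_congr rfl fun i _ => (norm_toLp_sq ((hφ.pderiv i).memLp 2)).symm
  -- the part `θ` of the energy controls the gradient, which pays for the Poincaré inequality in the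
  -- ball; the rest is bounded by the local estimates, with a loss of `5 s / 8` from the choice of `m`
  -- there and from the gradient of `χ`, and `3 s / 8` is left for the part `θ`
  set θ := min (1 / 2) (3 * s / 8 / (C + 1)) with hθ
  have hθ0 : 0 < θ := by positivity
  have hθ2 : θ ≤ 1 / 2 := min_le_left _ _
  have hθC : θ * C ≤ 3 * s / 8 := by
    have h1 : θ ≤ 3 * s / 8 / (C + 1) := min_le_right _ _
    rw [le_div_iff₀ (by positivity)] at h1
    nlinarith
  obtain ⟨N, g, Cp, hCp, hpoin⟩ := exists_local_poincare (R₁ + r) (κ := θ / (2 * (C + 1)))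
    (by positivity)
  refine boundedBelowModFinite_of_test hb g (K := C * Cp) (by positivity) fun φ hφ => ?_
  have h1 := le_energy_of_local hb hχ hχ1 hχr (m := -μ + s / 2) (C₀ := C) (by linarith) hC hR₁
    (fun ψ hψ => by
      have h2 := hgrad ψ hψ
      have h3 : 0 ≤ ∑ i, ∫ x, ‖pderiv i ψ x‖ ^ 2 :=
        Finset.sum_nonneg fun i _ => integral_nonneg fun x => sq_nonneg _
      linarith) hφ
  have h2 := hgrad φ hφ
  have h3 := hpoin φ hφ
  set E := energy Φ α V₀ U φ
  set G := ∑ i, ∫ x, ‖pderiv i φ x‖ ^ 2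
  set n := ∫ x, ‖φ x‖ ^ 2
  set nB := ∫ x in Metric.closedBall 0 (R₁ + r), ‖φ x‖ ^ 2
  set J := ∑ j, ‖⟪g j, hφ.toL2⟫_ℂ‖ ^ 2
  have hG : 0 ≤ G := Finset.sum_nonneg fun i _ => integral_nonneg fun x => sq_nonneg _
  have hn : 0 ≤ n := integral_nonneg fun x => sq_nonneg _
  have hnB : 0 ≤ nB := integral_nonneg fun x => sq_nonneg _
  have hJ : 0 ≤ J := Finset.sum_nonneg fun i _ => sq_nonneg _
  have h4 : C * nB ≤ θ / 2 * G + C * Cp * J := by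
    have h5 : C * nB ≤ C * (θ / (2 * (C + 1)) * G + Cp * J) := mul_le_mul_of_nonneg_left h3 hC
    have h6 : C * (θ / (2 * (C + 1))) ≤ θ / 2 := by
      have : C * (θ / (2 * (C + 1))) = θ / 2 * (C / (C + 1)) := by field_simp
      rw [this]
      exact mul_le_of_le_one_right (by positivity) ((div_le_one (by positivity)).2 (by linarith))
    have h7 := mul_le_mul_of_nonneg_right h6 hG
    linarith
  have h5 := mul_le_mul_of_nonneg_right hχε hn
  have h6 : (1 - θ) * ((-(-μ + s / 2) - s / 8) * n - C * nB) ≤ (1 - θ) * E :=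
    mul_le_mul_of_nonneg_left (by linarith) (by linarith)
  have h7 : θ * (1 / 2 * G) ≤ θ * (E + C * n) := mul_le_mul_of_nonneg_left h2 hθ0.le
  have h8 : (1 - θ) * (C * nB) ≤ C * nB := by
    have := mul_nonneg hθ0.le (mul_nonneg hC hnB)
    linarith
  have h9 := mul_le_mul_of_nonneg_right hθC hn
  have h10 : 0 ≤ θ * ((-μ + 5 * s / 8) * n) :=
    mul_nonneg hθ0.le (mul_nonneg (by linarith) hn)
  have h11 : m = μ - s := by rw [hs]; ring
  rw [h11]
  nlinarith

end LowerBound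

/-! ### Cut off exponentials and smooth steps -/

noncomputable section LineFunctions

theorem hasDerivAt_comp_div {f : ℝ → ℝ} {f' R t : ℝ} (h : HasDerivAt f f' (t / R)) :
    HasDerivAt (fun t => f (t / R)) (f' / R) t := by
  have h0 : HasDerivAt (fun t : ℝ => t / R) (1 / R) t := (hasDerivAt_id t).div_const R
  have h1 := HasDerivAt.comp t h h0
  rw [mul_one_div] at h1
  exact h1

/-- A smooth cutoff function on the line. -/
def lineBump : ContDiffBump (0 : ℝ) := ⟨1, 2, one_pos, one_lt_two⟩

/-- The exponential `t ↦ exp(β t)`, cut off smoothly at distance `R`. -/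
def cutExp (β : ℂ) (R t : ℝ) : ℂ := (lineBump (t / R) : ℂ) * Complex.exp (β * t)

theorem contDiff_cutExp (β : ℂ) (R : ℝ) : ContDiff ℝ ∞ (cutExp β R) := by
  have h1 : ContDiff ℝ ∞ fun t : ℝ => (lineBump (t / R) : ℂ) :=
    Complex.ofRealCLM.contDiff.comp (lineBump.contDiff.comp (contDiff_id.div_const R))
  have h2 : ContDiff ℝ ∞ fun t : ℝ => Complex.exp (β * t) :=
    (contDiff_const.mul Complex.ofRealCLM.contDiff).cexp
  exact h1.mul h2

theorem tsupport_cutExp_subset (β : ℂ) {R : ℝ} (hR : 0 < R) :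
    tsupport (cutExp β R) ⊆ Set.Icc (-(2 * R)) (2 * R) := by
  refine closure_minimal (fun t ht => ?_) isClosed_Icc
  have h1 : t / R ∈ Function.support lineBump := fun h0 => ht (by simp [cutExp, h0])
  rw [lineBump.support_eq, mem_ball_zero_iff, Real.norm_eq_abs, abs_div, abs_of_pos hR,
    div_lt_iff₀ hR] at h1
  exact abs_le.1 h1.le

theorem cutExp_of_abs_le (β : ℂ) {R t : ℝ} (hR : 0 < R) (ht : |t| ≤ R) :
    cutExp β R t = Complex.exp (β * t) := by
  have h1 : lineBump (t / R) = 1 := by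
    refine lineBump.one_of_mem_closedBall ?_
    rw [mem_closedBall_zero_iff, Real.norm_eq_abs, abs_div, abs_of_pos hR]
    exact (div_le_one hR).2 ht
  rw [cutExp, h1, Complex.ofReal_one, one_mul]

theorem norm_cexp_le {β : ℂ} {t M : ℝ} (h : β.re * t ≤ M) :
    ‖Complex.exp (β * t)‖ ≤ Real.exp M := by
  rw [Complex.norm_exp, Complex.mul_re, Complex.ofReal_re, Complex.ofReal_im, mul_zero, sub_zero]
  exact Real.exp_le_exp.2 h

theorem norm_cutExp_le {β : ℂ} (R : ℝ) {t M : ℝ} (h : β.re * t ≤ M) :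
    ‖cutExp β R t‖ ≤ Real.exp M := by
  rw [cutExp, norm_mul, Complex.norm_real, Real.norm_of_nonneg lineBump.nonneg]
  exact (mul_le_of_le_one_left (norm_nonneg _) lineBump.le_one).trans (norm_cexp_le h)

theorem hasDerivAt_lineBump_div (R t : ℝ) :
    HasDerivAt (fun t => (lineBump (t / R) : ℂ)) ((deriv lineBump (t / R) / R : ℝ) : ℂ) t := by
  have h1 : HasDerivAt lineBump (deriv lineBump (t / R)) (t / R) :=
    ((lineBump.contDiff (n := 1)).differentiable (by norm_num) _).hasDerivAt
  exact (hasDerivAt_comp_div h1).ofReal_comp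

theorem hasDerivAt_cexp_mul (β : ℂ) (t : ℝ) :
    HasDerivAt (fun t : ℝ => Complex.exp (β * t)) (β * Complex.exp (β * t)) t := by
  have h1 : HasDerivAt (fun t : ℝ => β * (t : ℂ)) (β * 1) t :=
    (hasDerivAt_id (t : ℝ)).ofReal_comp.const_mul β
  have h2 := h1.cexp
  rwa [mul_one, mul_comm] at h2

theorem deriv_cutExp (β : ℂ) (R : ℝ) : deriv (cutExp β R) = fun t => β * cutExp β R t +
    ((deriv lineBump (t / R) / R : ℝ) : ℂ) * Complex.exp (β * t) := by
  funext t
  have h : HasDerivAt (cutExp β R) _ t := (hasDerivAt_lineBump_div R t).mul (hasDerivAt_cexp_mul β t)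
  rw [h.deriv, cutExp]
  ring

theorem deriv_deriv_cutExp (β : ℂ) (R : ℝ) : deriv (deriv (cutExp β R)) = fun t =>
    β ^ 2 * cutExp β R t + (2 * β * ((deriv lineBump (t / R) / R : ℝ) : ℂ) +
      ((deriv (deriv lineBump) (t / R) / R / R : ℝ) : ℂ)) * Complex.exp (β * t) := by
  funext t
  have h1 : HasDerivAt (cutExp β R) (deriv (cutExp β R) t) t :=
    ((contDiff_cutExp β R).differentiable (by simp) t).hasDerivAt
  have h2 : HasDerivAt (deriv lineBump) (deriv (deriv lineBump) (t / R)) (t / R) := by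
    have : ContDiff ℝ 1 (deriv lineBump) := by
      have h3 : ContDiff ℝ 2 lineBump := lineBump.contDiff
      rw [show (2 : WithTop ℕ∞) = 1 + 1 by norm_num, contDiff_succ_iff_deriv] at h3
      exact h3.2.2
    exact (this.differentiable (by norm_num) _).hasDerivAt
  have h4 : HasDerivAt (fun t => deriv lineBump (t / R) / R)
      (deriv (deriv lineBump) (t / R) / R / R) t := (hasDerivAt_comp_div h2).div_const R
  have h6 := (h1.const_mul β).add (h4.ofReal_comp.mul (hasDerivAt_cexp_mul β t))
  calc deriv (deriv (cutExp β R)) t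
      = deriv (fun t => β * cutExp β R t +
          ((deriv lineBump (t / R) / R : ℝ) : ℂ) * Complex.exp (β * t)) t := by rw [← deriv_cutExp]
    _ = _ := h6.deriv
    _ = _ := by rw [deriv_cutExp]; ring

/-- Up to an error of order `1 / R`, the cut off exponential satisfies the differential equations
of the exponential. -/
theorem exists_cutExp_bound : ∃ C : ℝ, 0 ≤ C ∧ ∀ (β : ℂ) (R t M : ℝ), 1 ≤ R → β.re * t ≤ M →
    ‖deriv (cutExp β R) t - β * cutExp β R t‖ ≤ C * Real.exp M / R ∧
      ‖deriv (deriv (cutExp β R)) t - β ^ 2 * cutExp β R t‖ ≤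
        C * (2 * ‖β‖ + 1) * Real.exp M / R := by
  have hc1 : Continuous (deriv lineBump) := (lineBump.contDiff (n := 1)).continuous_deriv le_rfl
  have hc2 : Continuous (deriv (deriv lineBump)) := by
    have h3 : ContDiff ℝ 2 lineBump := lineBump.contDiff
    rw [show (2 : WithTop ℕ∞) = 1 + 1 by norm_num, contDiff_succ_iff_deriv] at h3
    exact h3.2.2.continuous_deriv le_rfl
  obtain ⟨C₁, h₁⟩ := lineBump.hasCompactSupport.deriv.exists_bound_of_continuous hc1
  obtain ⟨C₂, h₂⟩ := lineBump.hasCompactSupport.deriv.deriv.exists_bound_of_continuous hc2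
  set C := max C₁ C₂ with hC
  have hC0 : 0 ≤ C := (norm_nonneg _).trans ((h₁ 0).trans (le_max_left _ _))
  refine ⟨C, hC0, fun β R t M hR hM => ?_⟩
  have hR0 : 0 < R := by linarith
  have hE := norm_cexp_le hM
  have hA : ‖((deriv lineBump (t / R) / R : ℝ) : ℂ)‖ ≤ C / R := by
    rw [Complex.norm_real, norm_div, Real.norm_of_nonneg hR0.le]
    exact div_le_div_of_nonneg_right ((h₁ _).trans (le_max_left _ _)) hR0.le
  have hB : ‖((deriv (deriv lineBump) (t / R) / R / R : ℝ) : ℂ)‖ ≤ C / R := by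
    rw [Complex.norm_real, norm_div, norm_div, Real.norm_of_nonneg hR0.le]
    have h1 : ‖deriv (deriv lineBump) (t / R)‖ / R ≤ C / 1 :=
      div_le_div₀ hC0 ((h₂ _).trans (le_max_right _ _)) one_pos hR
    rw [div_one] at h1
    exact div_le_div_of_nonneg_right h1 hR0.le
  constructor
  · rw [deriv_cutExp, add_sub_cancel_left, norm_mul]
    calc _ ≤ C / R * Real.exp M := mul_le_mul hA hE (norm_nonneg _) (by positivity)
      _ = _ := by ring
  · rw [deriv_deriv_cutExp, add_sub_cancel_left, norm_mul]
    have h3 : ‖2 * β * ((deriv lineBump (t / R) / R : ℝ) : ℂ) +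
        ((deriv (deriv lineBump) (t / R) / R / R : ℝ) : ℂ)‖ ≤ 2 * ‖β‖ * (C / R) + C / R := by
      refine (norm_add_le _ _).trans (add_le_add ?_ hB)
      rw [norm_mul, norm_mul, Complex.norm_ofNat]
      exact mul_le_mul_of_nonneg_left hA (by positivity)
    calc _ ≤ (2 * ‖β‖ * (C / R) + C / R) * Real.exp M :=
          mul_le_mul h3 hE (norm_nonneg _) (by positivity)
      _ = _ := by ring

/-- A smooth step that rises from `0` to `1` between `-η` and `η`. -/
def smoothStep (η t : ℝ) : ℝ := Real.smoothTransition ((t / η + 1) / 2)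

theorem contDiff_smoothStep (η : ℝ) : ContDiff ℝ ∞ (smoothStep η) :=
  Real.smoothTransition.contDiff.comp (((contDiff_id.div_const η).add contDiff_const).div_const 2)

theorem smoothStep_of_le {η t : ℝ} (hη : 0 < η) (ht : t ≤ -η) : smoothStep η t = 0 := by
  refine Real.smoothTransition.zero_of_nonpos ?_
  have : t / η ≤ -1 := by rw [div_le_iff₀ hη]; linarith
  linarith

theorem smoothStep_of_ge {η t : ℝ} (hη : 0 < η) (ht : η ≤ t) : smoothStep η t = 1 := by
  refine Real.smoothTransition.one_of_one_le ?_
  have : 1 ≤ t / η := by rw [le_div_iff₀ hη]; linarith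
  linarith

theorem smoothStep_nonneg (η t : ℝ) : 0 ≤ smoothStep η t := Real.smoothTransition.nonneg _

theorem smoothStep_le_one (η t : ℝ) : smoothStep η t ≤ 1 := Real.smoothTransition.le_one _

theorem deriv_smoothStep_of_lt {η t : ℝ} (hη : 0 < η) (ht : η < |t|) : deriv (smoothStep η) t = 0 := by
  rcases lt_abs.1 ht with h | h
  · have : smoothStep η =ᶠ[𝓝 t] fun _ => 1 := by
      filter_upwards [lt_mem_nhds h] with u hu
      exact smoothStep_of_ge hη hu.le
    rw [this.deriv_eq, deriv_const]
  · have : smoothStep η =ᶠ[𝓝 t] fun _ => 0 := by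
      filter_upwards [gt_mem_nhds (show t < -η by linarith)] with u hu
      exact smoothStep_of_le hη hu.le
    rw [this.deriv_eq, deriv_const]

theorem exists_deriv_smoothStep_le : ∃ C : ℝ, 0 ≤ C ∧ ∀ η t : ℝ, 0 < η →
    |deriv (smoothStep η) t| ≤ C / η := by
  have hc : Continuous (deriv (smoothStep 1)) :=
    (contDiff_smoothStep 1).continuous_deriv (by simp)
  obtain ⟨C, hC⟩ := (isCompact_Icc (a := (-1 : ℝ)) (b := 1)).exists_bound_of_continuousOn
    hc.continuousOn
  have hC0 : 0 ≤ C := (norm_nonneg _).trans (hC 0 (by norm_num))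
  have hbound : ∀ t, |deriv (smoothStep 1) t| ≤ C := by
    intro t
    by_cases ht : |t| ≤ 1
    · exact hC t (abs_le.1 ht)
    · rw [deriv_smoothStep_of_lt one_pos (not_le.1 ht), abs_zero]; exact hC0
  refine ⟨C, hC0, fun η t hη => ?_⟩
  have h1 : smoothStep η = fun t => smoothStep 1 (t / η) := by
    funext t; simp [smoothStep]
  have h2 : HasDerivAt (smoothStep 1) (deriv (smoothStep 1) (t / η)) (t / η) :=
    ((contDiff_smoothStep 1).differentiable (by simp) _).hasDerivAt
  rw [h1, (hasDerivAt_comp_div h2).deriv, abs_div, abs_of_pos hη]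
  exact div_le_div_of_nonneg_right (hbound _) hη.le

end LineFunctions

/-! ### Products of functions of one variable -/

noncomputable section TensorFunctions

variable (b : OrthonormalBasis (Fin 3) ℝ Space) (p : Space)

/-- The coordinates of a point of space in the orthonormal frame `b` with origin `p`. -/
def frameCoord (j : Fin 3) (x : Space) : ℝ := ⟪b j, x - p⟫_ℝ

theorem contDiff_frameCoord (j : Fin 3) : ContDiff ℝ ∞ (frameCoord b p j) :=
  contDiff_const.inner ℝ (contDiff_id.sub contDiff_const)

theorem hasFDerivAt_frameCoord (j : Fin 3) (x : Space) :
    HasFDerivAt (frameCoord b p j) (innerSL ℝ (b j)) x :=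
  (innerSL ℝ (b j)).hasFDerivAt.comp x ((hasFDerivAt_id x).sub_const p)

theorem sum_frameCoord_sq (x : Space) : ∑ j, frameCoord b p j x ^ 2 = ‖x - p‖ ^ 2 := by
  simpa [frameCoord] using b.sum_sq_norm_inner_right (x - p)

/-- The box with edges along the frame `b` with origin `p`. -/
def frameBox (l u : Fin 3 → ℝ) : Set Space := {x | ∀ j, frameCoord b p j x ∈ Set.Icc (l j) (u j)}

theorem frameBox_eq (l u : Fin 3 → ℝ) : frameBox b p l u =
    (fun x => WithLp.ofLp (b.repr (x - p))) ⁻¹' Set.Icc l u := by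
  ext x
  simp only [frameBox, frameCoord, Set.mem_ofPred_eq, Set.mem_preimage, Set.mem_Icc, Pi.le_def,
    forall_and, b.repr_apply_apply]

theorem measurePreserving_frame :
    MeasurePreserving (fun x : Space => WithLp.ofLp (b.repr (x - p))) :=
  (PiLp.volume_preserving_ofLp (Fin 3)).comp
    (b.measurePreserving_repr.comp (measurePreserving_sub_right volume p))

theorem measurableSet_frameBox (l u : Fin 3 → ℝ) : MeasurableSet (frameBox b p l u) := by
  rw [frameBox_eq]
  exact (measurePreserving_frame b p).measurable measurableSet_Icc

theorem volume_frameBox (l u : Fin 3 → ℝ) :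
    volume (frameBox b p l u) = ∏ j, ENNReal.ofReal (u j - l j) := by
  rw [frameBox_eq, (measurePreserving_frame b p).measure_preimage
    measurableSet_Icc.nullMeasurableSet, Real.volume_Icc_pi]

/-- The product of three functions of one variable, in the coordinates of a frame. -/
def tensorFun (f₀ f₁ f₂ : ℝ → ℂ) (x : Space) : ℂ :=
  f₀ (frameCoord b p 0 x) * f₁ (frameCoord b p 1 x) * f₂ (frameCoord b p 2 x)

variable {b p} {f₀ f₁ f₂ : ℝ → ℂ}

theorem hasFDerivAt_comp_frameCoord {f : ℝ → ℂ} (hf : Differentiable ℝ f) (j : Fin 3) (x : Space) :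
    HasFDerivAt (fun x => f (frameCoord b p j x))
      ((innerSL ℝ (b j)).smulRight (deriv f (frameCoord b p j x))) x :=
  (hf (frameCoord b p j x)).hasDerivAt.hasFDerivAt.comp x (hasFDerivAt_frameCoord b p j x)

theorem fderiv_tensorFun (h₀ : Differentiable ℝ f₀) (h₁ : Differentiable ℝ f₁)
    (h₂ : Differentiable ℝ f₂) (x v : Space) : fderiv ℝ (tensorFun b p f₀ f₁ f₂) x v =
      ⟪b 0, v⟫_ℝ * tensorFun b p (deriv f₀) f₁ f₂ x + ⟪b 1, v⟫_ℝ * tensorFun b p f₀ (deriv f₁) f₂ x +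
        ⟪b 2, v⟫_ℝ * tensorFun b p f₀ f₁ (deriv f₂) x := by
  have h : HasFDerivAt (tensorFun b p f₀ f₁ f₂) _ x :=
    ((hasFDerivAt_comp_frameCoord (b := b) (p := p) h₀ 0 x).mul
      (hasFDerivAt_comp_frameCoord (b := b) (p := p) h₁ 1 x)).mul
      (hasFDerivAt_comp_frameCoord (b := b) (p := p) h₂ 2 x)
  rw [h.fderiv]
  simp [tensorFun]
  ring

theorem fderiv_tensorFun_zero (h₀ : Differentiable ℝ f₀) (h₁ : Differentiable ℝ f₁)
    (h₂ : Differentiable ℝ f₂) (x : Space) :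
    fderiv ℝ (tensorFun b p f₀ f₁ f₂) x (b 0) = tensorFun b p (deriv f₀) f₁ f₂ x := by
  simp [fderiv_tensorFun h₀ h₁ h₂, b.inner_eq_ite]

theorem fderiv_tensorFun_one (h₀ : Differentiable ℝ f₀) (h₁ : Differentiable ℝ f₁)
    (h₂ : Differentiable ℝ f₂) (x : Space) :
    fderiv ℝ (tensorFun b p f₀ f₁ f₂) x (b 1) = tensorFun b p f₀ (deriv f₁) f₂ x := by
  simp [fderiv_tensorFun h₀ h₁ h₂, b.inner_eq_ite]

theorem fderiv_tensorFun_two (h₀ : Differentiable ℝ f₀) (h₁ : Differentiable ℝ f₁)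
    (h₂ : Differentiable ℝ f₂) (x : Space) :
    fderiv ℝ (tensorFun b p f₀ f₁ f₂) x (b 2) = tensorFun b p f₀ f₁ (deriv f₂) x := by
  simp [fderiv_tensorFun h₀ h₁ h₂, b.inner_eq_ite]

theorem tensorFun_eq_zero {L : ℝ} (h₀ : tsupport f₀ ⊆ Set.Icc (-L) L)
    (h₁ : tsupport f₁ ⊆ Set.Icc (-L) L) (h₂ : tsupport f₂ ⊆ Set.Icc (-L) L) {x : Space}
    (hx : x ∉ frameBox b p (fun _ => -L) fun _ => L) : tensorFun b p f₀ f₁ f₂ x = 0 := by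
  simp only [frameBox, Set.mem_ofPred_eq, Fin.forall_fin_succ, IsEmpty.forall_iff, and_true,
    not_and_or] at hx
  rw [tensorFun]
  rcases hx with h | h | h
  · rw [image_eq_zero_of_notMem_tsupport fun h' => h (h₀ h'), zero_mul, zero_mul]
  · rw [show f₁ (frameCoord b p 1 x) = 0 from
      image_eq_zero_of_notMem_tsupport fun h' => h (h₁ h'), mul_zero, zero_mul]
  · rw [show f₂ (frameCoord b p 2 x) = 0 from
      image_eq_zero_of_notMem_tsupport fun h' => h (h₂ h'), mul_zero]

theorem frameBox_subset_closedBall {L : ℝ} (hL : 0 ≤ L) :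
    frameBox b p (fun _ => -L) (fun _ => L) ⊆ Metric.closedBall p (2 * L) := by
  intro x hx
  have h1 := sum_frameCoord_sq b p x
  have h2 : ∀ j, frameCoord b p j x ^ 2 ≤ L ^ 2 := fun j => sq_le_sq' (hx j).1 (hx j).2
  rw [Fin.sum_univ_three] at h1
  rw [mem_closedBall_iff_norm]
  refine le_of_sq_le_sq ?_ (by positivity)
  nlinarith [h2 0, h2 1, h2 2]

theorem tsupport_tensorFun_subset {L : ℝ} (hL : 0 ≤ L) (h₀ : tsupport f₀ ⊆ Set.Icc (-L) L)
    (h₁ : tsupport f₁ ⊆ Set.Icc (-L) L) (h₂ : tsupport f₂ ⊆ Set.Icc (-L) L) :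
    tsupport (tensorFun b p f₀ f₁ f₂) ⊆ Metric.closedBall p (2 * L) :=
  closure_minimal (fun _ hx => frameBox_subset_closedBall hL <| by_contra fun h =>
    hx (tensorFun_eq_zero h₀ h₁ h₂ h)) Metric.isClosed_closedBall

theorem isTestFunction_tensorFun {L : ℝ} (hL : 0 ≤ L) (hs₀ : ContDiff ℝ ∞ f₀)
    (hs₁ : ContDiff ℝ ∞ f₁) (hs₂ : ContDiff ℝ ∞ f₂) (h₀ : tsupport f₀ ⊆ Set.Icc (-L) L)
    (h₁ : tsupport f₁ ⊆ Set.Icc (-L) L) (h₂ : tsupport f₂ ⊆ Set.Icc (-L) L) :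
    IsTestFunction (tensorFun b p f₀ f₁ f₂) :=
  ⟨((hs₀.comp (contDiff_frameCoord b p 0)).mul (hs₁.comp (contDiff_frameCoord b p 1))).mul
    (hs₂.comp (contDiff_frameCoord b p 2)),
    HasCompactSupport.of_support_subset_isCompact (isCompact_closedBall p (2 * L))
      ((subset_tsupport _).trans (tsupport_tensorFun_subset hL h₀ h₁ h₂))⟩

theorem norm_tensorFun_le {x : Space} {B₀ B₁ B₂ : ℝ} (h₀ : ‖f₀ (frameCoord b p 0 x)‖ ≤ B₀)
    (h₁ : ‖f₁ (frameCoord b p 1 x)‖ ≤ B₁) (h₂ : ‖f₂ (frameCoord b p 2 x)‖ ≤ B₂) :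
    ‖tensorFun b p f₀ f₁ f₂ x‖ ≤ B₀ * B₁ * B₂ := by
  rw [tensorFun, norm_mul, norm_mul]
  have := (norm_nonneg _).trans h₀
  have := (norm_nonneg _).trans h₁
  gcongr

theorem fderiv_conj_mul {v w : Space → ℂ} {x : Space} (hv : DifferentiableAt ℝ v x)
    (hw : DifferentiableAt ℝ w x) (e : Space) :
    fderiv ℝ (fun x => starRingEnd ℂ (v x) * w x) x e =
      starRingEnd ℂ (fderiv ℝ v x e) * w x + starRingEnd ℂ (v x) * fderiv ℝ w x e := by
  have h1 : HasFDerivAt (fun x => starRingEnd ℂ (v x))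
      ((Complex.conjCLE : ℂ →L[ℝ] ℂ) ∘L fderiv ℝ v x) x :=
    (Complex.conjCLE : ℂ →L[ℝ] ℂ).hasFDerivAt.comp x hv.hasFDerivAt
  have h2 : HasFDerivAt (fun x => starRingEnd ℂ (v x) * w x) _ x := h1.mul hw.hasFDerivAt
  rw [h2.fderiv]
  simp
  ring

theorem IsTestFunction.conj_mul {v w : Space → ℂ} (hv : IsTestFunction v) (hw : IsTestFunction w) :
    IsTestFunction fun x => starRingEnd ℂ (v x) * w x :=
  ⟨((Complex.conjCLE : ℂ →L[ℝ] ℂ).contDiff.comp hv.1).mul hw.1,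
    hw.2.mono' fun x hx => subset_tsupport w fun h => hx (by simp [h])⟩

theorem IsTestFunction.integrable {v : Space → ℂ} (hv : IsTestFunction v) : Integrable v :=
  hv.continuous.integrable_of_hasCompactSupport hv.2

theorem IsTestFunction.differentiable {v : Space → ℂ} (hv : IsTestFunction v) :
    Differentiable ℝ v := hv.1.differentiable (by simp)

theorem setIntegral_fderiv_conj_mul {v w : Space → ℂ} (hv : IsTestFunction v)
    (hw : IsTestFunction w) (A : Set Space) (e : Space) :
    ∫ x in A, starRingEnd ℂ (fderiv ℝ v x e) * w x =
      (∫ x in A, fderiv ℝ (fun x => starRingEnd ℂ (v x) * w x) x e) -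
        ∫ x in A, starRingEnd ℂ (v x) * fderiv ℝ w x e := by
  have h1 := ((hv.fderiv_apply e).conj_mul hw).integrable.integrableOn (s := A)
  have h2 := (hv.conj_mul (hw.fderiv_apply e)).integrable.integrableOn (s := A)
  rw [eq_sub_iff_add_eq, ← integral_add h1 h2]
  exact integral_congr_ae (Eventually.of_forall fun x =>
    (fderiv_conj_mul (hv.differentiable x) (hw.differentiable x) e).symm)

theorem integral_conj_fderiv_mul {v w : Space → ℂ} (hv : IsTestFunction v)
    (hw : IsTestFunction w) (e : Space) :
    ∫ x, starRingEnd ℂ (fderiv ℝ v x e) * w x = -∫ x, starRingEnd ℂ (v x) * fderiv ℝ w x e := by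
  have h1 := setIntegral_fderiv_conj_mul hv hw Set.univ e
  have h2 := hv.conj_mul hw
  rwa [setIntegral_univ, setIntegral_univ, setIntegral_univ,
    integral_fderiv_eq_zero (h2.1.of_le (by simp)) h2.2, zero_sub] at h1

theorem sum_conj_mul_orthonormalBasis (b c : OrthonormalBasis (Fin 3) ℝ Space)
    (L M : Space →L[ℝ] ℂ) : ∑ i, starRingEnd ℂ (L (c i)) * M (c i) =
      ∑ j, starRingEnd ℂ (L (b j)) * M (b j) := by
  have hexp : ∀ (L : Space →L[ℝ] ℂ) (i : Fin 3),
      L (c i) = ∑ j, ((⟪b j, c i⟫_ℝ : ℝ) : ℂ) * L (b j) := by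
    intro L i
    conv_lhs => rw [← b.sum_repr' (c i), map_sum]
    exact Finset.sum_congr rfl fun j _ => by rw [map_smul, Complex.real_smul]
  have horth : ∀ j k : Fin 3, ∑ i, ((⟪b j, c i⟫_ℝ : ℝ) : ℂ) * ((⟪b k, c i⟫_ℝ : ℝ) : ℂ) =
      if j = k then 1 else 0 := by
    intro j k
    have h := c.sum_inner_mul_inner (b j) (b k)
    rw [b.inner_eq_ite] at h
    have h' : (((∑ i, ⟪b j, c i⟫_ℝ * ⟪c i, b k⟫_ℝ : ℝ)) : ℂ) = if j = k then 1 else 0 := by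
      rw [h]; split_ifs <;> simp
    rw [← h', Complex.ofReal_sum]
    exact Finset.sum_congr rfl fun i _ => by rw [Complex.ofReal_mul, real_inner_comm (c i) (b k)]
  calc _ = ∑ i, ∑ j, ∑ k, (((⟪b j, c i⟫_ℝ : ℝ) : ℂ) * ((⟪b k, c i⟫_ℝ : ℝ) : ℂ)) *
        (starRingEnd ℂ (L (b j)) * M (b k)) := by
        refine Finset.sum_congr rfl fun i _ => ?_
        rw [hexp L i, hexp M i, map_sum, Finset.sum_mul_sum]
        refine Finset.sum_congr rfl fun j _ => Finset.sum_congr rfl fun k _ => ?_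
        rw [map_mul, Complex.conj_ofReal]
        ring
    _ = ∑ j, ∑ k, (if j = k then 1 else 0) * (starRingEnd ℂ (L (b j)) * M (b k)) := by
        rw [Finset.sum_comm]
        refine Finset.sum_congr rfl fun j _ => ?_
        rw [Finset.sum_comm]
        refine Finset.sum_congr rfl fun k _ => ?_
        rw [← Finset.sum_mul, horth]
    _ = _ := by simp

/-- The gradient term of the form, computed in an arbitrary orthonormal frame. -/
theorem sum_integral_pderiv (b : OrthonormalBasis (Fin 3) ℝ Space) {v w : Space → ℂ}
    (hv : IsTestFunction v) (hw : IsTestFunction w) :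
    ∑ i, ∫ x, starRingEnd ℂ (pderiv i v x) * pderiv i w x =
      ∑ j, ∫ x, starRingEnd ℂ (fderiv ℝ v x (b j)) * fderiv ℝ w x (b j) := by
  rw [← integral_finsetSum _ fun i _ => ((hv.pderiv i).conj_mul (hw.pderiv i)).integrable,
    ← integral_finsetSum _ fun j _ => ((hv.fderiv_apply _).conj_mul (hw.fderiv_apply _)).integrable]
  refine integral_congr_ae (Eventually.of_forall fun x => ?_)
  simpa [pderiv] using sum_conj_mul_orthonormalBasis b (EuclideanSpace.basisFun (Fin 3) ℝ)
    (fderiv ℝ v x) (fderiv ℝ w x)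

/-- The Cauchy-Schwarz inequality against a function that is bounded on two sets and vanishes
elsewhere. -/
theorem norm_integral_conj_mul_le {X : Type*} [MeasurableSpace X] {ν : Measure X} {v E : X → ℂ}
    (hv : MemLp v 2 ν) {S T : Set X} (hS : MeasurableSet S) (hT : MeasurableSet T) {A B M N : ℝ}
    (hA : 0 ≤ A) (hB : 0 ≤ B) (hM : 0 ≤ M) (hN : 0 ≤ N)
    (hSM : ν S ≤ ENNReal.ofReal (M ^ 2)) (hTN : ν T ≤ ENNReal.ofReal (N ^ 2))
    (hE : ∀ x, ‖E x‖ ≤ S.indicator (fun _ => A) x + T.indicator (fun _ => B) x) :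
    ‖∫ x, starRingEnd ℂ (v x) * E x ∂ν‖ ≤ (A * M + B * N) * √(∫ x, ‖v x‖ ^ 2 ∂ν) := by
  have hvm : AEMeasurable (fun x => ‖v x‖ₑ) ν := hv.1.enorm
  have hset : ∀ {S : Set X} {A M : ℝ}, MeasurableSet S → 0 ≤ A → 0 ≤ M →
      ν S ≤ ENNReal.ofReal (M ^ 2) →
      ∫⁻ x, ‖v x‖ₑ * ENNReal.ofReal (S.indicator (fun _ => A) x) ∂ν ≤
        ENNReal.ofReal (A * M * √(∫ x, ‖v x‖ ^ 2 ∂ν)) := by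
    intro S A M hS hA hM hSM
    have h1 : ∫⁻ x, ‖v x‖ₑ * ENNReal.ofReal (S.indicator (fun _ => A) x) ∂ν =
        (∫⁻ x in S, ‖v x‖ₑ ∂ν) * ENNReal.ofReal A := by
      rw [← lintegral_mul_const' _ _ ENNReal.ofReal_ne_top, ← lintegral_indicator hS]
      refine lintegral_congr fun x => ?_
      by_cases hx : x ∈ S <;> simp [hx]
    have h2 : (∫⁻ x in S, ‖v x‖ₑ ∂ν) ^ 2 ≤
        ENNReal.ofReal (M * √(∫ x, ‖v x‖ ^ 2 ∂ν)) ^ 2 := by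
      refine (sq_lintegral_le (ν.restrict S) hvm.restrict).trans ?_
      rw [Measure.restrict_apply_univ, ← ENNReal.ofReal_pow (by positivity), mul_pow,
        Real.sq_sqrt (integral_nonneg fun x => by positivity), ENNReal.ofReal_mul (by positivity)]
      refine mul_le_mul' hSM ((setLIntegral_le_lintegral S _).trans ?_)
      rw [ofReal_integral_eq_lintegral_ofReal (hv.integrable_norm_pow (by norm_num))
        (Eventually.of_forall fun x => by positivity)]
      refine lintegral_mono fun x => ?_
      rw [ENNReal.ofReal_pow (norm_nonneg _), ofReal_norm]
    rw [h1, mul_comm A, mul_assoc, mul_comm A, ← mul_assoc, ENNReal.ofReal_mul (by positivity)]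
    exact mul_le_mul_left ((ENNReal.pow_le_pow_left_iff two_ne_zero).1 h2) _
  have hI : ∀ (S : Set X) (A : ℝ), 0 ≤ A → ∀ x, 0 ≤ S.indicator (fun _ => A) x :=
    fun S A hA x => Set.indicator_nonneg (fun _ _ => hA) x
  have h3 : ‖∫ x, starRingEnd ℂ (v x) * E x ∂ν‖ₑ ≤
      ENNReal.ofReal ((A * M + B * N) * √(∫ x, ‖v x‖ ^ 2 ∂ν)) := by
    refine (enorm_integral_le_lintegral_enorm _).trans ?_
    calc ∫⁻ x, ‖starRingEnd ℂ (v x) * E x‖ₑ ∂ν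
        ≤ ∫⁻ x, (‖v x‖ₑ * ENNReal.ofReal (S.indicator (fun _ => A) x) +
            ‖v x‖ₑ * ENNReal.ofReal (T.indicator (fun _ => B) x)) ∂ν := by
          refine lintegral_mono fun x => ?_
          rw [enorm_mul, ← mul_add, ← ENNReal.ofReal_add (hI S A hA x) (hI T B hB x), RCLike.enorm_conj,
            ← ofReal_norm (E x)]
          exact mul_le_mul_right (ENNReal.ofReal_le_ofReal (hE x)) _
      _ = _ := lintegral_add_left' (hvm.mul ((measurable_const.indicator hS).ennreal_ofReal.aemeasurable)) _
      _ ≤ _ := add_le_add (hset hS hA hM hSM) (hset hT hB hN hTN)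
      _ = _ := by rw [← ENNReal.ofReal_add (by positivity) (by positivity), add_mul]
  rw [← ofReal_norm] at h3
  exact (ENNReal.ofReal_le_ofReal_iff (by positivity)).1 h3

theorem IsTestFunction.sobolev_norm_sq {v : Space → ℂ} (hv : IsTestFunction v) :
    ‖hv.toSobolev‖ ^ 2 = (∫ x, ‖v x‖ ^ 2) + ∑ i, ∫ x, ‖_root_.pderiv i v x‖ ^ 2 := by
  rw [_root_.sobolev_norm_sq, sobolevEmb_toSobolev]
  congr 1
  · exact norm_toLp_sq (hv.memLp 2)
  · refine Finset.sum_congr rfl fun i _ => ?_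
    rw [sobolevDeriv_toSobolev]
    exact norm_toLp_sq ((hv.pderiv i).memLp 2)

theorem IsTestFunction.sqrt_integral_norm_sq_le {v : Space → ℂ} (hv : IsTestFunction v) :
    √(∫ x, ‖v x‖ ^ 2) ≤ ‖hv.toSobolev‖ := by
  rw [Real.sqrt_le_left (norm_nonneg _), hv.sobolev_norm_sq]
  exact le_add_of_nonneg_right (Finset.sum_nonneg fun i _ => integral_nonneg fun x => by positivity)

theorem IsTestFunction.sqrt_integral_norm_fderiv_sq_le {v : Space → ℂ} (hv : IsTestFunction v)
    {e : Space} (he : ‖e‖ = 1) : √(∫ x, ‖fderiv ℝ v x e‖ ^ 2) ≤ ‖hv.toSobolev‖ := by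
  rw [Real.sqrt_le_left (norm_nonneg _), hv.sobolev_norm_sq]
  have h1 := IsFlatPatch.sum_setIntegral_fderiv_sq_le hv he MeasurableSet.univ
  rw [Set.compl_univ, setIntegral_univ, setIntegral_empty, add_zero] at h1
  exact h1.trans (le_add_of_nonneg_left (integral_nonneg fun x => by positivity))

theorem HasTraceBound.exists_sqrt_integral_le {Φ : Plane → Space} (h : HasTraceBound Φ) :
    ∃ C : ℝ, 0 ≤ C ∧ ∀ v (hv : IsTestFunction v),
      √(∫ s, ‖v (Φ s)‖ ^ 2 ∂surfaceMeasure Φ) ≤ C * ‖hv.toSobolev‖ := by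
  obtain ⟨C, hC⟩ := h.restrictTest_bounded
  refine ⟨|C|, abs_nonneg C, fun v hv => ?_⟩
  have h1 : ‖h.restrictTest ⟨v, hv⟩‖ ^ 2 = ∫ s, ‖v (Φ s)‖ ^ 2 ∂surfaceMeasure Φ :=
    norm_toLp_sq (h.memLp ⟨v, hv⟩)
  rw [← h1, Real.sqrt_sq (norm_nonneg _)]
  exact (hC ⟨v, hv⟩).trans (mul_le_mul_of_nonneg_right (le_abs_self C) (norm_nonneg _))

/-- A lower bound for the norm of a function that is not small on a box. -/
theorem IsTestFunction.le_integral_norm_sq {w : Space → ℂ} (hw : IsTestFunction w) {S : Set Space}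
    (hS : MeasurableSet S) {m M : ℝ} (hm : 0 ≤ m) (hM : volume S = ENNReal.ofReal M) (hM0 : 0 ≤ M)
    (h : ∀ x ∈ S, m ≤ ‖w x‖) : m ^ 2 * M ≤ ∫ x, ‖w x‖ ^ 2 := by
  have h1 := setIntegral_ge_of_const_le_real hS (by rw [hM]; exact ENNReal.ofReal_ne_top)
    (fun x hx => pow_le_pow_left₀ hm (h x hx) 2) hw.integrable_sq.integrableOn
  rw [Measure.real, hM, ENNReal.toReal_ofReal hM0] at h1
  exact h1.trans (setIntegral_le_integral hw.integrable_sq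
    (Eventually.of_forall fun x => by positivity))

/-- Every unit vector is the last vector of an orthonormal frame. -/
theorem exists_frame {e : Space} (he : ‖e‖ = 1) :
    ∃ b : OrthonormalBasis (Fin 3) ℝ Space, b 2 = e := by
  have h1 : Orthonormal ℝ (Set.domRestrict {(2 : Fin 3)} fun _ : Fin 3 => e) :=
    ⟨fun _ => he, fun i j hij => absurd (Subsingleton.elim i j) hij⟩
  obtain ⟨b, hb⟩ := h1.exists_orthonormalBasis_extension_of_card_eq (by simp)
  exact ⟨b, hb 2 rfl⟩

end TensorFunctions

/-! ### Nonnegative energies -/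

noncomputable section PositiveEnergies

variable {Φ : Plane → Space} {U U' : Set Space} {ρ δ : ℝ} {x₁ e : Space}

/-- The height over the surface of a point in a flat patch is close to its height over the
center. -/
theorem IsFlatPatch.exists_foot_abs_sub_le (h : IsFlatPatch Φ U U' ρ δ x₁ e) (hρ : 0 < ρ)
    (hδ : 0 ≤ δ) {s₁ : Plane} (hs₁ : Φ s₁ = x₁) {x : Space} (hx : x ∈ Metric.ball x₁ (ρ / 3)) :
    ∃ s, ∃ t : ℝ, Φ s ∈ Metric.ball x₁ ρ ∧ x = Φ s + t • e ∧ |⟪e, x - x₁⟫_ℝ - t| ≤ δ * ρ := by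
  obtain ⟨s, t, hs, hxs⟩ := h.exists_foot x hx
  refine ⟨s, t, hs, hxs, ?_⟩
  have h1 := h.flat s s₁ hs (by rw [hs₁]; exact Metric.mem_ball_self hρ)
  rw [hs₁] at h1
  have h2 : ⟪e, x - x₁⟫_ℝ - t = ⟪Φ s - x₁, e⟫_ℝ := by
    rw [hxs, add_sub_right_comm, inner_add_right, inner_smul_right, real_inner_self_eq_norm_sq,
      h.norm_eq, real_inner_comm]
    ring
  rw [h2]
  exact h1.trans (mul_le_mul_of_nonneg_left (mem_ball_iff_norm.1 hs).le hδ)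

theorem ball_third_subset {x₁ : Space} {ρ : ℝ} (hρ : 0 < ρ) :
    Metric.ball x₁ (ρ / 3) ⊆ Metric.ball x₁ ρ := Metric.ball_subset_ball (by linarith)

theorem IsFlatPatch.mem_right (h : IsFlatPatch Φ U U' ρ δ x₁ e) (hρ : 0 < ρ) (hδ : 0 ≤ δ)
    {s₁ : Plane} (hs₁ : Φ s₁ = x₁) {x : Space} (hx : x ∈ Metric.ball x₁ (ρ / 3))
    (hlt : ⟪e, x - x₁⟫_ℝ < -(δ * ρ)) : x ∈ U' := by
  obtain ⟨s, t, hs, rfl, ht⟩ := h.exists_foot_abs_sub_le hρ hδ hs₁ hx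
  exact h.lower s t hs (by linarith [(abs_le.1 ht).1]) (ball_third_subset hρ hx)

theorem IsFlatPatch.mem_left (h : IsFlatPatch Φ U U' ρ δ x₁ e) (hρ : 0 < ρ) (hδ : 0 ≤ δ)
    {s₁ : Plane} (hs₁ : Φ s₁ = x₁) {x : Space} (hx : x ∈ Metric.ball x₁ (ρ / 3))
    (hlt : δ * ρ < ⟪e, x - x₁⟫_ℝ) : x ∈ U := by
  obtain ⟨s, t, hs, rfl, ht⟩ := h.exists_foot_abs_sub_le hρ hδ hs₁ hx
  exact h.upper s t hs (by linarith [(abs_le.1 ht).2]) (ball_third_subset hρ hx)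

theorem IsFlatPatch.closedBall_subset (h : IsFlatPatch Φ U U' ρ δ x₁ e) (hρ : 0 < ρ) (hδ : 0 ≤ δ)
    (hδ' : δ ≤ 1 / 32) {s₁ : Plane} (hs₁ : Φ s₁ = x₁) :
    Metric.closedBall (x₁ - (ρ / 6) • e) (ρ / 12) ⊆ U' := by
  intro x hx
  have h1 : ‖x - (x₁ - (ρ / 6) • e)‖ ≤ ρ / 12 := mem_closedBall_iff_norm.1 hx
  have h2 : x - x₁ = (x - (x₁ - (ρ / 6) • e)) - (ρ / 6) • e := by abel
  refine h.mem_right hρ hδ hs₁ ?_ ?_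
  · rw [mem_ball_iff_norm, h2]
    refine (norm_sub_le _ _).trans_lt ?_
    rw [norm_smul, h.norm_eq, Real.norm_of_nonneg (by positivity)]
    linarith
  · rw [h2, inner_sub_right, inner_smul_right, real_inner_self_eq_norm_sq, h.norm_eq]
    have h3 := (le_abs_self _).trans (abs_real_inner_le_norm e (x - (x₁ - (ρ / 6) • e)))
    rw [h.norm_eq, one_mul] at h3
    nlinarith

/-- A function supported in a region without potential and away from the surface only sees the
Laplacian. -/
theorem energyPairing_eq_of_support {α V₀ : ℝ} (hd : DividesInto (Set.range Φ) U U')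
    (b : OrthonormalBasis (Fin 3) ℝ Space) {v w : Space → ℂ} (hv : IsTestFunction v)
    (hw : IsTestFunction w) (hsupp : ∀ x, x ∉ U' → w x = 0) :
    energyPairing Φ α V₀ U v w =
      ∑ j, -∫ x, starRingEnd ℂ (v x) * fderiv ℝ (fun x => fderiv ℝ w x (b j)) x (b j) := by
  have h1 : ∀ x ∈ U, w x = 0 := fun x hx => hsupp x fun hx' => Set.disjoint_left.1 hd.disjoint hx hx'
  have h2 : ∀ s, w (Φ s) = 0 := fun s => hsupp _ fun hx' => by
    have h3 : Φ s ∈ (Set.range Φ)ᶜ := hd.union_eq ▸ Or.inr hx'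
    exact h3 ⟨s, rfl⟩
  have h3 : ∫ x in U, starRingEnd ℂ (v x) * w x = 0 := by
    rw [setIntegral_congr_fun hd.isOpen_left.measurableSet
      (fun x hx => by simp only [h1 x hx, mul_zero]) (g := fun _ => (0 : ℂ))]
    simp
  simp only [energyPairing, h2, h3, mul_zero, integral_zero, add_zero, sub_zero]
  rw [sum_integral_pderiv b hv hw]
  exact Finset.sum_congr rfl fun j _ => integral_conj_fderiv_mul hv (hw.fderiv_apply (b j)) (b j)

theorem contDiff_deriv {f : ℝ → ℂ} (hf : ContDiff ℝ ∞ f) : ContDiff ℝ ∞ (deriv f) :=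
  (contDiff_infty_iff_deriv.1 hf).2

theorem tsupport_deriv_deriv_subset (f : ℝ → ℂ) : tsupport (deriv (deriv f)) ⊆ tsupport f :=
  tsupport_deriv_subset.trans tsupport_deriv_subset

theorem fderiv_fderiv_tensorFun {b : OrthonormalBasis (Fin 3) ℝ Space} {p : Space}
    {f₀ f₁ f₂ : ℝ → ℂ} (h₀ : ContDiff ℝ ∞ f₀) (h₁ : ContDiff ℝ ∞ f₁) (h₂ : ContDiff ℝ ∞ f₂)
    (x : Space) :
    fderiv ℝ (fun x => fderiv ℝ (tensorFun b p f₀ f₁ f₂) x (b 0)) x (b 0) =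
        tensorFun b p (deriv (deriv f₀)) f₁ f₂ x ∧
      fderiv ℝ (fun x => fderiv ℝ (tensorFun b p f₀ f₁ f₂) x (b 1)) x (b 1) =
        tensorFun b p f₀ (deriv (deriv f₁)) f₂ x ∧
      fderiv ℝ (fun x => fderiv ℝ (tensorFun b p f₀ f₁ f₂) x (b 2)) x (b 2) =
        tensorFun b p f₀ f₁ (deriv (deriv f₂)) x := by
  have d : ∀ {f : ℝ → ℂ}, ContDiff ℝ ∞ f → Differentiable ℝ f := fun h => h.differentiable (by simp)
  refine ⟨?_, ?_, ?_⟩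
  · simp only [fderiv_tensorFun_zero (d h₀) (d h₁) (d h₂)]
    exact fderiv_tensorFun_zero (d (contDiff_deriv h₀)) (d h₁) (d h₂) x
  · simp only [fderiv_tensorFun_one (d h₀) (d h₁) (d h₂)]
    exact fderiv_tensorFun_one (d h₀) (d (contDiff_deriv h₁)) (d h₂) x
  · simp only [fderiv_tensorFun_two (d h₀) (d h₁) (d h₂)]
    exact fderiv_tensorFun_two (d h₀) (d h₁) (d (contDiff_deriv h₂)) x

theorem norm_cutExp_le_one {β : ℂ} (hβ : β.re = 0) (R t : ℝ) : ‖cutExp β R t‖ ≤ 1 := by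
  simpa using norm_cutExp_le (β := β) R (t := t) (M := 0) (by simp [hβ])

theorem norm_cutExp_of_abs_le {β : ℂ} (hβ : β.re = 0) {R t : ℝ} (hR : 0 < R) (ht : |t| ≤ R) :
    ‖cutExp β R t‖ = 1 := by
  rw [cutExp_of_abs_le β hR ht, Complex.norm_exp]
  simp [hβ]

/-- Cut off plane waves in the region without potential are approximate eigenfunctions for
nonnegative energies. -/
theorem isApproxFormEigenvalue_of_nonneg (hb : HasTraceBound Φ)
    (hd : DividesInto (Set.range Φ) U U') (hball : ∀ R, 0 < R → ∃ p, Metric.closedBall p R ⊆ U')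
    {α V₀ r : ℝ} (hr : 0 ≤ r) :
    IsApproxFormEigenvalue sobolevEmb (formOperator hb α V₀ U) r := by
  obtain ⟨C, hC, hCb⟩ := exists_cutExp_bound
  refine isApproxFormEigenvalue_of_test hb fun ε hε => ?_
  set κ := √r with hκ
  have hκr : κ ^ 2 = r := Real.sq_sqrt hr
  set β : ℂ := Complex.I * κ with hβ
  have hβre : β.re = 0 := by simp [hβ]
  have hβsq : β ^ 2 = -r := by
    rw [hβ, mul_pow, Complex.I_sq, ← Complex.ofReal_pow, hκr]; ring
  set B := C * (2 * ‖β‖ + 1) + 2 * C with hB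
  have hB0 : 0 ≤ B := by positivity
  set R := max 1 (3 * B / ε) with hRdef
  have hR1 : 1 ≤ R := le_max_left _ _
  have hR0 : 0 < R := by linarith
  have hRε : B / R * 3 ≤ ε := by
    have : 3 * B / ε ≤ R := le_max_right _ _
    rw [div_le_iff₀ hε] at this
    rw [div_mul_eq_mul_div, div_le_iff₀ hR0]
    linarith
  obtain ⟨p, hp⟩ := hball (2 * (2 * R)) (by positivity)
  set b := EuclideanSpace.basisFun (Fin 3) ℝ
  have hs := fun β => contDiff_cutExp β R
  have ht := fun β => tsupport_cutExp_subset β hR0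
  set ψ := tensorFun b p (cutExp β R) (cutExp 0 R) (cutExp 0 R) with hψdef
  have hψ : IsTestFunction ψ := isTestFunction_tensorFun (by positivity : 0 ≤ 2 * R) (hs _) (hs _)
    (hs _) (ht _) (ht _) (ht _)
  have hN : 1 ^ 2 * (2 * R) ^ 3 ≤ ∫ x, ‖ψ x‖ ^ 2 := by
    refine hψ.le_integral_norm_sq (measurableSet_frameBox b p (fun _ => -R) fun _ => R) zero_le_one
      ?_ (by positivity) fun x hx => ?_
    · rw [volume_frameBox, Finset.prod_const, Finset.card_univ, Fintype.card_fin,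
        ENNReal.ofReal_pow (by positivity)]
      congr 2
      ring
    · have hx' := fun j => abs_le.2 (hx j)
      rw [hψdef, tensorFun, norm_mul, norm_mul, norm_cutExp_of_abs_le hβre hR0 (hx' 0),
        norm_cutExp_of_abs_le Complex.zero_re hR0 (hx' 1),
        norm_cutExp_of_abs_le Complex.zero_re hR0 (hx' 2)]
      norm_num
  rw [one_pow, one_mul] at hN
  refine ⟨ψ, hψ, lt_of_lt_of_le (by positivity) hN, fun v hv => ?_⟩
  have hsupp : ∀ x, x ∉ U' → ψ x = 0 := fun x hx => image_eq_zero_of_notMem_tsupport fun h =>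
    hx (hp (tsupport_tensorFun_subset (by positivity) (ht _) (ht _) (ht _) h))
  have hD := fderiv_fderiv_tensorFun (b := b) (p := p) (hs β) (hs 0) (hs 0)
  have hi : ∀ j, Integrable fun x =>
      starRingEnd ℂ (v x) * fderiv ℝ (fun x => fderiv ℝ ψ x (b j)) x (b j) := fun j =>
    (hv.conj_mul ((hψ.fderiv_apply (b j)).fderiv_apply (b j))).integrable
  have hi0 : Integrable fun x => starRingEnd ℂ (v x) * ψ x := (hv.conj_mul hψ).integrable
  have hkey : energyPairing Φ α V₀ U v ψ - r * ∫ x, starRingEnd ℂ (v x) * ψ x =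
      ∫ x, starRingEnd ℂ (v x) * (-(∑ j, fderiv ℝ (fun x => fderiv ℝ ψ x (b j)) x (b j)) - r * ψ x) := by
    rw [energyPairing_eq_of_support hd b hv hψ hsupp, Finset.sum_neg_distrib,
      ← integral_finsetSum _ fun j _ => hi j, ← integral_neg, ← integral_const_mul,
      ← integral_sub (f := fun x => -∑ j, starRingEnd ℂ (v x) *
        fderiv ℝ (fun x => fderiv ℝ ψ x (b j)) x (b j))
        (integrable_finsetSum _ fun j _ => hi j).neg (hi0.const_mul (r : ℂ))]
    refine integral_congr_ae (Eventually.of_forall fun x => ?_)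
    simp only [Finset.mul_sum, mul_sub, mul_neg]
    ring
  -- the norm of the defect is of order `R^(-1) R^(3/2)`, that of the plane wave of order `R^(3/2)`
  rw [hkey]
  set S := frameBox b p (fun _ => -(2 * R)) fun _ => 2 * R
  have hS : MeasurableSet S := measurableSet_frameBox _ _ _ _
  have hSv : volume S = ENNReal.ofReal (√((4 * R) ^ 3) ^ 2) := by
    rw [Real.sq_sqrt (by positivity), volume_frameBox, Finset.prod_const, Finset.card_univ,
      Fintype.card_fin, ENNReal.ofReal_pow (by positivity)]
    congr 2
    ring
  have hE : ∀ x, ‖-(∑ j, fderiv ℝ (fun x => fderiv ℝ ψ x (b j)) x (b j)) - r * ψ x‖ ≤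
      S.indicator (fun _ => B / R) x + (∅ : Set Space).indicator (fun _ => 0) x := by
    intro x
    rw [Set.indicator_empty, add_zero, Fin.sum_univ_three, (hD x).1, (hD x).2.1, (hD x).2.2]
    have ht2 := fun β => (tsupport_deriv_deriv_subset (cutExp β R)).trans (ht β)
    by_cases hx : x ∈ S
    · rw [Set.indicator_of_mem hx]
      have h0 := (hCb β R (frameCoord b p 0 x) 0 hR1 (by simp [hβre])).2
      have h1 := (hCb 0 R (frameCoord b p 1 x) 0 hR1 (by simp)).2
      have h2 := (hCb 0 R (frameCoord b p 2 x) 0 hR1 (by simp)).2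
      simp only [Real.exp_zero, mul_one, norm_zero, mul_zero, zero_add, ne_eq, OfNat.ofNat_ne_zero,
        not_false_eq_true, zero_pow, zero_mul, sub_zero] at h0 h1 h2
      set y₀ := frameCoord b p 0 x
      set y₁ := frameCoord b p 1 x
      set y₂ := frameCoord b p 2 x
      have g0 := norm_cutExp_le_one hβre R y₀
      have g1 := norm_cutExp_le_one Complex.zero_re R y₁
      have g2 := norm_cutExp_le_one Complex.zero_re R y₂
      have h3 : -(tensorFun b p (deriv (deriv (cutExp β R))) (cutExp 0 R) (cutExp 0 R) x +
          tensorFun b p (cutExp β R) (deriv (deriv (cutExp 0 R))) (cutExp 0 R) x +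
          tensorFun b p (cutExp β R) (cutExp 0 R) (deriv (deriv (cutExp 0 R))) x) - r * ψ x =
          -((deriv (deriv (cutExp β R)) y₀ - β ^ 2 * cutExp β R y₀) * cutExp 0 R y₁ * cutExp 0 R y₂ +
            cutExp β R y₀ * deriv (deriv (cutExp 0 R)) y₁ * cutExp 0 R y₂ +
            cutExp β R y₀ * cutExp 0 R y₁ * deriv (deriv (cutExp 0 R)) y₂) := by
        rw [hβsq, hψdef]
        simp only [tensorFun]
        ring
      rw [h3, norm_neg]
      refine (norm_add₃_le).trans ?_
      simp only [norm_mul]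
      calc _ ≤ C * (2 * ‖β‖ + 1) / R * 1 * 1 + 1 * (C / R) * 1 + 1 * 1 * (C / R) := by gcongr
        _ = B / R := by rw [hB]; ring
    · rw [Set.indicator_of_notMem hx, hψdef, tensorFun_eq_zero (ht2 _) (ht _) (ht _) hx,
        tensorFun_eq_zero (ht _) (ht2 _) (ht _) hx, tensorFun_eq_zero (ht _) (ht _) (ht2 _) hx,
        tensorFun_eq_zero (ht _) (ht _) (ht _) hx]
      simp
  have h1 := norm_integral_conj_mul_le (hv.memLp 2) hS MeasurableSet.empty (by positivity) le_rfl
    (Real.sqrt_nonneg _) le_rfl hSv.le (by simp) hE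
  refine h1.trans ?_
  rw [zero_mul, add_zero]
  have h2 : √((4 * R) ^ 3) ≤ 3 * √(∫ x, ‖ψ x‖ ^ 2) := by
    rw [Real.sqrt_le_left (by positivity), mul_pow 3, Real.sq_sqrt (by positivity)]
    nlinarith [pow_pos hR0 3]
  calc B / R * √((4 * R) ^ 3) * √(∫ x, ‖v x‖ ^ 2)
      ≤ B / R * (3 * √(∫ x, ‖ψ x‖ ^ 2)) * ‖hv.toSobolev‖ := by
        refine mul_le_mul (mul_le_mul_of_nonneg_left h2 (by positivity)) hv.sqrt_integral_norm_sq_le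
          (by positivity) (by positivity)
    _ = B / R * 3 * (‖hv.toSobolev‖ * √(∫ x, ‖ψ x‖ ^ 2)) := by ring
    _ ≤ ε * (‖hv.toSobolev‖ * √(∫ x, ‖ψ x‖ ^ 2)) :=
        mul_le_mul_of_nonneg_right hRε (by positivity)
    _ = _ := by ring

end PositiveEnergies

/-! ### The transverse bound state -/

noncomputable section TransverseProfile

/-- The cut off profile of the bound state of a one-dimensional `δ`-interaction at the origin, with
decay rate `a₂` on the right and `a₁` on the left, the kink being smoothed out on the scale `η`. -/
def transverseProfile (a₁ a₂ η R t : ℝ) : ℂ :=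
  smoothStep η t * cutExp (-a₂ : ℝ) R t + (1 - smoothStep η t : ℝ) * cutExp (a₁ : ℝ) R t

variable {a₁ a₂ η R t : ℝ}

theorem contDiff_transverseProfile (a₁ a₂ η R : ℝ) : ContDiff ℝ ∞ (transverseProfile a₁ a₂ η R) :=
  ((Complex.ofRealCLM.contDiff.comp (contDiff_smoothStep η)).mul (contDiff_cutExp _ R)).add
    ((Complex.ofRealCLM.contDiff.comp (contDiff_const.sub (contDiff_smoothStep η))).mul
      (contDiff_cutExp _ R))

theorem tsupport_transverseProfile_subset (hR : 0 < R) :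
    tsupport (transverseProfile a₁ a₂ η R) ⊆ Set.Icc (-(2 * R)) (2 * R) := by
  refine closure_minimal (fun t ht => by_contra fun h => ht ?_) isClosed_Icc
  have h1 : ∀ β, cutExp β R t = 0 := fun β =>
    image_eq_zero_of_notMem_tsupport fun h' => h (tsupport_cutExp_subset β hR h')
  simp [transverseProfile, h1]

theorem deriv_transverseProfile : deriv (transverseProfile a₁ a₂ η R) t =
    (deriv (smoothStep η) t : ℝ) * (cutExp (-a₂ : ℝ) R t - cutExp (a₁ : ℝ) R t) +
      (smoothStep η t * deriv (cutExp (-a₂ : ℝ) R) t +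
        (1 - smoothStep η t : ℝ) * deriv (cutExp (a₁ : ℝ) R) t) := by
  have hs : HasDerivAt (smoothStep η) (deriv (smoothStep η) t) t :=
    ((contDiff_smoothStep η).differentiable (by simp) t).hasDerivAt
  have hg : ∀ β : ℂ, HasDerivAt (cutExp β R) (deriv (cutExp β R) t) t := fun β =>
    ((contDiff_cutExp β R).differentiable (by simp) t).hasDerivAt
  have h : HasDerivAt (transverseProfile a₁ a₂ η R) _ t :=
    (hs.ofReal_comp.mul (hg _)).add ((hs.const_sub 1).ofReal_comp.mul (hg _))
  rw [h.deriv]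
  push_cast
  ring

theorem abs_exp_sub_exp_le {x y M : ℝ} (hx : x ≤ M) (hy : y ≤ M) :
    |Real.exp x - Real.exp y| ≤ Real.exp M * |x - y| := by
  wlog h : y ≤ x generalizing x y
  · rw [abs_sub_comm, abs_sub_comm x]
    exact this hy hx (le_of_not_ge h)
  have h1 := Real.add_one_le_exp (y - x)
  have h2 : Real.exp y = Real.exp x * Real.exp (y - x) := by rw [← Real.exp_add]; ring_nf
  have h3 := Real.exp_le_exp.2 hx
  have h4 := Real.exp_pos x
  rw [abs_of_nonneg (sub_nonneg.2 (Real.exp_le_exp.2 h)), abs_of_nonneg (sub_nonneg.2 h), h2]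
  nlinarith [mul_le_mul_of_nonneg_right h3 (sub_nonneg.2 h)]

/-- The estimates for the transverse profile. It is bounded; on either side it agrees, outside the
layer `|t| ≤ η`, with the exponential on this side, up to the errors of order `1 / R` that the
cutoff causes; and the jump of the derivative of the exponentials is `a₁ + a₂` times the value of
the profile. -/
def IsProfileBound (a₁ a₂ η R K : ℝ) : Prop :=
  ∀ t, ‖transverseProfile a₁ a₂ η R t‖ ≤ K ∧
    (-η ≤ t →
      ‖deriv (transverseProfile a₁ a₂ η R) t - deriv (cutExp (-a₂ : ℝ) R) t‖ ≤
          (Set.Icc (-η) η).indicator (fun _ => K) t ∧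
        ‖(a₂ : ℂ) ^ 2 * transverseProfile a₁ a₂ η R t - deriv (deriv (cutExp (-a₂ : ℝ) R)) t‖ ≤
          (Set.Icc (-η) η).indicator (fun _ => K) t + K / R) ∧
    (t ≤ η →
      ‖deriv (transverseProfile a₁ a₂ η R) t - deriv (cutExp (a₁ : ℝ) R) t‖ ≤
          (Set.Icc (-η) η).indicator (fun _ => K) t ∧
        ‖(a₁ : ℂ) ^ 2 * transverseProfile a₁ a₂ η R t - deriv (deriv (cutExp (a₁ : ℝ) R)) t‖ ≤
          (Set.Icc (-η) η).indicator (fun _ => K) t + K / R) ∧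
    (t ∈ Set.Icc (-η) η →
      ‖deriv (cutExp (a₁ : ℝ) R) t - deriv (cutExp (-a₂ : ℝ) R) t‖ ≤ K ∧
        ‖deriv (cutExp (a₁ : ℝ) R) t - deriv (cutExp (-a₂ : ℝ) R) t -
          (a₁ + a₂ : ℝ) * transverseProfile a₁ a₂ η R t‖ ≤ K * (η + 1 / R))

/-- The estimates hold with one constant for all widths `η ≤ 1` of the layer and all cutoff
lengths `R ≥ 2`. -/
theorem exists_isProfileBound (h₁ : 0 ≤ a₁) (h₂ : 0 ≤ a₂) : ∃ K : ℝ, 0 ≤ K ∧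
    ∀ η R : ℝ, 0 < η → η ≤ 1 → 2 ≤ R → IsProfileBound a₁ a₂ η R K := by
  obtain ⟨C, hC, hCb⟩ := exists_cutExp_bound
  obtain ⟨D, hD, hDb⟩ := exists_deriv_smoothStep_le
  set M := a₁ + a₂ with hM
  set E := Real.exp M with hE
  have hE0 : 0 < E := Real.exp_pos _
  have hM0 : 0 ≤ M := by positivity
  refine ⟨E + D * E * M + 2 * (M + C) * E + M ^ 2 * (E * M) + C * (2 * M + 1) * E + E * M * M +
    2 * C * E, by positivity, fun η R hη hη1 hR t => ?_⟩
  set K := E + D * E * M + 2 * (M + C) * E + M ^ 2 * (E * M) + C * (2 * M + 1) * E + E * M * M +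
    2 * C * E with hK
  have k1 : 0 ≤ D * E * M := by positivity
  have k2 : 0 ≤ 2 * (M + C) * E := by positivity
  have k3 : 0 ≤ M ^ 2 * (E * M) := by positivity
  have k4 : 0 ≤ C * (2 * M + 1) * E := by positivity
  have k5 : 0 ≤ E * M * M := by positivity
  have k6 : 0 ≤ 2 * C * E := by positivity
  have hK0 : 0 ≤ K := by positivity
  have hR0 : 0 < R := by linarith
  have hR1 : 1 ≤ R := by linarith
  set θ := smoothStep η t with hθ
  have hθ0 : 0 ≤ θ := smoothStep_nonneg _ _
  have hθ1 : θ ≤ 1 := smoothStep_le_one _ _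
  set gp := cutExp (-a₂ : ℝ) R with hgp
  set gm := cutExp (a₁ : ℝ) R with hgm
  have hf : transverseProfile a₁ a₂ η R t = θ * gp t + (1 - θ : ℝ) * gm t := rfl
  have hp : -η ≤ t → ((-a₂ : ℝ) : ℂ).re * t ≤ M := fun ht => by
    rw [Complex.ofReal_re]; nlinarith
  have hm : t ≤ η → ((a₁ : ℝ) : ℂ).re * t ≤ M := fun ht => by
    rw [Complex.ofReal_re]; nlinarith
  have hnθ : ‖(θ : ℂ)‖ = θ := by rw [Complex.norm_real, Real.norm_of_nonneg hθ0]
  have hnθ' : ‖((1 - θ : ℝ) : ℂ)‖ = 1 - θ := by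
    rw [Complex.norm_real, Real.norm_of_nonneg (by linarith)]
  have hna₁ : ‖((a₁ : ℝ) : ℂ)‖ = a₁ := by rw [Complex.norm_real, Real.norm_of_nonneg h₁]
  have hna₂ : ‖((-a₂ : ℝ) : ℂ)‖ = a₂ := by
    rw [Complex.norm_real, norm_neg, Real.norm_of_nonneg h₂]
  -- outside the layer the profile is one of the two exponentials
  have hright : η < t → θ = 1 ∧ deriv (smoothStep η) t = 0 := fun ht =>
    ⟨smoothStep_of_ge hη ht.le, deriv_smoothStep_of_lt hη (lt_abs.2 (Or.inl ht))⟩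
  have hleft : t < -η → θ = 0 ∧ deriv (smoothStep η) t = 0 := fun ht =>
    ⟨smoothStep_of_le hη ht.le, deriv_smoothStep_of_lt hη (lt_abs.2 (Or.inr (by linarith)))⟩
  have hdiff : t ∈ Set.Icc (-η) η → ‖gp t - gm t‖ ≤ E * M * η := by
    intro ht
    have habs : |t| ≤ η := abs_le.2 ht
    rw [hgp, hgm, cutExp_of_abs_le _ hR0 (by linarith), cutExp_of_abs_le _ hR0 (by linarith),
      ← Complex.ofReal_mul, ← Complex.ofReal_mul, ← Complex.ofReal_exp, ← Complex.ofReal_exp,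
      ← Complex.ofReal_sub, Complex.norm_real]
    have h3 := abs_exp_sub_exp_le (by simpa using hp ht.1 : -a₂ * t ≤ M)
      (by simpa using hm ht.2 : a₁ * t ≤ M)
    have h4 : |-a₂ * t - a₁ * t| = M * |t| := by
      rw [← sub_mul, abs_mul, show -a₂ - a₁ = -M by rw [hM]; ring, abs_neg, abs_of_nonneg hM0]
    rw [h4, ← mul_assoc] at h3
    exact h3.trans (mul_le_mul_of_nonneg_left habs (by positivity))
  have hdp : -η ≤ t → ‖deriv gp t - (-a₂ : ℝ) * gp t‖ ≤ C * E / R := fun ht =>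
    (hCb _ R t M hR1 (hp ht)).1
  have hdm : t ≤ η → ‖deriv gm t - (a₁ : ℝ) * gm t‖ ≤ C * E / R := fun ht =>
    (hCb _ R t M hR1 (hm ht)).1
  have hCR : C * E / R ≤ C * E := div_le_self (by positivity) hR1
  have hdp' : -η ≤ t → ‖deriv gp t‖ ≤ (M + C) * E := fun ht => by
    have h3 := norm_cutExp_le R (hp ht)
    have h4 : ‖((-a₂ : ℝ) : ℂ) * gp t‖ ≤ M * E := by
      rw [norm_mul, hna₂]; gcongr; linarith
    have h5 := norm_le_norm_add_norm_sub (((-a₂ : ℝ) : ℂ) * gp t) (deriv gp t)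
    rw [norm_sub_rev] at h5
    linarith [hdp ht]
  have hdm' : t ≤ η → ‖deriv gm t‖ ≤ (M + C) * E := fun ht => by
    have h3 := norm_cutExp_le R (hm ht)
    have h4 : ‖((a₁ : ℝ) : ℂ) * gm t‖ ≤ M * E := by
      rw [norm_mul, hna₁]; gcongr; linarith
    have h5 := norm_le_norm_add_norm_sub (((a₁ : ℝ) : ℂ) * gm t) (deriv gm t)
    rw [norm_sub_rev] at h5
    linarith [hdm ht]
  have hjump : t ∈ Set.Icc (-η) η → ‖deriv gm t - deriv gp t‖ ≤ 2 * (M + C) * E := fun ht =>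
    (norm_sub_le _ _).trans (by linarith [hdp' ht.1, hdm' ht.2])
  have hθ' : t ∈ Set.Icc (-η) η →
      ‖((deriv (smoothStep η) t : ℝ) : ℂ) * (gp t - gm t)‖ ≤ D * E * M := fun ht => by
    rw [norm_mul, Complex.norm_real]
    calc _ ≤ D / η * (E * M * η) :=
          mul_le_mul (hDb η t hη) (hdiff ht) (norm_nonneg _) (by positivity)
      _ = D * E * M := by field_simp
  refine ⟨?_, fun ht => ?_, fun ht => ?_, fun ht => ⟨?_, ?_⟩⟩
  · have h3 : ‖(θ : ℂ) * gp t‖ ≤ θ * E := by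
      rw [norm_mul, hnθ]
      by_cases ht : t < -η
      · rw [(hleft ht).1]; simp
      · exact mul_le_mul_of_nonneg_left (norm_cutExp_le R (hp (not_lt.1 ht))) hθ0
    have h4 : ‖((1 - θ : ℝ) : ℂ) * gm t‖ ≤ (1 - θ) * E := by
      rw [norm_mul, hnθ']
      by_cases ht : η < t
      · rw [(hright ht).1]; simp
      · exact mul_le_mul_of_nonneg_left (norm_cutExp_le R (hm (not_lt.1 ht))) (by linarith)
    rw [hf]
    refine (norm_add_le _ _).trans ?_
    linarith
  · have h5 := (hCb _ R t M hR1 (hp ht)).2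
    rw [hna₂, norm_sub_rev, Complex.ofReal_neg, neg_sq, ← Complex.ofReal_neg] at h5
    have h6 : C * (2 * a₂ + 1) * E / R ≤ K / R := by
      refine div_le_div_of_nonneg_right ?_ hR0.le
      have : C * (2 * a₂ + 1) * E ≤ C * (2 * M + 1) * E := by gcongr; linarith
      linarith
    have h7 : (a₂ : ℂ) ^ 2 * transverseProfile a₁ a₂ η R t - deriv (deriv gp) t =
        (a₂ : ℂ) ^ 2 * ((1 - θ : ℝ) * (gm t - gp t)) + ((a₂ : ℂ) ^ 2 * gp t - deriv (deriv gp) t) := by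
      rw [hf]; push_cast; ring
    have h8 : deriv (transverseProfile a₁ a₂ η R) t - deriv gp t =
        (deriv (smoothStep η) t : ℝ) * (gp t - gm t) + (1 - θ : ℝ) * (deriv gm t - deriv gp t) := by
      rw [deriv_transverseProfile, ← hgp, ← hgm, ← hθ]; push_cast; ring
    rw [h7, h8]
    by_cases htη : η < t
    · rw [Set.indicator_of_notMem fun h => absurd h.2 (not_le.2 htη), (hright htη).1,
        (hright htη).2]
      simp only [sub_self, Complex.ofReal_zero, zero_mul, mul_zero, zero_add, norm_zero, le_refl,
        true_and]
      exact h5.trans h6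
    · have ht' : t ∈ Set.Icc (-η) η := ⟨ht, not_lt.1 htη⟩
      rw [Set.indicator_of_mem ht']
      constructor
      · refine (norm_add_le _ _).trans ?_
        have h9 : ‖((1 - θ : ℝ) : ℂ) * (deriv gm t - deriv gp t)‖ ≤ 1 * (2 * (M + C) * E) := by
          rw [norm_mul, hnθ']
          exact mul_le_mul (by linarith) (hjump ht') (norm_nonneg _) zero_le_one
        linarith [hθ' ht']
      · refine (norm_add_le _ _).trans (add_le_add ?_ (h5.trans h6))
        rw [norm_mul, norm_mul, hnθ', norm_pow, Complex.norm_real, Real.norm_of_nonneg h₂,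
          norm_sub_rev]
        have h9 : a₂ ^ 2 * ((1 - θ) * ‖gp t - gm t‖) ≤ M ^ 2 * (1 * (E * M * 1)) := by
          have := (hdiff ht').trans (mul_le_mul_of_nonneg_left hη1 (by positivity))
          gcongr <;> linarith
        linarith
  · have h5 := (hCb _ R t M hR1 (hm ht)).2
    rw [hna₁, norm_sub_rev] at h5
    have h6 : C * (2 * a₁ + 1) * E / R ≤ K / R := by
      refine div_le_div_of_nonneg_right ?_ hR0.le
      have : C * (2 * a₁ + 1) * E ≤ C * (2 * M + 1) * E := by gcongr; linarith
      linarith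
    have h7 : (a₁ : ℂ) ^ 2 * transverseProfile a₁ a₂ η R t - deriv (deriv gm) t =
        (a₁ : ℂ) ^ 2 * (θ * (gp t - gm t)) + ((a₁ : ℂ) ^ 2 * gm t - deriv (deriv gm) t) := by
      rw [hf]; push_cast; ring
    have h8 : deriv (transverseProfile a₁ a₂ η R) t - deriv gm t =
        (deriv (smoothStep η) t : ℝ) * (gp t - gm t) + -(θ * (deriv gm t - deriv gp t)) := by
      rw [deriv_transverseProfile, ← hgp, ← hgm, ← hθ]; push_cast; ring
    rw [h7, h8]
    by_cases htη : t < -η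
    · rw [Set.indicator_of_notMem fun h => absurd h.1 (not_le.2 htη), (hleft htη).1,
        (hleft htη).2]
      simp only [Complex.ofReal_zero, zero_mul, mul_zero, zero_add, norm_zero, le_refl, neg_zero,
        true_and]
      exact h5.trans h6
    · have ht' : t ∈ Set.Icc (-η) η := ⟨not_lt.1 htη, ht⟩
      rw [Set.indicator_of_mem ht']
      constructor
      · refine (norm_add_le _ _).trans ?_
        have h9 : ‖-((θ : ℂ) * (deriv gm t - deriv gp t))‖ ≤ 1 * (2 * (M + C) * E) := by
          rw [norm_neg, norm_mul, hnθ]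
          exact mul_le_mul hθ1 (hjump ht') (norm_nonneg _) zero_le_one
        linarith [hθ' ht']
      · refine (norm_add_le _ _).trans (add_le_add ?_ (h5.trans h6))
        rw [norm_mul, norm_mul, hnθ, norm_pow, Complex.norm_real, Real.norm_of_nonneg h₁]
        have h9 : a₁ ^ 2 * (θ * ‖gp t - gm t‖) ≤ M ^ 2 * (1 * (E * M * 1)) := by
          have := (hdiff ht').trans (mul_le_mul_of_nonneg_left hη1 (by positivity))
          gcongr
          linarith
        linarith
  · linarith [hjump ht]
  · have h7 : deriv gm t - deriv gp t - (M : ℂ) * transverseProfile a₁ a₂ η R t =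
        (deriv gm t - (a₁ : ℝ) * gm t) - (deriv gp t - (-a₂ : ℝ) * gp t) +
          ((a₂ - M * θ : ℝ) : ℂ) * (gp t - gm t) := by
      rw [hf, hM]; push_cast; ring
    rw [h7]
    have h9 : ‖((a₂ - M * θ : ℝ) : ℂ) * (gp t - gm t)‖ ≤ M * (E * M * η) := by
      rw [norm_mul, Complex.norm_real]
      refine mul_le_mul (abs_le.2 ⟨?_, ?_⟩) (hdiff ht) (norm_nonneg _) hM0 <;> nlinarith
    have h10 : M * (E * M * η) ≤ K * η := by
      rw [show M * (E * M * η) = E * M * M * η by ring]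
      exact mul_le_mul_of_nonneg_right (by linarith) hη.le
    have h11 : 2 * C * E / R ≤ K / R := div_le_div_of_nonneg_right (by linarith) hR0.le
    have h12 : C * E / R + C * E / R = 2 * C * E / R := by ring
    have h13 : K * (η + 1 / R) = K * η + K / R := by ring
    rw [h13]
    refine (norm_add_le _ _).trans ?_
    have := norm_sub_le (deriv gm t - (a₁ : ℝ) * gm t) (deriv gp t - (-a₂ : ℝ) * gp t)
    linarith [hdp ht.1, hdm ht.2]

end TransverseProfile

/-! ### Integration by parts on the two sides of the surface -/

noncomputable section FormIdentity

variable {Φ : Plane → Space} {U U' : Set Space} {ρ δ : ℝ} {x₁ e : Space}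

/-- The ratio of the area elements of the projection of the surface along `e` and of the surface
itself, equal to `1` where the latter vanishes. -/
def areaRatio (Φ : Plane → Space) (e : Space) (s : Plane) : ℝ :=
  if √(metricTensor Φ s).det = 0 then 1 else |⟪normalVec Φ s, e⟫_ℝ| / √(metricTensor Φ s).det

theorem mul_areaRatio (he : ‖e‖ = 1) (s : Plane) :
    √(metricTensor Φ s).det * areaRatio Φ e s = |⟪normalVec Φ s, e⟫_ℝ| := by
  rw [areaRatio]
  split_ifs with h
  · have h1 := abs_inner_normalVec_le Φ s he
    rw [h] at h1 ⊢
    rw [zero_mul, le_antisymm h1 (abs_nonneg _)]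
  · exact mul_div_cancel₀ _ h

theorem IsFlatPatch.abs_areaRatio_sub_one_le (h : IsFlatPatch Φ U U' ρ δ x₁ e) (hδ : 0 ≤ δ)
    {s : Plane} (hs : Φ s ∈ Metric.ball x₁ ρ) : |areaRatio Φ e s - 1| ≤ δ := by
  rw [areaRatio]
  split_ifs with h0
  · simpa using hδ
  · have h1 : 0 < √(metricTensor Φ s).det := (Real.sqrt_nonneg _).lt_of_ne' h0
    have h2 := abs_inner_normalVec_le Φ s h.norm_eq
    have h3 := h.density_le s hs
    rw [abs_le]
    constructor
    · rw [neg_le_sub_iff_le_add, ← sub_le_iff_le_add, le_div_iff₀ h1]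
      linarith
    · rw [sub_le_iff_le_add, div_le_iff₀ h1]
      nlinarith

theorem HasTraceBound.integrable_conj_mul (hb : HasTraceBound Φ) {v w : Space → ℂ}
    (hv : IsTestFunction v) (hw : IsTestFunction w) :
    Integrable (fun s => starRingEnd ℂ (v (Φ s)) * w (Φ s)) (surfaceMeasure Φ) := by
  have h := L2.integrable_inner (𝕜 := ℂ) ((hb.memLp ⟨v, hv⟩).toLp _) ((hb.memLp ⟨w, hw⟩).toLp _)
  refine h.congr ?_
  filter_upwards [(hb.memLp ⟨v, hv⟩).coeFn_toLp, (hb.memLp ⟨w, hw⟩).coeFn_toLp] with s h1 h2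
  rw [h1, h2]
  simp [mul_comm]

theorem integrable_areaRatio_smul (he : ‖e‖ = 1) (hΦ : Continuous Φ) {F : Space → ℂ}
    (hF : Continuous F) (hi : Integrable (fun s => F (Φ s)) (surfaceMeasure Φ)) :
    Integrable (fun s => areaRatio Φ e s • F (Φ s)) (surfaceMeasure Φ) := by
  rw [integrable_surfaceMeasure_iff]
  refine (integrable_inner_normalVec_smul he hi
    (hF.comp hΦ).aestronglyMeasurable).congr (Eventually.of_forall fun s => ?_)
  simp only [smul_smul, mul_areaRatio he]

theorem IsFlatPatch.setIntegral_normalVec_eq (h : IsFlatPatch Φ U U' ρ δ x₁ e) (hρ : 0 < ρ)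
    {F : Space → ℂ} (hsupp : tsupport F ⊆ Metric.ball x₁ (ρ / 3)) :
    ∫ s in Φ ⁻¹' Metric.ball x₁ ρ, |⟪normalVec Φ s, e⟫_ℝ| • F (Φ s) =
      ∫ s, areaRatio Φ e s • F (Φ s) ∂surfaceMeasure Φ := by
  rw [setIntegral_eq_integral_of_forall_compl_eq_zero, integral_surfaceMeasure]
  · simp only [smul_smul, mul_areaRatio h.norm_eq]
  · intro s hs
    rw [image_eq_zero_of_notMem_tsupport fun h' => hs (ball_third_subset hρ (hsupp h')), smul_zero]

theorem tsupport_conj_mul_subset (v w : Space → ℂ) :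
    tsupport (fun x => starRingEnd ℂ (v x) * w x) ⊆ tsupport w :=
  closure_mono fun x hx h => hx (by simp [h])

theorem tsupport_fderiv_apply_subset' (w : Space → ℂ) (e : Space) :
    tsupport (fun x => fderiv ℝ w x e) ⊆ tsupport w := tsupport_fderiv_apply_subset ℝ e

theorem integral_conj_mul_indicator {v g : Space → ℂ} {A : Set Space} (hA : MeasurableSet A) :
    ∫ x, starRingEnd ℂ (v x) * A.indicator g x = ∫ x in A, starRingEnd ℂ (v x) * g x := by
  rw [← integral_indicator hA]
  refine integral_congr_ae (Eventually.of_forall fun x => ?_)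
  by_cases hx : x ∈ A <;> simp [hx]

theorem integrable_conj_mul_indicator {v g : Space → ℂ} {A : Set Space} (hA : MeasurableSet A)
    (hv : IsTestFunction v) (hg : IsTestFunction g) :
    Integrable fun x => starRingEnd ℂ (v x) * A.indicator g x := by
  refine ((hv.conj_mul hg).integrable.indicator hA).congr (Eventually.of_forall fun x => ?_)
  by_cases hx : x ∈ A <;> simp [hx]

theorem integral_sub_sub {X : Type*} [MeasurableSpace X] {ν : Measure X} {f g h : X → ℂ}
    (hf : Integrable f ν) (hg : Integrable g ν) (hh : Integrable h ν) :
    Integrable (fun x => f x - g x - h x) ν ∧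
      ∫ x, (f x - g x - h x) ∂ν = ∫ x, f x ∂ν - ∫ x, g x ∂ν - ∫ x, h x ∂ν := by
  refine ⟨(hf.sub hg).sub hh, ?_⟩
  rw [integral_sub (f := fun x => f x - g x) (hf.sub hg) hh, integral_sub hf hg]

theorem integral_conj_mul_sides {A : Set Space} (hA : MeasurableSet A) {v w g₁ g₂ : Space → ℂ}
    (hv : IsTestFunction v) (hw : IsTestFunction w) (h₁ : IsTestFunction g₁)
    (h₂ : IsTestFunction g₂) :
    ∫ x, starRingEnd ℂ (v x) * (w x - (A.indicator g₁ x + Aᶜ.indicator g₂ x)) =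
      (∫ x, starRingEnd ℂ (v x) * w x) - (∫ x in A, starRingEnd ℂ (v x) * g₁ x) -
        (∫ x in Aᶜ, starRingEnd ℂ (v x) * g₂ x) := by
  rw [← integral_conj_mul_indicator hA, ← integral_conj_mul_indicator hA.compl,
    ← (integral_sub_sub (hv.conj_mul hw).integrable (integrable_conj_mul_indicator hA hv h₁)
      (integrable_conj_mul_indicator hA.compl hv h₂)).2]
  exact integral_congr_ae (Eventually.of_forall fun x => by ring)

theorem integral_conj_mul_defect {A : Set Space} (hA : MeasurableSet A)
    {v w f₀ f₁ g₁ g₂ : Space → ℂ} (hv : IsTestFunction v) (hw : IsTestFunction w)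
    (hf₀ : IsTestFunction f₀) (hf₁ : IsTestFunction f₁) (h₁ : IsTestFunction g₁)
    (h₂ : IsTestFunction g₂) (V₀ r : ℂ) :
    ∫ x, starRingEnd ℂ (v x) * (V₀ * A.indicator w x - r * w x - (f₀ x + f₁ x) -
        (A.indicator g₁ x + Aᶜ.indicator g₂ x)) =
      V₀ * (∫ x in A, starRingEnd ℂ (v x) * w x) - r * (∫ x, starRingEnd ℂ (v x) * w x) -
        ((∫ x, starRingEnd ℂ (v x) * f₀ x) + ∫ x, starRingEnd ℂ (v x) * f₁ x) -
        ((∫ x in A, starRingEnd ℂ (v x) * g₁ x) + ∫ x in Aᶜ, starRingEnd ℂ (v x) * g₂ x) := by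
  have h1 := (integrable_conj_mul_indicator hA hv hw).const_mul V₀
  have h2 := (hv.conj_mul hw).integrable.const_mul r
  have h7 := integral_sub_sub h1 h2 (hv.conj_mul hf₀).integrable
  have h8 := integral_sub_sub h7.1 (hv.conj_mul hf₁).integrable
    (integrable_conj_mul_indicator hA hv h₁)
  have h9 := integral_sub h8.1 (integrable_conj_mul_indicator hA.compl hv h₂)
  rw [h8.2, h7.2, integral_const_mul, integral_const_mul, integral_conj_mul_indicator hA,
    integral_conj_mul_indicator hA, integral_conj_mul_indicator hA.compl] at h9
  rw [← sub_sub, ← sub_sub, ← h9]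
  exact integral_congr_ae (Eventually.of_forall fun x => by ring)

theorem integral_conj_mul_jump (hb : HasTraceBound Φ) (he : ‖e‖ = 1) {v w g₁ g₂ : Space → ℂ}
    (hv : IsTestFunction v) (hw : IsTestFunction w) (h₁ : IsTestFunction g₁)
    (h₂ : IsTestFunction g₂) (α : ℂ) :
    ∫ s, starRingEnd ℂ (v (Φ s)) * (areaRatio Φ e s * (g₂ (Φ s) - g₁ (Φ s)) - α * w (Φ s))
        ∂surfaceMeasure Φ =
      (∫ s, areaRatio Φ e s • (starRingEnd ℂ (v (Φ s)) * g₂ (Φ s)) ∂surfaceMeasure Φ) -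
        (∫ s, areaRatio Φ e s • (starRingEnd ℂ (v (Φ s)) * g₁ (Φ s)) ∂surfaceMeasure Φ) -
        α * ∫ s, starRingEnd ℂ (v (Φ s)) * w (Φ s) ∂surfaceMeasure Φ := by
  rw [← integral_const_mul, ← (integral_sub_sub
    (integrable_areaRatio_smul he hb.1 (hv.conj_mul h₂).continuous (hb.integrable_conj_mul hv h₂))
    (integrable_areaRatio_smul he hb.1 (hv.conj_mul h₁).continuous (hb.integrable_conj_mul hv h₁))
    ((hb.integrable_conj_mul hv hw).const_mul α)).2]
  refine integral_congr_ae (Eventually.of_forall fun s => ?_)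
  simp only [Complex.real_smul]
  ring

/-- The form on a function supported in a flat patch, compared with functions `w₁` on the side of
`U` and `w₂` on the other side. If `w` is close to `w₁` and `w₂` on the respective sides, then the
derivative normal to the patch may be integrated by parts on the two sides separately. The three
integrands are the error of the normal derivative, the defect in the differential equation and the
defect in the jump condition on the surface. -/
theorem IsFlatPatch.energyPairing_sub_eq (h : IsFlatPatch Φ U U' ρ δ x₁ e) (hb : HasTraceBound Φ)
    (hinj : Function.Injective Φ) (hδ : δ < 1) (hρ : 0 < ρ) (hd : DividesInto (Set.range Φ) U U')
    {α V₀ r : ℝ} {b : OrthonormalBasis (Fin 3) ℝ Space} (hbe : b 2 = e) {v w w₁ w₂ : Space → ℂ}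
    (hv : IsTestFunction v) (hw : IsTestFunction w) (hw₁ : IsTestFunction w₁)
    (hw₂ : IsTestFunction w₂) (hs₁ : tsupport w₁ ⊆ Metric.ball x₁ (ρ / 3))
    (hs₂ : tsupport w₂ ⊆ Metric.ball x₁ (ρ / 3)) :
    energyPairing Φ α V₀ U v w - r * ∫ x, starRingEnd ℂ (v x) * w x =
      (∫ x, starRingEnd ℂ (fderiv ℝ v x e) * (fderiv ℝ w x e -
        (U.indicator (fun x => fderiv ℝ w₁ x e) x + Uᶜ.indicator (fun x => fderiv ℝ w₂ x e) x))) +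
      (∫ x, starRingEnd ℂ (v x) * (V₀ * U.indicator w x - r * w x -
        (fderiv ℝ (fun x => fderiv ℝ w x (b 0)) x (b 0) +
          fderiv ℝ (fun x => fderiv ℝ w x (b 1)) x (b 1)) -
        (U.indicator (fun x => fderiv ℝ (fun x => fderiv ℝ w₁ x e) x e) x +
          Uᶜ.indicator (fun x => fderiv ℝ (fun x => fderiv ℝ w₂ x e) x e) x))) +
      ∫ s, starRingEnd ℂ (v (Φ s)) * (areaRatio Φ e s *
        (fderiv ℝ w₂ (Φ s) e - fderiv ℝ w₁ (Φ s) e) - α * w (Φ s)) ∂surfaceMeasure Φ := by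
  have hU := hd.isOpen_left.measurableSet
  have hΦ : Continuous Φ := hb.1
  have hve := hv.fderiv_apply e
  have hwe := hw.fderiv_apply e
  have he₁ := hw₁.fderiv_apply e
  have he₂ := hw₂.fderiv_apply e
  have hF₁ := hv.conj_mul he₁
  have hF₂ := hv.conj_mul he₂
  have hF₁s : tsupport (fun x => starRingEnd ℂ (v x) * fderiv ℝ w₁ x e) ⊆ Metric.ball x₁ (ρ / 3) :=
    (tsupport_conj_mul_subset _ _).trans ((tsupport_fderiv_apply_subset' w₁ e).trans hs₁)
  have hF₂s : tsupport (fun x => starRingEnd ℂ (v x) * fderiv ℝ w₂ x e) ⊆ Metric.ball x₁ (ρ / 3) :=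
    (tsupport_conj_mul_subset _ _).trans ((tsupport_fderiv_apply_subset' w₂ e).trans hs₂)
  -- the divergence theorem on the two sides
  have hG₁ := h.setIntegral_fderiv hΦ hinj hδ hρ hd (hF₁.1.of_le (by simp)) hF₁.2 hF₁s
  have hG₂ := h.setIntegral_compl_fderiv hΦ hinj hδ hρ hd (hF₂.1.of_le (by simp)) hF₂.2 hF₂s
  rw [h.setIntegral_normalVec_eq hρ hF₁s] at hG₁
  rw [h.setIntegral_normalVec_eq hρ hF₂s] at hG₂
  have hP₁ := setIntegral_fderiv_conj_mul hv he₁ U e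
  have hP₂ := setIntegral_fderiv_conj_mul hv he₂ Uᶜ e
  rw [hG₁] at hP₁
  rw [hG₂] at hP₂
  have hgrad := sum_integral_pderiv b hv hw
  rw [Fin.sum_univ_three (fun j => ∫ x, starRingEnd ℂ (fderiv ℝ v x (b j)) * fderiv ℝ w x (b j)),
    integral_conj_fderiv_mul hv (hw.fderiv_apply (b 0)), 
    integral_conj_fderiv_mul hv (hw.fderiv_apply (b 1)), hbe] at hgrad
  rw [integral_conj_mul_sides hU hve hwe he₁ he₂, integral_conj_mul_jump hb h.norm_eq hv hw he₁ he₂,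
    integral_conj_mul_defect hU hv hw ((hw.fderiv_apply (b 0)).fderiv_apply (b 0))
      ((hw.fderiv_apply (b 1)).fderiv_apply (b 1)) (he₁.fderiv_apply e) (he₂.fderiv_apply e),
    energyPairing, hgrad, hP₁, hP₂]
  ring

end FormIdentity

/-! ### Errors of the smoothed bound state -/

noncomputable section MatchedStates

variable {Φ : Plane → Space} {U : Set Space} {b : OrthonormalBasis (Fin 3) ℝ Space}
  {p : Space} {a₁ a₂ η R K κ : ℝ}

/-- The part of the box of size `2 R` that lies in the layer of width `η` around the plane through
the origin of the frame. -/
def frameLayer (b : OrthonormalBasis (Fin 3) ℝ Space) (p : Space) (η R : ℝ) : Set Space :=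
  frameBox b p (fun _ => -(2 * R)) (fun _ => 2 * R) ∩ {x | frameCoord b p 2 x ∈ Set.Icc (-η) η}

theorem measurableSet_frameLayer : MeasurableSet (frameLayer b p η R) :=
  (measurableSet_frameBox b p _ _).inter
    ((contDiff_frameCoord b p 2).continuous.measurable measurableSet_Icc)

theorem volume_frameLayer_le (hR : 0 ≤ R) (hη : 0 ≤ η) :
    volume (frameLayer b p η R) ≤ ENNReal.ofReal ((6 * R * √η) ^ 2) := by
  have h1 : frameLayer b p η R ⊆
      frameBox b p ![-(2 * R), -(2 * R), -η] ![2 * R, 2 * R, η] := by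
    rintro x ⟨hx, hx'⟩ j
    fin_cases j
    · exact hx 0
    · exact hx 1
    · exact hx'
  refine (measure_mono h1).trans ?_
  rw [volume_frameBox, Fin.prod_univ_three]
  simp only [Matrix.cons_val]
  rw [← ENNReal.ofReal_mul (by linarith), ← ENNReal.ofReal_mul (by nlinarith), mul_pow,
    Real.sq_sqrt hη]
  refine ENNReal.ofReal_le_ofReal ?_
  nlinarith [mul_nonneg (mul_nonneg hR hR) hη]

theorem indicator_frameLayer {x : Space} (hx : x ∈ frameBox b p (fun _ => -(2 * R)) fun _ => 2 * R)
    (K : ℝ) : (frameLayer b p η R).indicator (fun _ => K) x =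
      (Set.Icc (-η) η).indicator (fun _ => K) (frameCoord b p 2 x) := by
  by_cases h : frameCoord b p 2 x ∈ Set.Icc (-η) η
  · rw [Set.indicator_of_mem h, Set.indicator_of_mem (show x ∈ frameLayer b p η R from ⟨hx, h⟩)]
  · rw [Set.indicator_of_notMem h, Set.indicator_of_notMem fun h' => h h'.2]

/-- The product of a cut off plane wave in the direction of the first vector of the frame, a cutoff
in the direction of the second one and a function `f` of the last coordinate. -/
def waveFun (b : OrthonormalBasis (Fin 3) ℝ Space) (p : Space) (κ R : ℝ) (f : ℝ → ℂ) :
    Space → ℂ := tensorFun b p (cutExp (Complex.I * κ) R) (cutExp 0 R) f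

theorem I_mul_re (κ : ℝ) : (Complex.I * κ).re = 0 := by simp

theorem norm_waveFun_le (f : ℝ → ℂ) (x : Space) :
    ‖waveFun b p κ R f x‖ ≤ ‖f (frameCoord b p 2 x)‖ := by
  have h := norm_tensorFun_le (b := b) (p := p) (f₀ := cutExp (Complex.I * κ) R) (f₁ := cutExp 0 R)
    (f₂ := f) (x := x) (norm_cutExp_le_one (I_mul_re κ) R _)
    (norm_cutExp_le_one Complex.zero_re R _) le_rfl
  simpa [waveFun] using h

theorem waveFun_eq_zero (hR : 0 < R) {f : ℝ → ℂ} (hf : tsupport f ⊆ Set.Icc (-(2 * R)) (2 * R))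
    {x : Space} (hx : x ∉ frameBox b p (fun _ => -(2 * R)) fun _ => 2 * R) :
    waveFun b p κ R f x = 0 :=
  tensorFun_eq_zero (tsupport_cutExp_subset _ hR) (tsupport_cutExp_subset _ hR) hf hx

theorem isTestFunction_waveFun (hR : 0 < R) {f : ℝ → ℂ} (hs : ContDiff ℝ ∞ f)
    (hf : tsupport f ⊆ Set.Icc (-(2 * R)) (2 * R)) : IsTestFunction (waveFun b p κ R f) :=
  isTestFunction_tensorFun (by positivity) (contDiff_cutExp _ R) (contDiff_cutExp _ R) hs
    (tsupport_cutExp_subset _ hR) (tsupport_cutExp_subset _ hR) hf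

theorem tsupport_waveFun_subset (hR : 0 < R) {f : ℝ → ℂ}
    (hf : tsupport f ⊆ Set.Icc (-(2 * R)) (2 * R)) :
    tsupport (waveFun b p κ R f) ⊆ Metric.closedBall p (4 * R) := by
  rw [show 4 * R = 2 * (2 * R) by ring]
  exact tsupport_tensorFun_subset (by positivity) (tsupport_cutExp_subset _ hR)
    (tsupport_cutExp_subset _ hR) hf

theorem fderiv_waveFun (R : ℝ) {f : ℝ → ℂ} (hs : ContDiff ℝ ∞ f) (x : Space) :
    fderiv ℝ (waveFun b p κ R f) x (b 2) = waveFun b p κ R (deriv f) x :=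
  fderiv_tensorFun_two ((contDiff_cutExp _ R).differentiable (by simp))
    ((contDiff_cutExp _ R).differentiable (by simp)) (hs.differentiable (by simp)) x

theorem waveFun_sub (f g : ℝ → ℂ) (x : Space) : waveFun b p κ R f x - waveFun b p κ R g x =
    waveFun b p κ R (fun t => f t - g t) x := by
  simp only [waveFun, tensorFun]; ring

/-- The smoothed transverse profile and the exponentials on the two sides have almost the same
normal derivatives. -/
theorem norm_normal_error_le (hR : 0 < R) (hK : IsProfileBound a₁ a₂ η R K)
    (hU : ∀ x ∈ frameBox b p (fun _ => -(2 * R)) fun _ => 2 * R, x ∈ U → -η ≤ frameCoord b p 2 x)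
    (hU' : ∀ x ∈ frameBox b p (fun _ => -(2 * R)) fun _ => 2 * R, x ∉ U → frameCoord b p 2 x ≤ η)
    (x : Space) :
    ‖fderiv ℝ (waveFun b p κ R (transverseProfile a₁ a₂ η R)) x (b 2) -
      (U.indicator (fun x => fderiv ℝ (waveFun b p κ R (cutExp (-a₂ : ℝ) R)) x (b 2)) x +
        Uᶜ.indicator (fun x => fderiv ℝ (waveFun b p κ R (cutExp (a₁ : ℝ) R)) x (b 2)) x)‖ ≤
      (frameLayer b p η R).indicator (fun _ => K) x := by
  have ht : ∀ β, tsupport (deriv (cutExp β R)) ⊆ Set.Icc (-(2 * R)) (2 * R) := fun β =>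
    tsupport_deriv_subset.trans (tsupport_cutExp_subset β hR)
  have ht' : tsupport (deriv (transverseProfile a₁ a₂ η R)) ⊆ Set.Icc (-(2 * R)) (2 * R) :=
    tsupport_deriv_subset.trans (tsupport_transverseProfile_subset hR)
  simp only [fderiv_waveFun R (contDiff_cutExp _ R), fderiv_waveFun R (contDiff_transverseProfile _ _ _ _)]
  by_cases hx : x ∈ frameBox b p (fun _ => -(2 * R)) fun _ => 2 * R
  · rw [indicator_frameLayer hx]
    by_cases hxU : x ∈ U
    · rw [Set.indicator_of_mem hxU, Set.indicator_of_notMem (Set.notMem_compl_iff.2 hxU), add_zero,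
        waveFun_sub]
      exact (norm_waveFun_le _ x).trans ((hK _).2.1 (hU x hx hxU)).1
    · rw [Set.indicator_of_notMem hxU, Set.indicator_of_mem (Set.mem_compl hxU), zero_add,
        waveFun_sub]
      exact (norm_waveFun_le _ x).trans ((hK _).2.2.1 (hU' x hx hxU)).1
  · rw [Set.indicator_of_notMem (s := frameLayer b p η R) fun h => hx h.1,
      waveFun_eq_zero hR ht' hx]
    by_cases hxU : x ∈ U <;> simp [hxU, waveFun_eq_zero hR (ht _) hx]

theorem fderiv_fderiv_waveFun (R : ℝ) {f : ℝ → ℂ} (hs : ContDiff ℝ ∞ f) (x : Space) :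
    fderiv ℝ (fun x => fderiv ℝ (waveFun b p κ R f) x (b 2)) x (b 2) =
      waveFun b p κ R (deriv (deriv f)) x :=
  (fderiv_fderiv_tensorFun (contDiff_cutExp _ R) (contDiff_cutExp _ R) hs x).2.2

/-- The tangential second derivatives of a cut off plane wave. -/
theorem exists_norm_tangential_error_le (κ : ℝ) : ∃ C : ℝ, 0 ≤ C ∧ ∀ (b : OrthonormalBasis (Fin 3) ℝ Space)
    (p : Space) (R : ℝ) (f : ℝ → ℂ) (x : Space), 1 ≤ R → ContDiff ℝ ∞ f →
    ‖fderiv ℝ (fun x => fderiv ℝ (waveFun b p κ R f) x (b 0)) x (b 0) +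
        fderiv ℝ (fun x => fderiv ℝ (waveFun b p κ R f) x (b 1)) x (b 1) +
        (κ : ℂ) ^ 2 * waveFun b p κ R f x‖ ≤ C / R * ‖f (frameCoord b p 2 x)‖ := by
  obtain ⟨C, hC, hCb⟩ := exists_cutExp_bound
  refine ⟨C * (2 * ‖Complex.I * κ‖ + 1) + C, by positivity, fun b p R f x hR hs => ?_⟩
  have hD := fderiv_fderiv_tensorFun (b := b) (p := p) (contDiff_cutExp (Complex.I * κ) R)
    (contDiff_cutExp 0 R) hs x
  have h0 := (hCb (Complex.I * κ) R (frameCoord b p 0 x) 0 hR (by simp)).2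
  have h1 := (hCb 0 R (frameCoord b p 1 x) 0 hR (by simp)).2
  simp only [Real.exp_zero, mul_one, norm_zero, mul_zero, zero_add, ne_eq, OfNat.ofNat_ne_zero,
    not_false_eq_true, zero_pow, zero_mul, sub_zero] at h0 h1
  have g0 := norm_cutExp_le_one (I_mul_re κ) R (frameCoord b p 0 x)
  have g1 := norm_cutExp_le_one Complex.zero_re R (frameCoord b p 1 x)
  set y₀ := frameCoord b p 0 x
  set y₁ := frameCoord b p 1 x
  set y₂ := frameCoord b p 2 x
  have hsq : (Complex.I * (κ : ℂ)) ^ 2 = -(κ : ℂ) ^ 2 := by rw [mul_pow, Complex.I_sq]; ring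
  have h2 : fderiv ℝ (fun x => fderiv ℝ (waveFun b p κ R f) x (b 0)) x (b 0) +
        fderiv ℝ (fun x => fderiv ℝ (waveFun b p κ R f) x (b 1)) x (b 1) +
        (κ : ℂ) ^ 2 * waveFun b p κ R f x =
      (deriv (deriv (cutExp (Complex.I * κ) R)) y₀ -
        (Complex.I * κ) ^ 2 * cutExp (Complex.I * κ) R y₀) * cutExp 0 R y₁ * f y₂ +
      cutExp (Complex.I * κ) R y₀ * deriv (deriv (cutExp 0 R)) y₁ * f y₂ := by
    simp only [waveFun]
    rw [hD.1, hD.2.1, hsq]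
    simp only [tensorFun]
    ring
  rw [h2]
  refine (norm_add_le _ _).trans ?_
  have hR0 : 0 ≤ R := by linarith
  rw [norm_mul, norm_mul, norm_mul, norm_mul]
  calc _ ≤ C * (2 * ‖Complex.I * κ‖ + 1) / R * 1 * ‖f y₂‖ + 1 * (C / R) * ‖f y₂‖ := by gcongr
    _ = _ := by ring

/-- The defect of the smoothed bound state in the differential equations on the two sides. -/
theorem exists_norm_defect_le (κ : ℝ) : ∃ C : ℝ, 0 ≤ C ∧
    ∀ (b : OrthonormalBasis (Fin 3) ℝ Space) (p : Space) (U : Set Space) (a₁ a₂ η R K : ℝ),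
      1 ≤ R → IsProfileBound a₁ a₂ η R K →
      (∀ x ∈ frameBox b p (fun _ => -(2 * R)) fun _ => 2 * R, x ∈ U → -η ≤ frameCoord b p 2 x) →
      (∀ x ∈ frameBox b p (fun _ => -(2 * R)) fun _ => 2 * R, x ∉ U → frameCoord b p 2 x ≤ η) →
      ∀ x, ‖((a₂ ^ 2 - a₁ ^ 2 : ℝ) : ℂ) * U.indicator (waveFun b p κ R (transverseProfile a₁ a₂ η R)) x -
          ((κ ^ 2 - a₁ ^ 2 : ℝ) : ℂ) * waveFun b p κ R (transverseProfile a₁ a₂ η R) x -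
        (fderiv ℝ (fun x => fderiv ℝ (waveFun b p κ R (transverseProfile a₁ a₂ η R)) x (b 0)) x (b 0) +
          fderiv ℝ (fun x => fderiv ℝ (waveFun b p κ R (transverseProfile a₁ a₂ η R)) x (b 1)) x (b 1)) -
        (U.indicator (fun x => fderiv ℝ (fun x =>
            fderiv ℝ (waveFun b p κ R (cutExp (-a₂ : ℝ) R)) x (b 2)) x (b 2)) x +
          Uᶜ.indicator (fun x => fderiv ℝ (fun x =>
            fderiv ℝ (waveFun b p κ R (cutExp (a₁ : ℝ) R)) x (b 2)) x (b 2)) x)‖ ≤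
      (frameLayer b p η R).indicator (fun _ => K) x +
        (frameBox b p (fun _ => -(2 * R)) fun _ => 2 * R).indicator (fun _ => C * K / R) x := by
  obtain ⟨C, hC, hCb⟩ := exists_norm_tangential_error_le κ
  refine ⟨C + 1, by positivity, fun b p U a₁ a₂ η R K hR hK hU hU' x => ?_⟩
  have hR0 : 0 < R := by linarith
  have ht : ∀ β, tsupport (deriv (deriv (cutExp β R))) ⊆ Set.Icc (-(2 * R)) (2 * R) := fun β =>
    (tsupport_deriv_deriv_subset _).trans (tsupport_cutExp_subset β hR0)
  have ht' : tsupport (transverseProfile a₁ a₂ η R) ⊆ Set.Icc (-(2 * R)) (2 * R) :=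
    tsupport_transverseProfile_subset hR0
  have htan := hCb b p R _ x hR (contDiff_transverseProfile a₁ a₂ η R)
  set D := fderiv ℝ (fun x => fderiv ℝ (waveFun b p κ R (transverseProfile a₁ a₂ η R)) x (b 0)) x (b 0) +
    fderiv ℝ (fun x => fderiv ℝ (waveFun b p κ R (transverseProfile a₁ a₂ η R)) x (b 1)) x (b 1) with hD
  simp only [fderiv_fderiv_waveFun R (contDiff_cutExp _ R)]
  set w := waveFun b p κ R (transverseProfile a₁ a₂ η R) with hw
  by_cases hx : x ∈ frameBox b p (fun _ => -(2 * R)) fun _ => 2 * R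
  · rw [indicator_frameLayer hx, Set.indicator_of_mem hx]
    have h2 : C / R * ‖transverseProfile a₁ a₂ η R (frameCoord b p 2 x)‖ ≤ C / R * K :=
      mul_le_mul_of_nonneg_left (hK _).1 (by positivity)
    have h3 : (C + 1) * K / R = K / R + C / R * K := by ring
    have h4 : ∀ a : ℝ, ∀ g : ℝ → ℂ, (a : ℂ) ^ 2 * w x - waveFun b p κ R g x =
        waveFun b p κ R (fun t => (a : ℂ) ^ 2 * transverseProfile a₁ a₂ η R t - g t) x := by
      intro a g
      simp only [hw, waveFun, tensorFun]; ring
    -- the tangential derivatives contribute `-κ²` up to the cutoff, and off the layer the second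
    -- derivative of the exponential is `a₂²` times the profile in `U`, and `a₁²` times it outside
    by_cases hxU : x ∈ U
    · rw [Set.indicator_of_mem hxU, Set.indicator_of_mem hxU,
        Set.indicator_of_notMem (Set.notMem_compl_iff.2 hxU), add_zero]
      have h1 : ((a₂ ^ 2 - a₁ ^ 2 : ℝ) : ℂ) * w x - ((κ ^ 2 - a₁ ^ 2 : ℝ) : ℂ) * w x - D -
          waveFun b p κ R (deriv (deriv (cutExp (-a₂ : ℝ) R))) x =
          ((a₂ : ℂ) ^ 2 * w x - waveFun b p κ R (deriv (deriv (cutExp (-a₂ : ℝ) R))) x) -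
            (D + (κ : ℂ) ^ 2 * w x) := by push_cast; ring
      rw [h1, h4]
      refine (norm_sub_le _ _).trans ?_
      have h5 := (norm_waveFun_le (b := b) (p := p) (κ := κ) (R := R) (fun t => (a₂ : ℂ) ^ 2 *
        transverseProfile a₁ a₂ η R t - deriv (deriv (cutExp (-a₂ : ℝ) R)) t) x).trans
          ((hK _).2.1 (hU x hx hxU)).2
      linarith
    · rw [Set.indicator_of_notMem hxU, Set.indicator_of_notMem hxU,
        Set.indicator_of_mem (Set.mem_compl hxU), zero_add, mul_zero]
      have h1 : 0 - ((κ ^ 2 - a₁ ^ 2 : ℝ) : ℂ) * w x - D -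
          waveFun b p κ R (deriv (deriv (cutExp (a₁ : ℝ) R))) x =
          ((a₁ : ℂ) ^ 2 * w x - waveFun b p κ R (deriv (deriv (cutExp (a₁ : ℝ) R))) x) -
            (D + (κ : ℂ) ^ 2 * w x) := by push_cast; ring
      rw [h1, h4]
      refine (norm_sub_le _ _).trans ?_
      have h5 := (norm_waveFun_le (b := b) (p := p) (κ := κ) (R := R) (fun t => (a₁ : ℂ) ^ 2 *
        transverseProfile a₁ a₂ η R t - deriv (deriv (cutExp (a₁ : ℝ) R)) t) x).trans
          ((hK _).2.2.1 (hU' x hx hxU)).2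
      linarith
  · have hw0 : w x = 0 := waveFun_eq_zero hR0 ht' hx
    have hD0 : D = 0 := by
      have h0 := fderiv_fderiv_tensorFun (b := b) (p := p) (contDiff_cutExp (Complex.I * κ) R)
        (contDiff_cutExp 0 R) (contDiff_transverseProfile a₁ a₂ η R) x
      have e0 := h0.1.trans
        (tensorFun_eq_zero (ht _) (tsupport_cutExp_subset _ hR0) ht' hx)
      have e1 := h0.2.1.trans
        (tensorFun_eq_zero (tsupport_cutExp_subset _ hR0) (ht _) ht' hx)
      exact (congrArg₂ (· + ·) e0 e1).trans (add_zero 0)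
    rw [Set.indicator_of_notMem (s := frameLayer b p η R) fun h => hx h.1,
      Set.indicator_of_notMem hx, hD0, hw0]
    by_cases hxU : x ∈ U <;> simp [hxU, waveFun_eq_zero hR0 (ht _) hx, hw0]

/-- The defect of the smoothed bound state in the jump condition on the surface. -/
theorem norm_jump_defect_le (hR : 0 < R) (hη : 0 ≤ η) (hK0 : 0 ≤ K)
    (hK : IsProfileBound a₁ a₂ η R K) {s : Plane} {δ : ℝ}
    (hflat : Φ s ∈ frameBox b p (fun _ => -(2 * R)) (fun _ => 2 * R) →
      frameCoord b p 2 (Φ s) ∈ Set.Icc (-η) η ∧ |areaRatio Φ (b 2) s - 1| ≤ δ) (hδ : 0 ≤ δ) :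
    ‖areaRatio Φ (b 2) s * (fderiv ℝ (waveFun b p κ R (cutExp (a₁ : ℝ) R)) (Φ s) (b 2) -
        fderiv ℝ (waveFun b p κ R (cutExp (-a₂ : ℝ) R)) (Φ s) (b 2)) -
      ((a₁ + a₂ : ℝ) : ℂ) * waveFun b p κ R (transverseProfile a₁ a₂ η R) (Φ s)‖ ≤
      {s | ‖p - Φ s‖ < 5 * R}.indicator (fun _ => K * (δ + η + 1 / R)) s := by
  have ht : ∀ β, tsupport (deriv (cutExp β R)) ⊆ Set.Icc (-(2 * R)) (2 * R) := fun β =>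
    tsupport_deriv_subset.trans (tsupport_cutExp_subset β hR)
  rw [fderiv_waveFun R (contDiff_cutExp _ R), fderiv_waveFun R (contDiff_cutExp _ R)]
  by_cases hx : Φ s ∈ frameBox b p (fun _ => -(2 * R)) fun _ => 2 * R
  · have hmem : s ∈ {s | ‖p - Φ s‖ < 5 * R} := by
      have h1 := mem_closedBall_iff_norm.1 (frameBox_subset_closedBall (by positivity) hx)
      rw [Set.mem_ofPred_eq, norm_sub_rev]
      linarith
    rw [Set.indicator_of_mem hmem]
    obtain ⟨hy, hj⟩ := hflat hx
    obtain ⟨h1, h2⟩ := (hK (frameCoord b p 2 (Φ s))).2.2.2 hy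
    have h3 : areaRatio Φ (b 2) s * (waveFun b p κ R (deriv (cutExp (a₁ : ℝ) R)) (Φ s) -
        waveFun b p κ R (deriv (cutExp (-a₂ : ℝ) R)) (Φ s)) -
        ((a₁ + a₂ : ℝ) : ℂ) * waveFun b p κ R (transverseProfile a₁ a₂ η R) (Φ s) =
        ((areaRatio Φ (b 2) s - 1 : ℝ) : ℂ) *
          waveFun b p κ R (fun t => deriv (cutExp (a₁ : ℝ) R) t - deriv (cutExp (-a₂ : ℝ) R) t) (Φ s) +
        waveFun b p κ R (fun t => deriv (cutExp (a₁ : ℝ) R) t - deriv (cutExp (-a₂ : ℝ) R) t -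
          (a₁ + a₂ : ℝ) * transverseProfile a₁ a₂ η R t) (Φ s) := by
      simp only [waveFun, tensorFun]; push_cast; ring
    -- the deviation of the area ratio from `1`, and the error of the profile in the jump condition
    rw [h3]
    refine (norm_add_le _ _).trans ?_
    rw [norm_mul, Complex.norm_real, Real.norm_eq_abs]
    have h4 := mul_le_mul hj ((norm_waveFun_le (b := b) (p := p) (κ := κ) (R := R)
      (fun t => deriv (cutExp (a₁ : ℝ) R) t - deriv (cutExp (-a₂ : ℝ) R) t) (Φ s)).trans h1)
      (norm_nonneg _) hδ
    have h5 := (norm_waveFun_le (b := b) (p := p) (κ := κ) (R := R) (fun t => deriv (cutExp (a₁ : ℝ) R) t -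
      deriv (cutExp (-a₂ : ℝ) R) t - (a₁ + a₂ : ℝ) * transverseProfile a₁ a₂ η R t) (Φ s)).trans h2
    linarith
  · rw [waveFun_eq_zero hR (ht _) hx, waveFun_eq_zero hR (ht _) hx,
      waveFun_eq_zero hR (tsupport_transverseProfile_subset hR) hx]
    simp only [sub_self, mul_zero, norm_zero]
    exact Set.indicator_nonneg (fun _ _ => by positivity) _

end MatchedStates

/-! ### Energies above that of the transverse bound state -/

noncomputable section BoundStates

variable {Φ : Plane → Space} {U U' : Set Space} {c : ℝ} {T : Set Space}

/-- The area of the surface in a ball grows at most quadratically with the radius. -/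
theorem exists_surfaceMeasure_ball_le (h : IsChordBound Φ c) (hT : IsSingularSet (Set.range Φ) T)
    (hreg : IsUniformlyEllipticC2Off Φ T) : ∃ K : ℝ, 0 ≤ K ∧ ∀ (p : Space) (R : ℝ), 0 < R →
      surfaceMeasure Φ {s | ‖p - Φ s‖ < 5 * R} ≤ ENNReal.ofReal ((K * R) ^ 2) := by
  obtain ⟨K, hK, hle⟩ := exists_surfaceMeasure_le h hT hreg
  set A := (volume (Metric.ball (0 : Plane) 1)).toReal with hA
  have hA0 : 0 ≤ A := ENNReal.toReal_nonneg
  have hAe : volume (Metric.ball (0 : Plane) 1) = ENNReal.ofReal A :=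
    (ENNReal.ofReal_toReal measure_ball_lt_top.ne).symm
  refine ⟨√(K * A) * (10 / c), mul_nonneg (Real.sqrt_nonneg _) (div_nonneg (by norm_num) h.1.le),
    fun p R hR => ?_⟩
  refine (hle _).trans ?_
  rw [Measure.smul_apply, smul_eq_mul]
  refine (mul_le_mul_right (volume_preimage_ball_le h p (by positivity : 0 < 5 * R)) _).trans ?_
  rw [hAe, ← ENNReal.ofReal_mul (by positivity), ← ENNReal.ofReal_mul hK]
  refine ENNReal.ofReal_le_ofReal (le_of_eq ?_)
  rw [mul_pow, mul_pow, Real.sq_sqrt (by positivity)]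
  ring

theorem volume_frameBox_const {b : OrthonormalBasis (Fin 3) ℝ Space} {p : Space} {R : ℝ}
    (hR : 0 ≤ R) : volume (frameBox b p (fun _ => -(2 * R)) fun _ => 2 * R) =
      ENNReal.ofReal ((8 * R * √R) ^ 2) := by
  rw [volume_frameBox, Finset.prod_const, Finset.card_univ, Fintype.card_fin,
    ← ENNReal.ofReal_pow (by linarith), mul_pow, Real.sq_sqrt hR]
  congr 1
  ring

theorem norm_waveFun_transverseProfile_ge {b : OrthonormalBasis (Fin 3) ℝ Space} {p : Space}
    {a₁ a₂ η R κ : ℝ} (h₂ : 0 ≤ a₂) (hη : 0 < η) (hη1 : η ≤ 1) (hR : 2 ≤ R) {x : Space}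
    (hx : x ∈ frameBox b p ![-R, -R, 1] ![R, R, 2]) :
    Real.exp (-(2 * a₂)) ≤ ‖waveFun b p κ R (transverseProfile a₁ a₂ η R) x‖ := by
  have hR0 : 0 < R := by linarith
  have h0 := hx 0
  have h1 := hx 1
  have h2 := hx 2
  simp only [Matrix.cons_val] at h0 h1 h2
  rw [waveFun, tensorFun, norm_mul, norm_mul, norm_cutExp_of_abs_le (I_mul_re κ) hR0 (abs_le.2 h0),
    norm_cutExp_of_abs_le Complex.zero_re hR0 (abs_le.2 h1), one_mul, one_mul, transverseProfile,
    smoothStep_of_ge hη (hη1.trans h2.1), sub_self, Complex.ofReal_zero, zero_mul, add_zero,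
    Complex.ofReal_one, one_mul,
    cutExp_of_abs_le _ hR0 (abs_le.2 ⟨by linarith [h2.1], h2.2.trans hR⟩), Complex.norm_exp,
    ← Complex.ofReal_mul, Complex.ofReal_re]
  exact Real.exp_le_exp.2 (by nlinarith [h2.2])

/-- If the decay rates `a₁` and `a₂` satisfy `a₁ + a₂ = α` and `a₂ ^ 2 - a₁ ^ 2 = V₀`, then the bound
state of the planar surface is available: a plane wave along the surface times the transverse bound
state is, in a large and very flat patch of the surface, an approximate eigenfunction. -/
theorem isApproxFormEigenvalue_of_matched (h : IsChordBound Φ c) (hb : HasTraceBound Φ)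
    (hT : IsSingularSet (Set.range Φ) T) (hreg : IsUniformlyEllipticC2Off Φ T)
    (hpl : IsAsymptoticallyPlanar Φ T) (hd : DividesInto (Set.range Φ) U U') {a₁ a₂ : ℝ}
    (h₁ : 0 ≤ a₁) (h₂ : 0 ≤ a₂) (κ : ℝ) :
    IsApproxFormEigenvalue sobolevEmb (formOperator hb (a₁ + a₂) (a₂ ^ 2 - a₁ ^ 2) U)
      (κ ^ 2 - a₁ ^ 2) := by
  obtain ⟨K, hK0, hKb⟩ := exists_isProfileBound h₁ h₂
  obtain ⟨C, hC0, hCb⟩ := exists_norm_defect_le κ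
  obtain ⟨Ct, hCt0, hCtb⟩ := hb.exists_sqrt_integral_le
  obtain ⟨Ks, hKs0, hKsb⟩ := exists_surfaceMeasure_ball_le h hT hreg
  refine isApproxFormEigenvalue_of_test hb fun ε hε => ?_
  set L := 12 * K + 8 * (C * K) + 3 * (K * Ks * Ct) with hL
  have hL0 : 0 ≤ L := by positivity
  -- the scales: the width `η` of the layer, the size `R` of the wave, the size `ρ` and the
  -- flatness `δ` of the patch
  set E := Real.exp (-(2 * a₂)) with hE
  have hE0 : 0 < E := Real.exp_pos _
  set ξ := min 1 (2 * E * ε / (L + 1)) with hξ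
  have hξ0 : 0 < ξ := lt_min one_pos (by positivity)
  have hξ1 : ξ ≤ 1 := min_le_left _ _
  have hξL : L * ξ ≤ 2 * E * ε := by
    have h3 : ξ * (L + 1) ≤ 2 * E * ε := (le_div_iff₀ (by positivity)).1 (min_le_right _ _)
    nlinarith
  set η := ξ ^ 2 with hη
  have hη0 : 0 < η := by positivity
  have hη1 : η ≤ 1 := pow_le_one₀ hξ0.le hξ1
  have hηξ : η ≤ ξ := by nlinarith
  have hsη : √η = ξ := Real.sqrt_sq hξ0.le
  set R := max 2 (1 / η) with hRdef
  have hR2 : 2 ≤ R := le_max_left _ _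
  have hR0 : 0 < R := by linarith
  have hR1 : 1 ≤ R := by linarith
  have hRη : 1 / R ≤ η := by
    rw [div_le_iff₀ hR0]
    have h3 : 1 / η ≤ R := le_max_right _ _
    rwa [div_le_iff₀ hη0, mul_comm] at h3
  have hsR : √R ≤ ξ * R := by
    rw [Real.sqrt_le_left (by positivity), mul_pow, ← hη]
    have h3 : 1 ≤ η * R := (div_le_iff₀ hR0).1 hRη
    nlinarith
  set ρ := 13 * R with hρdef
  have hρ0 : 0 < ρ := by positivity
  set δ := min (1 / 32) (η / ρ) with hδdef
  have hδ0 : 0 < δ := lt_min (by norm_num) (by positivity)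
  have hδ1 : δ ≤ 1 / 32 := min_le_left _ _
  have hδρ : δ * ρ ≤ η := (le_div_iff₀ hρ0).1 (min_le_right _ _)
  have hδη : δ ≤ η := (min_le_right _ _).trans (div_le_self hη0.le (by linarith))
  obtain ⟨R', hR'⟩ := exists_isFlatPatch h hT hreg hpl hd hρ0 hδ0 hδ1
  obtain ⟨s₁, hs₁⟩ : ∃ s₁ : Plane, R' < ‖s₁‖ := NormedSpace.exists_lt_norm ℝ Plane R'
  obtain ⟨e, he⟩ := hR' s₁ hs₁
  obtain ⟨b, hbe⟩ := exists_frame he.norm_eq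
  set p := Φ s₁ with hp
  set B := frameBox b p (fun _ => -(2 * R)) fun _ => 2 * R with hB
  have hBball : B ⊆ Metric.ball p (ρ / 3) := fun x hx => by
    have h3 := frameBox_subset_closedBall (by positivity) hx
    rw [Metric.mem_closedBall] at h3
    rw [Metric.mem_ball]
    linarith
  have hcb : Metric.closedBall p (4 * R) ⊆ Metric.ball p (ρ / 3) :=
    Metric.closedBall_subset_ball (by linarith)
  have hU : ∀ x ∈ B, x ∈ U → -η ≤ frameCoord b p 2 x := fun x hx hxU => by
    by_contra hlt
    rw [frameCoord, hbe] at hlt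
    exact Set.disjoint_left.1 hd.disjoint hxU
      (he.mem_right hρ0 hδ0.le rfl (hBball hx) (by linarith))
  have hU' : ∀ x ∈ B, x ∉ U → frameCoord b p 2 x ≤ η := fun x hx hxU => by
    by_contra hlt
    rw [frameCoord, hbe] at hlt
    exact hxU (he.mem_left hρ0 hδ0.le rfl (hBball hx) (by linarith))
  have hflat : ∀ s, Φ s ∈ B →
      frameCoord b p 2 (Φ s) ∈ Set.Icc (-η) η ∧ |areaRatio Φ (b 2) s - 1| ≤ δ := fun s hs => by
    have h3 := ball_third_subset hρ0 (hBball hs)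
    have h4 := he.flat s s₁ h3 (Metric.mem_ball_self hρ0)
    rw [hbe]
    refine ⟨?_, he.abs_areaRatio_sub_one_le hδ0.le h3⟩
    rw [frameCoord, hbe, real_inner_comm]
    exact abs_le.1 (h4.trans
      ((mul_le_mul_of_nonneg_left (mem_ball_iff_norm.1 h3).le hδ0.le).trans hδρ))
  have hKη := hKb η R hη0 hη1 hR2
  set w := waveFun b p κ R (transverseProfile a₁ a₂ η R) with hw
  set w₁ := waveFun b p κ R (cutExp (-a₂ : ℝ) R) with hw₁
  set w₂ := waveFun b p κ R (cutExp (a₁ : ℝ) R) with hw₂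
  have htw : IsTestFunction w := isTestFunction_waveFun hR0 (contDiff_transverseProfile _ _ _ _)
    (tsupport_transverseProfile_subset hR0)
  have htw₁ : IsTestFunction w₁ := isTestFunction_waveFun hR0 (contDiff_cutExp _ _)
    (tsupport_cutExp_subset _ hR0)
  have htw₂ : IsTestFunction w₂ := isTestFunction_waveFun hR0 (contDiff_cutExp _ _)
    (tsupport_cutExp_subset _ hR0)
  have hs₁' : tsupport w₁ ⊆ Metric.ball p (ρ / 3) :=
    (tsupport_waveFun_subset hR0 (tsupport_cutExp_subset _ hR0)).trans hcb
  have hs₂' : tsupport w₂ ⊆ Metric.ball p (ρ / 3) :=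
    (tsupport_waveFun_subset hR0 (tsupport_cutExp_subset _ hR0)).trans hcb
  have hN : E ^ 2 * (2 * R) ^ 2 ≤ ∫ x, ‖w x‖ ^ 2 := by
    refine htw.le_integral_norm_sq (measurableSet_frameBox b p ![-R, -R, 1] ![R, R, 2]) hE0.le ?_
      (by positivity) fun x hx => norm_waveFun_transverseProfile_ge h₂ hη0 hη1 hR2 hx
    rw [volume_frameBox, Fin.prod_univ_three]
    simp only [Matrix.cons_val]
    rw [← ENNReal.ofReal_mul (by linarith), ← ENNReal.ofReal_mul (by nlinarith)]
    congr 1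
    ring
  have hNs : E * (2 * R) ≤ √(∫ x, ‖w x‖ ^ 2) := by
    refine Real.le_sqrt_of_sq_le ?_
    rwa [mul_pow]
  refine ⟨w, htw, lt_of_lt_of_le (by positivity) hN, fun v hv => ?_⟩
  rw [he.energyPairing_sub_eq hb h.injective (by linarith) hρ0 hd hbe hv htw htw₁ htw₂ hs₁' hs₂']
  rw [← hbe]
  have hv0 : 0 ≤ ‖hv.toSobolev‖ := norm_nonneg _
  have hb1 : ‖b 2‖ = 1 := b.norm_eq_one 2
  -- the three error terms
  have e1 := norm_integral_conj_mul_le ((hv.fderiv_apply (b 2)).memLp 2)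
    (measurableSet_frameLayer (b := b) (p := p) (η := η) (R := R)) MeasurableSet.empty hK0 le_rfl
    (by positivity) le_rfl (volume_frameLayer_le hR0.le hη0.le) (by simp)
    (E := fun x => fderiv ℝ w x (b 2) - (U.indicator (fun x => fderiv ℝ w₁ x (b 2)) x +
      Uᶜ.indicator (fun x => fderiv ℝ w₂ x (b 2)) x)) (fun x => by
      rw [Set.indicator_empty (fun _ => (0 : ℝ)), add_zero]
      exact norm_normal_error_le hR0 hKη hU hU' x)
  have e2 := norm_integral_conj_mul_le (hv.memLp 2)
    (measurableSet_frameLayer (b := b) (p := p) (η := η) (R := R))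
    (measurableSet_frameBox b p (fun _ => -(2 * R)) fun _ => 2 * R) hK0
    (by positivity : 0 ≤ C * K / R)
    (by positivity) (by positivity) (volume_frameLayer_le hR0.le hη0.le)
    (volume_frameBox_const hR0.le).le (hCb b p U a₁ a₂ η R K hR1 hKη hU hU')
  have hΦm : Measurable Φ := hb.1.measurable
  have e3 := norm_integral_conj_mul_le (hb.memLp ⟨v, hv⟩)
    (measurableSet_lt (measurable_const.sub hΦm).norm measurable_const : 
      MeasurableSet {s | ‖p - Φ s‖ < 5 * R}) MeasurableSet.empty
    (by positivity : 0 ≤ K * (δ + η + 1 / R)) le_rfl (by positivity) le_rfl (hKsb p R hR0) (by simp)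
    (E := fun s => areaRatio Φ (b 2) s * (fderiv ℝ w₂ (Φ s) (b 2) - fderiv ℝ w₁ (Φ s) (b 2)) -
      ((a₁ + a₂ : ℝ) : ℂ) * w (Φ s)) (fun s => by
      rw [Set.indicator_empty (fun _ => (0 : ℝ)), add_zero]
      exact norm_jump_defect_le hR0 hη0.le hK0 hKη (hflat s) hδ0.le)
  refine (norm_add₃_le).trans ((add_le_add (add_le_add e1 e2) e3).trans ?_)
  have v1 := hv.sqrt_integral_norm_fderiv_sq_le hb1
  have v2 := hv.sqrt_integral_norm_sq_le
  have v3 := hCtb v hv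
  rw [hsη, zero_mul, add_zero, add_zero]
  set n := ‖hv.toSobolev‖
  have t1 : K * (6 * R * ξ) * √(∫ x, ‖fderiv ℝ v x (b 2)‖ ^ 2) ≤ 6 * K * (R * ξ * n) := by
    calc _ ≤ K * (6 * R * ξ) * n := mul_le_mul_of_nonneg_left v1 (by positivity)
      _ = _ := by ring
  have t2 : (K * (6 * R * ξ) + C * K / R * (8 * R * √R)) * √(∫ x, ‖v x‖ ^ 2) ≤
      (6 * K + 8 * (C * K)) * (R * ξ * n) := by
    have h3 : C * K / R * (8 * R * √R) ≤ 8 * (C * K) * (ξ * R) := by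
      calc _ = 8 * (C * K) * √R := by field_simp
        _ ≤ _ := mul_le_mul_of_nonneg_left hsR (by positivity)
    calc _ ≤ (K * (6 * R * ξ) + 8 * (C * K) * (ξ * R)) * n :=
          mul_le_mul (by linarith) v2 (Real.sqrt_nonneg _) (by positivity)
      _ = _ := by ring
  have t3 : K * (δ + η + 1 / R) * (Ks * R) * √(∫ s, ‖v (Φ s)‖ ^ 2 ∂surfaceMeasure Φ) ≤
      3 * (K * Ks * Ct) * (R * ξ * n) := by
    have h3 : δ + η + 1 / R ≤ 3 * ξ := by linarith
    calc _ ≤ K * (3 * ξ) * (Ks * R) * (Ct * n) :=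
          mul_le_mul (mul_le_mul_of_nonneg_right (mul_le_mul_of_nonneg_left h3 hK0) (by positivity))
            v3 (Real.sqrt_nonneg _) (by positivity)
      _ = _ := by ring
  have t4 : L * ξ * (R * n) ≤ 2 * E * ε * (R * n) := mul_le_mul_of_nonneg_right hξL (by positivity)
  have t5 : ε * n * (E * (2 * R)) ≤ ε * n * √(∫ x, ‖w x‖ ^ 2) :=
    mul_le_mul_of_nonneg_left hNs (by positivity)
  have t6 : 6 * K * (R * ξ * n) + (6 * K + 8 * (C * K)) * (R * ξ * n) +
      3 * (K * Ks * Ct) * (R * ξ * n) = L * ξ * (R * n) := by rw [hL]; ring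
  have t7 : 2 * E * ε * (R * n) = ε * n * (E * (2 * R)) := by ring
  linarith

end BoundStates

/-! ### The essential spectrum -/

noncomputable section EssentialSpectrum

variable {Φ : Plane → Space} {U U' : Set Space} {c : ℝ} {T : Set Space} {V : Space → ℝ} {α V₀ : ℝ}

/-- The region without potential contains arbitrarily large balls. -/
theorem exists_closedBall_subset (h : IsChordBound Φ c) (hT : IsSingularSet (Set.range Φ) T)
    (hreg : IsUniformlyEllipticC2Off Φ T) (hpl : IsAsymptoticallyPlanar Φ T)
    (hd : DividesInto (Set.range Φ) U U') {R : ℝ} (hR : 0 < R) :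
    ∃ p, Metric.closedBall p R ⊆ U' := by
  have hρ : 0 < 12 * R := by positivity
  obtain ⟨R', hR'⟩ := exists_isFlatPatch h hT hreg hpl hd hρ (by norm_num : (0 : ℝ) < 1 / 32) le_rfl
  obtain ⟨s₁, hs₁⟩ : ∃ s₁ : Plane, R' < ‖s₁‖ := NormedSpace.exists_lt_norm ℝ Plane R'
  obtain ⟨e, he⟩ := hR' s₁ hs₁
  have h1 := he.closedBall_subset hρ (by norm_num) le_rfl rfl
  rw [mul_div_cancel_left₀ R (by norm_num : (12 : ℝ) ≠ 0)] at h1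
  exact ⟨_, h1⟩

/-- Every energy above the threshold is an approximate eigenvalue. -/
theorem isApproxFormEigenvalue_formOperator (h : IsChordBound Φ c) (hb : HasTraceBound Φ)
    (hT : IsSingularSet (Set.range Φ) T) (hreg : IsUniformlyEllipticC2Off Φ T)
    (hpl : IsAsymptoticallyPlanar Φ T) (hd : DividesInto (Set.range Φ) U U') (hα : 0 < α)
    (hV₀ : 0 < V₀) {r : ℝ} (hr : threshold α V₀ ≤ r) :
    IsApproxFormEigenvalue sobolevEmb (formOperator hb α V₀ U) r := by
  rw [threshold] at hr
  split_ifs at hr with hlt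
  · -- the decay rates of the transverse bound state, whose energy is `-a₁ ^ 2`
    set a₁ := (α ^ 2 - V₀) / (2 * α) with ha₁
    set a₂ := (α ^ 2 + V₀) / (2 * α) with ha₂
    have h1 : 0 ≤ a₁ := div_nonneg (by linarith) (by linarith)
    have h2 : 0 ≤ a₂ := by positivity
    have h3 : a₁ + a₂ = α := by rw [ha₁, ha₂]; field_simp; ring
    have h4 : a₂ ^ 2 - a₁ ^ 2 = V₀ := by rw [ha₁, ha₂]; field_simp; ring
    have h5 : (α ^ 2 - V₀) ^ 2 / (4 * α ^ 2) = a₁ ^ 2 := by rw [ha₁]; field_simp; ring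
    have h6 : √(r + a₁ ^ 2) ^ 2 - a₁ ^ 2 = r := by
      rw [Real.sq_sqrt (by linarith)]; ring
    have h7 := isApproxFormEigenvalue_of_matched h hb hT hreg hpl hd h1 h2 √(r + a₁ ^ 2)
    rwa [h3, h4, h6] at h7
  · exact isApproxFormEigenvalue_of_nonneg hb hd
      (fun R hR => exists_closedBall_subset h hT hreg hpl hd hR) hr

theorem existsUnique_operator_and_essSpectrum_eq (h : IsChordBound Φ c) (hb : HasTraceBound Φ)
    (hT : IsSingularSet (Set.range Φ) T) (hreg : IsUniformlyEllipticC2Off Φ T)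
    (hpl : IsAsymptoticallyPlanar Φ T) (hd : DividesInto (Set.range Φ) U U') (hα : 0 < α)
    (hV₀ : 0 < V₀) (hV : ∀ x ∈ U, V x = V₀) (hV' : ∀ x ∈ U', V x = 0) :
    (∃! H : L2Space →ₗ.[ℂ] L2Space,
      IsSelfAdjoint H ∧ IsAssociatedOperator sobolevH1 (deltaForm α V Φ) H) ∧
    ∀ H : L2Space →ₗ.[ℂ] L2Space, IsAssociatedOperator sobolevH1 (deltaForm α V Φ) H →
      opEssSpectrum H = (fun r : ℝ => (r : ℂ)) '' Set.Ici (threshold α V₀) := by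
  have hae : ∀ᵐ x : Space, x ∈ U ∪ U' := by
    rw [hd.union_eq]
    exact compl_mem_ae_iff.2 (volume_range_eq_zero hT hreg)
  have hq := deltaForm_sobolevEmb hb α hd.isOpen_left.measurableSet hae hV hV' hd.disjoint
  obtain ⟨C, hF⟩ := exists_formData hb hα hV₀.le U
  exact ⟨hF.existsUnique_associated range_sobolevEmb hq, fun H hH =>
    hF.essSpectrum_eq range_sobolevEmb hq hH
      (fun m hm => boundedBelowModFinite_formOperator h hb hT hreg hpl hd hα hV₀ hm)
      (fun r hr => isApproxFormEigenvalue_formOperator h hb hT hreg hpl hd hα hV₀ hr)⟩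

end EssentialSpectrum

theorem theorem2p2
    (Φ : Plane → Space) (Ωint Ωext T : Set Space) (V : Space → ℝ) (α V₀ : ℝ)
    (hα : 0 < α) (hV₀ : 0 < V₀)
    (h_plane : IsEmbedding Φ)
    (h_regions : DividesInto (Set.range Φ) Ωint Ωext)
    (h_convex : Convex ℝ Ωint)
    (h_nontrivial : ¬ (IsOpenHalfSpace Ωint ∧ IsOpenHalfSpace Ωext))
    (h_singular : IsSingularSet (Set.range Φ) T)
    (h_regular : IsUniformlyEllipticC2Off Φ T)
    (h_planar : IsAsymptoticallyPlanar Φ T)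
    (h_chord : ∃ c : ℝ, 0 < c ∧ ∀ s t, c * ‖s - t‖ ≤ ‖Φ s - Φ t‖)
    (h_bias : IsStepBias V V₀ Ωint Ωext) :
    (∀ u ∈ sobolevH1, ∃! τ, IsTrace Φ u τ) ∧
    (∃! H : L2Space →ₗ.[ℂ] L2Space,
      IsSelfAdjoint H ∧ IsAssociatedOperator sobolevH1 (deltaForm α V Φ) H) ∧
    ∀ H : L2Space →ₗ.[ℂ] L2Space, IsAssociatedOperator sobolevH1 (deltaForm α V Φ) H →
      opEssSpectrum H = (fun r : ℝ => (r : ℂ)) '' Set.Ici (threshold α V₀) := by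
  obtain ⟨c, h⟩ := h_chord
  have hb : HasTraceBound Φ :=
    ⟨h_plane.continuous, fun _ hη => exists_trace_le h h_plane.continuous h_singular h_regular hη⟩
  refine ⟨fun u hu => hb.existsUnique_isTrace hu, ?_⟩
  rcases h_bias with ⟨hV, hV'⟩ | ⟨hV', hV⟩
  · exact existsUnique_operator_and_essSpectrum_eq h hb h_singular h_regular h_planar h_regions hα
      hV₀ hV hV'
  · exact existsUnique_operator_and_essSpectrum_eq h hb h_singular h_regular h_planar
      h_regions.symm hα hV₀ hV hV'
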